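/- Let $d\ge 3$, let $\Psi:\mathbb R^{d-1}\to\mathbb R$ be Lipschitz with constant $M$, and put $\Omega_+=\Omega=\{(x',t):t>\Psi(x')\}$, $\Omega_-=\mathbb R^d\setminus\overline\Omega$. Let $\sigma$ be the surface measure on $\partial\Omega$ and $n$ the unit normal to $\partial\Omega$ pointing out of $\Omega$. Let $A=(a_{ij})$ be a real, measurable, symmetric $d\times d$ matrix function on $\mathbb R^d$ with $A(x',s)=A(x',t)$ for all $x',s,t$ and, for some $\mu>0$, $\mu|\xi|^2\le \sum_{i,j}a_{ij}(x)\xi_i\xi_j$ and $|a_{ij}(x)|\le\mu^{-1}$ for a.e. $x$, all $\xi\in\mathbb R^d$ and all $i,j$; put $\mathcal L=-\operatorname{div}(A\nabla)$. Let $V\in L^\infty_{loc}(\mathbb R^d)$, $V>0$ a.e., satisfy $\|V\|_{L^\infty(B)}\le \frac{K}{|B|}\int_B V$ for every ball $B$, and let $$m(x,V)=\inf\Big\{\frac1r:\ r>0,\ \frac1{r^{d-2}}\int_{B(x,r)}V\le 1\Big\}.$$ For $D\in\{\Omega_+,\Omega_-\}$, a fixed aperture $\kappa>1$ and $z\in\partial\Omega$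 let $\Gamma_D(z)=\{x\in D:|x-z|<\kappa\,\mathrm{dist}(x,\partial\Omega)\}$, let $(w)^*(z)$ be the essential supremum of $|w|$ on $\Gamma_D(z)$, and say that $w$ has the nontangential limit $\ell$ at $z$ from $D$ if the average of $|w-\ell|$ over $\Gamma_D(z)\cap B(z,r)$ tends to $0$ as $r\to0$ (in particular if $w(x)\to\ell$ as $x\to z$ in $\Gamma_D(z)$). **Theorem.** There are constants $c,C>0$ depending only on $d$, $M$, $\mu$ and $K$ such that the following holds for $D=\Omega_+$ (sign $+$) and for $D=\Omega_-$ (sign $-$). Let $u\in W^{1,2}_{loc}(D)$ be a weak solution of $\mathcal Lu+Vu=0$ in $D$ with $(\nabla u)^*\in L^2(\partial\Omega,d\sigma)$ and $|u(x)|+|x||\nabla u(x)|=O(|x|^{2-d})$ as $|x|\to\infty$ in $D$. Let $u_\pm$ and $(\nabla u)_\pm$ denote the nontangential limits of $u$ and $\nabla u$ from $D$, taken to exist $\sigma$-a.e. on $\partial\Omega$, and put $\left(\frac{\partial u}{\partial\nu}\right)_\pm=n\cdot A(\nabla u)_\pm$ and $(\nabla_{tan}u)_\pm=(\nabla u)_\pm-\big(n\cdot(\nabla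 u)_\pm\big)n$. Then $$c\,\Big\{\int_{\partial\Omega}|(\nabla_{tan}u)_\pm|^2d\sigma+\int_{\partial\Omega}|u_\pm|^2m(x,V)^2d\sigma\Big\}\le\int_{\partial\Omega}\Big|\Big(\frac{\partial u}{\partial\nu}\Big)_\pm\Big|^2d\sigma\le C\,\Big\{\int_{\partial\Omega}|(\nabla_{tan}u)_\pm|^2d\sigma+\int_{\partial\Omega}|u_\pm|^2m(x,V)^2d\sigma\Big\}.$$ -/

import Mathlib

open MeasureTheory Filter Topology Set
open scoped ENNReal NNReal

noncomputable section

/-! Throughout, the dimension is `d = n + 1`; a point of `ℝ^d` is written `x = (x', x_d)`, where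
`x'` is the vector of the first `n` coordinates and `x_d` is the last coordinate. -/

/-- `ℝ^k` with the Euclidean norm. -/
abbrev Euc (k : ℕ) : Type := EuclideanSpace ℝ (Fin k)

/-- The first `n` coordinates `x'` of `x = (x', x_d)`. -/
def horiz {n : ℕ} (x : Euc (n + 1)) : Euc n :=
  WithLp.toLp 2 (fun i : Fin n => x i.castSucc)

/-- The last coordinate `x_d` of `x = (x', x_d)`. -/
def height {n : ℕ} (x : Euc (n + 1)) : ℝ := x (Fin.last n)

/-- The point `(x', t)`. -/
def pairPt {n : ℕ} (x' : Euc n) (t : ℝ) : Euc (n + 1) :=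
  WithLp.toLp 2 (Fin.snoc (α := fun _ => ℝ) (fun i : Fin n => x' i) t)

/-! ### The domain above a graph, its boundary, and the domain below it -/

/-- `Ω = Ω_+ = {(x', t) : t > Ψ x'}`. -/
def aboveGraph {n : ℕ} (Ψ : Euc n → ℝ) : Set (Euc (n + 1)) := {x | Ψ (horiz x) < height x}

/-- `Ω_- = {(x', t) : t < Ψ x'}`, the complement of the closure of `Ω` for continuous `Ψ`. -/
def belowGraph {n : ℕ} (Ψ : Euc n → ℝ) : Set (Euc (n + 1)) := {x | height x < Ψ (horiz x)}

/-- `∂Ω`, the graph of `Ψ` (the common boundary of `Ω_+` and `Ω_-` for continuous `Ψ`). -/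
def graphBdry {n : ℕ} (Ψ : Euc n → ℝ) : Set (Euc (n + 1)) := {x | height x = Ψ (horiz x)}

/-- The surface measure `σ` on `∂Ω`, as a measure on `ℝ^d` carried by `∂Ω`: the image of
`√(1 + |∇Ψ(x')|²) dx'` under `x' ↦ (x', Ψ x')`. -/
def surfMeasure {n : ℕ} (Ψ : Euc n → ℝ) : Measure (Euc (n + 1)) :=
  ((volume : Measure (Euc n)).withDensity
    (fun x' => ENNReal.ofReal (Real.sqrt (1 + ‖gradient Ψ x'‖ ^ 2)))).map
      (fun x' => pairPt x' (Ψ x'))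

/-- The unit normal to `∂Ω` pointing out of `Ω_+`, at the boundary point `z`. -/
def outerNormal {n : ℕ} (Ψ : Euc n → ℝ) (z : Euc (n + 1)) : Euc (n + 1) :=
  (Real.sqrt (1 + ‖gradient Ψ (horiz z)‖ ^ 2))⁻¹ • pairPt (gradient Ψ (horiz z)) (-1)

/-! ### The coefficients and the potential -/

/-- The conditions on the coefficient matrix: real, measurable, elliptic and bounded with
constant `μ`, symmetric, and independent of `x_d`. -/
structure IsCoeff {n : ℕ} (μ : ℝ) (A : Euc (n + 1) → Matrix (Fin (n + 1)) (Fin (n + 1)) ℝ) :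
    Prop where
  aemeasurable : ∀ i j, AEMeasurable (fun x => A x i j) volume
  elliptic : ∀ᵐ x, ∀ ξ : Euc (n + 1), μ * ‖ξ‖ ^ 2 ≤ ∑ i, ∑ j, A x i j * ξ i * ξ j
  bounded : ∀ᵐ x, ∀ i j, |A x i j| ≤ μ⁻¹
  symmetric : ∀ᵐ x, (A x).IsSymm
  independent : ∀ (x' : Euc n) (s t : ℝ), A (pairPt x' s) = A (pairPt x' t)

/-- `0 < V ∈ B_∞` with constant `K`: `V` is locally essentially bounded, positive almost
everywhere, and `‖V‖_{L^∞(B)} ≤ K ⨍_B V` for every ball `B`. -/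
structure IsBInfty {d : ℕ} (K : ℝ) (V : Euc d → ℝ) : Prop where
  locBounded : ∀ (x : Euc d) (r : ℝ), MemLp V ∞ (volume.restrict (Metric.ball x r))
  pos : ∀ᵐ x, 0 < V x
  reverseHolder : ∀ (x : Euc d) (r : ℝ), 0 < r →
    eLpNorm V ∞ (volume.restrict (Metric.ball x r)) ≤
      ENNReal.ofReal (K * ⨍ y in Metric.ball x r, V y)

/-- `ψ(x, r) = r^{-(d-2)} ∫_{B(x,r)} V`; here `d = n + 1` with `n ≥ 2`, so `d - 2 = n - 1`. -/
def psiFun {n : ℕ} (V : Euc (n + 1) → ℝ) (x : Euc (n + 1)) (r : ℝ) : ℝ :=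
  1 / r ^ (n - 1) * ∫ y in Metric.ball x r, V y

/-- The Fefferman–Phong–Shen function `m(x, V) = inf {1/r : r > 0, ψ(x, r) ≤ 1}`. -/
def mFun {n : ℕ} (V : Euc (n + 1) → ℝ) (x : Euc (n + 1)) : ℝ :=
  sInf {s : ℝ | ∃ r : ℝ, 0 < r ∧ psiFun V x r ≤ 1 ∧ s = 1 / r}

/-! ### Weak solutions -/

/-- `φ ∈ C_c^∞(D)`. -/
def IsTest {d : ℕ} (D : Set (Euc d)) (φ : Euc d → ℝ) : Prop :=
  ContDiff ℝ (⊤ : ℕ∞) φ ∧ HasCompactSupport φ ∧ tsupport φ ⊆ D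

/-- The partial derivative `∂φ/∂x_i` of a smooth function. -/
def partialD {d : ℕ} (i : Fin d) (φ : Euc d → ℝ) (x : Euc d) : ℝ :=
  fderiv ℝ φ x (EuclideanSpace.single i 1)

/-- `u ∈ W^{1,2}_loc(D)` with weak gradient `g`. -/
structure HasWeakGrad {d : ℕ} (D : Set (Euc d)) (u : Euc d → ℝ) (g : Euc d → Euc d) : Prop where
  memLp : ∀ K ⊆ D, IsCompact K → MemLp u 2 (volume.restrict K)
  memLp_grad : ∀ K ⊆ D, IsCompact K → MemLp g 2 (volume.restrict K)
  integral_eq : ∀ φ : Euc d → ℝ, IsTest D φ → ∀ i : Fin d,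
    ∫ x in D, u x * partialD i φ x = - ∫ x in D, g x i * φ x

/-- `u ∈ W^{1,2}_loc(D)`, with weak gradient `g`, is a weak solution of
`-div(A∇u) + V u = 0` in `D`. -/
structure IsWeakSol {d : ℕ} (D : Set (Euc d)) (A : Euc d → Matrix (Fin d) (Fin d) ℝ)
    (V : Euc d → ℝ) (u : Euc d → ℝ) (g : Euc d → Euc d) : Prop where
  weakGrad : HasWeakGrad D u g
  weak_eq : ∀ φ : Euc d → ℝ, IsTest D φ →
    ∫ x in D, ((∑ i, ∑ j, A x i j * g x j * partialD i φ x) + V x * u x * φ x) = 0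

/-! ### Nontangential maximal functions and nontangential limits -/

/-- The nontangential approach region `{x ∈ D : |x - z| < κ dist(x, S)}`, for `S = ∂D`. -/
def ntCone {d : ℕ} (D S : Set (Euc d)) (κ : ℝ) (z : Euc d) : Set (Euc d) :=
  {x | x ∈ D ∧ dist x z < κ * Metric.infDist x S}

/-- The nontangential maximal function. As `f` (for instance a weak gradient) is defined almost
everywhere only, the supremum is the essential one. -/
def ntMax {d : ℕ} {F : Type*} [NormedAddCommGroup F] (D S : Set (Euc d)) (κ : ℝ)
    (f : Euc d → F) (z : Euc d) : ℝ≥0∞ :=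
  essSup (fun x => ‖f x‖ₑ) (volume.restrict (ntCone D S κ z))

/-- `L` is the nontangential limit of `f` at `z`. As `f` is defined almost everywhere only, the
limit is taken in the mean: the average of `|f - L|` over the part of the approach region within
distance `r` of `z` tends to `0` as `r → 0`. This holds in particular if `f x → L` as `x → z`
in the approach region. -/
def HasNTLimit {d : ℕ} {F : Type*} [NormedAddCommGroup F] (D S : Set (Euc d)) (κ : ℝ)
    (f : Euc d → F) (z : Euc d) (L : F) : Prop :=
  Tendsto (fun r : ℝ =>
    laverage (volume.restrict (ntCone D S κ z ∩ Metric.ball z r)) (fun x => ‖f x - L‖ₑ))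
    (𝓝[>] 0) (𝓝 0)

/-! ### Boundary derivatives -/

/-- The conormal derivative `n · A G` at `z ∈ ∂Ω`, where `G` is the boundary value of `∇u`. -/
def conormalDeriv {n : ℕ} (Ψ : Euc n → ℝ)
    (A : Euc (n + 1) → Matrix (Fin (n + 1)) (Fin (n + 1)) ℝ)
    (G : Euc (n + 1) → Euc (n + 1)) (z : Euc (n + 1)) : ℝ :=
  ∑ i, ∑ j, outerNormal Ψ z i * A z i j * G z j

/-- The tangential gradient `G - (n · G) n` at `z ∈ ∂Ω`, where `G` is the boundary value of
`∇u`. -/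
def tangGrad {n : ℕ} (Ψ : Euc n → ℝ) (G : Euc (n + 1) → Euc (n + 1)) (z : Euc (n + 1)) :
    Euc (n + 1) :=
  G z - (inner ℝ (outerNormal Ψ z) (G z)) • outerNormal Ψ z

end

/-! The engine is the Rellich identity in the vertical direction e, the unit vector pointing into
the domain. Because A is symmetric and constant along e, the field 2(∂_e u) A∇u − (A∇u·∇u) e has
divergence 2Vu ∂_e u (`rellich_identity`). Hence the boundary integral of its normal component β
equals, up to sign, the solid integral of 2Vu ∂_e u. On the boundary let p be the conormal
derivative and T the tangential gradient. Linear algebra and ellipticity give, pointwise, p² ≤ Cβ +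
C|T|² (`BdrySol.flux_sq_le`) and |∇u|² ≤ −Cβ + Cp² (`BdrySol.norm_sq_le`). For V = 0 the integral of
β would vanish and these two inequalities would be the whole proof. For V > 0 the task is to control
the solid integral.

Let ρ(x) be the largest radius with r²‖V‖_{L^∞(B(x,r))} ≤ 1. It is 1-Lipschitz, comparable to
1/m(x,V), and V ≤ ρ^{-2} a.e. Thus 2|Vu ∂_e u| ≤ ρ^{-1}(|∇u|² + ρ^{-2}u²), and it suffices to bound
this weighted energy by the boundary integral of ρ^{-1}|u p|. To do so, the equation is tested with
S²u, where S ≈ ρ^{-1/2}. As |∇S| ≤ S³, differentiating the weight costs at most S⁶u², and this is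
absorbed by a Fefferman–Phong inequality ∫ρ^{-2}v² ≤ C∫(|∇v|² + Vv²) applied to v = Su, provided S²ρ
≤ δ with δ small. Taking in S the critical radius at a higher level, which is at least δ^{-1}ρ yet
still comparable to ρ, secures this (`exists_critRad_ge`). The Fefferman–Phong inequality
(`exists_feffermanPhong`) needs no boundary condition: points are compared along displacements in
the upward cone, which never leave the domain.

The weighted energy also controls the trace. The divergence theorem for S⁴u²e bounds ∫ρ^{-2}u² on
the boundary by the weighted energy, hence by ∫ρ^{-1}|u p|, hence by C∫p² after Young's inequality
(`exists_trace_bounds`). Finally |∫β| ≤ ε∫p² + C_ε∫ρ^{-2}u², and both halves of the theorem follow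
by inserting this in the pointwise inequalities (`exists_comparison`). Every absorption is
legitimate because the absorbed quantity is finite.

The remaining work justifies the boundary terms. All boundary integrals are written over the base ℝⁿ
of the graph, with the gradient N of the vertical depth in place of the unit normal, so that e·N = 1
and no Jacobian appears. The interior identities are tested with functions cut off at depths between
ε and 2ε, and the resulting layer averages must converge (`integral_eq_boundary`). For ∇u this
follows from its square integrable maximal function (`tendsto_slab_of_hasNTLimit`). For u no maximal
function is assumed, so its boundary values are constructed as a Sobolev trace along vertical lines
(`exists_trace`) and then identified with the nontangential limit (`IsTrace.ae_eq_ntLimit`). The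
decay at infinity removes the radial cut-offs. -/

noncomputable section

open Metric (ball closedBall ball_subset_ball infDist isOpen_ball mem_ball ball_subset_closedBall)
open ENNReal (ofReal ofReal_mul ofReal_le_ofReal ofReal_ne_top ofReal_pow ofReal_lt_top ofReal_add
  ofReal_pos ofReal_mul' ofReal_one ofReal_toReal ofReal_of_nonpos ofReal_eq_zero
  ofReal_ofNat ofReal_inv_of_pos toReal_ofReal toReal_mono toReal_nonneg one_le_ofReal
  ofReal_add_le continuous_ofReal)
open Real (norm_of_nonneg norm_eq_abs enorm_eq_ofReal_abs coe_toNNReal toNNReal_mul)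
open ENNReal (mul_lt_top)

local notation "𝕀" => Icc (0 : ℝ) 1

/-- The two signs, one for each side of a graph. -/
abbrev IsSgn (τ : ℝ) : Prop := τ = 1 ∨ τ = -1

/-- `ℝ^(n + 1)`, the space that contains the graphs over `ℝ^n`. -/
abbrev Pt (n : ℕ) : Type := Euc (n + 1)

/-! ### Geometry of graph domains -/

section Geometry

variable {n : ℕ}

@[simp] lemma horiz_pairPt (x' : Euc n) (t : ℝ) : horiz (pairPt x' t) = x' := by
  ext i; simp [horiz, pairPt]

@[simp] lemma height_pairPt (x' : Euc n) (t : ℝ) : height (pairPt x' t) = t := by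
  simp [height, pairPt]

@[simp] lemma pairPt_horiz_height (x : Pt n) : pairPt (horiz x) (height x) = x := by
  ext i
  refine Fin.lastCases ?_ (fun j => ?_) i <;> simp [horiz, height, pairPt]

lemma pairPt_ext {x y : Pt n} (h1 : horiz x = horiz y) (h2 : height x = height y) : x = y := by
  rw [← pairPt_horiz_height x, ← pairPt_horiz_height y, h1, h2]

/-- `x ↦ x'` as a continuous linear map. -/
def horizL (n : ℕ) : Pt n →L[ℝ] Euc n := LinearMap.toContinuousLinearMap
    { toFun := horiz, map_add' := fun x y => by ext i; simp [horiz],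
      map_smul' := fun c x => by ext i; simp [horiz] }

/-- `x ↦ x_d` as a continuous linear map. -/
def heightL (n : ℕ) : Pt n →L[ℝ] ℝ := LinearMap.toContinuousLinearMap
    { toFun := height, map_add' := fun x y => by simp [height],
      map_smul' := fun c x => by simp [height] }

@[simp] lemma horiz_add (x y : Pt n) : horiz (x + y) = horiz x + horiz y := map_add (horizL n) x y
@[simp] lemma height_add (x y : Pt n) : height (x + y) = height x + height y :=
  map_add (heightL n) x y
@[simp] lemma horiz_sub (x y : Pt n) : horiz (x - y) = horiz x - horiz y := map_sub (horizL n) x y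
@[simp] lemma height_sub (x y : Pt n) : height (x - y) = height x - height y :=
  map_sub (heightL n) x y
@[simp] lemma horiz_neg (x : Pt n) : horiz (-x) = -horiz x := map_neg (horizL n) x
@[simp] lemma height_neg (x : Pt n) : height (-x) = -height x := map_neg (heightL n) x
@[simp] lemma horiz_smul (c : ℝ) (x : Pt n) : horiz (c • x) = c • horiz x := map_smul (horizL n) c x
@[simp] lemma height_smul (c : ℝ) (x : Pt n) : height (c • x) = c * height x :=
  map_smul (heightL n) c x

@[fun_prop] lemma continuous_horiz : Continuous (horiz : Pt n → Euc n) := (horizL n).continuous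
@[fun_prop] lemma continuous_height : Continuous (height : Pt n → ℝ) := (heightL n).continuous
@[fun_prop] lemma measurable_horiz : Measurable (horiz : Pt n → Euc n) :=
  continuous_horiz.measurable
@[fun_prop] lemma measurable_height : Measurable (height : Pt n → ℝ) := continuous_height.measurable

lemma inner_eq_horiz_height (x y : Pt n) :
    inner ℝ x y = inner ℝ (horiz x) (horiz y) + height x * height y := by
  simp only [PiLp.inner_apply, Fin.sum_univ_castSucc, horiz, height]
  simp [mul_comm]

lemma norm_sq_eq_horiz_height (x : Pt n) : ‖x‖ ^ 2 = ‖horiz x‖ ^ 2 + height x ^ 2 := by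
  rw [← real_inner_self_eq_norm_sq, inner_eq_horiz_height, real_inner_self_eq_norm_sq, sq (height x)]

lemma norm_horiz_le (x : Pt n) : ‖horiz x‖ ≤ ‖x‖ := by
  have := norm_sq_eq_horiz_height x
  exact abs_le_of_sq_le_sq' (by nlinarith [sq_nonneg (height x)]) (norm_nonneg _) |>.2

lemma abs_height_le (x : Pt n) : |height x| ≤ ‖x‖ := by
  have := norm_sq_eq_horiz_height x
  exact abs_le_of_sq_le_sq (by nlinarith [sq_nonneg ‖horiz x‖]) (norm_nonneg _)

lemma norm_le_horiz_add_height (x : Pt n) : ‖x‖ ≤ ‖horiz x‖ + |height x| := by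
  have := norm_sq_eq_horiz_height x
  refine abs_le_of_sq_le_sq' ?_ (by positivity) |>.2
  rw [this]; nlinarith [sq_abs (height x), norm_nonneg (horiz x), abs_nonneg (height x),
    mul_nonneg (norm_nonneg (horiz x)) (abs_nonneg (height x))]

@[fun_prop] lemma continuous_pairPt : Continuous (fun p : Euc n × ℝ => pairPt p.1 p.2) := by
  unfold pairPt
  refine (PiLp.continuous_toLp 2 _).comp (continuous_pi fun i => ?_)
  refine Fin.lastCases ?_ (fun j => ?_) i
  · simpa using continuous_snd
  · simpa using (by fun_prop : Continuous fun p : Euc n × ℝ => p.1 j)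

/-- `(x', t) ↦ x` preserves volume. -/
lemma measurePreserving_pairPt : MeasurePreserving (fun p : Euc n × ℝ => pairPt p.1 p.2) := by
  have h1 : MeasurePreserving (fun p : Euc n × ℝ => ((WithLp.ofLp p.1 : Fin n → ℝ), p.2))
      ((volume : Measure (Euc n)).prod volume) (volume.prod volume) :=
    (PiLp.volume_preserving_ofLp (Fin n)).prod (MeasurePreserving.id volume)
  have h2 : MeasurePreserving (Prod.swap : (Fin n → ℝ) × ℝ → ℝ × (Fin n → ℝ))
      (volume.prod volume) (volume.prod volume) := Measure.measurePreserving_swap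
  have h3 := (volume_preserving_piFinSuccAbove (fun _ : Fin (n + 1) => ℝ) (Fin.last n)).symm
  have h4 := PiLp.volume_preserving_toLp (Fin (n + 1))
  have := h4.comp (h3.comp (h2.comp h1))
  rw [Measure.volume_eq_prod]
  convert this using 1
  funext p
  simp only [pairPt, Function.comp]
  congr 1
  funext i
  refine Fin.lastCases ?_ (fun j => ?_) i
  · simp [MeasurableEquiv.piFinSuccAbove]
  · simp [MeasurableEquiv.piFinSuccAbove]

/-- The signed vertical distance to the graph, positive in the domain. -/
def depth (τ : ℝ) (Ψ : Euc n → ℝ) (x : Pt n) : ℝ := τ * (height x - Ψ (horiz x))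

/-- The domain above the graph for `τ = 1` and below it for `τ = -1`. -/
def graphDom (τ : ℝ) (Ψ : Euc n → ℝ) : Set (Pt n) := {x | 0 < depth τ Ψ x}

/-- The point at vertical distance `t` of the graph, over `x'`. -/
def graphPt (τ : ℝ) (Ψ : Euc n → ℝ) (p : Euc n × ℝ) : Pt n := pairPt p.1 (Ψ p.1 + τ * p.2)

/-- The vertical unit vector pointing into the domain. -/
def vert (n : ℕ) (τ : ℝ) : Pt n := pairPt 0 τ

@[simp] lemma horiz_vert (τ : ℝ) : horiz (vert n τ) = 0 := by simp [vert]
@[simp] lemma height_vert (τ : ℝ) : height (vert n τ) = τ := by simp [vert]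

lemma aboveGraph_eq (Ψ : Euc n → ℝ) : aboveGraph Ψ = graphDom 1 Ψ := by
  ext x; simp [aboveGraph, graphDom, depth]

lemma belowGraph_eq (Ψ : Euc n → ℝ) : belowGraph Ψ = graphDom (-1) Ψ := by
  ext x; simp [belowGraph, graphDom, depth]

lemma unit_mul_self {τ : ℝ} (hτ : IsSgn τ) : τ * τ = 1 := by rcases hτ with rfl | rfl <;> norm_num

lemma abs_unit {τ : ℝ} (hτ : IsSgn τ) : |τ| = 1 := by rcases hτ with rfl | rfl <;> norm_num

lemma norm_vert {τ : ℝ} (hτ : IsSgn τ) : ‖vert n τ‖ = 1 := by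
  have := norm_sq_eq_horiz_height (vert n τ)
  simp only [horiz_vert, norm_zero, height_vert, sq, unit_mul_self hτ] at this
  nlinarith [norm_nonneg (vert n τ)]

lemma abs_inner_vert_le {τ : ℝ} (hτ : IsSgn τ) (v : Pt n) : |inner ℝ v (vert n τ)| ≤ ‖v‖ := by
  simpa [norm_vert hτ] using abs_real_inner_le_norm v (vert n τ)

variable {τ : ℝ} {M : ℝ≥0} {Ψ : Euc n → ℝ}

@[simp] lemma horiz_graphPt (p : Euc n × ℝ) : horiz (graphPt τ Ψ p) = p.1 := by simp [graphPt]

@[simp] lemma height_graphPt (p : Euc n × ℝ) : height (graphPt τ Ψ p) = Ψ p.1 + τ * p.2 := by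
  simp [graphPt]

lemma depth_graphPt (hτ : IsSgn τ) (p : Euc n × ℝ) : depth τ Ψ (graphPt τ Ψ p) = p.2 := by
  simp only [depth, height_graphPt, horiz_graphPt, add_sub_cancel_left, ← mul_assoc,
    unit_mul_self hτ, one_mul]

lemma graphPt_horiz_depth (hτ : IsSgn τ) (x : Pt n) : graphPt τ Ψ (horiz x, depth τ Ψ x) = x := by
  apply pairPt_ext
  · simp
  · simp [depth, ← mul_assoc, unit_mul_self hτ]

lemma depth_add_smul_vert (hτ : IsSgn τ) (x : Pt n) (s : ℝ) :
    depth τ Ψ (x + s • vert n τ) = depth τ Ψ x + s := by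
  have := unit_mul_self hτ
  simp only [depth, height_add, height_smul, height_vert, horiz_add, horiz_smul, horiz_vert,
    smul_zero, add_zero]
  linear_combination s * this

lemma graphPt_add_smul_vert (x' : Euc n) (t s : ℝ) :
    graphPt τ Ψ (x', t) + s • vert n τ = graphPt τ Ψ (x', t + s) := by
  apply pairPt_ext <;> simp; ring

lemma continuous_depth (hΨ : LipschitzWith M Ψ) : Continuous (depth τ Ψ) := by
  have := hΨ.continuous; unfold depth; fun_prop

lemma continuous_graphPt (hΨ : LipschitzWith M Ψ) : Continuous (graphPt τ Ψ) := by
  have := hΨ.continuous; unfold graphPt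
  exact continuous_pairPt.comp (by fun_prop : Continuous fun p : Euc n × ℝ => (p.1, Ψ p.1 + τ * p.2))

lemma isOpen_graphDom (hΨ : LipschitzWith M Ψ) : IsOpen (graphDom τ Ψ) :=
  isOpen_lt continuous_const (continuous_depth hΨ)

lemma measurableSet_graphDom (hΨ : LipschitzWith M Ψ) : MeasurableSet (graphDom τ Ψ) :=
  (isOpen_graphDom hΨ).measurableSet

lemma measurePreserving_mul_sign (hτ : IsSgn τ) : MeasurePreserving (fun t : ℝ => τ * t) := by
  rcases hτ with rfl | rfl
  · simp only [one_mul]; exact MeasurePreserving.id _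
  · simpa using Measure.measurePreserving_neg (volume : Measure ℝ)

/-- Flattening the graph is a shear composed with a possible vertical reflection, so its Jacobian is
1. All layer integrals are reduced to integrals over the base in this way. -/
lemma measurePreserving_graphPt (hτ : IsSgn τ) (hΨ : LipschitzWith M Ψ) :
    MeasurePreserving (graphPt τ Ψ) := by
  have hm := hΨ.continuous.measurable
  have h1 : MeasurePreserving (fun p : Euc n × ℝ => (p.1, Ψ p.1 + τ * p.2))
      ((volume : Measure (Euc n)).prod volume) (volume.prod volume) := by
    refine (MeasurePreserving.id volume).skew_product (g := fun x t => Ψ x + τ * t) (by fun_prop)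
      (.of_forall fun x => ?_)
    exact ((measurePreserving_add_left volume (Ψ x)).comp (measurePreserving_mul_sign hτ)).map_eq
  exact measurePreserving_pairPt.comp h1

lemma depth_le (hτ : IsSgn τ) (hΨ : LipschitzWith M Ψ) (x y : Pt n) :
    |depth τ Ψ x - depth τ Ψ y| ≤ |height (x - y)| + M * ‖horiz (x - y)‖ := by
  have h1 : depth τ Ψ x - depth τ Ψ y
      = τ * (height (x - y) - (Ψ (horiz x) - Ψ (horiz y))) := by simp [depth]; ring
  rw [h1, abs_mul, abs_unit hτ, one_mul]
  refine (abs_sub _ _).trans (add_le_add le_rfl ?_)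
  have := hΨ.dist_le_mul (horiz x) (horiz y)
  rwa [Real.dist_eq, dist_eq_norm, ← horiz_sub] at this

lemma lipschitz_depth (hτ : IsSgn τ) (hΨ : LipschitzWith M Ψ) :
    LipschitzWith (1 + M) (depth τ Ψ) := by
  refine LipschitzWith.of_dist_le_mul fun x y => ?_
  rw [Real.dist_eq, dist_eq_norm]
  refine (depth_le hτ hΨ x y).trans ?_
  have h1 := abs_height_le (x - y)
  have h2 := norm_horiz_le (x - y)
  have h3 : (M : ℝ) * ‖horiz (x - y)‖ ≤ M * ‖x - y‖ := by gcongr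
  push_cast; linarith

lemma mem_graphBdry_iff (hτ : IsSgn τ) (z : Pt n) : z ∈ graphBdry Ψ ↔ depth τ Ψ z = 0 := by
  have : τ ≠ 0 := by rcases hτ with rfl | rfl <;> norm_num
  simp [graphBdry, depth, this, sub_eq_zero]

lemma pairPt_mem_graphBdry (x' : Euc n) : pairPt x' (Ψ x') ∈ graphBdry Ψ := by simp [graphBdry]

lemma graphBdry_nonempty : (graphBdry Ψ).Nonempty := ⟨_, pairPt_mem_graphBdry 0⟩

lemma infDist_graph_le (hτ : IsSgn τ) (x : Pt n) : infDist x (graphBdry Ψ) ≤ |depth τ Ψ x| := by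
  refine (Metric.infDist_le_dist_of_mem (pairPt_mem_graphBdry (Ψ := Ψ) (horiz x))).trans ?_
  rw [dist_eq_norm]
  refine (norm_le_horiz_add_height _).trans ?_
  simp [depth, abs_mul, abs_unit hτ]

/-- The depth is (1 + M)-Lipschitz and vanishes on the graph. With `infDist_graph_le` this makes
depth and distance to the boundary comparable. -/
lemma depth_le_infDist (hτ : IsSgn τ) (hΨ : LipschitzWith M Ψ) (x : Pt n) :
    depth τ Ψ x ≤ (1 + M) * infDist x (graphBdry Ψ) := by
  have hM : (0 : ℝ) < 1 + M := by positivity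
  rw [← div_le_iff₀' hM]
  refine (Metric.le_infDist graphBdry_nonempty).2 fun z hz => ?_
  rw [div_le_iff₀' hM]
  have := (lipschitz_depth hτ hΨ).dist_le_mul x z
  rw [(mem_graphBdry_iff hτ z).1 hz, Real.dist_eq, sub_zero] at this
  push_cast at this
  exact (le_abs_self _).trans this

/-- Translation by vectors of the upward cone increases the depth. -/
lemma depth_add_of_mem_cone (hτ : IsSgn τ) (hΨ : LipschitzWith M Ψ) {h : Pt n}
    (hh : M * ‖horiz h‖ ≤ τ * height h) (x : Pt n) :
    depth τ Ψ x ≤ depth τ Ψ (x + h) := by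
  have h1 := hΨ.dist_le_mul (horiz (x + h)) (horiz x)
  rw [Real.dist_eq, dist_eq_norm, horiz_add, add_sub_cancel_left] at h1
  have h2 : |τ * (Ψ (horiz x + horiz h) - Ψ (horiz x))| ≤ M * ‖horiz h‖ := by
    rwa [abs_mul, abs_unit hτ, one_mul]
  have h3 := (abs_le.1 h2).2
  simp only [depth, height_add, horiz_add]
  linarith

end Geometry

local notation:max "gCone" t:max P:max k:max => ntCone (graphDom t P) (graphBdry P) k
local notation:max "gMax" t:max P:max k:max => ntMax (graphDom t P) (graphBdry P) k
local notation:max "GLimit" t:max P:max k:max => HasNTLimit (graphDom t P) (graphBdry P) k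

/-! ### The potential -/

section Potential

variable {n : ℕ}

/-- The volume of the unit ball. -/
def unitVol (d : ℕ) : ℝ := (volume (ball (0 : Euc d) 1)).toReal

lemma unitVol_pos (d : ℕ) : 0 < unitVol d :=
  ENNReal.toReal_pos (Metric.measure_ball_pos _ _ one_pos).ne' measure_ball_lt_top.ne

lemma volume_ball_toReal {d : ℕ} (x : Euc d) {r : ℝ} (hr : 0 < r) :
    (volume (ball x r)).toReal = r ^ d * unitVol d := by
  rw [Measure.addHaar_ball_of_pos _ _ hr, ENNReal.toReal_mul, toReal_ofReal (by positivity),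
    finrank_euclideanSpace_fin]; rfl

lemma volume_ball_eq {d : ℕ} (x : Euc d) {r : ℝ} (hr : 0 < r) :
    volume (ball x r) = ofReal (r ^ d * unitVol d) := by
  rw [← volume_ball_toReal x hr, ofReal_toReal measure_ball_lt_top.ne]

/-- `‖V‖_{L^∞(B(x,r))}`. -/
def ballSup {d : ℕ} (V : Euc d → ℝ) (x : Euc d) (r : ℝ) : ℝ :=
  (eLpNorm V ∞ (volume.restrict (ball x r))).toReal

/-- `∫_{B(x,r)} V`. -/
def ballInt {d : ℕ} (V : Euc d → ℝ) (x : Euc d) (r : ℝ) : ℝ := ∫ y in ball x r, V y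

/-- `ρ_λ(x) = sup {r > 0 : r² ‖V‖_{L^∞(B(x,r))} ≤ λ}`, the critical radius at level `λ`. -/
def critRad {d : ℕ} (V : Euc d → ℝ) (l : ℝ) (x : Euc d) : ℝ :=
  sSup {r : ℝ | 0 < r ∧ r ^ 2 * ballSup V x r ≤ l}

variable {d : ℕ} {V : Euc d → ℝ} {K : ℝ}

lemma ballSup_nonneg (x : Euc d) (r : ℝ) : 0 ≤ ballSup V x r := toReal_nonneg

/-- The averages of V are nonnegative, so K may be enlarged; this lets the quantitative lemmas
assume K ≥ 1. -/
lemma IsBInfty.mono {K' : ℝ} (hV : IsBInfty K V) (h : K ≤ K') : IsBInfty K' V where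
  locBounded := hV.locBounded
  pos := hV.pos
  reverseHolder x r hr := by
    refine (hV.reverseHolder x r hr).trans (ofReal_le_ofReal ?_)
    refine mul_le_mul_of_nonneg_right h ?_
    rw [setAverage_eq, smul_eq_mul]
    refine mul_nonneg (by positivity) (integral_nonneg_of_ae (ae_restrict_of_ae ?_))
    filter_upwards [hV.pos] with y hy using hy.le

lemma IsBInfty.integrableOn (hV : IsBInfty K V) (x : Euc d) (r : ℝ) :
    IntegrableOn V (ball x r) := by
  have : IsFiniteMeasure (volume.restrict (ball x r)) := ⟨by simpa using measure_ball_lt_top⟩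
  exact (hV.locBounded x r).integrable le_top

lemma IsBInfty.ae_le (hV : IsBInfty K V) (x : Euc d) (r : ℝ) :
    ∀ᵐ y, y ∈ ball x r → |V y| ≤ ballSup V x r := by
  rw [← ae_restrict_iff' measurableSet_ball]
  have h := ae_le_eLpNormEssSup (f := V) (μ := volume.restrict (ball x r))
  filter_upwards [h] with y hy
  have h2 := toReal_mono (hV.locBounded x r).eLpNorm_lt_top.ne
    (by rw [eLpNorm_exponent_top]; exact hy : ‖V y‖ₑ ≤ eLpNorm V ∞ (volume.restrict (ball x r)))
  rwa [toReal_enorm] at h2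

lemma IsBInfty.ballSup_mono (hV : IsBInfty K V) {x y : Euc d} {r s : ℝ}
    (h : ball x r ⊆ ball y s) : ballSup V x r ≤ ballSup V y s :=
  toReal_mono (hV.locBounded y s).eLpNorm_lt_top.ne
    (eLpNorm_mono_measure _ (Measure.restrict_mono h le_rfl))

lemma IsBInfty.nonneg_ae (hV : IsBInfty K V) : ∀ᵐ y, 0 ≤ V y := by
  filter_upwards [hV.pos] with y hy using hy.le

lemma IsBInfty.ballInt_pos (hV : IsBInfty K V) (x : Euc d) {r : ℝ} (hr : 0 < r) :
    0 < ballInt V x r := by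
  refine (setIntegral_pos_iff_support_of_nonneg_ae (ae_restrict_of_ae hV.nonneg_ae)
    (hV.integrableOn x r)).2 ?_
  have : volume (ball x r) ≤ volume (Function.support V ∩ ball x r) := by
    refine measure_mono_ae ?_
    filter_upwards [hV.pos] with y hy hyb using ⟨hy.ne', hyb⟩
  exact (Metric.measure_ball_pos _ _ hr).trans_le this

lemma IsBInfty.ballInt_mono (hV : IsBInfty K V) {x y : Euc d} {r s : ℝ}
    (h : ball x r ⊆ ball y s) : ballInt V x r ≤ ballInt V y s :=
  setIntegral_mono_set (hV.integrableOn y s) (ae_restrict_of_ae hV.nonneg_ae) h.eventuallyLE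

lemma IsBInfty.ballInt_le (hV : IsBInfty K V) (x : Euc d) {r : ℝ} (hr : 0 < r) :
    ballInt V x r ≤ r ^ d * unitVol d * ballSup V x r := by
  have h1 : ballInt V x r ≤ ∫ _ in ball x r, ballSup V x r := by
    refine setIntegral_mono_on_ae (hV.integrableOn x r)
      (integrableOn_const measure_ball_lt_top.ne) measurableSet_ball ?_
    filter_upwards [hV.ae_le x r] with y hy hyb using (le_abs_self _).trans (hy hyb)
  rwa [setIntegral_const, smul_eq_mul, Measure.real, volume_ball_toReal x hr] at h1

lemma IsBInfty.ballSup_le (hV : IsBInfty K V) (hK : 0 ≤ K) (x : Euc d) {r : ℝ} (hr : 0 < r) :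
    r ^ d * unitVol d * ballSup V x r ≤ K * ballInt V x r := by
  have h1 := toReal_mono ofReal_ne_top (hV.reverseHolder x r hr)
  have hp : 0 < r ^ d * unitVol d := mul_pos (by positivity) (unitVol_pos d)
  rw [setAverage_eq, smul_eq_mul, Measure.real, volume_ball_toReal x hr] at h1
  change ballSup V x r ≤ (ofReal (K * ((r ^ d * unitVol d)⁻¹ * ballInt V x r))).toReal at h1
  rw [toReal_ofReal (mul_nonneg hK (mul_nonneg (by positivity) (hV.ballInt_pos x hr).le))] at h1
  calc r ^ d * unitVol d * ballSup V x r
      ≤ r ^ d * unitVol d * (K * ((r ^ d * unitVol d)⁻¹ * ballInt V x r)) := by gcongr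
    _ = K * ballInt V x r := by have := (unitVol_pos d).ne'; field_simp

lemma IsBInfty.ballSup_pos (hV : IsBInfty K V) (x : Euc d) {r : ℝ} (hr : 0 < r) :
    0 < ballSup V x r := by
  by_contra h
  have h0 : ballSup V x r = 0 := le_antisymm (not_lt.1 h) (ballSup_nonneg x r)
  have := hV.ballInt_le x hr
  rw [h0, mul_zero] at this
  exact absurd (hV.ballInt_pos x hr) (not_lt.2 this)

/-- A small shrinking of a ball keeps half of the mass. -/
lemma IsBInfty.ballInt_le_two_mul (hV : IsBInfty K V) (hK : 1 ≤ K) (hd : 0 < d) (x : Euc d)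
    {r : ℝ} (hr : 0 < r) : ballInt V x r ≤ 2 * ballInt V x ((1 - 1 / (2 * K * d)) * r) := by
  -- By Bernoulli's inequality qᵈ ≥ 1 − 1/(2K), so the shell between the two balls has at most the
  -- fraction 1/(2K) of the volume. By the reverse Hölder condition it then carries at most half of
  -- the mass.
  set q : ℝ := 1 - 1 / (2 * K * d) with hq
  have hd' : (1 : ℝ) ≤ d := by exact_mod_cast hd
  have hb : 1 / (2 * K * d) ≤ 1 / 2 := by apply one_div_le_one_div_of_le (by norm_num); nlinarith
  have hb0 : 0 < 1 / (2 * K * d) := by positivity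
  have hq0 : 0 < q := by linarith
  have hq1 : q < 1 := by linarith
  have hqd : 1 - 1 / (2 * K) ≤ q ^ d := by
    have := one_add_mul_le_pow (a := -(1 / (2 * K * d))) (by linarith) d
    have e : (1 : ℝ) + d * (-(1 / (2 * K * d))) = 1 - 1 / (2 * K) := by field_simp; ring
    rw [e] at this
    calc _ ≤ _ := this
      _ = q ^ d := by rw [hq, sub_eq_add_neg]
  have hqr : 0 < q * r := mul_pos hq0 hr
  have hsub : ball x (q * r) ⊆ ball x r := ball_subset_ball (by nlinarith)
  have hsplit : ballInt V x r = ballInt V x (q * r) + ∫ y in ball x r \ ball x (q * r), V y := by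
    rw [setIntegral_sdiff measurableSet_ball (hV.integrableOn x r) hsub]
    simp [ballInt]
  have hdiff : ∫ y in ball x r \ ball x (q * r), V y
      ≤ (volume (ball x r \ ball x (q * r))).toReal * ballSup V x r := by
    have hfin : volume (ball x r \ ball x (q * r)) ≠ ∞ :=
      ((measure_mono sdiff_subset).trans_lt measure_ball_lt_top).ne
    have h1 : ∫ y in ball x r \ ball x (q * r), V y
        ≤ ∫ _ in ball x r \ ball x (q * r), ballSup V x r := by
      refine setIntegral_mono_on_ae ((hV.integrableOn x r).mono_set sdiff_subset)
        (integrableOn_const hfin) (measurableSet_ball.diff measurableSet_ball) ?_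
      filter_upwards [hV.ae_le x r] with y hy hyb using (le_abs_self _).trans (hy hyb.1)
    rwa [setIntegral_const, smul_eq_mul, Measure.real] at h1
  have hvol : (volume (ball x r \ ball x (q * r))).toReal = (1 - q ^ d) * (r ^ d * unitVol d) := by
    rw [measure_sdiff hsub measurableSet_ball.nullMeasurableSet measure_ball_lt_top.ne,
      ENNReal.toReal_sub_of_le (measure_mono hsub) measure_ball_lt_top.ne,
      volume_ball_toReal x hr, volume_ball_toReal x hqr, mul_pow]; ring
  have hrev := hV.ballSup_le (zero_le_one.trans hK) x hr
  have hI := hV.ballInt_pos x hr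
  have h1 : (1 - q ^ d) * (r ^ d * unitVol d * ballSup V x r) ≤ 1 / (2 * K) * (K * ballInt V x r) := by
    refine mul_le_mul (by linarith) hrev ?_ (by positivity)
    exact mul_nonneg (mul_nonneg (by positivity) (unitVol_pos d).le) (ballSup_nonneg _ _)
  have h2 : 1 / (2 * K) * (K * ballInt V x r) = ballInt V x r / 2 := by field_simp
  rw [hvol] at hdiff
  nlinarith

/-- `V ∈ B_∞` is doubling. -/
lemma exists_doubling (d : ℕ) (hd : 0 < d) (K : ℝ) (hK : 1 ≤ K) : ∃ C : ℝ, 1 ≤ C ∧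
    ∀ V : Euc d → ℝ, IsBInfty K V → ∀ x r, 0 < r → ballInt V x (2 * r) ≤ C * ballInt V x r := by
  have hd' : (1 : ℝ) ≤ d := by exact_mod_cast hd
  have hb : 1 / (2 * K * d) ≤ 1 / 2 := by apply one_div_le_one_div_of_le (by norm_num); nlinarith
  have hb0 : 0 < 1 / (2 * K * d) := by positivity
  -- Each shrinking step loses at most a factor 2 of mass; k steps reduce the radius by more than
  -- one half, which gives the doubling constant 2^k.
  obtain ⟨k, hk⟩ := exists_pow_lt_of_lt_one (show (0 : ℝ) < 1 / 2 by norm_num)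
    (show 1 - 1 / (2 * K * d) < 1 by linarith)
  refine ⟨2 ^ k, one_le_pow₀ (by norm_num), fun V hV x r hr => ?_⟩
  have hq0 : 0 < 1 - 1 / (2 * K * d) := by linarith
  have key : ∀ j : ℕ, ∀ s : ℝ, 0 < s →
      ballInt V x s ≤ 2 ^ j * ballInt V x ((1 - 1 / (2 * K * d)) ^ j * s) := by
    intro j
    induction j with
    | zero => intro s _; simp
    | succ j ih =>
      intro s hs
      refine (ih s hs).trans ?_
      have := hV.ballInt_le_two_mul hK hd x (r := (1 - 1 / (2 * K * d)) ^ j * s) (by positivity)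
      rw [pow_succ, pow_succ', mul_assoc _ 2, mul_assoc _ _ s]
      gcongr
  refine (key k (2 * r) (by positivity)).trans ?_
  gcongr
  refine hV.ballInt_mono (ball_subset_ball ?_)
  nlinarith

/-- Polynomial growth of `‖V‖_{L^∞(B(x,r))}` in `r`. -/
lemma exists_ballSup_growth (d : ℕ) (hd : 0 < d) (K : ℝ) (hK : 1 ≤ K) (s : ℝ) : ∃ C : ℝ, 1 ≤ C ∧
    ∀ V : Euc d → ℝ, IsBInfty K V → ∀ x r, 0 < r →
      ballInt V x (s * r) ≤ C * ballInt V x r ∧ ballSup V x (s * r) ≤ C * ballSup V x r := by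
  obtain ⟨C, hC, hdbl⟩ := exists_doubling d hd K hK
  obtain ⟨k, hk⟩ := pow_unbounded_of_one_lt s (show (1 : ℝ) < 2 by norm_num)
  have hCk : 1 ≤ C ^ k := one_le_pow₀ hC
  refine ⟨K * C ^ k, by nlinarith, fun V hV x r hr => ?_⟩
  have key : ∀ j : ℕ, ballInt V x (2 ^ j * r) ≤ C ^ j * ballInt V x r := by
    intro j
    induction j with
    | zero => simp
    | succ j ih =>
      have := hdbl V hV x (2 ^ j * r) (by positivity)
      rw [pow_succ', pow_succ', mul_assoc 2, mul_assoc C]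
      exact this.trans (by gcongr)
  have hle : s * r ≤ 2 ^ k * r := by gcongr
  have hI := hV.ballInt_pos x hr
  constructor
  · calc _ ≤ ballInt V x (2 ^ k * r) := hV.ballInt_mono (ball_subset_ball hle)
      _ ≤ C ^ k * ballInt V x r := key k
      _ ≤ K * C ^ k * ballInt V x r := by gcongr; nlinarith
  · refine (hV.ballSup_mono (ball_subset_ball hle)).trans ?_
    have h2 : 0 < (2 : ℝ) ^ k * r := by positivity
    have h3 := hV.ballSup_le (zero_le_one.trans hK) x h2
    have h4 := hV.ballInt_le x hr
    have h5 : r ^ d * unitVol d * ballSup V x (2 ^ k * r)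
        ≤ r ^ d * unitVol d * (K * C ^ k * ballSup V x r) := by
      calc r ^ d * unitVol d * ballSup V x (2 ^ k * r)
          ≤ (2 ^ k * r) ^ d * unitVol d * ballSup V x (2 ^ k * r) := by
            have := unitVol_pos d
            have := ballSup_nonneg (V := V) x (2 ^ k * r)
            gcongr
            exact le_mul_of_one_le_left hr.le (one_le_pow₀ (by norm_num))
        _ ≤ K * (C ^ k * (r ^ d * unitVol d * ballSup V x r)) := by
            refine h3.trans ?_
            gcongr
            exact (key k).trans (by gcongr)
        _ = _ := by ring
    exact le_of_mul_le_mul_left h5 (mul_pos (by positivity) (unitVol_pos d))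

/-- For r ≥ 1 the quantity r²‖V‖_{L^∞(B(x,r))} is at least r times its positive value at r = 1. So
the supremum in `critRad` is finite; with the default value of an unbounded `sSup` it would be
meaningless. -/
lemma IsBInfty.critSet_bddAbove (hV : IsBInfty K V) (l : ℝ) (x : Euc d) :
    BddAbove {r : ℝ | 0 < r ∧ r ^ 2 * ballSup V x r ≤ l} := by
  have h1 := hV.ballSup_pos x one_pos
  refine ⟨max 1 (l / ballSup V x 1), fun r ⟨hr, hrl⟩ => ?_⟩
  rcases le_total r 1 with h | h
  · exact h.trans (le_max_left _ _)
  · refine le_trans ?_ (le_max_right _ _)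
    rw [le_div_iff₀ h1]
    calc r * ballSup V x 1 ≤ r ^ 2 * ballSup V x r := by
          have := hV.ballSup_mono (ball_subset_ball h : ball x 1 ⊆ _)
          gcongr
          nlinarith
      _ ≤ l := hrl

lemma IsBInfty.exists_mem_critSet (hV : IsBInfty K V) {l : ℝ} (hl : 0 < l) (x : Euc d) :
    ∃ r : ℝ, 0 < r ∧ r ^ 2 * ballSup V x r ≤ l := by
  have h1 := hV.ballSup_pos x one_pos
  refine ⟨min 1 (l / ballSup V x 1), by positivity, ?_⟩
  set r := min 1 (l / ballSup V x 1)
  have hr0 : 0 < r := by positivity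
  have hr1 : r ≤ 1 := min_le_left _ _
  have hr2 : r * ballSup V x 1 ≤ l := (le_div_iff₀ h1).1 (min_le_right _ _)
  have h3 := hV.ballSup_mono (ball_subset_ball hr1 : ball x r ⊆ _)
  have h4 := ballSup_nonneg (V := V) x r
  calc r ^ 2 * ballSup V x r ≤ r * ballSup V x 1 := by gcongr; nlinarith
    _ ≤ l := hr2

lemma IsBInfty.le_critRad (hV : IsBInfty K V) {l : ℝ} {x : Euc d} {r : ℝ} (hr : 0 < r)
    (h : r ^ 2 * ballSup V x r ≤ l) : r ≤ critRad V l x :=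
  le_csSup (hV.critSet_bddAbove l x) ⟨hr, h⟩

lemma IsBInfty.critRad_pos (hV : IsBInfty K V) {l : ℝ} (hl : 0 < l) (x : Euc d) :
    0 < critRad V l x := by
  obtain ⟨r, hr, h⟩ := hV.exists_mem_critSet hl x
  exact hr.trans_le (hV.le_critRad hr h)

lemma IsBInfty.critRad_le (hV : IsBInfty K V) {l : ℝ} (hl : 0 < l) {x : Euc d} {R : ℝ}
    (h : ∀ r, 0 < r → r ^ 2 * ballSup V x r ≤ l → r ≤ R) : critRad V l x ≤ R :=
  csSup_le (hV.exists_mem_critSet hl x) fun r hr => h r hr.1 hr.2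

lemma IsBInfty.of_lt_critRad (hV : IsBInfty K V) {l : ℝ} (hl : 0 < l) {x : Euc d} {r : ℝ}
    (hr : 0 < r) (h : r < critRad V l x) : r ^ 2 * ballSup V x r ≤ l := by
  obtain ⟨s, ⟨hs, hsl⟩, hrs⟩ := exists_lt_of_lt_csSup (hV.exists_mem_critSet hl x) h
  refine le_trans ?_ hsl
  have := hV.ballSup_mono (ball_subset_ball hrs.le : ball x r ⊆ _)
  have := ballSup_nonneg (V := V) x r
  gcongr

/-- B(y, r − |x − y|) ⊆ B(x, r), and both factors of r²‖V‖_{L^∞(B(x,r))} are monotone. This is the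
advantage of the supremum norm over an average in the definition of the critical radius: the
Lipschitz constant is exactly 1 and no doubling enters. -/
lemma IsBInfty.lipschitz_critRad (hV : IsBInfty K V) {l : ℝ} (hl : 0 < l) :
    LipschitzWith 1 (critRad V l) := by
  refine LipschitzWith.of_le_add fun x y => ?_
  refine hV.critRad_le hl fun r hr hrl => ?_
  rcases le_or_gt r (dist x y) with h | h
  · linarith [hV.critRad_pos hl y]
  · have hr' : 0 < r - dist x y := by linarith
    have hsub : ball y (r - dist x y) ⊆ ball x r :=
      Metric.ball_subset_ball' (by rw [dist_comm y x]; linarith)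
    have : r - dist x y ≤ critRad V l y := by
      refine hV.le_critRad hr' (le_trans ?_ hrl)
      have h1 := hV.ballSup_mono hsub
      have h2 := ballSup_nonneg (V := V) y (r - dist x y)
      gcongr
      linarith [dist_nonneg (x := x) (y := y)]
    linarith

lemma IsBInfty.critRad_mono (hV : IsBInfty K V) {l l' : ℝ} (hl : 0 < l) (h : l ≤ l') (x : Euc d) :
    critRad V l x ≤ critRad V l' x :=
  hV.critRad_le hl fun _ hr hrl => hV.le_critRad hr (hrl.trans h)

/-- Dividing an admissible radius by s divides r² by s² and does not increase the supremum of V.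
Thus critical radii at different levels are comparable. -/
lemma IsBInfty.critRad_le_mul (hV : IsBInfty K V) {l s : ℝ} (hl : 0 < l) (hs : 1 ≤ s)
    (x : Euc d) : critRad V (s ^ 2 * l) x ≤ s * critRad V l x := by
  have hs0 : 0 < s := by linarith
  refine hV.critRad_le (by positivity) fun r hr hrl => ?_
  have : r / s ≤ critRad V l x := by
    refine hV.le_critRad (by positivity) ?_
    have h1 := hV.ballSup_mono (ball_subset_ball (div_le_self hr.le hs) : ball x (r / s) ⊆ _)
    rw [div_pow, div_mul_eq_mul_div, div_le_iff₀ (by positivity), mul_comm l]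
    exact le_trans (by gcongr) hrl
  rwa [div_le_iff₀ hs0, mul_comm] at this

/-- Polynomial growth of the supremum norm makes the dilated radius sr admissible at a sufficiently
high level. This produces a comparable critical radius exceeding the original one by any prescribed
factor, the source of the small parameter in the weighted estimates. -/
lemma exists_critRad_ge (d : ℕ) (hd : 0 < d) (K : ℝ) (hK : 1 ≤ K) (s : ℝ) (hs : 1 ≤ s) :
    ∃ l : ℝ, 1 ≤ l ∧ ∀ V : Euc d → ℝ, IsBInfty K V → ∀ x,
      s * critRad V 1 x ≤ critRad V (l ^ 2) x := by
  obtain ⟨C, hC, hgr⟩ := exists_ballSup_growth d hd K hK s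
  have hs0 : 0 < s := by linarith
  refine ⟨s * C, by nlinarith, fun V hV x => ?_⟩
  rw [mul_comm, ← le_div_iff₀ hs0]
  refine hV.critRad_le one_pos fun r hr hrl => ?_
  rw [le_div_iff₀ hs0, mul_comm]
  refine hV.le_critRad (by positivity) ?_
  have h1 := (hgr V hV x r hr).2
  calc (s * r) ^ 2 * ballSup V x (s * r) ≤ (s * r) ^ 2 * (C * ballSup V x r) := by gcongr
    _ = s ^ 2 * C * (r ^ 2 * ballSup V x r) := by ring
    _ ≤ s ^ 2 * C * 1 := by gcongr
    _ ≤ (s * C) ^ 2 := by nlinarith [sq_nonneg s]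

/-- `V ≤ ρ_1^{-2}` almost everywhere. -/
lemma IsBInfty.ae_le_critRad (hV : IsBInfty K V) : ∀ᵐ y, V y * critRad V 1 y ^ 2 ≤ 1 := by
  -- The bound |V| ≤ ‖V‖_{L^∞(B)} fails only on a null set for each ball; countably many balls keep
  -- the exceptional set null. If V(y)ρ(y)² > 1, a rational radius q < ρ(y) with V(y)q² > 1 and a
  -- nearby centre c with q < ρ(c) contradict the bound on B(c, q).
  obtain ⟨s, hsc, hsd⟩ := TopologicalSpace.exists_countable_dense (Euc d)
  have h1 : ∀ᵐ y, ∀ c ∈ s, ∀ q : ℚ, y ∈ ball c (q : ℝ) → |V y| ≤ ballSup V c q := by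
    refine (ae_ball_iff hsc).2 fun c _ => ae_all_iff.2 fun q => hV.ae_le c q
  filter_upwards [h1, hV.pos] with y hy hVy
  by_contra hcon
  push Not at hcon
  have hρ := hV.critRad_pos one_pos y
  have hlt : √(1 / V y) < critRad V 1 y := by
    rw [Real.sqrt_lt' hρ, div_lt_iff₀ hVy, mul_comm]; exact hcon
  obtain ⟨q, hq1, hq2⟩ := exists_rat_btwn hlt
  have hq0 : (0 : ℝ) < q := (Real.sqrt_nonneg _).trans_lt hq1
  have hpos : 0 < min (q : ℝ) (critRad V 1 y - q) := lt_min hq0 (by linarith)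
  obtain ⟨c, hcs, hc⟩ := hsd.exists_dist_lt y hpos
  have hb : y ∈ ball c (q : ℝ) := hc.trans_le (min_le_left _ _)
  have h2 := hy c hcs q hb
  have hlip := (hV.lipschitz_critRad one_pos).dist_le_mul y c
  rw [NNReal.coe_one, one_mul, Real.dist_eq] at hlip
  have h3 : (q : ℝ) < critRad V 1 c := by
    have := (abs_le.1 hlip).2
    have := hc.trans_le (min_le_right _ _)
    linarith
  have h4 := hV.of_lt_critRad one_pos hq0 h3
  have h5 : 1 / V y < (q : ℝ) ^ 2 := (Real.sqrt_lt' hq0).1 hq1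
  rw [div_lt_iff₀ hVy] at h5
  have h6 : (q : ℝ) ^ 2 * V y ≤ (q : ℝ) ^ 2 * ballSup V c q := by
    gcongr; exact (le_abs_self _).trans h2
  linarith

/-- Balls of radius comparable to `ρ_1(x)`, close to `x`, carry mass `≳ ρ_1(x)^{d-2}`. -/
lemma exists_mass_lower (d : ℕ) (hd : 0 < d) (K : ℝ) (hK : 1 ≤ K) (a : ℝ) (ha : 0 < a) :
    ∃ c : ℝ, 0 < c ∧ ∀ V : Euc d → ℝ, IsBInfty K V → ∀ x y, dist x y ≤ critRad V 1 x →
      c * critRad V 1 x ^ d ≤ critRad V 1 x ^ 2 * ballInt V y (a * critRad V 1 x) := by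
  obtain ⟨C, hC, hgr⟩ := exists_ballSup_growth d hd K hK (3 / a)
  refine ⟨unitVol d / (4 * (K * C)), div_pos (unitVol_pos d) (by positivity), fun V hV x y hxy => ?_⟩
  set ρ := critRad V 1 x
  have hρ : 0 < ρ := hV.critRad_pos one_pos x
  have h1 := (hgr V hV y (a * ρ) (by positivity)).1
  have e : 3 / a * (a * ρ) = 3 * ρ := by field_simp
  rw [e] at h1
  have hsub : ball x (2 * ρ) ⊆ ball y (3 * ρ) := Metric.ball_subset_ball' (by linarith)
  have h2 := hV.ballInt_mono hsub
  have h3 := hV.ballSup_le (zero_le_one.trans hK) x (r := 2 * ρ) (by positivity)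
  -- Twice the critical radius is no longer admissible, so V is large somewhere in B(x, 2ρ). The
  -- reverse Hölder condition turns this into mass, and the growth estimate transfers the mass to
  -- the small ball about y.
  have h4 : 1 < (2 * ρ) ^ 2 * ballSup V x (2 * ρ) := by
    by_contra hcon
    have := hV.le_critRad (x := x) (r := 2 * ρ) (by positivity) (not_lt.1 hcon)
    change 2 * ρ ≤ ρ at this
    linarith
  have hu := unitVol_pos d
  rw [div_mul_eq_mul_div, div_le_iff₀ (by positivity)]
  have h5 : unitVol d * ρ ^ d ≤ 4 * (unitVol d * (2 * ρ) ^ d * (ρ ^ 2 * ballSup V x (2 * ρ))) := by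
    have e1 : unitVol d * ρ ^ d ≤ unitVol d * (2 * ρ) ^ d * 1 := by rw [mul_one]; gcongr; linarith
    refine e1.trans ?_
    rw [mul_left_comm]
    refine mul_le_mul_of_nonneg_left ?_ (by positivity)
    nlinarith
  calc unitVol d * ρ ^ d ≤ 4 * (ρ ^ 2 * ((2 * ρ) ^ d * unitVol d * ballSup V x (2 * ρ))) := by
        linarith [h5]
    _ ≤ 4 * (ρ ^ 2 * (K * (C * ballInt V y (a * ρ)))) := by
        refine mul_le_mul_of_nonneg_left (mul_le_mul_of_nonneg_left (h3.trans ?_)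
          (by positivity)) (by norm_num)
        exact mul_le_mul_of_nonneg_left (h2.trans h1) (by linarith)
    _ = _ := by ring

/-- `ψ(x, r)` is comparable to `r² ‖V‖_{L^∞(B(x,r))}`. -/
lemma psiFun_bounds {n : ℕ} (hn : 1 ≤ n) {V : Pt n → ℝ} (hV : IsBInfty K V) (hK : 1 ≤ K)
    (x : Pt n) {r : ℝ} (hr : 0 < r) :
    psiFun V x r ≤ unitVol (n + 1) * (r ^ 2 * ballSup V x r) ∧
      unitVol (n + 1) * (r ^ 2 * ballSup V x r) ≤ K * psiFun V x r := by
  obtain ⟨k, rfl⟩ : ∃ k, n = k + 1 := ⟨n - 1, by omega⟩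
  have h1 := hV.ballInt_le x hr
  have h2 := hV.ballSup_le (zero_le_one.trans hK) x hr
  have hp : psiFun V x r = 1 / r ^ k * ballInt V x r := rfl
  rw [hp]
  constructor
  · calc 1 / r ^ k * ballInt V x r
        ≤ 1 / r ^ k * (r ^ (k + 1 + 1) * unitVol (k + 1 + 1) * ballSup V x r) := by gcongr
      _ = _ := by field_simp; ring
  · calc unitVol (k + 1 + 1) * (r ^ 2 * ballSup V x r)
        = 1 / r ^ k * (r ^ (k + 1 + 1) * unitVol (k + 1 + 1) * ballSup V x r) := by field_simp; ring
      _ ≤ 1 / r ^ k * (K * ballInt V x r) := by gcongr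
      _ = _ := by ring

/-- `m(x, V)` is comparable to `1 / ρ_1(x)`. -/
lemma exists_mFun_bounds {n : ℕ} (hn : 1 ≤ n) (K : ℝ) (hK : 1 ≤ K) : ∃ C : ℝ, 1 ≤ C ∧
    ∀ V : Pt n → ℝ, IsBInfty K V → ∀ x,
      (critRad V 1 x)⁻¹ ≤ C * mFun V x ∧ mFun V x ≤ C * (critRad V 1 x)⁻¹ := by
  have hu := unitVol_pos (n + 1)
  set u := unitVol (n + 1)
  -- A single constant for both sides: ψ ≤ 1 forces r²‖V‖ ≤ K/u, and r²‖V‖ ≤ 1/u forces ψ ≤ 1.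
  set s := max 1 (max (K / u) u)
  have hs1 : 1 ≤ s := le_max_left _ _
  have hs2 : K / u ≤ s := (le_max_left _ _).trans (le_max_right _ _)
  have hs3 : u ≤ s := (le_max_right _ _).trans (le_max_right _ _)
  have hs0 : 0 < s := by linarith
  refine ⟨s, hs1, fun V hV x => ?_⟩
  have hρ := hV.critRad_pos one_pos x
  have hup : ∀ r, 0 < r → psiFun V x r ≤ 1 → r ≤ s * critRad V 1 x := fun r hr h => by
    have h1 := (psiFun_bounds hn hV hK x hr).2
    have h2 : r ^ 2 * ballSup V x r ≤ K / u := by rw [le_div_iff₀ hu, mul_comm]; nlinarith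
    have h3 : r ^ 2 * ballSup V x r ≤ s ^ 2 * 1 := by nlinarith
    exact (hV.le_critRad hr h3).trans (hV.critRad_le_mul one_pos hs1 x)
  have hmem : ∀ r, 0 < r → r < critRad V (1 / s) x → psiFun V x r ≤ 1 := fun r hr h => by
    have h1 := (psiFun_bounds hn hV hK x hr).1
    have h2 := hV.of_lt_critRad (by positivity) hr h
    rw [le_div_iff₀ hs0] at h2
    have : 0 ≤ r ^ 2 * ballSup V x r := mul_nonneg (by positivity) (ballSup_nonneg _ _)
    nlinarith
  have hlow : critRad V 1 x ≤ s * critRad V (1 / s) x := by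
    have h1 := hV.critRad_le_mul (l := 1 / s) (by positivity) hs1 x
    refine le_trans (hV.critRad_mono one_pos ?_ x) h1
    rw [sq, mul_assoc, mul_one_div_cancel hs0.ne']; linarith
  have hρs := hV.critRad_pos (l := 1 / s) (by positivity) x
  have hne : {t : ℝ | ∃ r : ℝ, 0 < r ∧ psiFun V x r ≤ 1 ∧ t = 1 / r}.Nonempty :=
    ⟨_, critRad V (1 / s) x / 2, by positivity, hmem _ (by positivity) (by linarith), rfl⟩
  have hbdd : BddBelow {t : ℝ | ∃ r : ℝ, 0 < r ∧ psiFun V x r ≤ 1 ∧ t = 1 / r} :=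
    ⟨0, by rintro t ⟨r, hr, -, rfl⟩; positivity⟩
  constructor
  · rw [← div_le_iff₀' hs0]
    refine le_csInf hne ?_
    rintro t ⟨r, hr, h, rfl⟩
    have := hup r hr h
    rw [inv_eq_one_div, div_div, mul_comm]
    exact one_div_le_one_div_of_le hr this
  · refine le_of_forall_gt_imp_ge_of_dense fun t ht => ?_
    have ht0 : 0 < t := lt_trans (by positivity) ht
    refine csInf_le hbdd ⟨1 / t, by positivity, hmem _ (by positivity) ?_, by simp⟩
    have h1 : s * (critRad V 1 x)⁻¹ * (critRad V 1 x) < t * (s * critRad V (1 / s) x) := by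
      calc _ < t * critRad V 1 x := by gcongr
        _ ≤ _ := by gcongr
    rw [mul_assoc, inv_mul_cancel₀ hρ.ne'] at h1
    rw [div_lt_iff₀ ht0]
    have : s * 1 < s * (critRad V (1 / s) x * t) := by linarith
    exact lt_of_mul_lt_mul_left this hs0.le

end Potential

/-! ### Translations and mollification in `L²` -/

section Translation

variable {d : ℕ} {G : Type*} [NormedAddCommGroup G] [InnerProductSpace ℝ G]

/-- Translation as a continuous map. -/
def transMap (y : Euc d) : C(Euc d, Euc d) := ⟨fun x => x + y, by fun_prop⟩

lemma continuous_transMap : Continuous (transMap : Euc d → C(Euc d, Euc d)) :=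
  ContinuousMap.continuous_of_continuous_uncurry _ (by
    change Continuous fun p : Euc d × Euc d => p.2 + p.1
    fun_prop)

lemma measurePreserving_transMap (y : Euc d) : MeasurePreserving (transMap y) :=
  measurePreserving_add_right volume y

/-- Translations act strongly continuously on L², and the inner product is jointly continuous. -/
lemma tendsto_integral_inner_translate {F H : Euc d → G} (hF : MemLp F 2) (hH : MemLp H 2) :
    Tendsto (fun p : Euc d × Euc d => ∫ x, inner ℝ (F (x + p.1)) (H (x + p.2))) (𝓝 0)
      (𝓝 (∫ x, inner ℝ (F x) (H x))) := by
  have key : ∀ (F : Euc d → G) (hF : MemLp F 2), Continuous fun y : Euc d =>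
      Lp.compMeasurePreserving (transMap y) (measurePreserving_transMap y) (hF.toLp F) :=
    fun F hF => continuous_const.compMeasurePreservingLp continuous_transMap
      measurePreserving_transMap (by norm_num)
  have hc : Continuous fun p : Euc d × Euc d =>
      inner ℝ (Lp.compMeasurePreserving (transMap p.1) (measurePreserving_transMap p.1) (hF.toLp F))
        (Lp.compMeasurePreserving (transMap p.2) (measurePreserving_transMap p.2) (hH.toLp H)) :=
    ((key F hF).comp continuous_fst).inner ((key H hH).comp continuous_snd)
  have ae : ∀ (F : Euc d → G) (hF : MemLp F 2) (y : Euc d),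
      Lp.compMeasurePreserving (transMap y) (measurePreserving_transMap y) (hF.toLp F)
        =ᵐ[volume] fun x => F (x + y) := fun F hF y =>
    (Lp.coeFn_compMeasurePreserving _ _).trans
      ((measurePreserving_transMap y).quasiMeasurePreserving.ae_eq_comp hF.coeFn_toLp)
  have e : ∀ p : Euc d × Euc d,
      inner ℝ (Lp.compMeasurePreserving (transMap p.1) (measurePreserving_transMap p.1) (hF.toLp F))
        (Lp.compMeasurePreserving (transMap p.2) (measurePreserving_transMap p.2) (hH.toLp H))
      = ∫ x, inner ℝ (F (x + p.1)) (H (x + p.2)) := fun p => by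
    rw [L2.inner_def]
    refine integral_congr_ae ?_
    filter_upwards [ae F hF p.1, ae H hH p.2] with x h1 h2
    rw [h1, h2]
  have := hc.tendsto 0
  simp only [e] at this
  simpa using this

lemma tendsto_eLpNorm_translate {F : Euc d → G} (hF : MemLp F 2) :
    Tendsto (fun y : Euc d => eLpNorm (fun x => F (x + y) - F x) 2) (𝓝 0) (𝓝 0) := by
  have key : Continuous fun y : Euc d =>
      Lp.compMeasurePreserving (transMap y) (measurePreserving_transMap y) (hF.toLp F) :=
    continuous_const.compMeasurePreservingLp continuous_transMap
      measurePreserving_transMap (by norm_num)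
  have ae : ∀ (y : Euc d),
      Lp.compMeasurePreserving (transMap y) (measurePreserving_transMap y) (hF.toLp F)
        =ᵐ[volume] fun x => F (x + y) := fun y =>
    (Lp.coeFn_compMeasurePreserving _ _).trans
      ((measurePreserving_transMap y).quasiMeasurePreserving.ae_eq_comp hF.coeFn_toLp)
  have h2 : Tendsto (fun y : Euc d => edist
      (Lp.compMeasurePreserving (transMap y) (measurePreserving_transMap y) (hF.toLp F))
      (Lp.compMeasurePreserving (transMap 0) (measurePreserving_transMap 0) (hF.toLp F)))
      (𝓝 0) (𝓝 0) := by
    have := (key.edist (continuous_const (y := Lp.compMeasurePreserving (transMap 0)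
      (measurePreserving_transMap 0) (hF.toLp F)))).tendsto 0
    simpa using this
  refine h2.congr fun y => ?_
  rw [Lp.edist_def]
  refine eLpNorm_congr_ae ?_
  filter_upwards [ae y, ae 0] with x h1 h2
  simp only [Pi.sub_apply, h1, h2, add_zero]

lemma integrable_inner_of_memLp {X : Type*} [MeasurableSpace X] {μ : Measure X} {a b : X → G}
    (ha : MemLp a 2 μ) (hb : MemLp b 2 μ) : Integrable (fun x => inner ℝ (a x) (b x)) μ := by
  refine (MemLp.integrable_mul ha.norm hb.norm).mono' (ha.1.inner hb.1) (.of_forall fun x => ?_)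
  exact norm_inner_le_norm _ _

variable [CompleteSpace G]

/-- From |a||b| ≤ |a|² + |b|²: after a shear of the product space, each of the two terms is an
integrable function times the integrable mollifier. This justifies Fubini in `exists_mollify_close`.
-/
lemma integrable_mollify_integrand {a b : Euc d → G} (ha : MemLp a 2) (hb : MemLp b 2)
    (ρ : ContDiffBump (0 : Euc d)) :
    Integrable (fun p : Euc d × Euc d => ρ.normed volume p.2 * inner ℝ (a (p.1 - p.2)) (b p.1))
      (volume.prod volume) := by
  have hρ : Integrable (ρ.normed volume) (volume : Measure (Euc d)) := ρ.integrable_normed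
  have h2a : Integrable (fun x => ‖a x‖ ^ 2) := ha.integrable_norm_pow two_ne_zero
  have h2b : Integrable (fun x => ‖b x‖ ^ 2) := hb.integrable_norm_pow two_ne_zero
  have hmp : MeasurePreserving (fun p : Euc d × Euc d => (p.1 - p.2, p.2))
      (volume.prod volume) (volume.prod volume) := measurePreserving_sub_prod volume volume
  have i1 : Integrable (fun p : Euc d × Euc d => ‖a (p.1 - p.2)‖ ^ 2 * ρ.normed volume p.2)
      (volume.prod volume) := by
    have := h2a.mul_prod hρ
    exact (hmp.integrable_comp this.aestronglyMeasurable).2 this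
  have i2 : Integrable (fun p : Euc d × Euc d => ‖b p.1‖ ^ 2 * ρ.normed volume p.2)
      (volume.prod volume) := h2b.mul_prod hρ
  refine (i1.add i2).mono' ?_ (.of_forall fun p => ?_)
  · have m1 : AEStronglyMeasurable (fun p : Euc d × Euc d => a (p.1 - p.2)) (volume.prod volume) :=
      (ha.1.comp_fst (ν := volume)).comp_measurePreserving hmp
    have m2 : AEStronglyMeasurable (fun p : Euc d × Euc d => b p.1) (volume.prod volume) :=
      hb.1.comp_fst
    exact ((ρ.continuous_normed.comp continuous_snd).aestronglyMeasurable).mul (m1.inner m2)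
  · have h0 := ρ.nonneg_normed (μ := volume) p.2
    simp only [Pi.add_apply]
    rw [norm_mul, norm_of_nonneg h0]
    have h1 := norm_inner_le_norm (𝕜 := ℝ) (a (p.1 - p.2)) (b p.1)
    have h3 : ‖a (p.1 - p.2)‖ * ‖b p.1‖ ≤ ‖a (p.1 - p.2)‖ ^ 2 + ‖b p.1‖ ^ 2 := by
      nlinarith [sq_nonneg (‖a (p.1 - p.2)‖ - ‖b p.1‖), sq_nonneg (‖a (p.1 - p.2)‖),
        sq_nonneg ‖b p.1‖]
    nlinarith [h1.trans h3]

/-- Pairing with a mollified function converges to the pairing with the function. -/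
lemma exists_mollify_close {a b : Euc d → G} (ha : MemLp a 2) (hb : MemLp b 2) {ε : ℝ}
    (hε : 0 < ε) : ∃ r₀ : ℝ, 0 < r₀ ∧ ∀ ρ : ContDiffBump (0 : Euc d), ρ.rOut < r₀ →
      Integrable (fun x => inner ℝ (∫ t, ρ.normed volume (x - t) • a t) (b x)) ∧
      |(∫ x, inner ℝ (∫ t, ρ.normed volume (x - t) • a t) (b x)) - ∫ x, inner ℝ (a x) (b x)| ≤ ε := by
  have hc := (tendsto_integral_inner_translate ha hb)
  have hcont : Continuous fun y : Euc d => ((-y, 0) : Euc d × Euc d) := by fun_prop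
  have hc2 : Tendsto (fun y : Euc d => ((-y, 0) : Euc d × Euc d)) (𝓝 0) (𝓝 0) := by
    have := hcont.tendsto 0
    rw [neg_zero] at this
    exact this
  have hc3 := hc.comp hc2
  simp only [Function.comp_def, add_zero, ← sub_eq_add_neg] at hc3
  obtain ⟨r₀, hr₀, hball⟩ := Metric.tendsto_nhds_nhds.1 hc3 ε hε
  refine ⟨r₀, hr₀, fun ρ hρ => ?_⟩
  have hint := integrable_mollify_integrand ha hb ρ
  have e0 : (fun x => inner ℝ (∫ t, ρ.normed volume (x - t) • a t) (b x))
      = fun x => ∫ y, ρ.normed volume y * inner ℝ (a (x - y)) (b x) := by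
    funext x
    have h1 : ∫ t, ρ.normed volume (x - t) • a t = ∫ y, ρ.normed volume y • a (x - y) := by
      rw [← integral_sub_left_eq_self (fun y => ρ.normed volume y • a (x - y)) volume x]
      simp
    have hi : Integrable (fun y => ρ.normed volume y • a (x - y)) := by
      have hax : LocallyIntegrable (fun y => a (x - y)) := by
        have : MemLp (fun y => a (x - y)) 2 volume :=
          ha.comp_measurePreserving (Measure.measurePreserving_sub_left volume x)
        exact this.locallyIntegrable (by norm_num)
      exact hax.integrable_smul_left_of_hasCompactSupport ρ.continuous_normed
        ρ.hasCompactSupport_normed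
    rw [h1, real_inner_comm, ← integral_inner hi]
    refine integral_congr_ae (.of_forall fun y => ?_)
    simp only [real_inner_smul_right, real_inner_comm (b x)]
  rw [e0]
  refine ⟨hint.integral_prod_left, ?_⟩
  -- After Fubini the mollified pairing is an average, over shifts y in the support of the
  -- mollifier, of ∫ a(x − y)·b(x) dx, which is continuous at y = 0.
  rw [integral_integral_swap hint]
  have e2 : ∀ y, ∫ x, ρ.normed volume y * inner ℝ (a (x - y)) (b x)
      = ρ.normed volume y * ∫ x, inner ℝ (a (x - y)) (b x) := fun y => integral_const_mul _ _
  simp only [e2]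
  have hI2 : Integrable fun y => ρ.normed volume y * ∫ x, inner ℝ (a (x - y)) (b x) := by
    have := hint.integral_prod_right
    simpa only [e2] using this
  have e3 : ∫ x, inner ℝ (a x) (b x) = ∫ y, ρ.normed volume y * ∫ x, inner ℝ (a x) (b x) := by
    rw [integral_mul_const, ρ.integral_normed, one_mul]
  have hI3 : Integrable fun y => ρ.normed volume y * ∫ x, inner ℝ (a x) (b x) :=
    ρ.integrable_normed.mul_const _
  rw [e3, ← integral_sub hI2 hI3, ← norm_eq_abs]
  refine (norm_integral_le_of_norm_le (ρ.integrable_normed.mul_const ε)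
    (.of_forall fun y => ?_)).trans ?_
  · rw [← mul_sub, norm_mul, norm_of_nonneg (ρ.nonneg_normed y)]
    by_cases hy : y ∈ ball (0 : Euc d) ρ.rOut
    · have := hball (x := y) ((mem_ball.1 hy).trans hρ)
      rw [dist_eq_norm] at this
      exact mul_le_mul_of_nonneg_left this.le (ρ.nonneg_normed y)
    · have : ρ.normed volume y = 0 := by
        rw [← Function.notMem_support, ρ.support_normed_eq]; exact hy
      simp [this]
  · rw [integral_mul_const, ρ.integral_normed, one_mul]

end Translation

/-! ### Weak identities and Sobolev test functions -/

section Weak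

variable {d : ℕ} {G : Type*} [NormedAddCommGroup G]

/-- Square integrability on the compact subsets of `D`. -/
def L2On (D : Set (Euc d)) (F : Euc d → G) : Prop :=
  ∀ K ⊆ D, IsCompact K → MemLp F 2 (volume.restrict K)

/-- The weak form of `div F = H` in `D`. -/
structure WeakId (D : Set (Euc d)) (F : Euc d → Euc d) (H : Euc d → ℝ) : Prop where
  memF : L2On D F
  memH : L2On D H
  eq : ∀ φ, IsTest D φ → ∫ x in D, (fderiv ℝ φ x (F x) + H x * φ x) = 0

/-- `φ ∈ W^{1,2}` with gradient `ψ`, with compact support in `D`. -/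
structure CptSob (D : Set (Euc d)) (φ : Euc d → ℝ) (ψ : Euc d → Euc d) : Prop where
  supp : ∃ K ⊆ D, IsCompact K ∧ ∀ x ∉ K, φ x = 0 ∧ ψ x = 0
  memφ : MemLp φ 2
  memψ : MemLp ψ 2
  eq : ∀ ζ : Euc d → ℝ, ContDiff ℝ (⊤ : ℕ∞) ζ → HasCompactSupport ζ → ∀ e,
    ∫ x, φ x * fderiv ℝ ζ x e = - ∫ x, inner ℝ (ψ x) e * ζ x

lemma L2On.indicator {D K : Set (Euc d)} {F : Euc d → G} (hF : L2On D F) (hK : K ⊆ D)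
    (hKc : IsCompact K) : MemLp (K.indicator F) 2 :=
  (memLp_indicator_iff_restrict hKc.measurableSet).2 (hF K hK hKc)

/-- The mollification of a Sobolev function has the mollified gradient. -/
lemma CptSob.fderiv_mollify {D : Set (Euc d)} {φ : Euc d → ℝ} {ψ : Euc d → Euc d}
    (h : CptSob D φ ψ) (ρ : ContDiffBump (0 : Euc d)) :
    ContDiff ℝ (⊤ : ℕ∞) (fun x => ∫ t, ρ.normed volume (x - t) • φ t) ∧
    ∀ x e, fderiv ℝ (fun x => ∫ t, ρ.normed volume (x - t) • φ t) x e
      = inner ℝ (∫ t, ρ.normed volume (x - t) • ψ t) e := by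
  have hloc : LocallyIntegrable φ := h.memφ.locallyIntegrable (by norm_num)
  have hρs : ContDiff ℝ (⊤ : ℕ∞) (ρ.normed volume) := ρ.contDiff_normed
  have hρ1 : ContDiff ℝ 1 (ρ.normed volume) := hρs.of_le (by exact_mod_cast le_top)
  have hρc := ρ.hasCompactSupport_normed (μ := volume)
  have e0 : (fun x => ∫ t, ρ.normed volume (x - t) • φ t)
      = convolution φ (ρ.normed volume) (ContinuousLinearMap.mul ℝ ℝ) volume := by
    funext x
    simp only [convolution, ContinuousLinearMap.mul_apply', smul_eq_mul, mul_comm]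
  refine ⟨by rw [e0]; exact hρc.contDiff_convolution_right _ hloc hρs, fun x e => ?_⟩
  rw [e0, (hρc.hasFDerivAt_convolution_right _ hloc hρ1 x).fderiv,
    convolution_precompR_apply _ hloc (hρc.fderiv ℝ) (hρ1.continuous_fderiv one_ne_zero)]
  have hζ : ContDiff ℝ (⊤ : ℕ∞) fun t => ρ.normed volume (x - t) :=
    hρs.comp (contDiff_const.sub contDiff_id)
  have hζc : HasCompactSupport fun t => ρ.normed volume (x - t) :=
    hρc.comp_homeomorph (Homeomorph.subLeft x)
  have hd : ∀ t, fderiv ℝ (fun t => ρ.normed volume (x - t)) t e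
      = - fderiv ℝ (ρ.normed volume) (x - t) e := fun t => by
    have h1 : HasFDerivAt (fun t : Euc d => x - t) (-ContinuousLinearMap.id ℝ (Euc d)) t := by
      simpa using (hasFDerivAt_id t).const_sub x
    have h2 := ((hρ1.differentiable one_ne_zero (x - t)).hasFDerivAt).comp t h1
    have h3 : fderiv ℝ (fun t => ρ.normed volume (x - t)) t = _ := h2.fderiv
    rw [h3]; simp
  -- The weak gradient is tested with the reflected and translated mollifier t ↦ ρ(x − t), so the
  -- derivative passes from the mollifier to φ.
  have := h.eq _ hζ hζc e
  simp only [hd, mul_neg, integral_neg, neg_inj] at this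
  simp only [convolution, ContinuousLinearMap.mul_apply']
  rw [this]
  have hi : Integrable (fun t => ρ.normed volume (x - t) • ψ t) :=
    (h.memψ.locallyIntegrable (by norm_num)).integrable_smul_left_of_hasCompactSupport
      hζ.continuous hζc
  rw [real_inner_comm, ← integral_inner hi]
  refine integral_congr_ae (.of_forall fun t => ?_)
  simp only [real_inner_smul_right, real_inner_comm e, mul_comm]

/-- A weak identity may be tested with compactly supported Sobolev functions. -/
lemma WeakId.test {D : Set (Euc d)} (hD : IsOpen D) {F : Euc d → Euc d} {H : Euc d → ℝ}
    (hW : WeakId D F H) {φ : Euc d → ℝ} {ψ : Euc d → Euc d} (h : CptSob D φ ψ) :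
    ∫ x in D, (inner ℝ (ψ x) (F x) + H x * φ x) = 0 := by
  obtain ⟨K, hKD, hK, hoff⟩ := h.supp
  -- The margin δ leaves room for mollifying φ inside D. Restricting F and H to the compact
  -- thickening turns them into global L² functions, to which `exists_mollify_close` applies.
  obtain ⟨δ, hδ, hδD⟩ := hK.exists_cthickening_subset_open hD hKD
  set K' := Metric.cthickening δ K with hK'
  have hK'c : IsCompact K' := hK.cthickening
  have hKK' : K ⊆ K' := Metric.self_subset_cthickening K
  set F' := K'.indicator F with hF'
  set H' := K'.indicator H with hH'
  have mF' : MemLp F' 2 := hW.memF.indicator hδD hK'c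
  have mH' : MemLp H' 2 := hW.memH.indicator hδD hK'c
  have target : ∫ x in D, (inner ℝ (ψ x) (F x) + H x * φ x)
      = (∫ x, inner ℝ (ψ x) (F' x)) + ∫ x, inner ℝ (φ x) (H' x) := by
    rw [← integral_add (integrable_inner_of_memLp h.memψ mF') (integrable_inner_of_memLp h.memφ mH')]
    rw [← integral_indicator hD.measurableSet]
    refine integral_congr_ae (.of_forall fun x => ?_)
    by_cases hx : x ∈ K
    · simp [hF', hH', hKK' hx, hKD hx]
    · simp [hoff x hx, indicator]
  rw [target]
  refine abs_eq_zero.1 (le_antisymm (le_of_forall_pos_le_add fun ε hε => ?_) (abs_nonneg _))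
  obtain ⟨r₁, hr₁, h1⟩ := exists_mollify_close h.memψ mF' (half_pos hε)
  obtain ⟨r₂, hr₂, h2⟩ := exists_mollify_close h.memφ mH' (half_pos hε)
  set r := min δ (min r₁ r₂)
  have hr0 : 0 < r := lt_min hδ (lt_min hr₁ hr₂)
  let ρ : ContDiffBump (0 : Euc d) := ⟨r / 4, r / 2, by positivity, by linarith⟩
  have hρr : ρ.rOut = r / 2 := rfl
  have hrd : r ≤ δ := min_le_left _ _
  have hr1 : r ≤ r₁ := (min_le_right _ _).trans (min_le_left _ _)
  have hr2 : r ≤ r₂ := (min_le_right _ _).trans (min_le_right _ _)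
  obtain ⟨i1, h1⟩ := h1 ρ (by rw [hρr]; linarith)
  obtain ⟨i2, h2⟩ := h2 ρ (by rw [hρr]; linarith)
  obtain ⟨hs, hder⟩ := h.fderiv_mollify ρ
  set Φ : Euc d → ℝ := fun x => ∫ t, ρ.normed volume (x - t) • φ t
  have hoff' : ∀ x ∉ K', Φ x = 0 := fun x hx => by
    refine integral_eq_zero_of_ae (.of_forall fun t => ?_)
    by_cases ht : t ∈ K
    · have : δ < dist x t := by
        by_contra hcon
        exact hx (Metric.mem_cthickening_of_dist_le x t δ K ht (not_lt.1 hcon))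
      have : ρ.normed volume (x - t) = 0 := by
        rw [← Function.notMem_support, ρ.support_normed_eq, mem_ball, dist_zero_right,
          ← dist_eq_norm, hρr]
        linarith
      simp [this]
    · simp [(hoff t ht).1]
  have htsupp : tsupport Φ ⊆ K' := closure_minimal
    (fun x hx => by by_contra hcon; exact hx (hoff' x hcon)) hK'c.isClosed
  have htest : IsTest D Φ :=
    ⟨hs, hK'c.of_isClosed_subset (isClosed_tsupport _) htsupp, htsupp.trans hδD⟩
  have h0 := hW.eq Φ htest
  have e : ∫ x in D, (fderiv ℝ Φ x (F x) + H x * Φ x)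
      = (∫ x, inner ℝ (∫ t, ρ.normed volume (x - t) • ψ t) (F' x))
        + ∫ x, inner ℝ (∫ t, ρ.normed volume (x - t) • φ t) (H' x) := by
    rw [← integral_add i1 i2, ← integral_indicator hD.measurableSet]
    refine integral_congr_ae (.of_forall fun x => ?_)
    by_cases hx : x ∈ K'
    · simp only [hF', hH', hx, hδD hx, indicator_of_mem, ← hder, Real.inner_apply]
      rw [mul_comm (H x)]
    · simp [hF', hH', hx, hoff' x hx, fderiv_of_notMem_tsupport ℝ fun hh => hx (htsupp hh), indicator]
  rw [e] at h0
  rw [zero_add]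
  have := abs_sub_comm (∫ x, inner ℝ (ψ x) (F' x))
    (∫ x, inner ℝ (∫ t, ρ.normed volume (x - t) • ψ t) (F' x))
  rw [abs_le] at h1 h2 ⊢
  constructor <;> linarith [h1.1, h1.2, h2.1, h2.2]

end Weak

/-! ### Lipschitz cut-offs as test functions and as factors of Sobolev functions -/

section WeakLip

variable {d : ℕ} {G : Type*} [NormedAddCommGroup G]

lemma memLp_of_bounded_of_supp {p : ℝ≥0∞} {f : Euc d → G} (hf : AEStronglyMeasurable f volume)
    {K : Set (Euc d)} (hK : IsCompact K) (hoff : ∀ x ∉ K, f x = 0) {C : ℝ} (hC : ∀ x, ‖f x‖ ≤ C) :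
    MemLp f p := by
  have : IsFiniteMeasure (volume.restrict K) := ⟨by simpa using hK.measure_lt_top⟩
  have h1 : MemLp f p (volume.restrict K) := MemLp.of_bound hf.restrict C (Eventually.of_forall hC)
  have h2 : K.indicator f = f := indicator_eq_self.2 fun x hx => by
    by_contra hcon; exact hx (hoff x hcon)
  rw [← h2]
  exact (memLp_indicator_iff_restrict hK.measurableSet).2 h1

lemma measurable_gradient (θ : Euc d → ℝ) : Measurable (gradient θ) :=
  (InnerProductSpace.toDual ℝ (Euc d)).symm.continuous.measurable.comp (measurable_fderiv ℝ θ)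

lemma norm_gradient (θ : Euc d → ℝ) (x : Euc d) : ‖gradient θ x‖ = ‖fderiv ℝ θ x‖ := by
  simp [gradient]

lemma norm_gradient_le {θ : Euc d → ℝ} {C : ℝ≥0} (h : LipschitzWith C θ) (x : Euc d) :
    ‖gradient θ x‖ ≤ C := by
  rw [norm_gradient]; exact norm_fderiv_le_of_lipschitz ℝ h

lemma gradient_eq_zero_of_notMem {θ : Euc d → ℝ} {x : Euc d} (hx : x ∉ tsupport θ) :
    gradient θ x = 0 := by
  simp [gradient, fderiv_of_notMem_tsupport ℝ hx]

lemma LipschitzWith.mul_of_bounded {X : Type*} [PseudoMetricSpace X] {f g : X → ℝ} {C₁ C₂ : ℝ≥0}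
    (hf : LipschitzWith C₁ f) (hg : LipschitzWith C₂ g) {B₁ B₂ : ℝ≥0} (hB₁ : ∀ x, |f x| ≤ B₁)
    (hB₂ : ∀ x, |g x| ≤ B₂) : LipschitzWith (B₁ * C₂ + B₂ * C₁) (fun x => f x * g x) := by
  refine LipschitzWith.of_dist_le_mul fun x y => ?_
  have h1 := hf.dist_le_mul x y
  have h2 := hg.dist_le_mul x y
  rw [Real.dist_eq] at h1 h2 ⊢
  have e : f x * g x - f y * g y = f x * (g x - g y) + g y * (f x - f y) := by ring
  rw [e]
  refine (abs_add_le _ _).trans ?_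
  rw [abs_mul, abs_mul]
  have h3 : |f x| * |g x - g y| ≤ B₁ * (C₂ * dist x y) := by gcongr; exact hB₁ x
  have h4 : |g y| * |f x - f y| ≤ B₂ * (C₁ * dist x y) := by gcongr; exact hB₂ y
  push_cast; linarith

lemma exists_bound_of_lipschitz {θ : Euc d → ℝ} {C : ℝ≥0} (h : LipschitzWith C θ)
    (hc : HasCompactSupport θ) : ∃ B : ℝ≥0, ∀ x, |θ x| ≤ B := by
  obtain ⟨B, hB⟩ := hc.exists_bound_of_continuous h.continuous
  exact ⟨B.toNNReal, fun x => (hB x).trans (Real.le_coe_toNNReal B)⟩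

/-- Lipschitz functions with compact support are admissible Sobolev test functions. -/
lemma cptSob_of_lipschitz {D : Set (Euc d)} {θ : Euc d → ℝ} {C : ℝ≥0} (h : LipschitzWith C θ)
    (hc : HasCompactSupport θ) (hD : tsupport θ ⊆ D) : CptSob D θ (gradient θ) where
  supp := ⟨tsupport θ, hD, hc, fun x hx =>
    ⟨image_eq_zero_of_notMem_tsupport hx, gradient_eq_zero_of_notMem hx⟩⟩
  memφ := by
    obtain ⟨B, hB⟩ := exists_bound_of_lipschitz h hc
    exact memLp_of_bounded_of_supp h.continuous.aestronglyMeasurable hc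
      (fun x hx => image_eq_zero_of_notMem_tsupport hx) hB
  memψ := memLp_of_bounded_of_supp (measurable_gradient θ).aestronglyMeasurable hc
    (fun x hx => gradient_eq_zero_of_notMem hx) (norm_gradient_le h)
  eq ζ hζ hζc e := by
    obtain ⟨C', hC'⟩ := ContDiff.lipschitzWith_of_hasCompactSupport hζc hζ (by simp)
    have h1 := LipschitzWith.integral_lineDeriv_mul_eq (μ := volume) h hC' hζc e
    have h2 : ∫ x, lineDeriv ℝ θ x e * ζ x = ∫ x, inner ℝ (gradient θ x) e * ζ x := by
      refine integral_congr_ae ?_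
      filter_upwards [h.ae_differentiableAt (μ := volume)] with x hx
      rw [hx.lineDeriv_eq_fderiv, inner_gradient_left]
    have h3 : ∫ x, lineDeriv ℝ ζ x (-e) * θ x = - ∫ x, θ x * fderiv ℝ ζ x e := by
      rw [← integral_neg]
      refine integral_congr_ae (.of_forall fun x => ?_)
      simp only [(hζ.differentiable (by simp) x).lineDeriv_eq_fderiv, map_neg]
      ring
    rw [h2, h3] at h1
    linarith

lemma WeakId.test_lipschitz {D : Set (Euc d)} (hD : IsOpen D) {F : Euc d → Euc d} {H : Euc d → ℝ}
    (hW : WeakId D F H) {θ : Euc d → ℝ} {C : ℝ≥0} (h : LipschitzWith C θ)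
    (hc : HasCompactSupport θ) (hθ : tsupport θ ⊆ D) :
    ∫ x in D, (fderiv ℝ θ x (F x) + H x * θ x) = 0 := by
  have := hW.test hD (cptSob_of_lipschitz h hc hθ)
  simpa only [inner_gradient_left] using this

lemma L2On.integrableOn_mul {D : Set (Euc d)} (hD : IsOpen D) {f : Euc d → ℝ} (hf : L2On D f)
    {φ : Euc d → ℝ} (hφ : MemLp φ 2) {K : Set (Euc d)} (hKD : K ⊆ D) (hK : IsCompact K)
    (hoff : ∀ x ∉ K, φ x = 0) : IntegrableOn (fun x => f x * φ x) D := by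
  have h1 : Integrable (fun x => K.indicator f x * φ x) :=
    MemLp.integrable_mul (hf.indicator hKD hK) hφ
  refine h1.integrableOn.congr_fun (fun x hx => ?_) hD.measurableSet
  by_cases hxK : x ∈ K
  · simp [hxK]
  · simp [hoff x hxK]

lemma L2On.inner_const {D : Set (Euc d)} {g : Euc d → Euc d} (hg : L2On D g) (e : Euc d) :
    L2On D (fun x => inner ℝ (g x) e) := fun K hK hKc => by
  have := (hg K hK hKc).const_inner (𝕜 := ℝ) e
  simpa only [real_inner_comm] using this

lemma L2On.smul_const {D : Set (Euc d)} {u : Euc d → ℝ} (hu : L2On D u) (e : Euc d) :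
    L2On D (fun x => u x • e) := fun K hK hKc => by
  have h1 := hu K hK hKc
  refine (h1.const_mul ‖e‖).of_le (h1.1.smul_const e) (.of_forall fun x => ?_)
  rw [norm_smul, norm_mul, norm_norm, mul_comm]

lemma IsTest.memLp {D : Set (Euc d)} {φ : Euc d → ℝ} (h : IsTest D φ) : MemLp φ 2 :=
  h.1.continuous.memLp_of_hasCompactSupport h.2.1

lemma IsTest.memLp_fderiv {D : Set (Euc d)} {φ : Euc d → ℝ} (h : IsTest D φ) (e : Euc d) :
    MemLp (fun x => fderiv ℝ φ x e) 2 := by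
  have h1 := h.1.continuous_fderiv (by simp)
  exact (h1.clm_apply continuous_const).memLp_of_hasCompactSupport (h.2.1.fderiv_apply ℝ e)

lemma IsTest.fderiv_eq_zero {D : Set (Euc d)} {φ : Euc d → ℝ} (_ : IsTest D φ) (e : Euc d)
    {x : Euc d} (hx : x ∉ tsupport φ) : fderiv ℝ φ x e = 0 := by
  rw [fderiv_of_notMem_tsupport ℝ hx]; rfl

/-- The weak gradient is read as div(u e) = ∇u·e for a constant vector e, obtained from the
coordinate directions by linearity. In this form it can be tested with Sobolev and Lipschitz
functions like the equation itself. -/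
lemma HasWeakGrad.weakId {D : Set (Euc d)} (hD : IsOpen D) {u : Euc d → ℝ} {g : Euc d → Euc d}
    (h : HasWeakGrad D u g) (e : Euc d) :
    WeakId D (fun x => u x • e) (fun x => inner ℝ (g x) e) where
  memF := L2On.smul_const h.memLp e
  memH := L2On.inner_const h.memLp_grad e
  eq φ hφ := by
    have hgi : ∀ i, L2On D (fun x => g x i) := fun i => by
      have := L2On.inner_const h.memLp_grad (EuclideanSpace.single i 1)
      simpa [EuclideanSpace.inner_single_right] using this
    have i1 : ∀ i, IntegrableOn (fun x => u x * partialD i φ x) D := fun i =>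
      L2On.integrableOn_mul hD h.memLp (hφ.memLp_fderiv _) hφ.2.2 hφ.2.1
        fun x hx => hφ.fderiv_eq_zero _ hx
    have i2 : ∀ i, IntegrableOn (fun x => g x i * φ x) D := fun i =>
      L2On.integrableOn_mul hD (hgi i) hφ.memLp hφ.2.2 hφ.2.1
        fun x hx => image_eq_zero_of_notMem_tsupport hx
    have he : e = ∑ i, e i • EuclideanSpace.single i (1 : ℝ) := by ext j; simp [Pi.single_apply]
    have e1 : ∀ x, fderiv ℝ φ x (u x • e) + inner ℝ (g x) e * φ x
        = ∑ i, e i * (u x * partialD i φ x + g x i * φ x) := fun x => by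
      have a1 : fderiv ℝ φ x e = ∑ i, e i * partialD i φ x := by
        conv_lhs => rw [he]
        simp [partialD]
      have a2 : inner ℝ (g x) e = ∑ i, e i * g x i := by simp [PiLp.inner_apply]
      rw [map_smul, a1, a2, smul_eq_mul, Finset.mul_sum, Finset.sum_mul, ← Finset.sum_add_distrib]
      exact Finset.sum_congr rfl fun i _ => by ring
    simp only [e1]
    rw [integral_finsetSum]
    · refine Finset.sum_eq_zero fun i _ => ?_
      rw [integral_const_mul, integral_add (i1 i) (i2 i), h.integral_eq φ hφ i]
      ring
    · exact fun i _ => ((i1 i).add (i2 i)).const_mul _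

/-- Cutting off a Sobolev function by a Lipschitz function with compact support. -/
lemma HasWeakGrad.cutoff {D : Set (Euc d)} (hD : IsOpen D) {u : Euc d → ℝ} {g : Euc d → Euc d}
    (h : HasWeakGrad D u g) {θ : Euc d → ℝ} {C : ℝ≥0} (hθ : LipschitzWith C θ)
    (hc : HasCompactSupport θ) (hθD : tsupport θ ⊆ D) :
    CptSob D (fun x => u x * θ x) (fun x => θ x • g x + u x • gradient θ x) := by
  obtain ⟨B, hB⟩ := exists_bound_of_lipschitz hθ hc
  have hK : IsCompact (tsupport θ) := hc
  set K := tsupport θ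
  have off1 : ∀ x ∉ K, θ x = 0 := fun x hx => image_eq_zero_of_notMem_tsupport hx
  have off2 : ∀ x ∉ K, gradient θ x = 0 := fun x hx => gradient_eq_zero_of_notMem hx
  have mu : MemLp (K.indicator u) 2 := L2On.indicator h.memLp hθD hK
  have mg : MemLp (K.indicator g) 2 := L2On.indicator h.memLp_grad hθD hK
  have m1 : MemLp (fun x => u x * θ x) 2 := by
    have : (fun x => u x * θ x) = fun x => K.indicator u x * θ x := by
      funext x; by_cases hx : x ∈ K <;> simp [hx, off1]
    rw [this]
    refine (mu.const_mul (B : ℝ)).of_le (mu.1.mul hθ.continuous.aestronglyMeasurable)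
      (.of_forall fun x => ?_)
    rw [norm_mul, norm_mul, mul_comm]
    gcongr
    simpa using hB x
  have m2 : MemLp (fun x => θ x • g x) 2 := by
    have : (fun x => θ x • g x) = fun x => θ x • K.indicator g x := by
      funext x; by_cases hx : x ∈ K <;> simp [hx, off1]
    rw [this]
    refine (mg.norm.const_mul (B : ℝ)).of_le (hθ.continuous.aestronglyMeasurable.smul mg.1)
      (.of_forall fun x => ?_)
    rw [norm_smul, norm_mul, norm_norm]
    gcongr
    simpa using hB x
  have m3 : MemLp (fun x => u x • gradient θ x) 2 := by
    have : (fun x => u x • gradient θ x) = fun x => K.indicator u x • gradient θ x := by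
      funext x; by_cases hx : x ∈ K <;> simp [hx, off2]
    rw [this]
    refine (mu.const_mul (C : ℝ)).of_le (mu.1.smul (measurable_gradient θ).aestronglyMeasurable)
      (.of_forall fun x => ?_)
    rw [norm_smul, norm_mul, mul_comm]
    gcongr
    simpa using norm_gradient_le hθ x
  refine ⟨⟨K, hθD, hK, fun x hx => by simp [off1 x hx, off2 x hx]⟩, m1, m2.add m3, ?_⟩
  intro ζ hζ hζc e
  obtain ⟨C', hC'⟩ := ContDiff.lipschitzWith_of_hasCompactSupport hζc hζ (by simp)
  obtain ⟨B', hB'⟩ := exists_bound_of_lipschitz hC' hζc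
  -- The product rule for uθ comes from testing div(u e) = ∇u·e with the Lipschitz function θζ;
  -- Rademacher's theorem supplies the pointwise product rule for θζ.
  have hL := (h.weakId hD e).test_lipschitz hD (hθ.mul_of_bounded hC' hB hB')
    hc.mul_right (tsupport_mul_subset_left.trans hθD)
  have hfz : MemLp (fun x => fderiv ℝ ζ x e) 2 :=
    IsTest.memLp_fderiv (D := univ) ⟨hζ, hζc, subset_univ _⟩ e
  have hz : MemLp ζ 2 := IsTest.memLp (D := univ) ⟨hζ, hζc, subset_univ _⟩
  have i1 : Integrable (fun x => u x * θ x * fderiv ℝ ζ x e) := MemLp.integrable_mul m1 hfz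
  have i2 : Integrable (fun x => inner ℝ (θ x • g x + u x • gradient θ x) e * ζ x) := by
    have hc2 : MemLp (fun x => inner ℝ (θ x • g x + u x • gradient θ x) e) 2 := by
      simpa only [real_inner_comm, Pi.add_apply] using (m2.add m3).const_inner (𝕜 := ℝ) e
    exact MemLp.integrable_mul hc2 hz
  have key : ∫ x in D, (fderiv ℝ (fun x => θ x * ζ x) x (u x • e) + inner ℝ (g x) e * (θ x * ζ x))
      = ∫ x, (u x * θ x * fderiv ℝ ζ x e + inner ℝ (θ x • g x + u x • gradient θ x) e * ζ x) := by
    rw [← integral_indicator hD.measurableSet]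
    refine integral_congr_ae ?_
    filter_upwards [hθ.ae_differentiableAt (μ := volume)] with x hx
    by_cases hxD : x ∈ D
    · rw [indicator_of_mem hxD, fderiv_fun_mul hx (hζ.differentiable (by simp) x)]
      simp only [_root_.add_apply, _root_.smul_apply, map_smul, smul_eq_mul, inner_add_left,
        real_inner_smul_left, inner_gradient_left]
      ring
    · have hxK : x ∉ K := fun hh => hxD (hθD hh)
      simp [hxD, off1 x hxK, off2 x hxK]
  rw [key, integral_add i1 i2] at hL
  linarith

/-- Multiplication of a Sobolev function by a bounded Lipschitz function. -/
lemma HasWeakGrad.mul_lipschitz {D : Set (Euc d)} (hD : IsOpen D) {u : Euc d → ℝ}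
    {g : Euc d → Euc d} (h : HasWeakGrad D u g) {w : Euc d → ℝ} {C B : ℝ≥0}
    (hw : LipschitzWith C w) (hB : ∀ x, |w x| ≤ B) :
    HasWeakGrad D (fun x => u x * w x) (fun x => w x • g x + u x • gradient w x) := by
  have m1 : L2On D (fun x => u x * w x) := fun K hK hKc => by
    have hu := h.memLp K hK hKc
    refine (hu.const_mul (B : ℝ)).of_le (hu.1.mul hw.continuous.aestronglyMeasurable)
      (.of_forall fun x => ?_)
    rw [norm_mul, norm_mul, mul_comm]
    gcongr
    simpa using hB x
  have m2 : L2On D (fun x => w x • g x) := fun K hK hKc => by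
    have hg := h.memLp_grad K hK hKc
    refine (hg.norm.const_mul (B : ℝ)).of_le (hw.continuous.aestronglyMeasurable.smul hg.1)
      (.of_forall fun x => ?_)
    rw [norm_smul, norm_mul, norm_norm]
    gcongr
    simpa using hB x
  have m3 : L2On D (fun x => u x • gradient w x) := fun K hK hKc => by
    have hu := h.memLp K hK hKc
    refine (hu.const_mul (C : ℝ)).of_le
      (hu.1.smul (measurable_gradient w).aestronglyMeasurable) (.of_forall fun x => ?_)
    rw [norm_smul, norm_mul, mul_comm]
    gcongr
    simpa using norm_gradient_le hw x
  refine ⟨m1, fun K hK hKc => (m2 K hK hKc).add (m3 K hK hKc), fun φ hφ i => ?_⟩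
  obtain ⟨C', hC'⟩ := ContDiff.lipschitzWith_of_hasCompactSupport hφ.2.1 hφ.1 (by simp)
  obtain ⟨B', hB'⟩ := exists_bound_of_lipschitz hC' hφ.2.1
  set e : Euc d := EuclideanSpace.single i 1
  have hL := (h.weakId hD e).test_lipschitz hD (hw.mul_of_bounded hC' hB hB')
    hφ.2.1.mul_left (tsupport_mul_subset_right.trans hφ.2.2)
  have hgi : L2On D (fun x => (w x • g x + u x • gradient w x) i) := by
    have : L2On D (fun x => w x • g x + u x • gradient w x) :=
      fun K hK hKc => (m2 K hK hKc).add (m3 K hK hKc)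
    have := L2On.inner_const this e
    simpa [e, EuclideanSpace.inner_single_right] using this
  have i1 : IntegrableOn (fun x => u x * w x * partialD i φ x) D :=
    L2On.integrableOn_mul hD m1 (hφ.memLp_fderiv _) hφ.2.2 hφ.2.1 fun x hx => hφ.fderiv_eq_zero _ hx
  have i2 : IntegrableOn (fun x => (w x • g x + u x • gradient w x) i * φ x) D :=
    L2On.integrableOn_mul hD hgi hφ.memLp hφ.2.2 hφ.2.1
      fun x hx => image_eq_zero_of_notMem_tsupport hx
  have key : ∫ x in D, (fderiv ℝ (fun x => w x * φ x) x (u x • e) + inner ℝ (g x) e * (w x * φ x))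
      = ∫ x in D, (u x * w x * partialD i φ x + (w x • g x + u x • gradient w x) i * φ x) := by
    refine integral_congr_ae (ae_restrict_of_ae ?_)
    filter_upwards [hw.ae_differentiableAt (μ := volume)] with x hx
    rw [fderiv_fun_mul hx (hφ.1.differentiable (by simp) x)]
    have e1 : inner ℝ (g x) e = g x i := by simp [e, EuclideanSpace.inner_single_right]
    have e2 : fderiv ℝ w x e = gradient w x i := by
      rw [← inner_gradient_left, EuclideanSpace.inner_single_right]; simp
    have e3 : partialD i φ x = fderiv ℝ φ x e := rfl
    rw [e1, e3]
    simp only [_root_.add_apply, _root_.smul_apply, map_smul, smul_eq_mul, e2, PiLp.add_apply,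
      PiLp.smul_apply]
    ring
  rw [key, integral_add i1 i2] at hL
  linarith

end WeakLip

/-! ### Difference quotients of Sobolev functions -/

section Difference

variable {d : ℕ}

lemma lintegral_sq_le {X : Type*} [MeasurableSpace X] {μ : Measure X} [IsProbabilityMeasure μ]
    {f : X → ℝ≥0∞} (hf : AEMeasurable f μ) : (∫⁻ x, f x ∂μ) ^ 2 ≤ ∫⁻ x, f x ^ 2 ∂μ := by
  have h := ENNReal.lintegral_mul_le_Lp_mul_Lq μ (Real.HolderConjugate.two_two) hf
    (aemeasurable_const (b := (1 : ℝ≥0∞)))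
  simp only [Pi.mul_apply, mul_one, ENNReal.one_rpow, lintegral_const, measure_univ] at h
  calc (∫⁻ x, f x ∂μ) ^ 2 ≤ ((∫⁻ x, f x ^ (2 : ℝ) ∂μ) ^ (1 / 2 : ℝ)) ^ 2 := by gcongr
    _ = ∫⁻ x, f x ^ 2 ∂μ := by
      rw [← ENNReal.rpow_natCast, ← ENNReal.rpow_mul]
      norm_num

instance isProbabilityMeasure_unit : IsProbabilityMeasure (volume.restrict 𝕀) := ⟨by simp⟩

/-- For fixed s this is a translation. It gives joint integrability of (s, x) ↦ f(x + sh), needed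
for Fubini along segments. -/
lemma measurePreserving_shear (h : Euc d) :
    MeasurePreserving (fun p : ℝ × Euc d => (p.1, p.2 + p.1 • h))
      ((volume.restrict 𝕀).prod volume)
      ((volume.restrict 𝕀).prod volume) :=
  (MeasurePreserving.id _).skew_product (g := fun s x => x + s • h) (by fun_prop)
    (.of_forall fun s => (measurePreserving_add_right volume (s • h)).map_eq)

lemma hasDerivAt_comp_sub_smul {φ : Euc d → ℝ} {x h : Euc d} {s : ℝ}
    (hφ : DifferentiableAt ℝ φ (x - s • h)) :
    HasDerivAt (fun s : ℝ => φ (x - s • h)) (-fderiv ℝ φ (x - s • h) h) s := by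
  have h1 : HasDerivAt (fun s : ℝ => x - s • h) (-((1 : ℝ) • h)) s :=
    ((hasDerivAt_id s).smul_const h).const_sub x
  simpa [Function.comp_def] using hφ.hasFDerivAt.comp_hasDerivAt s h1

lemma IsTest.translate {D : Set (Euc d)} {φ : Euc d → ℝ} (hφ : IsTest D φ) {y : Euc d}
    (hy : ∀ x ∈ D, x + y ∈ D) : IsTest D (fun x => φ (x - y)) := by
  have hts : tsupport (fun x => φ (x - y)) ⊆ (fun x => x + y) '' tsupport φ := by
    refine closure_minimal (fun x hx => ⟨x - y, subset_tsupport _ hx, by simp⟩) ?_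
    exact (hφ.2.1.image (by fun_prop : Continuous fun x : Euc d => x + y)).isClosed
  refine ⟨hφ.1.comp (contDiff_id.sub contDiff_const),
    hφ.2.1.comp_homeomorph (Homeomorph.subRight y), hts.trans ?_⟩
  rintro _ ⟨x, hx, rfl⟩
  exact hy x (hφ.2.2 hx)

/-- The fundamental theorem of calculus along a segment, for Sobolev functions. -/
lemma HasWeakGrad.ae_sub_eq {D : Set (Euc d)} (hD : IsOpen D) {v : Euc d → ℝ} {q : Euc d → Euc d}
    (hv : HasWeakGrad D v q) {h : Euc d}
    (hseg : ∀ x ∈ D, ∀ s ∈ 𝕀, x + s • h ∈ D) :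
    ∀ᵐ x, x ∈ D → v (x + h) - v x = ∫ s in 𝕀, inner ℝ (q (x + s • h)) h := by
  -- for a compact `K ⊆ D`, the union of the segments starting in `K`
  have hull : ∀ K ⊆ D, IsCompact K → ∃ K' ⊆ D, IsCompact K' ∧ K ⊆ K' ∧
      ∀ x ∈ K, ∀ s ∈ 𝕀, x + s • h ∈ K' := by
    intro K hK hKc
    refine ⟨(fun p : Euc d × ℝ => p.1 + p.2 • h) '' (K ×ˢ 𝕀), ?_,
      (hKc.prod isCompact_Icc).image (by fun_prop), ?_, ?_⟩
    · rintro _ ⟨⟨x, s⟩, ⟨hx, hs⟩, rfl⟩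
      exact hseg x (hK hx) s hs
    · exact fun x hx => ⟨(x, 0), ⟨hx, by simp⟩, by simp⟩
    · exact fun x hx s hs => ⟨(x, s), ⟨hx, hs⟩, rfl⟩
  have i1 : ∀ {E : Type} [NormedAddCommGroup E] {k : Euc d → E}, L2On D k →
      ∀ K ⊆ D, IsCompact K → Integrable (K.indicator k) := fun {E} _ {k} hk K hK hKc => by
    have : IsFiniteMeasure (volume.restrict K) := ⟨by simpa using hKc.measure_lt_top⟩
    rw [integrable_indicator_iff hKc.measurableSet]
    exact (hk K hK hKc).integrable (by norm_num)
  have i2 : ∀ K ⊆ D, IsCompact K → Integrable (fun x => inner ℝ (K.indicator q x) h) :=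
    fun K hK hKc => (i1 hv.memLp_grad K hK hKc).inner_const h
  have i3 : ∀ K ⊆ D, IsCompact K → Integrable (fun p : ℝ × Euc d =>
      inner ℝ (K.indicator q (p.2 + p.1 • h)) h) ((volume.restrict 𝕀).prod volume) := fun K hK hKc => by
    have h1 := (i2 K hK hKc).comp_snd (volume.restrict 𝕀)
    exact ((measurePreserving_shear h).integrable_comp h1.aestronglyMeasurable).2 h1
  -- The defect in the fundamental theorem of calculus. It is locally integrable, and it vanishes
  -- once its integral against every test function does.
  set f : Euc d → ℝ := fun x => v (x + h) - v x - ∫ s in 𝕀, inner ℝ (q (x + s • h)) h with hf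
  have hfK : ∀ K ⊆ D, ∀ K' : Set (Euc d), K ⊆ K' → (∀ x ∈ K, ∀ s ∈ 𝕀, x + s • h ∈ K') →
      ∀ x ∈ K, f x = K'.indicator v (x + h) - K'.indicator v x
        - ∫ s in 𝕀, inner ℝ (K'.indicator q (x + s • h)) h := by
    intro K _ K' hKK' hK' x hx
    have h1 := hK' x hx 1 (by simp)
    rw [one_smul] at h1
    have h2 : ∫ s in 𝕀, inner ℝ (q (x + s • h)) h
        = ∫ s in 𝕀, inner ℝ (K'.indicator q (x + s • h)) h := by
      refine setIntegral_congr_fun (measurableSet_Icc (a := (0 : ℝ)) (b := 1)) fun s hs => ?_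
      simp only [indicator_of_mem (hK' x hx s hs)]
    simp only [hf, indicator_of_mem h1, indicator_of_mem (hKK' hx), h2]
  have hloc : LocallyIntegrableOn f D := by
    rw [locallyIntegrableOn_iff hD.isLocallyClosed]
    intro K hK hKc
    obtain ⟨K', hK'D, hK'c, hKK', hK'⟩ := hull K hK hKc
    have : Integrable (fun x => K'.indicator v (x + h) - K'.indicator v x
        - ∫ s in 𝕀, inner ℝ (K'.indicator q (x + s • h)) h) :=
      (((i1 hv.memLp K' hK'D hK'c).comp_add_right h).sub (i1 hv.memLp K' hK'D hK'c)).sub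
        (i3 K' hK'D hK'c).integral_prod_right
    exact this.integrableOn.congr_fun (fun x hx => (hfK K hK K' hKK' hK' x hx).symm)
      hKc.measurableSet
  have main : ∀ᵐ x, x ∈ D → f x = 0 := by
    refine hD.ae_eq_zero_of_integral_contDiff_smul_eq_zero hloc fun φ hφ hφc hφD => ?_
    obtain ⟨K', hK'D, hK'c, hKK', hK'⟩ := hull _ hφD hφc
    set v' := K'.indicator v
    set q' := K'.indicator q
    have hφ0 := hφ.continuous
    have hφ1 : ContDiff ℝ 1 φ := hφ.of_le (by exact_mod_cast le_top)
    have hfc : Continuous (fderiv ℝ φ) := hφ1.continuous_fderiv one_ne_zero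
    have off : ∀ x ∉ tsupport φ, φ x = 0 := fun x hx => image_eq_zero_of_notMem_tsupport hx
    obtain ⟨B, hB⟩ := hφc.exists_bound_of_continuous hφ.continuous
    obtain ⟨B', hB'⟩ := (hφc.fderiv ℝ).exists_bound_of_continuous hfc
    have hB'h : ∀ x, ‖fderiv ℝ φ x h‖ ≤ B' * ‖h‖ := fun x =>
      (ContinuousLinearMap.le_opNorm _ _).trans (by gcongr; exact hB' _)
    have jv := i1 hv.memLp K' hK'D hK'c
    have jq := i3 K' hK'D hK'c
    -- The weak derivative is tested with φ translated by sh; the segment condition keeps the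
    -- translated support in D.
    have hweak : ∀ s ∈ 𝕀, ∫ x, v' x * fderiv ℝ φ (x - s • h) h
        = - ∫ x, inner ℝ (q' (x + s • h)) h * φ x := fun s hs => by
      have h1 := (hv.weakId hD h).eq _ (IsTest.translate ⟨hφ, hφc, hφD⟩ fun x hx => hseg x hx s hs)
      have e1 : ∀ x, fderiv ℝ (fun x => φ (x - s • h)) x = fderiv ℝ φ (x - s • h) := fun x =>
        fderiv_comp_sub (f := φ) (s • h)
      have e2 : ∫ x in D, (fderiv ℝ (fun x => φ (x - s • h)) x (v x • h)
            + inner ℝ (q x) h * φ (x - s • h))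
          = ∫ x, (v' x * fderiv ℝ φ (x - s • h) h + inner ℝ (q' x) h * φ (x - s • h)) := by
        rw [← integral_indicator hD.measurableSet]
        refine integral_congr_ae (.of_forall fun x => ?_)
        simp only [e1]
        by_cases hx : x - s • h ∈ tsupport φ
        · have hx' : x ∈ K' := by simpa using hK' _ hx s hs
          simp [v', q', hx', hK'D hx']
        · simp [off _ hx, fderiv_of_notMem_tsupport ℝ hx, indicator]
      have j1 : Integrable (fun x => v' x * fderiv ℝ φ (x - s • h) h) :=
        jv.mul_bdd (Continuous.aestronglyMeasurable (by fun_prop)) (.of_forall fun _ => hB'h _)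
      have j2 : Integrable (fun x => inner ℝ (q' x) h * φ (x - s • h)) :=
        (i2 K' hK'D hK'c).mul_bdd (Continuous.aestronglyMeasurable (by fun_prop))
          (.of_forall fun _ => hB _)
      rw [e2, integral_add j1 j2] at h1
      rw [← integral_add_right_eq_self (fun x => inner ℝ (q' x) h * φ (x - s • h)) (s • h)] at h1
      simp only [add_sub_cancel_right] at h1
      linarith
    have ftc : ∀ x, φ (x - h) - φ x = ∫ s in 𝕀, -fderiv ℝ φ (x - s • h) h := fun x => by
      rw [integral_Icc_eq_integral_Ioc, ← intervalIntegral.integral_of_le zero_le_one]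
      have hder : ∀ s ∈ uIcc (0 : ℝ) 1,
          HasDerivAt (fun s : ℝ => φ (x - s • h)) (-fderiv ℝ φ (x - s • h) h) s := fun s _ =>
        hasDerivAt_comp_sub_smul (hφ1.differentiable one_ne_zero _)
      rw [intervalIntegral.integral_eq_sub_of_hasDerivAt hder
        (Continuous.intervalIntegrable (by fun_prop) _ _)]
      simp
    have jA : Integrable (Function.uncurry fun (x : Euc d) (s : ℝ) => v' x * -fderiv ℝ φ (x - s • h) h)
        (volume.prod (volume.restrict 𝕀)) :=
      (jv.comp_fst _).mul_bdd (Continuous.aestronglyMeasurable (by fun_prop))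
        (.of_forall fun _ => (norm_neg _).trans_le (hB'h _))
    have jB : Integrable (Function.uncurry fun (s : ℝ) (x : Euc d) =>
        inner ℝ (q' (x + s • h)) h * φ x) ((volume.restrict 𝕀).prod volume) :=
      jq.mul_bdd (Continuous.aestronglyMeasurable (by fun_prop)) (.of_forall fun _ => hB _)
    have hbd : ∀ {F : Euc d → ℝ}, Integrable F → ∀ y, Integrable (fun x => φ (x - y) * F x) :=
      fun hF y => hF.bdd_mul (Continuous.aestronglyMeasurable (by fun_prop)) (.of_forall fun _ => hB _)
    have c1 : ∫ x, φ x * v' (x + h) = ∫ x, φ (x - h) * v' x := by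
      rw [← integral_add_right_eq_self (fun x => φ (x - h) * v' x) h]
      simp
    -- The classical fundamental theorem is applied to φ, not to v; Fubini and the weak derivative
    -- then carry it over to v.
    have c2 : ∫ x, v' x * (φ (x - h) - φ x) = ∫ x, φ x * ∫ s in 𝕀, inner ℝ (q' (x + s • h)) h := by
      calc ∫ x, v' x * (φ (x - h) - φ x)
          = ∫ x, ∫ s in 𝕀, v' x * -fderiv ℝ φ (x - s • h) h := by
            refine integral_congr_ae (.of_forall fun x => ?_)
            simp only [ftc x, integral_const_mul]
        _ = ∫ s in 𝕀, ∫ x, v' x * -fderiv ℝ φ (x - s • h) h :=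
            integral_integral_swap jA
        _ = ∫ s in 𝕀, ∫ x, inner ℝ (q' (x + s • h)) h * φ x := by
            refine setIntegral_congr_fun measurableSet_Icc fun s hs => ?_
            simp only [mul_neg, integral_neg, hweak s hs, neg_neg]
        _ = ∫ x, ∫ s in 𝕀, inner ℝ (q' (x + s • h)) h * φ x :=
            integral_integral_swap jB
        _ = _ := by
            refine integral_congr_ae (.of_forall fun x => ?_)
            simp only [integral_mul_const]
            rw [mul_comm]
    have k1 : Integrable (fun x => φ x * v' (x + h)) := by simpa using hbd (jv.comp_add_right h) 0
    have k2 : Integrable (fun x => φ x * v' x) := by simpa using hbd jv 0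
    have k3 : Integrable (fun x => φ x * ∫ s in 𝕀, inner ℝ (q' (x + s • h)) h) := by
      simpa using hbd jq.integral_prod_right 0
    have k4 := hbd jv h
    have c0 : ∫ x, φ x • f x = ∫ x, (φ x * v' (x + h) - φ x * v' x
        - φ x * ∫ s in 𝕀, inner ℝ (q' (x + s • h)) h) := by
      refine integral_congr_ae (.of_forall fun x => ?_)
      by_cases hx : x ∈ tsupport φ
      · simp only [hfK _ hφD K' hKK' hK' x hx, smul_eq_mul, v', q']; ring
      · simp [off x hx]
    have c3 : ∫ x, v' x * (φ (x - h) - φ x) = (∫ x, φ (x - h) * v' x) - ∫ x, φ x * v' x := by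
      rw [← integral_sub k4 k2]
      refine integral_congr_ae (.of_forall fun x => ?_)
      simp only; ring
    rw [c0, integral_sub (by exact k1.sub k2) k3, integral_sub k1 k2, c1, ← c3, c2, sub_self]
  filter_upwards [main] with x hx hxD
  exact sub_eq_zero.1 (hx hxD)

lemma enorm_integral_inner_sq_le {f : ℝ → Euc d} (hf : Measurable f) (e : Euc d) :
    ‖∫ s in 𝕀, inner ℝ (f s) e‖ₑ ^ 2 ≤ ‖e‖ₑ ^ 2 * ∫⁻ s in 𝕀, ‖f s‖ₑ ^ 2 := by
  calc _ ≤ (∫⁻ s in 𝕀, ‖inner ℝ (f s) e‖ₑ) ^ 2 := by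
        gcongr; exact enorm_integral_le_lintegral_enorm _
    _ ≤ (∫⁻ s in 𝕀, ‖f s‖ₑ * ‖e‖ₑ) ^ 2 := by
        gcongr with s
        rw [← ofReal_norm, ← ofReal_norm, ← ofReal_norm, ← ofReal_mul (norm_nonneg _)]
        exact ofReal_le_ofReal (norm_inner_le_norm (𝕜 := ℝ) _ _)
    _ = ‖e‖ₑ ^ 2 * (∫⁻ s in 𝕀, ‖f s‖ₑ) ^ 2 := by
        rw [lintegral_mul_const _ hf.enorm, mul_pow, mul_comm]
    _ ≤ _ := by gcongr; exact lintegral_sq_le hf.enorm.aemeasurable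

/-- The squared difference quotient is controlled by the average of the squared gradient. -/
lemma HasWeakGrad.ae_enorm_sub_sq_le {D : Set (Euc d)} (hD : IsOpen D) {v : Euc d → ℝ}
    {q : Euc d → Euc d} (hq : Measurable q) (hv : HasWeakGrad D v q) {h : Euc d}
    (hseg : ∀ x ∈ D, ∀ s ∈ 𝕀, x + s • h ∈ D) :
    ∀ᵐ x, x ∈ D → ‖v (x + h) - v x‖ₑ ^ 2 ≤ ‖h‖ₑ ^ 2 * ∫⁻ s in 𝕀, ‖q (x + s • h)‖ₑ ^ 2 := by
  filter_upwards [hv.ae_sub_eq hD hseg] with x hx hxD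
  rw [hx hxD]
  exact enorm_integral_inner_sq_le (by fun_prop) h

end Difference

/-! ### The Fefferman–Phong inequality on a graph domain -/

section FeffermanPhong

variable {n : ℕ}

lemma enorm_add_sq_le {E : Type*} [SeminormedAddCommGroup E] (a b : E) :
    ‖a + b‖ₑ ^ 2 ≤ 2 * ‖a‖ₑ ^ 2 + 2 * ‖b‖ₑ ^ 2 := by
  have h : ‖a + b‖₊ ^ 2 ≤ 2 * ‖a‖₊ ^ 2 + 2 * ‖b‖₊ ^ 2 := by
    rw [← NNReal.coe_le_coe]
    push_cast
    have h1 := norm_add_le a b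
    nlinarith [sq_nonneg (‖a‖ - ‖b‖), norm_nonneg (a + b)]
  rw [enorm_eq_nnnorm, enorm_eq_nnnorm, enorm_eq_nnnorm]
  exact_mod_cast h

lemma enorm_sub_sq_le {E : Type*} [SeminormedAddCommGroup E] (a b : E) :
    ‖a - b‖ₑ ^ 2 ≤ 2 * ‖a‖ₑ ^ 2 + 2 * ‖b‖ₑ ^ 2 := by
  simpa [sub_eq_add_neg] using enorm_add_sq_le a (-b)

/-- Admissible displacements: vectors of the upward cone which are short at scale `ρ(x)`. -/
def dispSet (τ : ℝ) (M : ℝ≥0) (ρ : Pt n → ℝ) : Set (Pt n × Pt n) :=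
  {p | M * ‖horiz p.1‖ < τ * height p.1} ∩ {p | ‖p.1‖ < ρ p.2 / 2}

/-- The weight `ρ(x)^{-d}` on the admissible displacements. -/
def dispWt (τ : ℝ) (M : ℝ≥0) (ρ : Pt n → ℝ) : Pt n × Pt n → ℝ≥0∞ :=
  (dispSet τ M ρ).indicator fun p => ofReal ((ρ p.2 ^ (n + 1))⁻¹)

lemma measurable_dispWt (τ : ℝ) (M : ℝ≥0) {ρ : Pt n → ℝ} (hρ : Measurable ρ) :
    Measurable (dispWt τ M ρ) :=
  Measurable.indicator (by fun_prop) ((measurableSet_lt (by fun_prop) (by fun_prop)).inter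
    (measurableSet_lt (by fun_prop) (by fun_prop)))

variable {τ : ℝ} {M : ℝ≥0} {Ψ : Euc n → ℝ} {ρ : Pt n → ℝ}

lemma lipschitz_one_le {x y : Pt n} (hlip : LipschitzWith 1 ρ) : ρ x ≤ ρ y + ‖x - y‖ := by
  have := hlip.dist_le_mul x y
  rw [NNReal.coe_one, one_mul, Real.dist_eq, dist_eq_norm] at this
  linarith [(abs_le.1 this).2]

lemma seg_mem_graphDom (hτ : IsSgn τ) (hΨ : LipschitzWith M Ψ) {h : Pt n}
    (hh : M * ‖horiz h‖ ≤ τ * height h) {x : Pt n} (hx : x ∈ graphDom τ Ψ) {s : ℝ}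
    (hs : 0 ≤ s) : x + s • h ∈ graphDom τ Ψ := by
  refine lt_of_lt_of_le hx (depth_add_of_mem_cone hτ hΨ ?_ x)
  rw [horiz_smul, height_smul, norm_smul, norm_of_nonneg hs]
  nlinarith

/-- Substitute z = x + sh, which stays in the domain since h lies in the upward cone. As ρ is
1-Lipschitz and |h| < ρ(x)/2, one has ρ(z) ≤ 2ρ(x) and |h| < ρ(z); the weight ρ^{-d} is therefore
normalized by the volume of the ball of radius ρ(z). -/
lemma average_translate_le (hτ : IsSgn τ) (hΨ : LipschitzWith M Ψ)
    (hlip : LipschitzWith 1 ρ) (hpos : ∀ x, 0 < ρ x) {Φ : Pt n → ℝ≥0∞} (hΦ : Measurable Φ)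
    {s : ℝ} (hs : s ∈ 𝕀) :
    ∫⁻ h, ∫⁻ x in graphDom τ Ψ, dispWt τ M ρ (h, x) * Φ (x + s • h)
      ≤ ofReal (2 ^ (n + 1) * unitVol (n + 1)) * ∫⁻ x in graphDom τ Ψ, Φ x := by
  set D := graphDom τ Ψ
  have hDm : MeasurableSet D := measurableSet_graphDom hΨ
  have hρm : Measurable ρ := hlip.continuous.measurable
  set T : Set (Pt n × Pt n) := {p | ‖p.1‖ < ρ p.2} ∩ {p | p.2 ∈ D} with hT
  set k : Pt n → Pt n → ℝ≥0∞ := fun h z => T.indicator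
    (fun p => ofReal (2 ^ (n + 1) * (ρ p.2 ^ (n + 1))⁻¹) * Φ p.2) (h, z) with hk
  have hkm : Measurable (Function.uncurry k) := Measurable.indicator (by fun_prop)
    ((measurableSet_lt (by fun_prop) (by fun_prop)).inter (measurable_snd hDm))
  have step1 : ∀ h, ∫⁻ x in D, dispWt τ M ρ (h, x) * Φ (x + s • h) ≤ ∫⁻ z, k h z := fun h => by
    rw [← lintegral_indicator hDm, ← lintegral_add_right_eq_self (fun z => k h z) (s • h)]
    refine lintegral_mono fun x => ?_
    by_cases hx : x ∈ D
    swap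
    · simp [hx]
    by_cases hh : (h, x) ∈ dispSet τ M ρ
    swap
    · simp [dispWt, hh, hx]
    rw [indicator_of_mem hx, dispWt, indicator_of_mem hh]
    have hxs : x + s • h ∈ D := seg_mem_graphDom hτ hΨ hh.1.le hx hs.1
    have hsh : ‖s • h‖ ≤ ‖h‖ := by
      rw [norm_smul, norm_of_nonneg hs.1]
      exact mul_le_of_le_one_left (norm_nonneg _) hs.2
    have h2 : ‖h‖ < ρ x / 2 := hh.2
    have h3 : ρ x ≤ ρ (x + s • h) + ‖s • h‖ := by
      simpa using lipschitz_one_le (x := x) (y := x + s • h) hlip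
    have h4 : ρ (x + s • h) ≤ ρ x + ‖s • h‖ := by
      simpa using lipschitz_one_le (x := x + s • h) (y := x) hlip
    have h5 : ‖h‖ < ρ (x + s • h) := by linarith
    simp only [hk, indicator_of_mem (show (h, x + s • h) ∈ T from ⟨h5, hxs⟩)]
    gcongr
    have h6 := hpos x
    have h7 := hpos (x + s • h)
    have h8 : ρ (x + s • h) ^ (n + 1) ≤ 2 ^ (n + 1) * ρ x ^ (n + 1) := by
      rw [← mul_pow]; gcongr; linarith
    rw [inv_le_iff_one_le_mul₀ (by positivity), mul_right_comm, ← div_eq_mul_inv,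
      one_le_div (by positivity)]
    exact h8
  calc _ ≤ ∫⁻ h, ∫⁻ z, k h z := lintegral_mono step1
    _ = ∫⁻ z, ∫⁻ h, k h z := lintegral_lintegral_swap hkm.aemeasurable
    _ = ∫⁻ z in D, ofReal (2 ^ (n + 1) * unitVol (n + 1)) * Φ z := by
        rw [← lintegral_indicator hDm]
        refine lintegral_congr fun z => ?_
        by_cases hz : z ∈ D
        swap
        · simp [hk, hT, hz]
        have hball : ∀ h, k h z = (ball (0 : Pt n) (ρ z)).indicator
            (fun _ => ofReal (2 ^ (n + 1) * (ρ z ^ (n + 1))⁻¹) * Φ z) h := fun h => by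
          simp [hk, hT, indicator, hz]
        simp only [indicator_of_mem hz]
        rw [lintegral_congr hball, lintegral_indicator measurableSet_ball, setLIntegral_const,
          volume_ball_eq 0 (hpos z), mul_right_comm, ← ofReal_mul (by have := hpos z; positivity)]
        congr 2
        have := (hpos z).ne'
        field_simp
    _ = _ := lintegral_const_mul _ hΦ

-- The value v(x) is compared with v(x + h) for h in the upward cone with |h| < ρ(x)/2, and the
-- comparison is integrated against ρ(x)^{-d}V(x + h) dh. This weight has total mass at least
-- cρ(x)^{-2} by `exists_mass_lower`. The difference costs |h|² times the squared gradient averaged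
-- over the segment, and V(x + h)|h|² ≤ 1. All displacements stay in the domain, so nothing is asked
-- of v at the boundary.
set_option maxHeartbeats 400000 in
lemma exists_feffermanPhong (n : ℕ) (M : ℝ≥0) (K : ℝ) (hK : 1 ≤ K) : ∃ C : ℝ, 0 < C ∧
    ∀ (τ : ℝ), IsSgn τ → ∀ (Ψ : Euc n → ℝ), LipschitzWith M Ψ →
    ∀ (V : Pt n → ℝ), IsBInfty K V → Measurable V →
    ∀ (v : Pt n → ℝ) (q : Pt n → Pt n), Measurable v → Measurable q →
      HasWeakGrad (graphDom τ Ψ) v q →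
      ∫⁻ x in graphDom τ Ψ, ofReal ((critRad V 1 x ^ 2)⁻¹) * ‖v x‖ₑ ^ 2
        ≤ ofReal C * ((∫⁻ x in graphDom τ Ψ, ‖q x‖ₑ ^ 2)
          + ∫⁻ x in graphDom τ Ψ, ofReal (V x) * ‖v x‖ₑ ^ 2) := by
  -- With a(1 + M) = 1/8, the ball of radius aρ(x) about x + (ρ(x)/4)e consists of points whose
  -- displacement from x is in the open upward cone and shorter than ρ(x)/2.
  set a : ℝ := 1 / (8 * (1 + M)) with ha
  have hM0 : (0 : ℝ) ≤ M := M.2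
  have ha0 : 0 < a := by positivity
  have ha1 : a * (1 + M) = 1 / 8 := by rw [ha]; field_simp
  obtain ⟨c, hc, hmass⟩ := exists_mass_lower (n + 1) (by omega) K hK a ha0
  set Cv := 2 ^ (n + 1) * unitVol (n + 1) with hCv
  have hCv0 : 0 < Cv := mul_pos (by positivity) (unitVol_pos _)
  refine ⟨2 * Cv / c, by positivity, ?_⟩
  intro τ hτ Ψ hΨ V hV hVm v q hvm hqm hv
  set D := graphDom τ Ψ
  have hDm : MeasurableSet D := measurableSet_graphDom hΨ
  set ρ := critRad V 1 with hρdef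
  have hlip : LipschitzWith 1 ρ := hV.lipschitz_critRad one_pos
  have hpos : ∀ x, 0 < ρ x := hV.critRad_pos one_pos
  have hρm : Measurable ρ := hlip.continuous.measurable
  set W := dispWt τ M ρ with hW
  have hWm : Measurable W := measurable_dispWt τ M hρm
  set k1 : Pt n → Pt n → ℝ≥0∞ := fun h x => W (h, x) * (ofReal (V (x + h)) * ‖v x‖ₑ ^ 2) with hk1
  have low : ∀ x, ofReal c * (ofReal ((ρ x ^ 2)⁻¹) * ‖v x‖ₑ ^ 2) ≤ ∫⁻ h, k1 h x := fun x => by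
    have hx := hpos x
    set y : Pt n := x + (ρ x / 4) • vert n τ
    have hyx : y - x = (ρ x / 4) • vert n τ := by simp [y]
    have hnorm : ‖y - x‖ = ρ x / 4 := by
      rw [hyx, norm_smul, norm_vert hτ, mul_one, norm_of_nonneg (by positivity)]
    have hsub : ball y (a * ρ x) ⊆ {z | (z - x, x) ∈ dispSet τ M ρ} := fun z hz => by
      rw [mem_ball, dist_eq_norm] at hz
      have e : z - x = (z - y) + (ρ x / 4) • vert n τ := by rw [← hyx]; abel
      have h1 := norm_horiz_le (z - y)
      have h2 : -‖z - y‖ ≤ τ * height (z - y) := by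
        have := abs_height_le (z - y)
        have h3 : |τ * height (z - y)| ≤ ‖z - y‖ := by rwa [abs_mul, abs_unit hτ, one_mul]
        exact (abs_le.1 h3).1
      have h4 : a * ρ x ≤ ρ x / 8 := by nlinarith
      refine ⟨?_, ?_⟩
      · simp only [e, mem_ofPred_eq, horiz_add, horiz_smul, horiz_vert, smul_zero, add_zero, height_add,
          height_smul, height_vert, mul_add]
        have h5 : τ * (ρ x / 4 * τ) = ρ x / 4 := by
          rw [mul_comm (ρ x / 4), ← mul_assoc, unit_mul_self hτ, one_mul]
        rw [h5]
        have h6 : (M : ℝ) * ‖horiz (z - y)‖ ≤ M * (a * ρ x) := by gcongr; linarith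
        nlinarith
      · simp only [e, ← hyx, mem_ofPred_eq]
        have := norm_add_le (z - y) (y - x)
        linarith
    have hxy : dist x y ≤ ρ x := by rw [dist_comm, dist_eq_norm, hnorm]; linarith
    have h1 := hmass V hV x y hxy
    have hint : ofReal ((ρ x ^ (n + 1))⁻¹) * ofReal (ballInt V y (a * ρ x))
        ≤ ∫⁻ h, W (h, x) * ofReal (V (x + h)) := by
      rw [ballInt, ofReal_integral_eq_lintegral_ofReal (hV.integrableOn y _)
        (ae_restrict_of_ae hV.nonneg_ae), ← lintegral_const_mul _ (by fun_prop),
        ← lintegral_indicator measurableSet_ball,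
        ← lintegral_sub_right_eq_self (fun h => W (h, x) * ofReal (V (x + h))) x]
      refine lintegral_mono fun z => ?_
      by_cases hz : z ∈ ball y (a * ρ x)
      · simp [hW, dispWt, hz, show (z - x, x) ∈ dispSet τ M ρ from hsub hz]
      · simp [hz]
    simp only [hk1, ← mul_assoc]
    rw [lintegral_mul_const _ (by fun_prop)]
    gcongr
    refine le_trans ?_ hint
    rw [← ofReal_mul hc.le, ← ofReal_mul (by positivity)]
    refine ofReal_le_ofReal ?_
    rw [← div_eq_mul_inv, div_le_iff₀ (by positivity), mul_assoc, mul_comm _ (ρ x ^ 2),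
      ← div_eq_inv_mul, le_div_iff₀ (by positivity)]
    exact h1
  set k3 : Pt n → Pt n → ℝ≥0∞ := fun h x =>
    W (h, x) * (ofReal (V (x + (1 : ℝ) • h)) * ‖v (x + (1 : ℝ) • h)‖ₑ ^ 2) with hk3
  set k2 : ℝ → Pt n → Pt n → ℝ≥0∞ := fun s h x => W (h, x) * ‖q (x + s • h)‖ₑ ^ 2
  have hk2x : ∀ h x, ∫⁻ s in 𝕀, k2 s h x = W (h, x) * ∫⁻ s in 𝕀, ‖q (x + s • h)‖ₑ ^ 2 :=
    fun h x => lintegral_const_mul _ (by fun_prop)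
  have up : ∀ h, ∫⁻ x in D, k1 h x
      ≤ 2 * (∫⁻ x in D, ∫⁻ s in 𝕀, k2 s h x) + 2 * ∫⁻ x in D, k3 h x := fun h => by
    by_cases hcone : M * ‖horiz h‖ < τ * height h
    swap
    · have : ∀ x, k1 h x = 0 := fun x => by
        simp [hk1, hW, dispWt, show (h, x) ∉ dispSet τ M ρ from fun hh => hcone hh.1]
      simp [this]
    have hACL := hv.ae_enorm_sub_sq_le (isOpen_graphDom hΨ) hqm (h := h)
      fun x hx s hs => seg_mem_graphDom hτ hΨ hcone.le hx hs.1
    have hVae : ∀ᵐ x, V (x + h) * ρ (x + h) ^ 2 ≤ 1 :=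
      (measurePreserving_add_right volume h).quasiMeasurePreserving.ae hV.ae_le_critRad
    have hk2h : Measurable (fun x => ∫⁻ s in 𝕀, k2 s h x) :=
      Measurable.lintegral_prod_right' (f := fun p : Pt n × ℝ => k2 p.2 h p.1) (by fun_prop)
    rw [← lintegral_const_mul _ hk2h, ← lintegral_const_mul' 2 _ (by norm_num),
      ← lintegral_add_right _ (by fun_prop)]
    refine lintegral_mono_ae ((ae_restrict_iff' hDm).2 ?_)
    filter_upwards [hACL, hVae] with x hx hVx hxD
    by_cases hh : (h, x) ∈ dispSet τ M ρ
    swap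
    · simp [hk1, hW, dispWt, hh]
    have hh2 : ‖h‖ < ρ x / 2 := hh.2
    have hx0 := hpos x
    have h3 : ρ x ≤ ρ (x + h) + ‖h‖ := by simpa using lipschitz_one_le (x := x) (y := x + h) hlip
    -- From |h| < ρ(x)/2 and the Lipschitz bound, |h| ≤ ρ(x + h), while Vρ² ≤ 1 almost everywhere.
    have hcoef : ofReal (V (x + h)) * ‖h‖ₑ ^ 2 ≤ 1 := by
      rw [← ofReal_norm, ← ofReal_pow (norm_nonneg _), ← ofReal_mul' (by positivity), ← ofReal_one]
      refine ofReal_le_ofReal ?_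
      rcases le_or_gt (V (x + h)) 0 with hneg | hposV
      · nlinarith [sq_nonneg ‖h‖]
      · refine le_trans ?_ hVx
        gcongr
        linarith
    have hsq : ‖v x‖ₑ ^ 2 ≤ 2 * ‖v (x + h) - v x‖ₑ ^ 2 + 2 * ‖v (x + h)‖ₑ ^ 2 := by
      have := enorm_sub_sq_le (v (x + h)) (v (x + h) - v x)
      rwa [sub_sub_cancel, add_comm] at this
    simp only [hk2x, hk1, hk3, one_smul]
    set r := W (h, x)
    set U := ofReal (V (x + h))
    set I := ∫⁻ s in 𝕀, ‖q (x + s • h)‖ₑ ^ 2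
    calc r * (U * ‖v x‖ₑ ^ 2) ≤ r * (U * (2 * (‖h‖ₑ ^ 2 * I) + 2 * ‖v (x + h)‖ₑ ^ 2)) := by
          gcongr; exact hsq.trans (by gcongr; exact hx hxD)
      _ = 2 * (r * ((U * ‖h‖ₑ ^ 2) * I)) + 2 * (r * (U * ‖v (x + h)‖ₑ ^ 2)) := by ring
      _ ≤ 2 * (r * (1 * I)) + 2 * (r * (U * ‖v (x + h)‖ₑ ^ 2)) := by gcongr
      _ = _ := by rw [one_mul]
  have b2 : ∫⁻ h, ∫⁻ x in D, ∫⁻ s in 𝕀, k2 s h x ≤ ofReal Cv * ∫⁻ x in D, ‖q x‖ₑ ^ 2 := by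
    calc ∫⁻ h, ∫⁻ x in D, ∫⁻ s in 𝕀, k2 s h x
        = ∫⁻ h, ∫⁻ s in 𝕀, ∫⁻ x in D, k2 s h x := by
          refine lintegral_congr fun h => lintegral_lintegral_swap (Measurable.aemeasurable ?_)
          fun_prop
      _ = ∫⁻ s in 𝕀, ∫⁻ h, ∫⁻ x in D, k2 s h x := by
          refine lintegral_lintegral_swap ?_
          refine (Measurable.lintegral_prod_right'
            (f := fun p : (Pt n × ℝ) × Pt n => k2 p.1.2 p.1.1 p.2) (by fun_prop)).aemeasurable
      _ ≤ ∫⁻ _ in 𝕀, ofReal Cv * ∫⁻ x in D, ‖q x‖ₑ ^ 2 := by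
          refine setLIntegral_mono measurable_const fun s hs => ?_
          exact average_translate_le hτ hΨ hlip hpos (Φ := fun x => ‖q x‖ₑ ^ 2) (by fun_prop) hs
      _ = _ := by simp
  have b3 : ∫⁻ h, ∫⁻ x in D, k3 h x ≤ ofReal Cv * ∫⁻ x in D, ofReal (V x) * ‖v x‖ₑ ^ 2 :=
    average_translate_le hτ hΨ hlip hpos (Φ := fun x => ofReal (V x) * ‖v x‖ₑ ^ 2)
      (by fun_prop) (s := 1) (by simp)
  set L := ∫⁻ x in D, ofReal ((ρ x ^ 2)⁻¹) * ‖v x‖ₑ ^ 2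
  have main : ofReal c * L ≤ ofReal (2 * Cv) * ((∫⁻ x in D, ‖q x‖ₑ ^ 2)
          + ∫⁻ x in D, ofReal (V x) * ‖v x‖ₑ ^ 2) := by
    calc ofReal c * L
        = ∫⁻ x in D, ofReal c * (ofReal ((ρ x ^ 2)⁻¹) * ‖v x‖ₑ ^ 2) :=
          (lintegral_const_mul' _ _ ofReal_ne_top).symm
      _ ≤ ∫⁻ x in D, ∫⁻ h, k1 h x := lintegral_mono low
      _ = ∫⁻ h, ∫⁻ x in D, k1 h x :=
          lintegral_lintegral_swap (Measurable.aemeasurable (by fun_prop))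
      _ ≤ ∫⁻ h, (2 * (∫⁻ x in D, ∫⁻ s in 𝕀, k2 s h x) + 2 * ∫⁻ x in D, k3 h x) :=
          lintegral_mono up
      _ = 2 * (∫⁻ h, ∫⁻ x in D, ∫⁻ s in 𝕀, k2 s h x)
          + 2 * ∫⁻ h, ∫⁻ x in D, k3 h x := by
          rw [lintegral_add_right, lintegral_const_mul' _ _ (by norm_num),
            lintegral_const_mul' _ _ (by norm_num)]
          exact (Measurable.lintegral_prod_right (by fun_prop)).const_mul _
      _ ≤ 2 * (ofReal Cv * ∫⁻ x in D, ‖q x‖ₑ ^ 2)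
          + 2 * (ofReal Cv * ∫⁻ x in D, ofReal (V x) * ‖v x‖ₑ ^ 2) := by gcongr
      _ = _ := by rw [ofReal_mul zero_le_two, ofReal_ofNat]; ring
  have hc' : ofReal c ≠ 0 := by simpa using hc
  rw [ENNReal.ofReal_div_of_pos hc, ENNReal.mul_comm_div, ← mul_div_assoc,
    ENNReal.le_div_iff_mul_le (Or.inl hc') (Or.inl ofReal_ne_top), mul_comm L]
  exact main

end FeffermanPhong

/-! ### Energy, trace and Rellich identities in the interior -/

section Interior

variable {n : ℕ}

/-- Measurable, bounded, symmetric, elliptic and vertically constant coefficients. -/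
structure GoodCoeff (μ Λ : ℝ) (a : Pt n → Pt n →L[ℝ] Pt n) : Prop where
  meas : ∀ g : Pt n → Pt n, Measurable g → Measurable fun x => a x (g x)
  elliptic : ∀ x v, μ * ‖v‖ ^ 2 ≤ inner ℝ (a x v) v
  bound : ∀ x v, ‖a x v‖ ≤ Λ * ‖v‖
  symm : ∀ x v w, inner ℝ (a x v) w = inner ℝ (a x w) v
  indep : ∀ x y, horiz x = horiz y → a x = a y

lemma GoodCoeff.abs_inner_le {μ Λ : ℝ} {a : Pt n → Pt n →L[ℝ] Pt n} (ha : GoodCoeff μ Λ a)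
    (x v w : Pt n) : |inner ℝ (a x v) w| ≤ Λ * (‖v‖ * ‖w‖) := by
  refine (abs_real_inner_le_norm _ _).trans ?_
  rw [← mul_assoc]; gcongr; exact ha.bound x v

/-- The vector field of the Rellich identity, as a bilinear form in the gradient. -/
def rellichField (A : Pt n →L[ℝ] Pt n) (e v w : Pt n) : Pt n :=
  (2 * inner ℝ v e) • A w - inner ℝ (A v) w • e

variable {D : Set (Pt n)} {F : Pt n → Pt n} {H : Pt n → ℝ}

lemma WeakId.integrableOn_test (hD : IsOpen D) (hW : WeakId D F H) {φ : Pt n → ℝ}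
    {ψ : Pt n → Pt n} (h : CptSob D φ ψ) :
    IntegrableOn (fun x => inner ℝ (ψ x) (F x) + H x * φ x) D := by
  obtain ⟨K, hKD, hK, hoff⟩ := h.supp
  have h1 := integrable_inner_of_memLp h.memψ (hW.memF.indicator hKD hK)
  have h2 := integrable_inner_of_memLp h.memφ (hW.memH.indicator hKD hK)
  refine (h1.add h2).integrableOn.congr_fun (fun x _ => ?_) hD.measurableSet
  by_cases hx : x ∈ K
  · simp [hx]
  · simp [hx, hoff x hx]

lemma CptSob.sub {φ₁ φ₂ : Pt n → ℝ} {ψ₁ ψ₂ : Pt n → Pt n}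
    (h₁ : CptSob D φ₁ ψ₁) (h₂ : CptSob D φ₂ ψ₂) :
    CptSob D (fun x => φ₁ x - φ₂ x) (fun x => ψ₁ x - ψ₂ x) where
  supp := by
    obtain ⟨K₁, hKD₁, hK₁, off₁⟩ := h₁.supp
    obtain ⟨K₂, hKD₂, hK₂, off₂⟩ := h₂.supp
    refine ⟨K₁ ∪ K₂, union_subset hKD₁ hKD₂, hK₁.union hK₂, fun x hx => ?_⟩
    rw [mem_union, not_or] at hx
    simp [off₁ x hx.1, off₂ x hx.2]
  memφ := h₁.memφ.sub h₂.memφ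
  memψ := h₁.memψ.sub h₂.memψ
  eq ζ hζ hζc e := by
    have hz : IsTest univ ζ := ⟨hζ, hζc, subset_univ _⟩
    have i1 : Integrable (fun x => φ₁ x * fderiv ℝ ζ x e) :=
      MemLp.integrable_mul h₁.memφ (hz.memLp_fderiv e)
    have i2 : Integrable (fun x => φ₂ x * fderiv ℝ ζ x e) :=
      MemLp.integrable_mul h₂.memφ (hz.memLp_fderiv e)
    have m : ∀ {ψ : Pt n → Pt n}, MemLp ψ 2 →
        Integrable (fun x => inner ℝ (ψ x) e * ζ x) := fun {ψ} hψ => by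
      have hc2 : MemLp (fun x => inner ℝ (ψ x) e) 2 := by
        simpa only [real_inner_comm] using hψ.const_inner (𝕜 := ℝ) e
      exact MemLp.integrable_mul hc2 hz.memLp
    simp only [sub_mul, inner_sub_left]
    rw [integral_sub i1 i2, integral_sub (m h₁.memψ) (m h₂.memψ), h₁.eq ζ hζ hζc e,
      h₂.eq ζ hζ hζc e]
    ring

lemma L2On.translate {G : Type*} [NormedAddCommGroup G] {f : Pt n → G} (hf : L2On D f)
    {y : Pt n} (hy : ∀ x ∈ D, x + y ∈ D) : L2On D (fun x => f (x + y)) := fun K hK hKc => by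
  have hK' : IsCompact ((fun x => x + y) '' K) := hKc.image (by fun_prop)
  have hsub : (fun x => x + y) '' K ⊆ D := by rintro _ ⟨x, hx, rfl⟩; exact hy x (hK hx)
  have h1 := hf _ hsub hK'
  have e : (fun x => x + y) ⁻¹' ((fun x => x + y) '' K) = K :=
    preimage_image_eq _ (add_left_injective y)
  have hmp := (measurePreserving_add_right volume y).restrict_preimage hK'.measurableSet
  rw [e] at hmp
  exact h1.comp_measurePreserving hmp

lemma setIntegral_translate {f : Pt n → ℝ} {y : Pt n}
    (hy : ∀ x ∈ D, x + y ∈ D) {φ : Pt n → ℝ} (hφ : ∀ x ∉ D, φ x = 0)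
    {ψ : Pt n → ℝ} (hψ : ∀ x, ψ (x + y) = φ x) :
    ∫ x in D, f (x + y) * φ x = ∫ x in D, f x * ψ x := by
  have e : ∀ k : Pt n → ℝ, (∀ x ∉ D, k x = 0) → ∫ x in D, k x = ∫ x, k x := fun k hk =>
    setIntegral_eq_integral_of_forall_compl_eq_zero hk
  rw [e (fun x => f (x + y) * φ x) fun x hx => by simp [hφ x hx], e (fun x => f x * ψ x) fun x hx => ?_]
  · rw [← integral_add_right_eq_self (fun x => f x * ψ x) y]
    simp only [hψ]
  · have h1 : x - y ∉ D := fun hh => hx (by simpa using hy _ hh)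
    have h2 := hψ (x - y)
    rw [sub_add_cancel, hφ _ h1] at h2
    simp [h2]

lemma HasWeakGrad.translate {u : Pt n → ℝ} {g : Pt n → Pt n}
    (h : HasWeakGrad D u g) {y : Pt n} (hy : ∀ x ∈ D, x + y ∈ D) :
    HasWeakGrad D (fun x => u (x + y)) (fun x => g (x + y)) where
  memLp := L2On.translate h.memLp hy
  memLp_grad := L2On.translate h.memLp_grad hy
  integral_eq φ hφ i := by
    have h1 := h.integral_eq _ (hφ.translate hy) i
    rw [setIntegral_translate (f := u) hy (φ := fun x => partialD i φ x)
        (ψ := fun x => partialD i (fun x => φ (x - y)) x),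
      setIntegral_translate (f := fun x => g x i) hy (φ := φ) (ψ := fun x => φ (x - y)), h1]
    · exact fun x hx => image_eq_zero_of_notMem_tsupport fun hh => hx (hφ.2.2 hh)
    · simp
    · exact fun x hx => hφ.fderiv_eq_zero _ fun hh => hx (hφ.2.2 hh)
    · intro x
      simp only [partialD, fderiv_comp_sub (f := φ) y, add_sub_cancel_right]

lemma WeakId.translate (h : WeakId D F H) {y : Pt n}
    (hy : ∀ x ∈ D, x + y ∈ D) : WeakId D (fun x => F (x + y)) (fun x => H (x + y)) where
  memF := h.memF.translate hy
  memH := h.memH.translate hy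
  eq φ hφ := by
    have h1 := h.eq _ (hφ.translate hy)
    have hφy := hφ.translate hy
    rw [setIntegral_eq_integral_of_forall_compl_eq_zero fun x hx => ?_] at h1 ⊢
    · rw [← integral_add_right_eq_self _ y] at h1
      simpa only [fderiv_comp_sub (f := φ) y, add_sub_cancel_right] using h1
    · have hx' : x ∉ tsupport φ := fun hh => hx (hφ.2.2 hh)
      simp [fderiv_of_notMem_tsupport ℝ hx', image_eq_zero_of_notMem_tsupport hx']
    · have hx' : x ∉ tsupport (fun x => φ (x - y)) := fun hh => hx (hφy.2.2 hh)
      have h2 : φ (x - y) = 0 := image_eq_zero_of_notMem_tsupport (f := fun x => φ (x - y)) hx'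
      rw [h2, fderiv_of_notMem_tsupport ℝ hx']; simp

variable {u : Pt n → ℝ} {g : Pt n → Pt n} {V : Pt n → ℝ} {a : Pt n → Pt n →L[ℝ] Pt n} {μ Λ : ℝ}

/-- The energy identity. -/
lemma energy_identity (hD : IsOpen D) (hu : HasWeakGrad D u g)
    (hW : WeakId D (fun x => a x (g x)) (fun x => V x * u x)) {θ : Pt n → ℝ} {C : ℝ≥0}
    (hθ : LipschitzWith C θ) (hc : HasCompactSupport θ) (hθD : tsupport θ ⊆ D) :
    ∫ x in D, (fderiv ℝ θ x (u x • a x (g x))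
      + (inner ℝ (a x (g x)) (g x) + V x * u x ^ 2) * θ x) = 0 := by
  rw [← hW.test hD (hu.cutoff hD hθ hc hθD)]
  refine integral_congr_ae (.of_forall fun x => ?_)
  simp only [inner_add_left, real_inner_smul_left, inner_gradient_left, map_smul, smul_eq_mul,
    real_inner_comm (g x) (a x (g x))]
  ring

/-- The identity `div (u² e) = 2 u g·e`. -/
lemma trace_identity (hD : IsOpen D) (hu : HasWeakGrad D u g) (e : Pt n) {θ : Pt n → ℝ} {C : ℝ≥0}
    (hθ : LipschitzWith C θ) (hc : HasCompactSupport θ) (hθD : tsupport θ ⊆ D) :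
    ∫ x in D, (fderiv ℝ θ x (u x ^ 2 • e) + 2 * u x * inner ℝ (g x) e * θ x) = 0 := by
  rw [← (hu.weakId hD e).test hD (hu.cutoff hD hθ hc hθD)]
  refine integral_congr_ae (.of_forall fun x => ?_)
  simp only [inner_add_left, real_inner_smul_left, inner_gradient_left, map_smul, smul_eq_mul,
    inner_smul_right]
  ring

/-- Strong convergence of both factors in L² is needed for the product: in the Rellich limit both
the difference quotient and its coefficient vary with the step. -/
lemma tendsto_integral_mul_of_eLpNorm {X ι : Type*} [MeasurableSpace X] {m : Measure X}
    {l : Filter ι} {P : ι → X → ℝ} {P₀ : X → ℝ} {Q : ι → X → ℝ} {Q₀ : X → ℝ}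
    (hP : ∀ i, MemLp (P i) 2 m) (hP₀ : MemLp P₀ 2 m) (hQ : ∀ i, MemLp (Q i) 2 m)
    (hQ₀ : MemLp Q₀ 2 m) (h1 : Tendsto (fun i => eLpNorm (P i - P₀) 2 m) l (𝓝 0))
    (h2 : Tendsto (fun i => eLpNorm (Q i - Q₀) 2 m) l (𝓝 0)) :
    Tendsto (fun i => ∫ x, P i x * Q i x ∂m) l (𝓝 (∫ x, P₀ x * Q₀ x ∂m)) := by
  have t1 := (Lp.tendsto_Lp_iff_tendsto_eLpNorm'' P hP P₀ hP₀).2 h1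
  have t2 := (Lp.tendsto_Lp_iff_tendsto_eLpNorm'' Q hQ Q₀ hQ₀).2 h2
  have t3 := t1.inner (𝕜 := ℝ) t2
  have e : ∀ {f k : X → ℝ} (hf : MemLp f 2 m) (hk : MemLp k 2 m),
      inner ℝ (hf.toLp f) (hk.toLp k) = ∫ x, f x * k x ∂m := fun {f k} hf hk => by
    rw [L2.inner_def]
    refine integral_congr_ae ?_
    filter_upwards [hf.coeFn_toLp, hk.coeFn_toLp] with x e1 e2
    rw [e1, e2, Real.inner_apply]
  simpa only [e] using t3

lemma eLpNorm_two_sq {X G : Type*} [MeasurableSpace X] [NormedAddCommGroup G] (m : Measure X)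
    (f : X → G) : eLpNorm f 2 m ^ 2 = ∫⁻ x, ‖f x‖ₑ ^ 2 ∂m := by
  rw [eLpNorm_eq_lintegral_rpow_enorm_toReal two_ne_zero (by norm_num)]
  simp only [ENNReal.toReal_ofNat, ENNReal.rpow_ofNat]
  rw [← ENNReal.rpow_natCast, ← ENNReal.rpow_mul]
  norm_num

/-- Difference quotients of a Sobolev function converge in `L²_loc` to the derivative. -/
lemma tendsto_diffQuot (hD : IsOpen D) (hgm : Measurable g) (hu : HasWeakGrad D u g)
    {e : Pt n} (he : ∀ x ∈ D, ∀ s : ℝ, 0 ≤ s → x + s • e ∈ D) {K : Set (Pt n)}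
    (hK : IsCompact K) (hKD : K ⊆ D) :
    Tendsto (fun h : ℝ => eLpNorm (fun x => h⁻¹ * (u (x + h • e) - u x) - inner ℝ (g x) e) 2
      (volume.restrict K)) (𝓝[>] 0) (𝓝 0) := by
  obtain ⟨δ, hδ, hδD⟩ := hK.exists_cthickening_subset_open hD hKD
  set K' := Metric.cthickening δ K
  have hK'c : IsCompact K' := hK.cthickening
  have hKK' : K ⊆ K' := Metric.self_subset_cthickening K
  set g' := K'.indicator g
  have mg' : MemLp g' 2 := L2On.indicator hu.memLp_grad hδD hK'c
  have hg'm : Measurable g' := hgm.indicator hK'c.measurableSet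
  have ht := tendsto_eLpNorm_translate mg'
  rw [ENNReal.tendsto_nhds_zero]
  intro ε hε
  obtain ⟨ε', hε', hε'2⟩ : ∃ ε' : ℝ≥0∞, 0 < ε' ∧ ‖e‖ₑ * ε' ≤ ε := by
    rcases eq_or_ne ε ∞ with rfl | hεt
    · exact ⟨1, one_pos, le_top⟩
    · refine ⟨ε / (‖e‖ₑ + 1), ENNReal.div_pos hε.ne' (by simp), ?_⟩
      rw [← mul_div_assoc, ENNReal.div_le_iff (by simp) (by simp), mul_comm]
      gcongr
      exact le_self_add
  rw [ENNReal.tendsto_nhds_zero] at ht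
  obtain ⟨r, hr, hball⟩ := Metric.eventually_nhds_iff.1 (ht ε' hε')
  set h₀ := min δ (r / 2) / (‖e‖ + 1) with hh₀
  have hep : 0 < ‖e‖ + 1 := by positivity
  have hh₀p : 0 < h₀ := by positivity
  filter_upwards [Ioo_mem_nhdsGT hh₀p] with h hh
  have hsmall : h * ‖e‖ ≤ min δ (r / 2) := by
    have : h * (‖e‖ + 1) ≤ min δ (r / 2) := by
      have := hh.2.le
      rwa [hh₀, le_div_iff₀ hep] at this
    nlinarith [hh.1]
  have hs_small : ∀ s ∈ 𝕀, ‖s • h • e‖ ≤ min δ (r / 2) := fun s hs => by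
    rw [norm_smul, norm_smul, norm_of_nonneg hs.1, norm_of_nonneg hh.1.le]
    nlinarith [hs.2, hs.1, mul_nonneg hh.1.le (norm_nonneg e)]
  have hmemK' : ∀ x ∈ K, ∀ s ∈ 𝕀, x + s • h • e ∈ K' := fun x hx s hs =>
    Metric.mem_cthickening_of_dist_le _ x δ K hx (by
      rw [dist_eq_norm, add_sub_cancel_left]; exact (hs_small s hs).trans (min_le_left _ _))
  have hACL := hu.ae_sub_eq hD (h := h • e) fun x hx s hs => by
    rw [smul_smul]; exact he x hx _ (mul_nonneg hs.1 hh.1.le)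
  have hpt : ∀ᵐ x ∂volume.restrict K, ‖h⁻¹ * (u (x + h • e) - u x) - inner ℝ (g x) e‖ₑ ^ 2
      ≤ ‖e‖ₑ ^ 2 * ∫⁻ s in 𝕀, ‖g' (x + s • h • e) - g' x‖ₑ ^ 2 := by
    rw [ae_restrict_iff' hK.measurableSet]
    have hfin : ∀ᵐ x, Integrable (fun s => g' (x + s • h • e)) (volume.restrict 𝕀) := by
      have hK'f : IsFiniteMeasure (volume.restrict K') := ⟨by simpa using hK'c.measure_lt_top⟩
      have j1 : Integrable g' := by
        rw [integrable_indicator_iff hK'c.measurableSet]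
        exact (hu.memLp_grad K' hδD hK'c).integrable (by norm_num)
      have j2 : Integrable (fun p : ℝ × Pt n => g' p.2)
        ((volume.restrict 𝕀).prod volume) := j1.comp_snd _
      have j3 := ((measurePreserving_shear (h • e)).integrable_comp j2.aestronglyMeasurable).2 j2
      exact j3.prod_left_ae
    filter_upwards [hACL, hfin] with x hx hfx hxK
    -- The error of the difference quotient is the mean over s of (g(x + she) − g(x))·e, so its L²
    -- norm is controlled by Jensen's inequality and the continuity of translations.
    have h1 : h⁻¹ * (u (x + h • e) - u x) - inner ℝ (g x) e
        = ∫ s in 𝕀, inner ℝ (g' (x + s • h • e) - g' x) e := by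
      have h2 : ∫ s in 𝕀, inner ℝ (g (x + s • h • e)) (h • e)
          = ∫ s in 𝕀, h * inner ℝ (g' (x + s • h • e)) e := by
        refine setIntegral_congr_fun (measurableSet_Icc (a := (0 : ℝ)) (b := 1)) fun s hs => ?_
        simp only [g', indicator_of_mem (hmemK' x hxK s hs), inner_smul_right]
      rw [hx (hKD hxK), h2, integral_const_mul, ← mul_assoc, inv_mul_cancel₀ hh.1.ne', one_mul]
      simp only [inner_sub_left]
      rw [integral_sub (hfx.inner_const e) (integrable_const _)]
      simp [g', indicator_of_mem (hKK' hxK)]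
    rw [h1]
    exact enorm_integral_inner_sq_le (by fun_prop) e
  have hsq : eLpNorm (fun x => h⁻¹ * (u (x + h • e) - u x) - inner ℝ (g x) e) 2
      (volume.restrict K) ^ 2 ≤ (‖e‖ₑ * ε') ^ 2 := by
    rw [eLpNorm_two_sq]
    have hmeas : Measurable fun p : Pt n × ℝ => ‖g' (p.1 + p.2 • h • e) - g' p.1‖ₑ ^ 2 := by
      fun_prop
    calc _ ≤ ∫⁻ x in K, ‖e‖ₑ ^ 2 * ∫⁻ s in 𝕀, ‖g' (x + s • h • e) - g' x‖ₑ ^ 2 :=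
          lintegral_mono_ae hpt
      _ ≤ ∫⁻ x, ‖e‖ₑ ^ 2 * ∫⁻ s in 𝕀, ‖g' (x + s • h • e) - g' x‖ₑ ^ 2 :=
          setLIntegral_le_lintegral _ _
      _ = ‖e‖ₑ ^ 2 * ∫⁻ s in 𝕀, ∫⁻ x, ‖g' (x + s • h • e) - g' x‖ₑ ^ 2 := by
          rw [lintegral_const_mul _ hmeas.lintegral_prod_right',
            lintegral_lintegral_swap hmeas.aemeasurable]
      _ ≤ ‖e‖ₑ ^ 2 * ∫⁻ _ in 𝕀, ε' ^ 2 := by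
          gcongr ‖e‖ₑ ^ 2 * ?_
          refine setLIntegral_mono measurable_const fun s hs => ?_
          rw [← eLpNorm_two_sq volume fun x => g' (x + s • h • e) - g' x]
          gcongr
          refine hball ?_
          rw [dist_zero_right]
          have := (hs_small s hs).trans (min_le_right _ _)
          linarith
      _ = _ := by simp [mul_pow]
  exact ((ENNReal.pow_le_pow_left_iff two_ne_zero).1 hsq).trans hε'2

end Interior

/-! ### The Rellich identity by vertical difference quotients -/

section Rellich

variable {n : ℕ} {D : Set (Pt n)} {u : Pt n → ℝ} {g : Pt n → Pt n} {V : Pt n → ℝ}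
  {a : Pt n → Pt n →L[ℝ] Pt n} {μ Λ : ℝ}

/-- Subtracting the equations of `u` and of a vertical translate, tested with their difference. -/
lemma rellich_difference (hD : IsOpen D) (ha : GoodCoeff μ Λ a) (hu : HasWeakGrad D u g)
    (hW : WeakId D (fun x => a x (g x)) (fun x => V x * u x)) {y : Pt n}
    (hy : ∀ x ∈ D, x + y ∈ D) (hy0 : horiz y = 0) {θ : Pt n → ℝ} {C : ℝ≥0}
    (hθ : LipschitzWith C θ) (hc : HasCompactSupport θ) (hθD : tsupport θ ⊆ D) :
    ∫ x in D, (θ x * (inner ℝ (a (x + y) (g (x + y))) (g (x + y)) - inner ℝ (a x (g x)) (g x))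
      + (fderiv ℝ θ x (a x (g x + g (x + y))) + (V x * u x + V (x + y) * u (x + y)) * θ x)
        * (u (x + y) - u x)) = 0 := by
  have hcut := ((hu.translate hy).cutoff hD hθ hc hθD).sub (hu.cutoff hD hθ hc hθD)
  have hW' := hW.translate hy
  have h1 := hW.test hD hcut
  have h2 := hW'.test hD hcut
  -- Both equations are tested with θ(u(x + y) − u(x)) and added. As a is symmetric and a(x + y) =
  -- a(x), the product (g(x + y) − g(x))·a(g(x) + g(x + y)) is the difference of the energy
  -- densities, and a itself is never differentiated.
  have h3 := integral_add (hW.integrableOn_test hD hcut) (hW'.integrableOn_test hD hcut)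
  rw [h1, h2, add_zero] at h3
  rw [← h3]
  refine integral_congr_ae (.of_forall fun x => ?_)
  have hax : a (x + y) = a x := ha.indep _ _ (by simp [hy0])
  have s1 := ha.symm x (g x) (g (x + y))
  simp only [hax, inner_add_left, inner_sub_left, real_inner_smul_left, inner_gradient_left,
    map_add]
  rw [real_inner_comm (a x (g x)) (g (x + y)), real_inner_comm (a x (g x)) (g x),
    real_inner_comm (a x (g (x + y))) (g (x + y)), real_inner_comm (a x (g (x + y))) (g x), s1]
  ring

/-- The Rellich identity. -/
lemma rellich_identity (hD : IsOpen D) (ha : GoodCoeff μ Λ a) (hgm : Measurable g)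
    (hu : HasWeakGrad D u g) (hW : WeakId D (fun x => a x (g x)) (fun x => V x * u x))
    {e : Pt n} (he : ∀ x ∈ D, ∀ s : ℝ, 0 ≤ s → x + s • e ∈ D) (he0 : horiz e = 0)
    {θ : Pt n → ℝ} {C : ℝ≥0} (hθ : LipschitzWith C θ) (hc : HasCompactSupport θ)
    (hθD : tsupport θ ⊆ D) :
    ∫ x in D, (fderiv ℝ θ x (rellichField (a x) e (g x) (g x))
      + 2 * V x * u x * inner ℝ (g x) e * θ x) = 0 := by
  simp only [rellichField]
  set K := tsupport θ
  have hK : IsCompact K := hc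
  obtain ⟨δ, hδ, hδD⟩ := hK.exists_cthickening_subset_open hD hθD
  set K' := Metric.cthickening δ K
  have hK'c : IsCompact K' := hK.cthickening
  have hKK' : K ⊆ K' := Metric.self_subset_cthickening K
  have off1 : ∀ x ∉ K, θ x = 0 := fun x hx => image_eq_zero_of_notMem_tsupport hx
  have off2 : ∀ x ∉ K, fderiv ℝ θ x = 0 := fun x hx => fderiv_of_notMem_tsupport ℝ hx
  obtain ⟨B, hB⟩ := exists_bound_of_lipschitz hθ hc
  have hfd : ∀ x y, ‖fderiv ℝ θ x y‖ ≤ C * ‖y‖ := fun x y =>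
    ContinuousLinearMap.le_of_opNorm_le _ (norm_fderiv_le_of_lipschitz ℝ hθ) y
  have hfda : ∀ x y, ‖fderiv ℝ θ x (a x y)‖ ≤ C * Λ * ‖y‖ := fun x y =>
    (hfd x _).trans (by rw [mul_assoc]; gcongr; exact ha.bound x y)
  have hθm : AEStronglyMeasurable θ volume := hθ.continuous.aestronglyMeasurable
  have bdd : ∀ {k : Pt n → ℝ}, Integrable k → Integrable (fun x => θ x * k x) := fun hk =>
    hk.bdd_mul hθm (.of_forall hB)
  set g' := K'.indicator g with hg'
  set H' := K'.indicator (fun x => V x * u x) with hH'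
  have mg' : MemLp g' 2 := L2On.indicator hu.memLp_grad hδD hK'c
  have mH' : MemLp H' 2 := hW.memH.indicator hδD hK'c
  have hg'm : Measurable g' := hgm.indicator hK'c.measurableSet
  set Q' : Pt n → ℝ := fun x => inner ℝ (a x (g' x)) (g' x) with hQ'
  have mag' : MemLp (fun x => a x (g' x)) 2 := by
    refine (mg'.norm.const_mul Λ).of_le (ha.meas g' hg'm).aestronglyMeasurable
      (.of_forall fun x => ?_)
    exact (ha.bound x _).trans (le_abs_self _)
  have iQ' : Integrable Q' := integrable_inner_of_memLp mag' mg'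
  set h₀ := δ / (‖e‖ + 1) with hh₀
  have hep : 0 < ‖e‖ + 1 := by positivity
  have hh₀p : 0 < h₀ := by positivity
  have hmemK' : ∀ h ∈ Ioo 0 h₀, ∀ x ∈ K, x + h • e ∈ K' := fun h hh x hx =>
    Metric.mem_cthickening_of_dist_le _ x δ K hx (by
      rw [dist_eq_norm, add_sub_cancel_left, norm_smul, norm_of_nonneg hh.1.le]
      have := hh.2.le
      rw [hh₀, le_div_iff₀ hep] at this
      nlinarith [hh.1])
  -- The coefficient of the difference quotient of u. Neither g nor Vu is smooth; their translates
  -- converge only in L², which suffices because the quotients converge in L² as well. Restriction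
  -- to K' makes everything globally square integrable.
  set P : ℝ → Pt n → ℝ := fun h x =>
    fderiv ℝ θ x (a x (g' x + g' (x + h • e))) + (H' x + H' (x + h • e)) * θ x with hP
  set P₀ : Pt n → ℝ := fun x => fderiv ℝ θ x (a x (g' x + g' x)) + (H' x + H' x) * θ x with hP₀
  set R : ℝ → Pt n → ℝ := fun h x => h⁻¹ * (u (x + h • e) - u x) with hR
  have tr : ∀ {G : Type} [NormedAddCommGroup G] {f : Pt n → G}, MemLp f 2 →
      ∀ y, MemLp (fun x => f (x + y)) 2 := fun {G} _ {f} hf y =>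
    hf.comp_measurePreserving (measurePreserving_add_right volume y)
  have mfd : ∀ {k : Pt n → Pt n}, Measurable k → MemLp k 2 →
      MemLp (fun x => fderiv ℝ θ x (a x (k x))) 2 := fun {k} hk hk2 => by
    have hm : Measurable fun x => fderiv ℝ θ x (a x (k x)) := by
      simp only [← inner_gradient_left]; exact (measurable_gradient θ).inner (ha.meas k hk)
    exact (hk2.norm.const_mul (C * Λ)).of_le hm.aestronglyMeasurable
      (.of_forall fun x => (hfda x _).trans (le_abs_self _))
  have mθ : ∀ {k : Pt n → ℝ}, MemLp k 2 → MemLp (fun x => k x * θ x) 2 := fun {k} hk => by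
    refine (hk.const_mul (B : ℝ)).of_le (hk.1.mul hθm) (.of_forall fun x => ?_)
    rw [norm_mul, norm_mul, mul_comm]; gcongr; simpa using hB x
  have hgtm : ∀ h : ℝ, Measurable fun x => g' x + g' (x + h • e) := fun h => by fun_prop
  have mP : ∀ h, MemLp (P h) 2 := fun h =>
    (mfd (hgtm h) (mg'.add (tr mg' (h • e)))).add (mθ (mH'.add (tr mH' (h • e))))
  have mP₀ : MemLp P₀ 2 := (mfd (hg'm.add hg'm) (mg'.add mg')).add (mθ (mH'.add mH'))
  have hcont : Tendsto (fun h : ℝ => h • e) (𝓝[>] 0) (𝓝 0) := by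
    have : Tendsto (fun h : ℝ => h • e) (𝓝 0) (𝓝 ((0 : ℝ) • e)) :=
      (continuous_id.smul continuous_const).tendsto 0
    rw [zero_smul] at this
    exact this.mono_left nhdsWithin_le_nhds
  have tP : Tendsto (fun h => eLpNorm (P h - P₀) 2 (volume.restrict K)) (𝓝[>] 0) (𝓝 0) := by
    have t1 := (tendsto_eLpNorm_translate mg').comp hcont
    have t2 := (tendsto_eLpNorm_translate mH').comp hcont
    have t3 : Tendsto (fun h : ℝ => ofReal (C * Λ) * eLpNorm (fun x => g' (x + h • e) - g' x) 2
        + (B : ℝ≥0∞) * eLpNorm (fun x => H' (x + h • e) - H' x) 2) (𝓝[>] 0) (𝓝 0) := by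
      have := (ENNReal.Tendsto.const_mul (a := ofReal (C * Λ)) t1 (Or.inr ofReal_ne_top)).add
        (ENNReal.Tendsto.const_mul (a := (B : ℝ≥0∞)) t2 (Or.inr ENNReal.coe_ne_top))
      simpa using this
    refine tendsto_nhds_bot_mono t3 <| .of_forall fun h => ?_
    have hm : Measurable fun x => g' (x + h • e) - g' x := by fun_prop
    have b1 : eLpNorm (fun x => fderiv ℝ θ x (a x (g' (x + h • e) - g' x))) 2
        ≤ ofReal (C * Λ) * eLpNorm (fun x => g' (x + h • e) - g' x) 2 :=
      eLpNorm_le_mul_eLpNorm_of_ae_le_mul (.of_forall fun x => hfda x _) 2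
    have b2 : eLpNorm (fun x => (H' (x + h • e) - H' x) * θ x) 2
        ≤ (B : ℝ≥0∞) * eLpNorm (fun x => H' (x + h • e) - H' x) 2 := by
      have := eLpNorm_le_mul_eLpNorm_of_ae_le_mul (μ := volume)
        (f := fun x => (H' (x + h • e) - H' x) * θ x) (g := fun x => H' (x + h • e) - H' x)
        (c := (B : ℝ)) (.of_forall fun x => by
          rw [norm_mul, mul_comm]
          gcongr
          exact hB x) 2
      simpa using this
    have e0 : P h - P₀ = (fun x => fderiv ℝ θ x (a x (g' (x + h • e) - g' x)))
        + fun x => (H' (x + h • e) - H' x) * θ x := by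
      funext x
      simp only [hP, hP₀, Pi.sub_apply, Pi.add_apply, map_add, map_sub]
      ring
    refine (eLpNorm_mono_measure _ Measure.restrict_le_self).trans ?_
    rw [e0]
    refine (eLpNorm_add_le (mfd hm ((tr mg' (h • e)).sub mg')).1
      (mθ ((tr mH' (h • e)).sub mH')).1 (by norm_num)).trans ?_
    exact add_le_add b1 b2
  have tR := tendsto_diffQuot hD hgm hu he hK hθD
  have mge : MemLp (fun x => inner ℝ (g x) e) 2 (volume.restrict K) :=
    L2On.inner_const hu.memLp_grad e K hθD hK
  -- Setting the quotient to zero for h ≤ 0 gives an L² function for every real h: for negative h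
  -- the translate may leave the domain.
  have mR : ∀ h : ℝ, MemLp (fun x => if 0 < h then R h x else 0) 2 (volume.restrict K) := fun h => by
    by_cases hh : 0 < h
    · simp only [hh, if_true]
      have hy : ∀ x ∈ D, x + h • e ∈ D := fun x hx => he x hx h hh.le
      exact (((L2On.translate hu.memLp hy) K hθD hK).sub (hu.memLp K hθD hK)).const_mul h⁻¹
    · simp [hh]
  have tPR := tendsto_integral_mul_of_eLpNorm (m := volume.restrict K) (fun h => (mP h).restrict K)
    (mP₀.restrict K) mR mge tP (by
      refine tR.congr' ?_
      filter_upwards [self_mem_nhdsWithin] with h hh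
      have hh' : 0 < h := hh
      refine congrArg (fun f => eLpNorm f 2 (volume.restrict K)) ?_
      funext x
      simp [hR, hh'])
  -- The difference quotient of the energy density Q' has been moved onto θ by a change of
  -- variables. Since θ is Lipschitz, its quotients are bounded and converge a.e. by Rademacher's
  -- theorem, so no regularity of Q' beyond integrability is used.
  have tQ : Tendsto (fun h : ℝ => ∫ x, Q' x * (h⁻¹ * (θ (x - h • e) - θ x))) (𝓝[>] 0)
      (𝓝 (∫ x, Q' x * (-fderiv ℝ θ x e))) := by
    refine tendsto_integral_filter_of_dominated_convergence (fun x => |Q' x| * (C * ‖e‖)) ?_ ?_ ?_ ?_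
    · filter_upwards with h
      have := hθ.continuous
      exact iQ'.1.mul (Continuous.aestronglyMeasurable (by fun_prop))
    · filter_upwards [self_mem_nhdsWithin] with h hh
      have hh' : 0 < h := hh
      filter_upwards with x
      rw [norm_mul, norm_eq_abs]
      gcongr
      have h1 := hθ.dist_le_mul (x - h • e) x
      rw [dist_eq_norm, dist_eq_norm, sub_sub_cancel_left, norm_neg, norm_smul,
        norm_of_nonneg hh'.le] at h1
      rw [norm_mul, norm_inv, norm_of_nonneg hh'.le, inv_mul_le_iff₀ hh']
      linarith
    · exact iQ'.abs.mul_const _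
    · filter_upwards [hθ.ae_differentiableAt (μ := volume)] with x hx
      refine Tendsto.const_mul _ ?_
      have h1 : HasDerivAt (fun h : ℝ => θ (x - h • e)) (-fderiv ℝ θ x e) 0 := by
        simpa using hasDerivAt_comp_sub_smul (s := 0) (h := e) (by simpa using hx)
      simpa using h1.tendsto_slope_zero_right
  have hzero : ∀ᶠ h : ℝ in 𝓝[>] 0, (∫ x, Q' x * (h⁻¹ * (θ (x - h • e) - θ x)))
      + ∫ x in K, P h x * (if 0 < h then R h x else 0) = 0 := by
    filter_upwards [Ioo_mem_nhdsGT hh₀p] with h hh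
    have hh' : 0 < h := hh.1
    have h1 := rellich_difference hD ha hu hW (fun x hx => he x hx h hh'.le)
      (show horiz (h • e) = 0 by simp [he0]) hθ hc hθD
    have offP : ∀ x ∉ K, P h x = 0 := fun x hx => by simp [hP, off1 x hx, off2 x hx]
    have i1 : Integrable (fun x => θ x * (Q' (x + h • e) - Q' x)) :=
      bdd ((iQ'.comp_add_right (h • e)).sub iQ')
    have hR2 : MemLp (R h) 2 (volume.restrict K) := by simpa [hh'] using mR h
    have i2 : Integrable (fun x => P h x * R h x) := by
      rw [← integrableOn_iff_integrable_of_support_subset (s := K)]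
      · exact MemLp.integrable_mul ((mP h).restrict K) hR2
      · intro x hx; by_contra hcon; exact hx (by simp [offP x hcon])
    have e1 : ∫ x, Q' x * (h⁻¹ * (θ (x - h • e) - θ x))
        = h⁻¹ * ∫ x, θ x * (Q' (x + h • e) - Q' x) := by
      have j1 := bdd (iQ'.comp_add_right (h • e))
      have j2 := bdd iQ'
      have j3 : Integrable (fun x => Q' x * θ (x - h • e)) := by
        simpa [mul_comm] using j1.comp_sub_right (h • e)
      have e2 : ∫ x, θ x * Q' (x + h • e) = ∫ x, Q' x * θ (x - h • e) := by
        rw [← integral_sub_right_eq_self (fun x => θ x * Q' (x + h • e)) (h • e)]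
        simp [mul_comm]
      have e3 : (fun x => Q' x * (h⁻¹ * (θ (x - h • e) - θ x)))
          = fun x => h⁻¹ * (Q' x * θ (x - h • e) - θ x * Q' x) := by funext x; ring
      rw [e3, integral_const_mul, integral_sub j3 j2, ← e2, ← integral_sub j1 j2]
      simp only [mul_sub]
    have e4 : ∫ x in K, P h x * (if 0 < h then R h x else 0) = ∫ x, P h x * R h x := by
      simp only [hh', if_true]
      exact setIntegral_eq_integral_of_forall_compl_eq_zero fun x hx => by simp [offP x hx]
    rw [e1, e4, ← integral_const_mul, ← integral_add (i1.const_mul _) i2]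
    rw [setIntegral_eq_integral_of_forall_compl_eq_zero fun x hx => ?_] at h1
    · rw [← mul_zero h⁻¹, ← h1, ← integral_const_mul]
      refine integral_congr_ae (.of_forall fun x => ?_)
      by_cases hx : x ∈ K
      · have m1 := hKK' hx
        have m2 := hmemK' h hh x hx
        simp only [hQ', hP, hR, hg', hH', indicator_of_mem m1, indicator_of_mem m2]
        ring
      · simp [off1 x hx, off2 x hx, offP x hx]
    · have hxK : x ∉ K := fun hh => hx (hθD hh)
      simp [off1 x hxK, off2 x hxK]
  -- The discrete identity vanishes for all small h > 0, so its limit does.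
  have hlim := tendsto_nhds_unique (tendsto_const_nhds.congr' (hzero.mono fun h hh => hh.symm))
    (tQ.add tPR)
  have offP₀ : ∀ x ∉ K, P₀ x = 0 := fun x hx => by simp [hP₀, off1 x hx, off2 x hx]
  have i1 : IntegrableOn (fun x => Q' x * (-fderiv ℝ θ x e)) K := by
    refine (iQ'.mul_bdd (c := C * ‖e‖) (measurable_fderiv_apply_const ℝ θ e).neg.aestronglyMeasurable
      (.of_forall fun x => ?_)).integrableOn
    exact (norm_neg _).trans_le (hfd x e)
  have i2 : IntegrableOn (fun x => P₀ x * inner ℝ (g x) e) K :=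
    MemLp.integrable_mul (mP₀.restrict K) mge
  rw [← setIntegral_eq_integral_of_forall_compl_eq_zero (s := K)
    (f := fun x => Q' x * (-fderiv ℝ θ x e)) (fun x hx => by simp [off2 x hx]),
    ← integral_add i1 i2] at hlim
  rw [hlim, ← integral_indicator hD.measurableSet, ← integral_indicator hK.measurableSet]
  refine integral_congr_ae (.of_forall fun x => ?_)
  by_cases hx : x ∈ K
  · have m1 := hKK' hx
    simp only [indicator_of_mem hx, indicator_of_mem (hθD hx), hQ', hP₀, hg', hH',
      indicator_of_mem m1, map_sub, map_smul, map_add, smul_eq_mul]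
    ring
  · by_cases hxD : x ∈ D
    · simp [hx, hxD, off1 x hx, off2 x hx]
    · simp [hx, hxD]

end Rellich

/-! ### Approach regions and boundary layers -/

section Cones

variable {n : ℕ} {τ : ℝ} {M : ℝ≥0} {Ψ : Euc n → ℝ} {κ : ℝ}

/-- The boundary point over `z'`. -/
def bdryPt (Ψ : Euc n → ℝ) (z : Euc n) : Pt n := pairPt z (Ψ z)

@[simp] lemma horiz_bdryPt (z : Euc n) : horiz (bdryPt Ψ z) = z := by simp [bdryPt]
@[simp] lemma height_bdryPt (z : Euc n) : height (bdryPt Ψ z) = Ψ z := by simp [bdryPt]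

lemma exists_bdryPt {z : Pt n} (hz : z ∈ graphBdry Ψ) : ∃ z', z = bdryPt Ψ z' :=
  ⟨horiz z, pairPt_ext (by simp) (by simpa [graphBdry] using hz)⟩

lemma continuous_bdryPt (hΨ : LipschitzWith M Ψ) : Continuous (bdryPt Ψ) := by
  have := hΨ.continuous
  exact continuous_pairPt.comp (by fun_prop : Continuous fun z : Euc n => (z, Ψ z))

lemma depth_bdryPt (z : Euc n) : depth τ Ψ (bdryPt Ψ z) = 0 := by simp [depth]

lemma dist_bdryPt_le (hΨ : LipschitzWith M Ψ) (z w : Euc n) :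
    dist (bdryPt Ψ z) (bdryPt Ψ w) ≤ (1 + M) * dist z w := by
  rw [dist_eq_norm]
  refine (norm_le_horiz_add_height _).trans ?_
  have := hΨ.dist_le_mul z w
  rw [Real.dist_eq] at this
  simp only [horiz_sub, horiz_bdryPt, height_sub, height_bdryPt, ← dist_eq_norm]
  linarith

/-- The pairs `(y, z')` with `y` in the approach region of the boundary point over `z'`. -/
def coneRel (τ : ℝ) (Ψ : Euc n → ℝ) (κ : ℝ) : Set (Pt n × Euc n) :=
  {p | p.1 ∈ gCone τ Ψ κ (bdryPt Ψ p.2)}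

lemma isOpen_coneRel (hΨ : LipschitzWith M Ψ) : IsOpen (coneRel τ Ψ κ) := by
  have h1 := continuous_bdryPt hΨ
  have h2 : IsOpen {p : Pt n × Euc n | dist p.1 (bdryPt Ψ p.2) < κ * infDist p.1 (graphBdry Ψ)} :=
    isOpen_lt (continuous_fst.dist (h1.comp continuous_snd))
      (continuous_const.mul ((Metric.continuous_infDist_pt _).comp continuous_fst))
  exact ((isOpen_graphDom hΨ).preimage continuous_fst).inter h2

lemma isOpen_ntCone (hΨ : LipschitzWith M Ψ) (z : Pt n) : IsOpen (gCone τ Ψ κ z) :=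
  (isOpen_graphDom hΨ).inter (isOpen_lt (by fun_prop)
    (continuous_const.mul (Metric.continuous_infDist_pt _)))

lemma coneRel_dist_lt (hτ : IsSgn τ) (hκ : 1 < κ) {y : Pt n} {z : Euc n}
    (h : (y, z) ∈ coneRel τ Ψ κ) : dist y (bdryPt Ψ z) < κ * depth τ Ψ y := by
  refine h.2.trans_le ?_
  have h1 : (0 : ℝ) < depth τ Ψ y := h.1
  have := infDist_graph_le hτ (Ψ := Ψ) y
  rw [abs_of_pos h1] at this
  gcongr

lemma coneRel_horiz_lt (hτ : IsSgn τ) (hκ : 1 < κ) {y : Pt n} {z : Euc n}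
    (h : (y, z) ∈ coneRel τ Ψ κ) : ‖z - horiz y‖ < κ * depth τ Ψ y := by
  refine lt_of_le_of_lt ?_ (coneRel_dist_lt hτ hκ h)
  have := norm_horiz_le (y - bdryPt Ψ z)
  rwa [horiz_sub, horiz_bdryPt, norm_sub_rev, ← dist_eq_norm y] at this

/-- The boundary points whose approach region contains `y` have measure `≳ depth(y)^n`. -/
lemma exists_coneRel_volume (n : ℕ) (M : ℝ≥0) (κ : ℝ) (hκ : 1 < κ) : ∃ c : ℝ, 0 < c ∧
    ∀ τ : ℝ, (τ = 1 ∨ τ = -1) → ∀ Ψ : Euc n → ℝ, LipschitzWith M Ψ → ∀ y ∈ graphDom τ Ψ,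
      ofReal (c * depth τ Ψ y ^ n) ≤ volume {z : Euc n | (y, z) ∈ coneRel τ Ψ κ} := by
  have hM : (0 : ℝ) < 1 + M := by positivity
  have hκ' : 0 < κ - 1 := by linarith
  -- Half of the slack κ − 1 is spent on an almost nearest boundary point w, the other half on
  -- moving from w along the graph: one factor 1 + M bounds depth by distance, the other is the
  -- Lipschitz constant of the parametrization.
  set b : ℝ := (κ - 1) / (2 * (1 + M) ^ 2) with hb
  have hb0 : 0 < b := by positivity
  refine ⟨b ^ n * unitVol n, mul_pos (by positivity) (unitVol_pos n), ?_⟩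
  intro τ hτ Ψ hΨ y hy
  have ht : 0 < depth τ Ψ y := hy
  set δ := infDist y (graphBdry Ψ)
  have h1 : depth τ Ψ y ≤ (1 + M) * δ := depth_le_infDist hτ hΨ y
  have hδ0 : 0 < δ := pos_of_mul_pos_right (ht.trans_le h1) hM.le
  have h2 : δ < δ + (κ - 1) / 2 * δ := lt_add_of_pos_right _ (by positivity)
  obtain ⟨w, hw, hyw⟩ := (Metric.infDist_lt_iff graphBdry_nonempty).1 h2
  obtain ⟨w', rfl⟩ := exists_bdryPt hw
  have hr : 0 < b * depth τ Ψ y := by positivity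
  have hsub : ball w' (b * depth τ Ψ y) ⊆ {z : Euc n | (y, z) ∈ coneRel τ Ψ κ} := by
    intro z hz
    refine ⟨hy, ?_⟩
    have h3 := dist_bdryPt_le hΨ w' z
    have h4 : dist w' z ≤ b * depth τ Ψ y := by rw [dist_comm]; exact (mem_ball.1 hz).le
    have h5 : (1 + M : ℝ) * dist w' z ≤ (κ - 1) / 2 * δ := by
      calc (1 + M : ℝ) * dist w' z ≤ (1 + M) * (b * ((1 + M) * δ)) := by
            gcongr; exact h4.trans (by gcongr)
        _ = (κ - 1) / 2 * δ := by rw [hb]; field_simp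
    have h6 := dist_triangle y (bdryPt Ψ w') (bdryPt Ψ z)
    change dist y (bdryPt Ψ z) < κ * δ
    linarith
  refine le_trans (le_of_eq ?_) (measure_mono hsub)
  rw [volume_ball_eq w' hr, mul_pow]
  ring_nf

lemma volume_horiz_ball_le (y : Euc n) {r : ℝ} (hr : 0 < r) :
    volume {z : Euc n | ‖z - y‖ < r} = ofReal (r ^ n * unitVol n) := by
  have : {z : Euc n | ‖z - y‖ < r} = ball y r := by ext z; simp [dist_eq_norm]
  rw [this, volume_ball_eq y hr]

lemma sqrt_one_add_ge_one (s : ℝ) : 1 ≤ √(1 + s ^ 2) :=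
  Real.one_le_sqrt.2 (by nlinarith [sq_nonneg s])

/-- At a boundary point where the graph has a tangent plane, the approach region contains a
proportional part of the small balls. -/
lemma exists_cone_volume (n : ℕ) (M : ℝ≥0) (κ : ℝ) (hκ : 1 < κ) : ∃ c : ℝ, 0 < c ∧
    ∀ τ : ℝ, (τ = 1 ∨ τ = -1) → ∀ Ψ : Euc n → ℝ, LipschitzWith M Ψ →
    ∀ z : Euc n, DifferentiableAt ℝ Ψ z → ∃ r₀ : ℝ, 0 < r₀ ∧ ∀ r, 0 < r → r < r₀ →
      ofReal (c * r ^ (n + 1)) ≤ volume (gCone τ Ψ κ (bdryPt Ψ z) ∩ ball (bdryPt Ψ z) r) := by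
  have hκ' : 0 < κ - 1 := by linarith
  have hM : (1 : ℝ) ≤ 1 + M := by have := M.2; linarith
  -- Membership in the approach region will require s(1 + η) < κs(1 − 5η), that is η(5κ + 1) < κ −
  -- 1. In 5η, the part 4η is lost to the deviation from the tangent plane and η to the radius of
  -- the small ball.
  set η : ℝ := (κ - 1) / (2 * (5 * κ + 1)) with hη
  have hη0 : 0 < η := by positivity
  have hη2 : η * (2 * (5 * κ + 1)) = κ - 1 := by rw [hη]; field_simp
  have hη1 : η ≤ 1 / 10 := by rw [hη, div_le_div_iff₀ (by positivity) (by norm_num)]; linarith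
  set β : ℝ := η / (1 + M) with hβ
  have hβ0 : 0 < β := by positivity
  have hβη : β ≤ η := div_le_self hη0.le hM
  have hβM : (1 + M) * β = η := by rw [hβ]; field_simp
  refine ⟨(β / 2) ^ (n + 1) * unitVol (n + 1), mul_pos (by positivity) (unitVol_pos _), ?_⟩
  intro τ hτ Ψ hΨ z hz
  have hlittle := hz.hasFDerivAt.isLittleO.def hη0
  obtain ⟨ρ, hρ, hball⟩ := Metric.eventually_nhds_iff.1 hlittle
  refine ⟨ρ / 4, by positivity, fun r hr hrr => ?_⟩
  set s := r / 2 with hs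
  have hs0 : 0 < s := by positivity
  set J := √(1 + ‖gradient Ψ z‖ ^ 2)
  have hJ1 : 1 ≤ J := sqrt_one_add_ge_one _
  have hJ2 : J ^ 2 = 1 + ‖gradient Ψ z‖ ^ 2 := Real.sq_sqrt (by positivity)
  have hJ0 : 0 < J := by linarith
  -- the inner unit normal
  set ν : Pt n := (τ * J⁻¹) • pairPt (-gradient Ψ z) 1 with hν
  have hτ2 := unit_mul_self hτ
  have hνh : horiz ν = -((τ * J⁻¹) • gradient Ψ z) := by simp [hν]
  have hνd : height ν = τ * J⁻¹ := by simp [hν]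
  have hνn : ‖ν‖ = 1 := by
    have h1 : ‖ν‖ ^ 2 = 1 := by
      rw [norm_sq_eq_horiz_height ν, hνh, hνd, norm_neg, norm_smul, norm_eq_abs, abs_mul,
        abs_unit hτ, one_mul, abs_of_pos (inv_pos.2 hJ0)]
      have h2 : J⁻¹ ^ 2 * J ^ 2 = 1 := by rw [← mul_pow, inv_mul_cancel₀ hJ0.ne', one_pow]
      rw [hJ2] at h2
      rw [mul_pow, mul_pow, sq τ, hτ2]
      linarith
    nlinarith [norm_nonneg ν]
  -- The centre is taken on the inner normal, not on the vertical line: for κ close to 1 a vertical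
  -- line over a steep tangent plane can miss the approach region.
  set y := bdryPt Ψ z + s • ν with hy
  have hsν : ‖s • ν‖ = s := by rw [norm_smul, hνn, mul_one, norm_of_nonneg hs0.le]
  have hys : dist y (bdryPt Ψ z) = s := by rw [dist_eq_norm, hy, add_sub_cancel_left, hsν]
  have hinner : ∀ w : Euc n, inner ℝ (bdryPt Ψ w - bdryPt Ψ z) ν
      = τ * J⁻¹ * (Ψ w - Ψ z - fderiv ℝ Ψ z (w - z)) := fun w => by
    rw [inner_eq_horiz_height, hνh, hνd]
    simp only [horiz_sub, horiz_bdryPt, height_sub, height_bdryPt, inner_neg_right,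
      inner_smul_right, real_inner_comm (gradient Ψ z), inner_gradient_left]
    ring
  -- Boundary points within 4s of z in the base are close to the tangent plane, so their distance to
  -- y is seen in the normal direction; farther ones are at distance more than 3s by the triangle
  -- inequality.
  have hdist : ∀ w : Euc n, s * (1 - 4 * η) ≤ dist y (bdryPt Ψ w) := fun w => by
    rcases le_or_gt (dist w z) (4 * s) with hw | hw
    · have h1 := hball (y := w) (by linarith)
      rw [← dist_eq_norm w] at h1
      have h2 : |τ * J⁻¹ * (Ψ w - Ψ z - fderiv ℝ Ψ z (w - z))| ≤ η * (4 * s) := by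
        rw [abs_mul, abs_mul, abs_unit hτ, one_mul, abs_of_pos (inv_pos.2 hJ0)]
        have h3 : J⁻¹ ≤ 1 := inv_le_one_of_one_le₀ hJ1
        calc _ ≤ 1 * (η * (4 * s)) := by
              refine mul_le_mul h3 ?_ (abs_nonneg _) zero_le_one
              exact h1.trans (by gcongr)
          _ = _ := one_mul _
      have h3 : inner ℝ (y - bdryPt Ψ w) ν = s - τ * J⁻¹ * (Ψ w - Ψ z - fderiv ℝ Ψ z (w - z)) := by
        rw [← hinner w]
        have : y - bdryPt Ψ w = s • ν - (bdryPt Ψ w - bdryPt Ψ z) := by rw [hy]; abel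
        rw [this, inner_sub_left, real_inner_smul_left, real_inner_self_eq_norm_sq, hνn]
        ring
      have h4 := real_inner_le_norm (y - bdryPt Ψ w) ν
      rw [hνn, mul_one, h3, ← dist_eq_norm] at h4
      have := (abs_le.1 h2).2
      linarith
    · have h1 := norm_horiz_le (bdryPt Ψ w - bdryPt Ψ z)
      rw [horiz_sub, horiz_bdryPt, horiz_bdryPt, ← dist_eq_norm, ← dist_eq_norm] at h1
      have h3 := dist_triangle_left (bdryPt Ψ w) (bdryPt Ψ z) y
      rw [hys] at h3
      have h4 : 0 < s * η := by positivity
      linarith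
  have hinf : s * (1 - 4 * η) ≤ infDist y (graphBdry Ψ) := by
    refine (Metric.le_infDist graphBdry_nonempty).2 fun w hw => ?_
    obtain ⟨w', rfl⟩ := exists_bdryPt hw
    exact hdist w'
  have hdepth : s * (1 - η) ≤ depth τ Ψ y := by
    have hh : ‖horiz (s • ν)‖ ≤ s := (norm_horiz_le _).trans_eq hsν
    have h1 := hball (y := z + horiz (s • ν)) (by rw [dist_eq_norm, add_sub_cancel_left]; linarith)
    rw [add_sub_cancel_left, norm_eq_abs] at h1
    have h2 : fderiv ℝ Ψ z (horiz (s • ν)) = -(s * (τ * J⁻¹) * ‖gradient Ψ z‖ ^ 2) := by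
      rw [← inner_gradient_left, horiz_smul, hνh, inner_smul_right, inner_neg_right,
        inner_smul_right, real_inner_self_eq_norm_sq]
      ring
    have h3 : depth τ Ψ y = s * J
        - τ * (Ψ (z + horiz (s • ν)) - Ψ z - fderiv ℝ Ψ z (horiz (s • ν))) := by
      rw [h2]
      simp only [depth, hy, height_add, height_bdryPt, horiz_add, horiz_bdryPt, height_smul, hνd]
      have e1 : J = J⁻¹ * (1 + ‖gradient Ψ z‖ ^ 2) := by rw [← hJ2]; field_simp
      have e2 : s * J = τ * τ * (s * (J⁻¹ * (1 + ‖gradient Ψ z‖ ^ 2))) := by rw [hτ2, ← e1, one_mul]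
      rw [e2]; ring
    have h4 : |τ * (Ψ (z + horiz (s • ν)) - Ψ z - fderiv ℝ Ψ z (horiz (s • ν)))| ≤ η * s := by
      rw [abs_mul, abs_unit hτ, one_mul]
      exact h1.trans (by gcongr)
    have := (abs_le.1 h4).2
    rw [h3]
    nlinarith
  have hsub : ball y (β * s) ⊆ gCone τ Ψ κ (bdryPt Ψ z) ∩ ball (bdryPt Ψ z) r := by
    intro x hx
    have hx' : dist x y < β * s := hx
    have h3 := dist_triangle x y (bdryPt Ψ z)
    have h4 : infDist y (graphBdry Ψ) ≤ infDist x (graphBdry Ψ) + dist y x :=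
      Metric.infDist_le_infDist_add_dist
    have h5 := (lipschitz_depth hτ hΨ).dist_le_mul x y
    rw [Real.dist_eq] at h5
    push_cast at h5
    have h6 := (abs_le.1 h5).1
    have h7 : (1 + M : ℝ) * dist x y ≤ η * s := by
      calc (1 + M : ℝ) * dist x y ≤ (1 + M) * (β * s) := by gcongr
        _ = η * s := by rw [← mul_assoc, hβM]
    have h8 : β * s ≤ η * s := by gcongr
    have e0 : s * η ≤ s * (1 / 10) := by gcongr
    have e1 : s * (1 - η) = s - s * η := by ring
    have e2 : s * (1 - 4 * η) = s - 4 * (s * η) := by ring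
    have e3 : s * (1 - 5 * η) = s - 5 * (s * η) := by ring
    have e4 : s * (1 + η) = s + s * η := by ring
    rw [mul_comm η s] at h7 h8
    rw [e1] at hdepth
    rw [e2] at hinf
    have hsr : r = 2 * s := by rw [hs]; ring
    refine ⟨⟨?_, ?_⟩, ?_⟩
    · change 0 < depth τ Ψ x
      nlinarith
    · rw [dist_comm y x] at h4
      have h9 : s * (1 - 5 * η) ≤ infDist x (graphBdry Ψ) := by linarith
      have h10 : κ * (s * (1 - 5 * η)) ≤ κ * infDist x (graphBdry Ψ) := by gcongr
      have h11 : s * (1 + η) < κ * (s * (1 - 5 * η)) := by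
        have : s * (κ * (1 - 5 * η) - (1 + η)) = s * (η * (5 * κ + 1)) := by
          rw [show κ * (1 - 5 * η) - (1 + η) = (κ - 1) - η * (5 * κ + 1) by ring, ← hη2]; ring
        have h12 : 0 < s * (η * (5 * κ + 1)) := by positivity
        have h13 : s * (κ * (1 - 5 * η) - (1 + η)) = κ * (s * (1 - 5 * η)) - s * (1 + η) := by ring
        linarith
      rw [e4] at h11
      linarith
    · rw [mem_ball]
      linarith
  refine le_trans (le_of_eq ?_) (measure_mono hsub)
  rw [volume_ball_eq y (by positivity), hs]
  congr 1
  rw [show β * (r / 2) = β / 2 * r by ring, mul_pow]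
  ring

end Cones

/-! ### Boundary layers and the normalized layer measures -/

section Layers

variable {n : ℕ} {τ : ℝ} {M : ℝ≥0} {Ψ : Euc n → ℝ} {κ : ℝ}

/-- The points at depth between `a` and `b`. -/
def layer (τ : ℝ) (Ψ : Euc n → ℝ) (a b : ℝ) : Set (Pt n) := depth τ Ψ ⁻¹' Ioo a b

lemma isOpen_layer (hΨ : LipschitzWith M Ψ) (a b : ℝ) : IsOpen (layer τ Ψ a b) :=
  isOpen_Ioo.preimage (continuous_depth hΨ)

lemma measurableSet_layer (hΨ : LipschitzWith M Ψ) (a b : ℝ) : MeasurableSet (layer τ Ψ a b) :=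
  (isOpen_layer hΨ a b).measurableSet

lemma layer_subset {a b : ℝ} (ha : 0 ≤ a) : layer τ Ψ a b ⊆ graphDom τ Ψ :=
  fun _ hx => ha.trans_lt hx.1

/-- Fubini in the coordinates (base point, depth), whose Jacobian is 1. -/
lemma lintegral_depth_preimage (hτ : IsSgn τ) (hΨ : LipschitzWith M Ψ) {s : Set ℝ}
    (hs : MeasurableSet s) {F : Pt n → ℝ≥0∞} (hF : Measurable F) :
    ∫⁻ x in depth τ Ψ ⁻¹' s, F x = ∫⁻ t in s, ∫⁻ x' : Euc n, F (graphPt τ Ψ (x', t)) := by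
  have hmp := measurePreserving_graphPt hτ hΨ
  rw [← hmp.setLIntegral_comp_preimage ((continuous_depth hΨ).measurable hs) hF]
  have : graphPt τ Ψ ⁻¹' (depth τ Ψ ⁻¹' s) = univ ×ˢ s := by ext p; simp [depth_graphPt hτ]
  rw [this, Measure.volume_eq_prod, ← Measure.prod_restrict, lintegral_prod_symm]
  · simp
  · exact (hF.comp hmp.measurable).aemeasurable

lemma lintegral_depth_preimage_horiz (hτ : IsSgn τ) (hΨ : LipschitzWith M Ψ) {s : Set ℝ}
    (hs : MeasurableSet s) {h : Euc n → ℝ≥0∞} (hh : Measurable h) :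
    ∫⁻ x in depth τ Ψ ⁻¹' s, h (horiz x) = volume s * ∫⁻ z, h z := by
  rw [lintegral_depth_preimage hτ hΨ hs (F := fun x => h (horiz x)) (hh.comp measurable_horiz)]
  simp [mul_comm]

/-- Normalized Lebesgue measure on the layer between the depths `ε` and `2ε`. -/
def slab (τ : ℝ) (Ψ : Euc n → ℝ) (ε : ℝ) : Measure (Pt n) :=
  ofReal ε⁻¹ • volume.restrict (layer τ Ψ ε (2 * ε))

lemma lintegral_slab {ε : ℝ} (F : Pt n → ℝ≥0∞) : ∫⁻ x, F x ∂slab τ Ψ ε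
    = ofReal ε⁻¹ * ∫⁻ x in layer τ Ψ ε (2 * ε), F x := by
  rw [slab, lintegral_smul_measure, smul_eq_mul]

/-- The layer has thickness ε in the vertical direction, which the factor ε⁻¹ cancels. Boundary
integrals over the base can thus be rewritten as layer integrals of functions constant along
vertical lines. -/
lemma measurePreserving_horiz_slab (hτ : IsSgn τ) (hΨ : LipschitzWith M Ψ) {ε : ℝ}
    (hε : 0 < ε) : MeasurePreserving horiz (slab τ Ψ ε) volume := by
  refine ⟨measurable_horiz, Measure.ext_of_lintegral _ fun h hh => ?_⟩
  rw [lintegral_map hh measurable_horiz, lintegral_slab, layer,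
    lintegral_depth_preimage_horiz hτ hΨ measurableSet_Ioo hh, Real.volume_Ioo, ← mul_assoc,
    ← ofReal_mul (by positivity)]
  rw [show ε⁻¹ * (2 * ε - ε) = 1 by field_simp; ring]
  simp

end Layers

/-! ### Measurability of the nontangential maximal function -/

section NTMax

variable {n : ℕ} {τ : ℝ} {M : ℝ≥0} {Ψ : Euc n → ℝ} {κ : ℝ}
  {E : Type*} [NormedAddCommGroup E] [MeasurableSpace E] [BorelSpace E]

/-- The essential supremum over an approach region exceeds a exactly when the set of points y there
with |F(y)| > a has positive volume. These sets are the sections of one measurable set, so their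
volumes depend measurably on z. -/
lemma measurable_ntMax (hΨ : LipschitzWith M Ψ) {F : Pt n → E} (hF : Measurable F) :
    Measurable fun z => gMax τ Ψ κ F (bdryPt Ψ z) := by
  refine measurable_of_Ioi fun a => ?_
  have e : (fun z => gMax τ Ψ κ F (bdryPt Ψ z)) ⁻¹' Ioi a = (fun z => volume ((fun y => (y, z)) ⁻¹'
        (coneRel τ Ψ κ ∩ {p | a < ‖F p.1‖ₑ}))) ⁻¹' {0}ᶜ := by
    ext z
    simp only [mem_preimage, mem_Ioi, mem_compl_iff, mem_singleton_iff]
    rw [← not_le, not_iff_not]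
    have hset : (fun y => (y, z)) ⁻¹' (coneRel τ Ψ κ ∩ {p | a < ‖F p.1‖ₑ})
        = {y | a < ‖F y‖ₑ} ∩ gCone τ Ψ κ (bdryPt Ψ z) := by
      ext y; simp [coneRel, and_comm]
    rw [hset, ← Measure.restrict_apply (measurableSet_lt measurable_const hF.enorm)]
    constructor
    · intro h
      have h1 := ENNReal.ae_le_essSup (μ := volume.restrict
        (gCone τ Ψ κ (bdryPt Ψ z))) (fun x => ‖F x‖ₑ)
      refine measure_mono_null (fun y hy => ?_) h1
      exact not_le.2 ((show _ ≤ a from h).trans_lt hy)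
    · intro h
      refine essSup_le_of_ae_le _ ?_
      rw [EventuallyLE, ae_iff]
      simpa using h
  rw [e]
  refine measurable_measure_prodMk_right ?_ (measurableSet_singleton _).compl
  exact (isOpen_coneRel hΨ).measurableSet.inter
    (measurableSet_lt measurable_const (hF.comp measurable_fst).enorm)

end NTMax

/-! ### Mean square convergence on layers from nontangential convergence -/

section SlabLimit

variable {n : ℕ} {τ : ℝ} {M : ℝ≥0} {Ψ : Euc n → ℝ} {κ : ℝ} {F : Pt n → Pt n}
  {F₀ : Euc n → Pt n} {N : Euc n → ℝ≥0∞}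

/-- The integral over the part of the approach region at depth between `ε` and `2ε`. -/
def coneLayerInt (τ : ℝ) (Ψ : Euc n → ℝ) (κ : ℝ) (F : Pt n → Pt n)
    (F₀ : Euc n → Pt n) (ε : ℝ) (z : Euc n) : ℝ≥0∞ :=
  ∫⁻ y in layer τ Ψ ε (2 * ε), (coneRel τ Ψ κ).indicator (fun p => ‖F p.1 - F₀ p.2‖ₑ ^ 2) (y, z)

lemma measurable_coneRel_indicator (hΨ : LipschitzWith M Ψ) (hF : Measurable F)
    (hF₀ : Measurable F₀) : Measurable ((coneRel τ Ψ κ).indicator fun p => ‖F p.1 - F₀ p.2‖ₑ ^ 2) :=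
  Measurable.indicator (by fun_prop) (isOpen_coneRel hΨ).measurableSet

/-- A point y of the layer is seen by a set of boundary points z of measure at least cεⁿ, all within
2κε of y' in the base. Averaging |F(y) − F₀(y')|² ≤ 2|F(y) − F₀(z)|² + 2|F₀(z) − F₀(y')|² over these
z leaves integrals over approach regions and an L² modulus of continuity of F₀. -/
lemma layer_lintegral_le (hτ : IsSgn τ) (hΨ : LipschitzWith M Ψ) (hκ : 1 < κ)
    (hF : Measurable F) (hF₀ : Measurable F₀) {c ε : ℝ} (hc : 0 < c) (hε : 0 < ε)
    (hcone : ∀ y ∈ graphDom τ Ψ,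
      ofReal (c * depth τ Ψ y ^ n) ≤ volume {z : Euc n | (y, z) ∈ coneRel τ Ψ κ}) :
    ofReal (c * ε ^ n) * ∫⁻ y in layer τ Ψ ε (2 * ε), ‖F y - F₀ (horiz y)‖ₑ ^ 2
      ≤ 2 * (∫⁻ z, coneLayerInt τ Ψ κ F F₀ ε z) + 2 * (ofReal ε *
        ∫⁻ k in ball (0 : Euc n) (2 * κ * ε), ∫⁻ y', ‖F₀ (y' + k) - F₀ y'‖ₑ ^ 2) := by
  set B := ball (0 : Euc n) (2 * κ * ε) with hB
  have hBm : MeasurableSet B := measurableSet_ball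
  set T : Euc n → Euc n → ℝ≥0∞ := fun y' k => B.indicator (fun k => ‖F₀ (y' + k) - F₀ y'‖ₑ ^ 2) k
   
  have hTm : Measurable (Function.uncurry T) := by
    have : Function.uncurry T = (Prod.snd ⁻¹' B).indicator
        (fun p : Euc n × Euc n => ‖F₀ (p.1 + p.2) - F₀ p.1‖ₑ ^ 2) := by
      rfl
    rw [this]
    exact Measurable.indicator (by fun_prop) (measurable_snd hBm)
  have hT1 : ∀ y', ∀ k ∈ B, T y' k = ‖F₀ (y' + k) - F₀ y'‖ₑ ^ 2 := fun y' k hk =>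
    indicator_of_mem hk _
  have hT0 : ∀ y', ∀ k ∉ B, T y' k = 0 := fun y' k hk => indicator_of_notMem hk _
  clear_value T
  have hIm := measurable_coneRel_indicator (τ := τ) (κ := κ) hΨ hF hF₀
  have hpt : ∀ y ∈ layer τ Ψ ε (2 * ε), ofReal (c * ε ^ n) * ‖F y - F₀ (horiz y)‖ₑ ^ 2
      ≤ 2 * (∫⁻ z, (coneRel τ Ψ κ).indicator (fun p => ‖F p.1 - F₀ p.2‖ₑ ^ 2) (y, z))
        + 2 * ∫⁻ k, T (horiz y) k := by
    intro y hy
    have hyD : y ∈ graphDom τ Ψ := layer_subset hε.le hy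
    have hZm : MeasurableSet {z : Euc n | (y, z) ∈ coneRel τ Ψ κ} :=
      measurable_prodMk_left (isOpen_coneRel hΨ).measurableSet
    calc ofReal (c * ε ^ n) * ‖F y - F₀ (horiz y)‖ₑ ^ 2
        ≤ volume {z : Euc n | (y, z) ∈ coneRel τ Ψ κ} * ‖F y - F₀ (horiz y)‖ₑ ^ 2 := by
          gcongr
          refine le_trans (ofReal_le_ofReal ?_) (hcone y hyD)
          gcongr
          exact hy.1.le
      _ = ∫⁻ z, {z : Euc n | (y, z) ∈ coneRel τ Ψ κ}.indicator
            (fun _ => ‖F y - F₀ (horiz y)‖ₑ ^ 2) z := by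
          rw [lintegral_indicator_const hZm, mul_comm]
      _ ≤ ∫⁻ z, (2 * ((coneRel τ Ψ κ).indicator (fun p => ‖F p.1 - F₀ p.2‖ₑ ^ 2) (y, z))
            + 2 * T (horiz y) (z - horiz y)) := by
          refine lintegral_mono fun z => ?_
          by_cases hz : (y, z) ∈ coneRel τ Ψ κ
          · have hzB : z - horiz y ∈ B := by
              rw [hB, mem_ball_zero_iff]
              have h1 := coneRel_horiz_lt hτ hκ hz
              have h2 : depth τ Ψ y < 2 * ε := hy.2
              have h3 : κ * depth τ Ψ y ≤ κ * (2 * ε) := by gcongr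
              linarith
            rw [indicator_of_mem (show z ∈ {z : Euc n | (y, z) ∈ coneRel τ Ψ κ} from hz),
              indicator_of_mem hz]
            rw [hT1 _ _ hzB, add_sub_cancel]
            have := enorm_add_sq_le (F y - F₀ z) (F₀ z - F₀ (horiz y))
            rwa [sub_add_sub_cancel] at this
          · rw [indicator_of_notMem (show z ∉ {z : Euc n | (y, z) ∈ coneRel τ Ψ κ} from hz)]
            exact zero_le
      _ = _ := by
          have h1 : Measurable fun z =>
              (coneRel τ Ψ κ).indicator (fun p => ‖F p.1 - F₀ p.2‖ₑ ^ 2) (y, z) :=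
            hIm.comp measurable_prodMk_left
          have h2 : Measurable (T (horiz y)) := hTm.comp measurable_prodMk_left
          have h3 : Measurable fun z => T (horiz y) (z - horiz y) :=
            h2.comp (measurable_sub_const _)
          rw [lintegral_add_left (h1.const_mul 2), lintegral_const_mul _ h1,
            lintegral_const_mul _ h3, lintegral_sub_right_eq_self (T (horiz y)) (horiz y)]
  have hT2 : Measurable fun y' => ∫⁻ k, T y' k := hTm.lintegral_prod_right'
  have hT3 : Measurable fun y : Pt n => ∫⁻ k, T (horiz y) k := hT2.comp measurable_horiz
  calc _ = ∫⁻ y in layer τ Ψ ε (2 * ε), ofReal (c * ε ^ n) * ‖F y - F₀ (horiz y)‖ₑ ^ 2 := by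
        rw [lintegral_const_mul]
        have := measurable_horiz (n := n)
        fun_prop
    _ ≤ ∫⁻ y in layer τ Ψ ε (2 * ε),
        (2 * (∫⁻ z, (coneRel τ Ψ κ).indicator (fun p => ‖F p.1 - F₀ p.2‖ₑ ^ 2) (y, z))
        + 2 * ∫⁻ k, T (horiz y) k) := setLIntegral_mono' (measurableSet_layer hΨ _ _) hpt
    _ = 2 * (∫⁻ y in layer τ Ψ ε (2 * ε), ∫⁻ z,
          (coneRel τ Ψ κ).indicator (fun p => ‖F p.1 - F₀ p.2‖ₑ ^ 2) (y, z))
        + 2 * ∫⁻ y in layer τ Ψ ε (2 * ε), ∫⁻ k, T (horiz y) k := by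
        rw [lintegral_add_left (hIm.lintegral_prod_right'.const_mul 2),
          lintegral_const_mul _ hIm.lintegral_prod_right',
          lintegral_const_mul _ hT3]
    _ = _ := by
        congr 2
        · rw [lintegral_lintegral_swap (f := fun y z => (coneRel τ Ψ κ).indicator
            (fun p => ‖F p.1 - F₀ p.2‖ₑ ^ 2) (y, z)) hIm.aemeasurable]
          rfl
        · rw [layer, lintegral_depth_preimage_horiz hτ hΨ measurableSet_Ioo hT2, Real.volume_Ioo,
            show 2 * ε - ε = ε by ring, lintegral_lintegral_swap hTm.aemeasurable]
          congr 1
          rw [← lintegral_indicator hBm]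
          refine lintegral_congr fun k => ?_
          by_cases hk : k ∈ B
          · rw [indicator_of_mem hk]
            exact lintegral_congr fun y' => hT1 y' k hk
          · rw [indicator_of_notMem hk]
            simp only [hT0 _ k hk, lintegral_zero]

/-- The contribution of the approach regions tends to `0`. -/
lemma tendsto_coneLayerInt (hτ : IsSgn τ) (hΨ : LipschitzWith M Ψ) (hκ : 1 < κ)
    (hF : Measurable F) (hF₀ : Measurable F₀) (hN : Measurable N) (hNfin : ∫⁻ z, N z ^ 2 < ∞)
    (hFN : ∀ᵐ z, ∀ᵐ y ∂volume.restrict (gCone τ Ψ κ (bdryPt Ψ z)), ‖F y‖ₑ ≤ N z)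
    (hF₀N : ∀ᵐ z, ‖F₀ z‖ₑ ≤ N z)
    (hlim : ∀ᵐ z, GLimit τ Ψ κ F (bdryPt Ψ z) (F₀ z)) :
    Tendsto (fun ε : ℝ => ofReal (ε ^ (n + 1))⁻¹ * ∫⁻ z, coneLayerInt τ Ψ κ F F₀ ε z)
      (𝓝[>] 0) (𝓝 0) := by
  have hIm := measurable_coneRel_indicator (τ := τ) (κ := κ) hΨ hF hF₀
  have hcm : ∀ ε, Measurable (coneLayerInt τ Ψ κ F F₀ ε) := fun ε => by
    have := hIm.lintegral_prod_left' (μ := volume.restrict (layer τ Ψ ε (2 * ε)))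
    exact this
  have e1 : ∀ ε : ℝ, ofReal (ε ^ (n + 1))⁻¹ * ∫⁻ z, coneLayerInt τ Ψ κ F F₀ ε z
      = ∫⁻ z, ofReal (ε ^ (n + 1))⁻¹ * coneLayerInt τ Ψ κ F F₀ ε z := fun ε =>
    (lintegral_const_mul _ (hcm ε)).symm
  simp only [e1]
  set C : ℝ≥0∞ := ofReal ((2 * κ) ^ (n + 1) * unitVol (n + 1)) with hC
  have hCtop : C ≠ ∞ := ofReal_ne_top
  set A : ℝ → Euc n → ℝ≥0∞ := fun r z => laverage (volume.restrict
    (gCone τ Ψ κ (bdryPt Ψ z) ∩ ball (bdryPt Ψ z) r)) (fun x => ‖F x - F₀ z‖ₑ) with hA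
  have hbd : ∀ᵐ z, ∀ ε > 0, ofReal (ε ^ (n + 1))⁻¹ * coneLayerInt τ Ψ κ F F₀ ε z
      ≤ C * (2 * N z * A (2 * κ * ε) z) ∧ A (2 * κ * ε) z ≤ 2 * N z := by
    filter_upwards [hFN, hF₀N] with z h1 h2 ε hε
    set Γ := gCone τ Ψ κ (bdryPt Ψ z) with hΓ
    have hr : 0 < 2 * κ * ε := by positivity
    set S := Γ ∩ ball (bdryPt Ψ z) (2 * κ * ε)
    have hSm : MeasurableSet S := ((isOpen_ntCone hΨ _).inter isOpen_ball).measurableSet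
    have hvol : volume S ≤ C * ofReal (ε ^ (n + 1)) := by
      refine (measure_mono inter_subset_right).trans (le_of_eq ?_)
      rw [volume_ball_eq _ hr, hC, ← ofReal_mul
        (mul_nonneg (by positivity) (unitVol_pos _).le), mul_pow _ ε]
      ring_nf
    have hfin : IsFiniteMeasure (volume.restrict S) := ⟨by
          rw [Measure.restrict_apply_univ]; exact hvol.trans_lt (mul_lt_top hCtop.lt_top ofReal_lt_top)⟩
    -- Nontangential convergence is only in the mean of first order. Bounding one factor of the
    -- square by 2N makes this sufficient, and the same bound provides a multiple of N² as
    -- integrable majorant.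
    have hFS : ∀ᵐ y ∂volume.restrict S, ‖F y - F₀ z‖ₑ ≤ 2 * N z := by
      filter_upwards [ae_restrict_of_ae_restrict_of_subset inter_subset_left h1] with y hy
      calc ‖F y - F₀ z‖ₑ ≤ ‖F y‖ₑ + ‖F₀ z‖ₑ := enorm_sub_le
        _ ≤ N z + N z := add_le_add hy h2
        _ = 2 * N z := (two_mul _).symm
    have hmul : volume S * A (2 * κ * ε) z = ∫⁻ y in S, ‖F y - F₀ z‖ₑ := by
      have := measure_mul_laverage (μ := volume.restrict S) (fun x => ‖F x - F₀ z‖ₑ)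
      rwa [Measure.restrict_apply_univ] at this
    constructor
    · have h3 : coneLayerInt τ Ψ κ F F₀ ε z ≤ ∫⁻ y in S, ‖F y - F₀ z‖ₑ ^ 2 := by
        rw [coneLayerInt, ← lintegral_indicator (measurableSet_layer hΨ _ _),
          ← lintegral_indicator hSm]
        refine lintegral_mono fun y => ?_
        by_cases hy : y ∈ layer τ Ψ ε (2 * ε) ∧ (y, z) ∈ coneRel τ Ψ κ
        · have hyS : y ∈ S := by
            refine ⟨hy.2, ?_⟩
            have h4 := coneRel_dist_lt hτ hκ hy.2
            have h5 : depth τ Ψ y < 2 * ε := hy.1.2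
            have h6 : κ * depth τ Ψ y ≤ κ * (2 * ε) := by gcongr
            rw [mem_ball]
            linarith
          rw [indicator_of_mem hy.1, indicator_of_mem hy.2, indicator_of_mem hyS]
        · rw [not_and_or] at hy
          rcases hy with hy | hy
          · rw [indicator_of_notMem hy]; exact zero_le
          · refine (le_of_eq ?_).trans zero_le
            rw [indicator_apply_eq_zero]
            exact fun _ => indicator_of_notMem hy _
      calc ofReal (ε ^ (n + 1))⁻¹ * coneLayerInt τ Ψ κ F F₀ ε z
          ≤ ofReal (ε ^ (n + 1))⁻¹ * ∫⁻ y in S, 2 * N z * ‖F y - F₀ z‖ₑ := by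
            gcongr
            refine h3.trans (lintegral_mono_ae ?_)
            filter_upwards [hFS] with y hy
            rw [sq]
            gcongr
        _ = ofReal (ε ^ (n + 1))⁻¹ * (2 * N z * (volume S * A (2 * κ * ε) z)) := by
            rw [lintegral_const_mul _ (by fun_prop), hmul]
        _ ≤ ofReal (ε ^ (n + 1))⁻¹ *
              (2 * N z * (C * ofReal (ε ^ (n + 1)) * A (2 * κ * ε) z)) := by gcongr
        _ = (ofReal (ε ^ (n + 1))⁻¹ * ofReal (ε ^ (n + 1))) *
              (C * (2 * N z * A (2 * κ * ε) z)) := by ring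
        _ = _ := by
            rw [← ofReal_mul (by positivity), inv_mul_cancel₀ (by positivity)]
            simp
    · rw [hA]
      simp only
      rw [laverage_eq]
      refine ENNReal.div_le_of_le_mul ?_
      refine (lintegral_mono_ae hFS).trans (le_of_eq ?_)
      rw [lintegral_const]
  have hdom : ∫⁻ z, C * (2 * N z * (2 * N z)) ≠ ∞ := by
    have : ∀ z, C * (2 * N z * (2 * N z)) = C * 4 * N z ^ 2 := fun z => by ring
    simp only [this]
    rw [lintegral_const_mul _ (by fun_prop)]
    exact (mul_lt_top (mul_lt_top hCtop.lt_top (by simp)) hNfin).ne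
  have hNae : ∀ᵐ z, N z < ∞ := by
    filter_upwards [ae_lt_top (by fun_prop) hNfin.ne] with z hz
    by_contra hcon
    rw [not_lt_top_iff.1 hcon] at hz
    simp at hz
  have := tendsto_lintegral_filter_of_dominated_convergence (l := 𝓝[>] (0 : ℝ))
    (F := fun ε z => ofReal (ε ^ (n + 1))⁻¹ * coneLayerInt τ Ψ κ F F₀ ε z)
    (f := fun _ => 0) (fun z => C * (2 * N z * (2 * N z)))
    (.of_forall fun ε => (hcm ε).const_mul _) ?_ hdom ?_
  · simpa using this
  · filter_upwards [self_mem_nhdsWithin] with ε (hε : 0 < ε)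
    filter_upwards [hbd] with z hz
    refine (hz ε hε).1.trans ?_
    gcongr
    exact (hz ε hε).2
  · filter_upwards [hbd, hlim, hNae] with z hz hl hNz
    have hl' : Tendsto (fun ε : ℝ => A (2 * κ * ε) z) (𝓝[>] 0) (𝓝 0) := by
      refine Tendsto.comp (g := fun r => A r z) hl ?_
      refine tendsto_nhdsWithin_iff.2 ⟨?_, ?_⟩
      · refine Tendsto.mono_left ?_ nhdsWithin_le_nhds
        have : Continuous fun ε : ℝ => 2 * κ * ε := by fun_prop
        simpa using this.tendsto 0
      · filter_upwards [self_mem_nhdsWithin] with ε (hε : 0 < ε)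
        exact (by positivity : (0 : ℝ) < 2 * κ * ε)
    have h3 : Tendsto (fun ε : ℝ => C * (2 * N z * A (2 * κ * ε) z)) (𝓝[>] 0) (𝓝 0) := by
      have h4 := ENNReal.Tendsto.const_mul (a := 2 * N z) hl' (Or.inr (mul_lt_top (by simp) hNz).ne)
      have h5 := ENNReal.Tendsto.const_mul (a := C) h4 (Or.inr hCtop)
      simpa using h5
    refine tendsto_nhds_bot_mono h3 ?_
    filter_upwards [self_mem_nhdsWithin] with ε (hε : 0 < ε)
    exact (hz ε hε).1

/-- The factor ε⁻ⁿ cancels the volume of the ball of shifts, so this is a bounded average of squared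
L² translation moduli at shifts tending to zero. -/
lemma tendsto_ball_translate (hF₀L : MemLp F₀ 2) {κ : ℝ} (hκ : 0 < κ) :
    Tendsto (fun ε : ℝ => ofReal (ε ^ n)⁻¹ *
      ∫⁻ k in ball (0 : Euc n) (κ * ε), ∫⁻ y', ‖F₀ (y' + k) - F₀ y'‖ₑ ^ 2)
      (𝓝[>] 0) (𝓝 0) := by
  set C : ℝ≥0∞ := ofReal (κ ^ n * unitVol n) with hC
  have hC0 : C ≠ 0 := by
    rw [hC, Ne, ofReal_eq_zero, not_le]
    exact mul_pos (by positivity) (unitVol_pos n)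
  have hCtop : C ≠ ∞ := ofReal_ne_top
  rw [ENNReal.tendsto_nhds_zero]
  intro δ hδ
  have hlim : Tendsto (fun k : Euc n => ∫⁻ y', ‖F₀ (y' + k) - F₀ y'‖ₑ ^ 2) (𝓝 0) (𝓝 0) := by
    have := ENNReal.Tendsto.pow (n := 2) (tendsto_eLpNorm_translate hF₀L)
    simpa only [eLpNorm_two_sq, zero_pow two_ne_zero] using this
  have h1 : ∀ᶠ k in 𝓝 (0 : Euc n), ∫⁻ y', ‖F₀ (y' + k) - F₀ y'‖ₑ ^ 2 ≤ δ / C :=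
    ENNReal.tendsto_nhds_zero.1 hlim _ (ENNReal.div_pos hδ.ne' hCtop)
  obtain ⟨r, hr, hball⟩ := Metric.eventually_nhds_iff_ball.1 h1
  have h2 : ∀ᶠ ε : ℝ in 𝓝[>] 0, ε < r / κ := nhdsWithin_le_nhds (Iio_mem_nhds (by positivity))
  filter_upwards [h2, self_mem_nhdsWithin] with ε hε1 (hε : 0 < ε)
  have h3 : κ * ε < r := by rw [lt_div_iff₀ hκ] at hε1; linarith
  calc _ ≤ ofReal (ε ^ n)⁻¹ * ∫⁻ k in ball (0 : Euc n) (κ * ε), δ / C := by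
        refine mul_le_mul_right ?_ _
        exact setLIntegral_mono' measurableSet_ball fun k hk => hball k (ball_subset_ball h3.le hk)
    _ = ofReal (ε ^ n)⁻¹ * (δ / C * (C * ofReal (ε ^ n))) := by
        rw [setLIntegral_const, volume_ball_eq _ (by positivity), hC, ← ofReal_mul
          (mul_nonneg (by positivity) (unitVol_pos _).le), mul_pow]
        ring_nf
    _ = (ofReal (ε ^ n)⁻¹ * ofReal (ε ^ n)) * (δ / C * C) := by ring
    _ ≤ 1 * δ := by
        gcongr
        · rw [← ofReal_mul (by positivity), inv_mul_cancel₀ (by positivity)]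
          simp
        · exact (ENNReal.div_mul_cancel hC0 hCtop).le
    _ = δ := one_mul _

/-- A function with square integrable nontangential maximal function converges to its
nontangential limit in mean square on the boundary layers. -/
lemma tendsto_slab_of_hasNTLimit (hτ : IsSgn τ) (hΨ : LipschitzWith M Ψ) (hκ : 1 < κ)
    (hF : Measurable F) (hF₀ : Measurable F₀) (hF₀L : MemLp F₀ 2)
    (hN : Measurable N) (hNfin : ∫⁻ z, N z ^ 2 < ∞)
    (hFN : ∀ᵐ z, ∀ᵐ y ∂volume.restrict (gCone τ Ψ κ (bdryPt Ψ z)), ‖F y‖ₑ ≤ N z)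
    (hF₀N : ∀ᵐ z, ‖F₀ z‖ₑ ≤ N z)
    (hlim : ∀ᵐ z, GLimit τ Ψ κ F (bdryPt Ψ z) (F₀ z)) :
    Tendsto (fun ε : ℝ => ∫⁻ x, ‖F x - F₀ (horiz x)‖ₑ ^ 2 ∂slab τ Ψ ε) (𝓝[>] 0) (𝓝 0) := by
  obtain ⟨c, hc, hcone⟩ := exists_coneRel_volume n M κ hκ
  have h1 := tendsto_coneLayerInt hτ hΨ hκ hF hF₀ hN hNfin hFN hF₀N hlim
  have h2 := tendsto_ball_translate hF₀L (κ := 2 * κ) (by positivity)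
  have h3 : Tendsto (fun ε : ℝ => ofReal c⁻¹ *
      (2 * (ofReal (ε ^ (n + 1))⁻¹ * ∫⁻ z, coneLayerInt τ Ψ κ F F₀ ε z)
        + 2 * (ofReal (ε ^ n)⁻¹ * ∫⁻ k in ball (0 : Euc n) (2 * κ * ε),
          ∫⁻ y', ‖F₀ (y' + k) - F₀ y'‖ₑ ^ 2))) (𝓝[>] 0) (𝓝 0) := by
    have h4 := ENNReal.Tendsto.const_mul (a := 2) h1 (Or.inr (by simp))
    have h5 := ENNReal.Tendsto.const_mul (a := 2) h2 (Or.inr (by simp))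
    have h6 := ENNReal.Tendsto.const_mul (a := ofReal c⁻¹) (h4.add h5) (Or.inr ofReal_ne_top)
    simpa using h6
  refine tendsto_nhds_bot_mono h3 ?_
  filter_upwards [self_mem_nhdsWithin] with ε (hε : 0 < ε)
  have key := layer_lintegral_le hτ hΨ hκ hF hF₀ hc hε (hcone τ hτ Ψ hΨ)
  rw [lintegral_slab]
  set X := ∫⁻ x in layer τ Ψ ε (2 * ε), ‖F x - F₀ (horiz x)‖ₑ ^ 2
  set P := ∫⁻ z, coneLayerInt τ Ψ κ F F₀ ε z
  set Q := ∫⁻ k in ball (0 : Euc n) (2 * κ * ε), ∫⁻ y', ‖F₀ (y' + k) - F₀ y'‖ₑ ^ 2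
  have e1 : ofReal ε⁻¹ = ofReal c⁻¹ * ofReal (ε ^ (n + 1))⁻¹ * ofReal (c * ε ^ n) := by
    rw [← ofReal_mul (by positivity), ← ofReal_mul (by positivity)]
    congr 1
    field_simp
    ring
  have e2 : ofReal (ε ^ (n + 1))⁻¹ * ofReal ε = ofReal (ε ^ n)⁻¹ := by
    rw [← ofReal_mul (by positivity)]
    congr 1
    field_simp
    ring
  calc ofReal ε⁻¹ * X = ofReal c⁻¹ * ofReal (ε ^ (n + 1))⁻¹ *
        (ofReal (c * ε ^ n) * X) := by rw [e1, mul_assoc]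
    _ ≤ ofReal c⁻¹ * ofReal (ε ^ (n + 1))⁻¹ *
        (2 * P + 2 * (ofReal ε * Q)) := by gcongr
    _ = ofReal c⁻¹ * (2 * (ofReal (ε ^ (n + 1))⁻¹ * P)
        + 2 * (ofReal (ε ^ (n + 1))⁻¹ * ofReal ε * Q)) := by ring
    _ = _ := by rw [e2]

end SlabLimit

/-! ### Bounds and measurability of nontangential limits -/

section NTLimits

variable {n : ℕ} {τ : ℝ} {M : ℝ≥0} {Ψ : Euc n → ℝ} {κ : ℝ} {F : Pt n → Pt n} {F₀ : Euc n → Pt n}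

/-- By Rademacher's theorem the graph has a tangent plane almost everywhere. Positivity matters:
means over null sets would make the nontangential limit carry no information. -/
lemma ae_cone_volume_pos (hτ : IsSgn τ) (hΨ : LipschitzWith M Ψ) (hκ : 1 < κ) :
    ∀ᵐ z : Euc n, ∀ r > 0, volume (gCone τ Ψ κ (bdryPt Ψ z) ∩ ball (bdryPt Ψ z) r) ≠ 0 := by
  obtain ⟨c, hc, h⟩ := exists_cone_volume n M κ hκ
  filter_upwards [hΨ.ae_differentiableAt] with z hz r hr
  obtain ⟨r₀, hr₀, h1⟩ := h τ hτ Ψ hΨ z hz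
  have hs : 0 < min r (r₀ / 2) := lt_min hr (by positivity)
  have h2 := h1 _ hs ((min_le_right _ _).trans_lt (by linarith))
  have h3 : (0 : ℝ≥0∞) < ofReal (c * min r (r₀ / 2) ^ (n + 1)) := ofReal_pos.2 (by positivity)
  refine (h3.trans_le (h2.trans (measure_mono ?_))).ne'
  exact inter_subset_inter_right _ (ball_subset_ball (min_le_left _ _))

lemma isFiniteMeasure_restrict_inter_ball {d : ℕ} (S : Set (Euc d)) (z : Euc d) (r : ℝ) :
    IsFiniteMeasure ((volume : Measure (Euc d)).restrict (S ∩ ball z r)) :=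
  ⟨by rw [Measure.restrict_apply_univ]
      exact (measure_mono inter_subset_right).trans_lt measure_ball_lt_top⟩

lemma neZero_restrict {d : ℕ} {S : Set (Euc d)} (h : volume S ≠ 0) :
    NeZero ((volume : Measure (Euc d)).restrict S) := ⟨by simpa using h⟩

lemma ae_ntMax {d : ℕ} {E : Type*} [NormedAddCommGroup E] (D S : Set (Euc d)) (κ : ℝ)
    (f : Euc d → E) (z : Euc d) :
    ∀ᵐ y ∂volume.restrict (ntCone D S κ z), ‖f y‖ₑ ≤ ntMax D S κ f z :=
  ENNReal.ae_le_essSup _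

/-- The nontangential limit is bounded by the nontangential maximal function. -/
lemma ae_enorm_ntLimit_le (hτ : IsSgn τ) (hΨ : LipschitzWith M Ψ) (hκ : 1 < κ)
    (hlim : ∀ᵐ z, GLimit τ Ψ κ F (bdryPt Ψ z) (F₀ z)) :
    ∀ᵐ z, ‖F₀ z‖ₑ ≤ gMax τ Ψ κ F (bdryPt Ψ z) := by
  filter_upwards [hlim, ae_cone_volume_pos hτ hΨ hκ] with z hz hpos
  set Γ := gCone τ Ψ κ (bdryPt Ψ z)
  have h1 : ∀ r > 0, ‖F₀ z‖ₑ ≤ gMax τ Ψ κ F (bdryPt Ψ z)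
      + laverage (volume.restrict (Γ ∩ ball (bdryPt Ψ z) r)) (fun x => ‖F x - F₀ z‖ₑ) := by
    intro r hr
    have := isFiniteMeasure_restrict_inter_ball Γ (bdryPt Ψ z) r
    have := neZero_restrict (hpos r hr)
    set m := volume.restrict (Γ ∩ ball (bdryPt Ψ z) r)
    have h2 : ∀ᵐ y ∂m, ‖F y‖ₑ ≤ gMax τ Ψ κ F (bdryPt Ψ z) :=
      ae_restrict_of_ae_restrict_of_subset inter_subset_left (ae_ntMax _ _ _ _ _)
    have hac : (m univ)⁻¹ • m ≪ m := Measure.smul_absolutelyContinuous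
    calc ‖F₀ z‖ₑ = laverage m (fun _ => ‖F₀ z‖ₑ) := (laverage_const m _).symm
      _ ≤ laverage m (fun x => gMax τ Ψ κ F (bdryPt Ψ z)
          + ‖F x - F₀ z‖ₑ) := by
          rw [laverage_eq', laverage_eq']
          refine lintegral_mono_ae (hac.ae_le ?_)
          filter_upwards [h2] with y hy
          have e : F₀ z = F y - (F y - F₀ z) := by abel
          calc ‖F₀ z‖ₑ = ‖F y - (F y - F₀ z)‖ₑ := by rw [← e]
            _ ≤ ‖F y‖ₑ + ‖F y - F₀ z‖ₑ := enorm_sub_le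
            _ ≤ _ := by gcongr
      _ = _ := by
          rw [laverage_eq', lintegral_add_left measurable_const, ← laverage_eq', ← laverage_eq',
            laverage_const]
  have h3 : Tendsto (fun r : ℝ => gMax τ Ψ κ F (bdryPt Ψ z)
      + laverage (volume.restrict (Γ ∩ ball (bdryPt Ψ z) r)) (fun x => ‖F x - F₀ z‖ₑ))
      (𝓝[>] 0) (𝓝 (gMax τ Ψ κ F (bdryPt Ψ z) + 0)) :=
    tendsto_const_nhds.add hz
  rw [add_zero] at h3
  refine ge_of_tendsto h3 ?_
  filter_upwards [self_mem_nhdsWithin] with r hr using h1 r hr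

/-- The nontangential limit is a measurable function of the boundary point. -/
lemma aemeasurable_ntLimit (hτ : IsSgn τ) (hΨ : LipschitzWith M Ψ) (hκ : 1 < κ) (hF : Measurable F)
    (hfin : ∀ᵐ z, gMax τ Ψ κ F (bdryPt Ψ z) < ∞)
    (hlim : ∀ᵐ z, GLimit τ Ψ κ F (bdryPt Ψ z) (F₀ z)) :
    AEMeasurable F₀ := by
  set S : ℕ → Set (Pt n × Euc n) := fun k => coneRel τ Ψ κ ∩
    {p | dist p.1 (bdryPt Ψ p.2) < 1 / (k + 1 : ℝ)}
  have hSo : ∀ k, MeasurableSet (S k) := fun k => by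
    refine ((isOpen_coneRel hΨ).inter ?_).measurableSet
    exact isOpen_lt (continuous_fst.dist ((continuous_bdryPt hΨ).comp continuous_snd))
      continuous_const
  set T : ℕ → Euc n → Set (Pt n) := fun k z =>
    gCone τ Ψ κ (bdryPt Ψ z) ∩ ball (bdryPt Ψ z) (1 / (k + 1 : ℝ))
   
  have hTm : ∀ k z, MeasurableSet (T k z) := fun k z =>
    ((isOpen_ntCone hΨ _).inter isOpen_ball).measurableSet
  have hmemS : ∀ k z y, (y, z) ∈ S k ↔ y ∈ T k z := fun k z y => Iff.rfl
  -- Averages of F over the approach region cut at radius 1/(k + 1). They depend measurably on z by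
  -- Fubini and converge to the nontangential limit.
  set a : ℕ → Euc n → Pt n := fun k z =>
    (volume (T k z)).toReal⁻¹ • ∫ y, (S k).indicator (fun p => F p.1) (y, z)
  have ham : ∀ k, AEMeasurable (a k) := fun k => by
    have h1 : StronglyMeasurable ((S k).indicator fun p => F p.1) :=
      ((hF.comp measurable_fst).stronglyMeasurable).indicator (hSo k)
    have h2 : Measurable fun z => volume (T k z) := measurable_measure_prodMk_right (hSo k)
    have h3 := h1.integral_prod_left' (μ := (volume : Measure (Pt n)))
    exact (h2.ennreal_toReal.inv.smul h3.measurable).aemeasurable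
  refine aemeasurable_of_tendsto_metrizable_ae atTop ham ?_
  filter_upwards [hlim, hfin, ae_cone_volume_pos hτ hΨ hκ] with z hz hN hpos
  have hlk : Tendsto (fun k : ℕ => 1 / ((k : ℝ) + 1)) atTop (𝓝[>] 0) :=
    tendsto_nhdsWithin_iff.2 ⟨tendsto_one_div_add_atTop_nhds_zero_nat,
      Eventually.of_forall fun k => (by positivity : (0 : ℝ) < 1 / ((k : ℝ) + 1))⟩
  have hz' := Tendsto.comp hz hlk
  rw [tendsto_iff_edist_tendsto_0]
  refine tendsto_nhds_bot_mono hz' <| .of_forall fun k => ?_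
  beta_reduce
  have hk : (0 : ℝ) < 1 / ((k : ℝ) + 1) := by positivity
  have hfinm : IsFiniteMeasure (volume.restrict (T k z)) :=
    isFiniteMeasure_restrict_inter_ball _ _ _
  have hvol0 : volume (T k z) ≠ 0 := hpos _ hk
  have hvolt : volume (T k z) ≠ ∞ := by
    have := hfinm.1
    rw [Measure.restrict_apply_univ] at this
    exact this.ne
  have hFi : IntegrableOn F (T k z) := by
    refine ⟨hF.aestronglyMeasurable, ?_⟩
    refine lt_of_le_of_lt (lintegral_mono_ae
      (ae_restrict_of_ae_restrict_of_subset inter_subset_left (ae_ntMax _ _ _ F _))) ?_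
    rw [lintegral_const]
    exact mul_lt_top hN hfinm.1
  have e1 : ∫ y, (S k).indicator (fun p => F p.1) (y, z) = ∫ y in T k z, F y := by
    rw [← integral_indicator (hTm k z)]
    rfl
  have e2 : a k z - F₀ z = (volume (T k z)).toReal⁻¹ • ∫ y in T k z, (F y - F₀ z) := by
    have h5 : (volume (T k z)).toReal ≠ 0 := ENNReal.toReal_ne_zero.2 ⟨hvol0, hvolt⟩
    rw [integral_sub hFi (integrable_const _), integral_const, smul_sub, measureReal_def,
      Measure.restrict_apply_univ, smul_smul, inv_mul_cancel₀ h5, one_smul, ← e1]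
  rw [edist_eq_enorm_sub, e2, enorm_smul]
  calc _ ≤ ‖(volume (T k z)).toReal⁻¹‖ₑ * ∫⁻ y in T k z, ‖F y - F₀ z‖ₑ := by
        gcongr; exact enorm_integral_le_lintegral_enorm _
    _ = laverage (volume.restrict (T k z)) (fun x => ‖F x - F₀ z‖ₑ) := by
        rw [laverage_eq, Measure.restrict_apply_univ, ENNReal.div_eq_inv_mul]
        congr 1
        rw [← ENNReal.toReal_inv, Real.enorm_of_nonneg toReal_nonneg,
          ofReal_toReal (ENNReal.inv_ne_top.2 hvol0)]

/-- Square integrability near the boundary. -/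
lemma lintegral_layer_sq_lt_top (hτ : IsSgn τ) (hΨ : LipschitzWith M Ψ) (hκ : 1 < κ)
    (hF : Measurable F)
    (hN : ∫⁻ z, gMax τ Ψ κ F (bdryPt Ψ z) ^ 2 < ∞) (T : ℝ) :
    ∫⁻ x in layer τ Ψ 0 T, ‖F x‖ₑ ^ 2 < ∞ := by
  obtain ⟨c, hc, hcone⟩ := exists_coneRel_volume n M κ hκ
  set N := fun z => gMax τ Ψ κ F (bdryPt Ψ z) with hNdef
  have hNm : Measurable N := measurable_ntMax hΨ hF
  have hdm := (continuous_depth (τ := τ) hΨ).measurable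
  have hhm := measurable_horiz (n := n)
  -- The inverse of the lower bound for the measure of the set of boundary points that see y. It
  -- lets |F(y)|² be replaced by an integral over these points, after which Fubini brings in the
  -- maximal function.
  set w : Pt n → ℝ≥0∞ := fun y => ofReal (c * depth τ Ψ y ^ n)⁻¹ with hw
  have hwm : Measurable w := by fun_prop
  have hIm : Measurable ((coneRel τ Ψ κ).indicator fun p => w p.1 * ‖F p.1‖ₑ ^ 2) :=
    Measurable.indicator (by fun_prop) (isOpen_coneRel hΨ).measurableSet
  set Cc : ℝ≥0∞ := ofReal (c⁻¹ * (κ ^ n * unitVol n)) with hCc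
  -- At each depth t the slice has volume of order tⁿ and the weight is of order t⁻ⁿ, so the
  -- integral over depths up to T is of order T.
  have hinner : ∀ z, ∫⁻ y in layer τ Ψ 0 T, {y | ‖z - horiz y‖ < κ * depth τ Ψ y}.indicator w y
      ≤ Cc * ofReal T := by
    intro z
    have hset : MeasurableSet {y : Pt n | ‖z - horiz y‖ < κ * depth τ Ψ y} :=
      measurableSet_lt (by fun_prop) (by fun_prop)
    rw [layer, lintegral_depth_preimage hτ hΨ measurableSet_Ioo (hwm.indicator hset)]
    calc _ ≤ ∫⁻ _ in Ioo 0 T, Cc := by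
          refine setLIntegral_mono' measurableSet_Ioo fun t ht => ?_
          have ht0 : 0 < t := ht.1
          calc _ = ∫⁻ x' : Euc n, {x' : Euc n | ‖x' - z‖ < κ * t}.indicator
                (fun _ => ofReal (c * t ^ n)⁻¹) x' := by
                refine lintegral_congr fun x' => ?_
                simp only [indicator, mem_ofPred_eq, horiz_graphPt, depth_graphPt hτ, hw,
                  norm_sub_rev z]
            _ = ofReal (c * t ^ n)⁻¹ * ofReal ((κ * t) ^ n * unitVol n) := by
                rw [lintegral_indicator_const (measurableSet_lt (by fun_prop) (by fun_prop)),
                  volume_horiz_ball_le z (by positivity)]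
            _ = Cc := by
                rw [← ofReal_mul (by positivity), hCc]
                congr 1
                have := hc.ne'
                field_simp
                rw [mul_pow]; ring
            _ ≤ Cc := le_rfl
      _ = _ := by simp
  have hpt : ∀ y ∈ layer τ Ψ 0 T, ‖F y‖ₑ ^ 2
      ≤ ∫⁻ z, (coneRel τ Ψ κ).indicator (fun p => w p.1 * ‖F p.1‖ₑ ^ 2) (y, z) := by
    intro y hy
    have hyD : y ∈ graphDom τ Ψ := layer_subset le_rfl hy
    have ht : 0 < depth τ Ψ y := hyD
    have hZm : MeasurableSet {z : Euc n | (y, z) ∈ coneRel τ Ψ κ} :=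
      measurable_prodMk_left (isOpen_coneRel hΨ).measurableSet
    calc ‖F y‖ₑ ^ 2 = w y * ‖F y‖ₑ ^ 2 * ofReal (c * depth τ Ψ y ^ n) := by
          rw [mul_right_comm, hw, ← ofReal_mul (by positivity), inv_mul_cancel₀ (by positivity)]
          simp
      _ ≤ w y * ‖F y‖ₑ ^ 2 * volume {z : Euc n | (y, z) ∈ coneRel τ Ψ κ} := by
          gcongr; exact hcone τ hτ Ψ hΨ y hyD
      _ = _ := by
          rw [← lintegral_indicator_const hZm]
          rfl
  calc _ ≤ ∫⁻ y in layer τ Ψ 0 T, ∫⁻ z,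
        (coneRel τ Ψ κ).indicator (fun p => w p.1 * ‖F p.1‖ₑ ^ 2) (y, z) :=
        setLIntegral_mono' (measurableSet_layer hΨ _ _) hpt
    _ = ∫⁻ z, ∫⁻ y in layer τ Ψ 0 T,
        (coneRel τ Ψ κ).indicator (fun p => w p.1 * ‖F p.1‖ₑ ^ 2) (y, z) :=
        lintegral_lintegral_swap (f := fun y z => (coneRel τ Ψ κ).indicator
          (fun p => w p.1 * ‖F p.1‖ₑ ^ 2) (y, z)) hIm.aemeasurable
    _ ≤ ∫⁻ z, N z ^ 2 * (Cc * ofReal T) := by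
        refine lintegral_mono fun z => ?_
        have h1 : ∀ᵐ y, y ∈ gCone τ Ψ κ (bdryPt Ψ z) → ‖F y‖ₑ ≤ N z :=
          (ae_restrict_iff' (isOpen_ntCone hΨ _).measurableSet).1 (ae_ntMax _ _ _ F _)
        have hset : MeasurableSet {y : Pt n | ‖z - horiz y‖ < κ * depth τ Ψ y} :=
          measurableSet_lt (by fun_prop) (by fun_prop)
        calc _ ≤ ∫⁻ y in layer τ Ψ 0 T,
              N z ^ 2 * {y | ‖z - horiz y‖ < κ * depth τ Ψ y}.indicator w y := by
              refine lintegral_mono_ae (ae_restrict_of_ae ?_)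
              filter_upwards [h1] with y hy
              by_cases hyz : (y, z) ∈ coneRel τ Ψ κ
              · rw [indicator_of_mem hyz, indicator_of_mem
                  (show y ∈ {y | ‖z - horiz y‖ < κ * depth τ Ψ y} from
                    coneRel_horiz_lt hτ hκ hyz), mul_comm]
                gcongr
                exact hy hyz
              · rw [indicator_of_notMem hyz]; exact zero_le
          _ = N z ^ 2 * ∫⁻ y in layer τ Ψ 0 T,
              {y | ‖z - horiz y‖ < κ * depth τ Ψ y}.indicator w y :=
              lintegral_const_mul _ (hwm.indicator hset)
          _ ≤ _ := by gcongr; exact hinner z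
    _ = (∫⁻ z, N z ^ 2) * (Cc * ofReal T) := lintegral_mul_const _ (by fun_prop)
    _ < ∞ := mul_lt_top hN (mul_lt_top ofReal_lt_top ofReal_lt_top)

end NTLimits

/-- Cauchy–Schwarz for extended nonnegative functions, stated with squares so that infinite values
need no separate treatment. -/
lemma lintegral_mul_sq_le {X : Type*} [MeasurableSpace X] {m : Measure X} {f g : X → ℝ≥0∞}
    (hf : AEMeasurable f m) (hg : AEMeasurable g m) :
    (∫⁻ x, f x * g x ∂m) ^ 2 ≤ (∫⁻ x, f x ^ 2 ∂m) * ∫⁻ x, g x ^ 2 ∂m := by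
  have h := ENNReal.lintegral_mul_le_Lp_mul_Lq m Real.HolderConjugate.two_two hf hg
  have e : ∀ a : ℝ≥0∞, (a ^ (1 / (2 : ℝ))) ^ 2 = a := fun a => by
    rw [← ENNReal.rpow_natCast, ← ENNReal.rpow_mul]; norm_num
  refine (pow_le_pow_left₀ zero_le h 2).trans_eq ?_
  rw [mul_pow, e, e]
  simp

lemma setLIntegral_sq_le {X : Type*} [MeasurableSpace X] {m : Measure X} {s : Set X} {f : X → ℝ≥0∞}
    (hf : AEMeasurable f (m.restrict s)) :
    (∫⁻ x in s, f x ∂m) ^ 2 ≤ m s * ∫⁻ x in s, f x ^ 2 ∂m := by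
  simpa using lintegral_mul_sq_le (f := fun _ => 1) aemeasurable_const hf

/-- A measurable function on `(0, 2)` that is invariant under almost every translation is
constant. -/
lemma ae_eq_average_of_ae_translate {W : ℝ → ℝ}
    (h : ∀ᵐ t : ℝ, ∀ᵐ r : ℝ, r ≤ 0 ∨ t ≤ 0 ∨ 2 ≤ t + r ∨ W (t + r) = W t) :
    ∀ᵐ t ∂volume.restrict (Ioo (0 : ℝ) 2), W t = ∫ s in Ioo (1 : ℝ) 2, W s := by
  have h1 : ∀ᵐ t : ℝ, ∀ᵐ s : ℝ, s ∈ Ioo t 2 → 0 < t → W s = W t := by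
    filter_upwards [h] with t ht
    have h2 := (quasiMeasurePreserving_add_right volume (-t)).ae ht
    filter_upwards [h2] with s hs hst h0
    have e : t + (s + -t) = s := by ring
    rw [e] at hs
    rcases hs with h3 | h3 | h3 | h3
    · linarith [hst.1]
    · linarith
    · linarith [hst.2]
    · exact h3
  -- Two good points are compared through a common later s, which exists since (t₂, 2) has positive
  -- measure.
  have hpair : ∀ t₁ t₂ : ℝ, 0 < t₁ → t₁ < t₂ → t₂ < 2 →
      (∀ᵐ s : ℝ, s ∈ Ioo t₁ 2 → 0 < t₁ → W s = W t₁) →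
      (∀ᵐ s : ℝ, s ∈ Ioo t₂ 2 → 0 < t₂ → W s = W t₂) → W t₁ = W t₂ := by
    intro t₁ t₂ h0 h12 h2 g1 g2
    have hne : (volume (Ioo t₂ 2)) ≠ 0 := by simp [h2]
    have hfr : ∃ᵐ s : ℝ, s ∈ Ioo t₂ 2 := frequently_ae_mem_iff.2 hne
    obtain ⟨s, hs, hs1, hs2⟩ := (hfr.and_eventually (g1.and g2)).exists
    rw [← hs1 ⟨h12.trans hs.1, hs.2⟩ h0, hs2 hs (h0.trans h12)]
  refine (ae_restrict_iff' measurableSet_Ioo).2 ?_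
  filter_upwards [h1] with t ht htI
  have h3 : ∀ᵐ s ∂volume.restrict (Ioo (1 : ℝ) 2), W s = W t := by
    refine (ae_restrict_iff' measurableSet_Ioo).2 ?_
    filter_upwards [h1] with s hs hsI
    have hs0 : 0 < s := zero_lt_one.trans hsI.1
    rcases lt_trichotomy s t with h4 | h4 | h4
    · exact hpair s t hs0 h4 htI.2 hs ht
    · rw [h4]
    · exact (hpair t s htI.1 h4 hsI.2 ht hs).symm
  rw [integral_congr_ae h3]
  norm_num

/-! ### The trace along vertical lines -/

section Trace

variable {n : ℕ} {τ : ℝ} {M : ℝ≥0} {Ψ : Euc n → ℝ} {u : Pt n → ℝ} {g : Pt n → Pt n}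

/-- The square of the gradient, integrated along a vertical segment. -/
def vertEnergy (τ : ℝ) (Ψ : Euc n → ℝ) (g : Pt n → Pt n) (x' : Euc n) : ℝ≥0∞ :=
  ∫⁻ s in Ioo (0 : ℝ) 2, ‖g (graphPt τ Ψ (x', s))‖ₑ ^ 2

lemma measurable_vertEnergy (hΨ : LipschitzWith M Ψ) (hgm : Measurable g) :
    Measurable (vertEnergy τ Ψ g) := by
  have h1 := (continuous_graphPt (τ := τ) hΨ).measurable
  have h2 : Measurable fun p : Euc n × ℝ => ‖g (graphPt τ Ψ p)‖ₑ ^ 2 := by fun_prop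
  exact h2.lintegral_prod_right'

lemma lintegral_vertEnergy (hτ : IsSgn τ) (hΨ : LipschitzWith M Ψ) (hgm : Measurable g) :
    ∫⁻ x', vertEnergy τ Ψ g x' = ∫⁻ x in layer τ Ψ 0 2, ‖g x‖ₑ ^ 2 := by
  have h1 := (continuous_graphPt (τ := τ) hΨ).measurable
  have h2 : Measurable fun p : Euc n × ℝ => ‖g (graphPt τ Ψ p)‖ₑ ^ 2 := by fun_prop
  rw [layer, lintegral_depth_preimage hτ hΨ measurableSet_Ioo (by fun_prop)]
  exact lintegral_lintegral_swap (f := fun x' s => ‖g (graphPt τ Ψ (x', s))‖ₑ ^ 2) h2.aemeasurable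

/-- The boundary trace of a Sobolev function. -/
lemma exists_trace (hτ : IsSgn τ) (hΨ : LipschitzWith M Ψ)
    (hu : HasWeakGrad (graphDom τ Ψ) u g) (hum : Measurable u) (hgm : Measurable g)
    (hE : ∫⁻ x in layer τ Ψ 0 2, ‖g x‖ₑ ^ 2 < ∞) :
    ∃ u₀ : Euc n → ℝ, Measurable u₀ ∧ ∀ᵐ x', ∀ᵐ t ∂volume.restrict (Ioo (0 : ℝ) 2),
      ‖u (graphPt τ Ψ (x', t)) - u₀ x'‖ₑ ^ 2 ≤ ofReal t * vertEnergy τ Ψ g x' := by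
  have hcm := (continuous_graphPt (τ := τ) hΨ).measurable
  set γ : Euc n × ℝ → ℝ := fun p => inner ℝ (g (graphPt τ Ψ p)) (vert n τ) with hγ
  have hγm : Measurable γ := by fun_prop
  have hγle : ∀ p, ‖γ p‖ₑ ≤ ‖g (graphPt τ Ψ p)‖ₑ := fun p => by
    rw [← ofReal_norm, ← ofReal_norm]
    exact ofReal_le_ofReal (abs_inner_vert_le hτ _)
  clear_value γ
  -- On almost every vertical line, u minus the integral of its vertical derivative γ from depth 0
  -- should be constant in the depth; the constant is the trace.
  set W : Euc n × ℝ → ℝ := fun p =>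
    u (graphPt τ Ψ p) - ∫ s, (Ioo 0 p.2).indicator (fun s => γ (p.1, s)) s with hW
  have hWm : Measurable W := by
    have h0 : MeasurableSet {q : (Euc n × ℝ) × ℝ | 0 < q.2} :=
      measurableSet_lt (by fun_prop) (by fun_prop)
    have h0' : MeasurableSet {q : (Euc n × ℝ) × ℝ | q.2 < q.1.2} :=
      measurableSet_lt (by fun_prop) (by fun_prop)
    have h1 : StronglyMeasurable fun q : (Euc n × ℝ) × ℝ =>
        {q : (Euc n × ℝ) × ℝ | 0 < q.2 ∧ q.2 < q.1.2}.indicator (fun q => γ (q.1.1, q.2)) q := by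
      refine (Measurable.indicator (by fun_prop) ?_).stronglyMeasurable
      exact h0.inter h0'
    exact (hum.comp hcm).sub h1.integral_prod_right'.measurable
  have hIfin : ∀ᵐ x', vertEnergy τ Ψ g x' < ∞ := by
    refine ae_lt_top (measurable_vertEnergy hΨ hgm) ?_
    rw [lintegral_vertEnergy hτ hΨ hgm]
    exact hE.ne
  have hγint : ∀ x', vertEnergy τ Ψ g x' < ∞ → IntegrableOn (fun s => γ (x', s)) (Ioo 0 2) := by
    intro x' hx'
    have hm : Measurable fun s => γ (x', s) := by fun_prop
    refine MemLp.integrable (q := 2) (by norm_num) ⟨hm.aestronglyMeasurable, ?_⟩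
    have h1 : eLpNorm (fun s => γ (x', s)) 2 (volume.restrict (Ioo 0 2)) ^ 2 < ∞ := by
      rw [eLpNorm_two_sq]
      refine lt_of_le_of_lt (lintegral_mono fun s => ?_) hx'
      exact ENNReal.pow_le_pow_left (hγle _)
    by_contra hcon
    rw [not_lt_top_iff.1 hcon] at h1
    simp at h1
  have hind : ∀ x' t, 0 ≤ t → ∫ s, (Ioo 0 t).indicator (fun s => γ (x', s)) s
      = ∫ s in (0 : ℝ)..t, γ (x', s) := fun x' t ht => by
    rw [integral_indicator measurableSet_Ioo, intervalIntegral.integral_of_le ht,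
      integral_Ioc_eq_integral_Ioo]
  have step : ∀ r : ℝ, ∀ᵐ p : Euc n × ℝ,
      r ≤ 0 ∨ p.2 ≤ 0 ∨ 2 ≤ p.2 + r ∨ W (p.1, p.2 + r) = W p := by
    intro r
    rcases le_or_gt r 0 with hr | hr
    · exact Eventually.of_forall fun p => Or.inl hr
    have hseg : ∀ x ∈ graphDom τ Ψ, ∀ s ∈ 𝕀, x + s • (r • vert n τ) ∈ graphDom τ Ψ := by
      intro x hx s hs
      change 0 < depth τ Ψ _
      rw [smul_smul, depth_add_smul_vert hτ]
      have : 0 < depth τ Ψ x := hx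
      have := mul_nonneg hs.1 hr.le
      linarith
    have h1 := (measurePreserving_graphPt hτ hΨ).quasiMeasurePreserving.ae
      (hu.ae_sub_eq (isOpen_graphDom hΨ) hseg)
    have h2 : ∀ᵐ p : Euc n × ℝ, vertEnergy τ Ψ g p.1 < ∞ :=
      Measure.quasiMeasurePreserving_fst.ae hIfin
    filter_upwards [h1, h2] with p hp hI
    obtain ⟨x', t⟩ := p
    by_contra! hcon
    obtain ⟨-, ht, ht2, hne⟩ := hcon
    simp only at ht ht2 hne hI
    refine hne ?_
    have hD : graphPt τ Ψ (x', t) ∈ graphDom τ Ψ := by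
      change 0 < depth τ Ψ _
      rw [depth_graphPt hτ]; exact ht
    have h3 := hp hD
    rw [graphPt_add_smul_vert] at h3
    have h4 : ∫ s in 𝕀, inner ℝ (g (graphPt τ Ψ (x', t) + s • r • vert n τ)) (r • vert n τ)
        = ∫ s in t..(t + r), γ (x', s) := by
      rw [integral_Icc_eq_integral_Ioc, ← intervalIntegral.integral_of_le zero_le_one]
      have h5 := intervalIntegral.smul_integral_comp_add_mul (a := 0) (b := 1)
        (fun s => γ (x', s)) r t
      rw [mul_zero, mul_one, add_zero] at h5
      rw [← h5, ← intervalIntegral.integral_smul]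
      refine intervalIntegral.integral_congr fun s _ => ?_
      simp only [smul_eq_mul, hγ]
      rw [smul_smul, graphPt_add_smul_vert, inner_smul_right, mul_comm s r]
    rw [h4] at h3
    have hii : ∀ a b : ℝ, 0 ≤ a → a ≤ b → b < 2 →
        IntervalIntegrable (fun s => γ (x', s)) volume a b := fun a b ha hab hb => by
      rw [intervalIntegrable_iff_integrableOn_Ioc_of_le hab, integrableOn_Ioc_iff_integrableOn_Ioo]
      exact (hγint x' hI).mono_set (Ioo_subset_Ioo ha hb.le)
    have h6 := intervalIntegral.integral_add_adjacent_intervals (hii 0 t le_rfl ht.le (by linarith))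
      (hii t (t + r) ht.le (by linarith) ht2)
    simp only [hW]
    rw [hind _ _ ht.le, hind _ _ (by linarith)]
    linarith
  -- For each fixed shift r the null set of bad points depends on r. Measurability of the condition
  -- allows the order of the quantifiers to be exchanged.
  have hcomm : ∀ᵐ p : Euc n × ℝ, ∀ᵐ r : ℝ,
      r ≤ 0 ∨ p.2 ≤ 0 ∨ 2 ≤ p.2 + r ∨ W (p.1, p.2 + r) = W p := by
    refine (Measure.ae_ae_comm (p := fun (p : Euc n × ℝ) (r : ℝ) =>
      r ≤ 0 ∨ p.2 ≤ 0 ∨ 2 ≤ p.2 + r ∨ W (p.1, p.2 + r) = W p) ?_).2 (Eventually.of_forall step)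
    have m1 : MeasurableSet {q : (Euc n × ℝ) × ℝ | q.2 ≤ 0} :=
      measurableSet_le (by fun_prop) (by fun_prop)
    have m2 : MeasurableSet {q : (Euc n × ℝ) × ℝ | q.1.2 ≤ 0} :=
      measurableSet_le (by fun_prop) (by fun_prop)
    have m3 : MeasurableSet {q : (Euc n × ℝ) × ℝ | 2 ≤ q.1.2 + q.2} :=
      measurableSet_le (by fun_prop) (by fun_prop)
    have m4 : MeasurableSet {q : (Euc n × ℝ) × ℝ | W (q.1.1, q.1.2 + q.2) = W q.1} :=
      measurableSet_eq_fun (hWm.comp (by fun_prop)) (hWm.comp (by fun_prop))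
    exact m1.union (m2.union (m3.union m4))
  have hcomm' : ∀ᵐ x' : Euc n, ∀ᵐ t : ℝ, ∀ᵐ r : ℝ,
      r ≤ 0 ∨ t ≤ 0 ∨ 2 ≤ t + r ∨ W (x', t + r) = W (x', t) := by
    rw [Measure.volume_eq_prod] at hcomm
    exact Measure.ae_ae_of_ae_prod hcomm
  -- The constant value is recovered as a mean over an interval of length 1, a formula that is
  -- visibly measurable in the base point.
  refine ⟨fun x' => ∫ s in Ioo (1 : ℝ) 2, W (x', s), ?_, ?_⟩
  · exact (hWm.stronglyMeasurable.integral_prod_right' (ν := volume.restrict (Ioo (1 : ℝ) 2))).measurable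
  · filter_upwards [hcomm', hIfin] with x' hx' hI
    have h1 := ae_eq_average_of_ae_translate (W := fun t => W (x', t)) hx'
    filter_upwards [h1, ae_restrict_mem measurableSet_Ioo] with t ht htI
    rw [← ht]
    have e : u (graphPt τ Ψ (x', t)) - W (x', t) = ∫ s in Ioo 0 t, γ (x', s) := by
      rw [← integral_indicator measurableSet_Ioo]
      simp [hW]
    rw [e]
    calc _ ≤ (∫⁻ s in Ioo 0 t, ‖γ (x', s)‖ₑ) ^ 2 := by
          gcongr; exact enorm_integral_le_lintegral_enorm _
      _ ≤ volume (Ioo 0 t) * ∫⁻ s in Ioo 0 t, ‖γ (x', s)‖ₑ ^ 2 :=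
          setLIntegral_sq_le (by fun_prop)
      _ ≤ ofReal t * vertEnergy τ Ψ g x' := by
          rw [Real.volume_Ioo, sub_zero, vertEnergy]
          gcongr with s
          · exact htI.2.le
          · exact hγle _

end Trace

/-! ### Estimates for the trace and its agreement with the nontangential limit -/

section TraceBounds

variable {n : ℕ} {τ : ℝ} {M : ℝ≥0} {Ψ : Euc n → ℝ} {κ : ℝ} {u : Pt n → ℝ}
  {g : Pt n → Pt n} {u₀ : Euc n → ℝ}

lemma layer_mono {a a' b : ℝ} (h : a' ≤ a) : layer τ Ψ a b ⊆ layer τ Ψ a' b :=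
  preimage_mono (Ioo_subset_Ioo_left h)

/-- `u₀` is the boundary trace of a function `u` of finite energy near the boundary. -/
structure IsTrace (τ : ℝ) (M : ℝ≥0) (Ψ : Euc n → ℝ) (u : Pt n → ℝ) (g : Pt n → Pt n)
    (u₀ : Euc n → ℝ) : Prop where
  sgn : IsSgn τ
  lip : LipschitzWith M Ψ
  weak : HasWeakGrad (graphDom τ Ψ) u g
  meas_u : Measurable u
  meas_g : Measurable g
  meas_t : Measurable u₀
  energy : ∫⁻ x in layer τ Ψ 0 2, ‖g x‖ₑ ^ 2 < ∞
  ae_le : ∀ᵐ x', ∀ᵐ t ∂volume.restrict (Ioo (0 : ℝ) 2),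
    ‖u (graphPt τ Ψ (x', t)) - u₀ x'‖ₑ ^ 2 ≤ ofReal t * vertEnergy τ Ψ g x'

/-- One factor b comes from the pointwise bound at depth t ≤ b, the other from integration over the
depth. After division by a layer of thickness comparable to b one factor remains, hence convergence
on the layers. -/
lemma IsTrace.lintegral_layer_le (h : IsTrace τ M Ψ u g u₀) {b : ℝ} (hb : b ≤ 2) :
    ∫⁻ x in layer τ Ψ 0 b, ‖u x - u₀ (horiz x)‖ₑ ^ 2
      ≤ ofReal b ^ 2 * ∫⁻ x in layer τ Ψ 0 2, ‖g x‖ₑ ^ 2 := by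
  have ⟨hτ, hΨ, hu, hum, hgm, hu₀, hE, h0⟩ := h
  have hcm := (continuous_graphPt (τ := τ) hΨ).measurable
  have hhm := measurable_horiz (n := n)
  have h2 : Measurable fun p : ℝ × Euc n =>
      ‖u (graphPt τ Ψ (p.2, p.1)) - u₀ p.2‖ₑ ^ 2 := by fun_prop
  rw [layer, lintegral_depth_preimage hτ hΨ measurableSet_Ioo (by fun_prop)]
  simp only [horiz_graphPt]
  rw [lintegral_lintegral_swap (f := fun t x' => ‖u (graphPt τ Ψ (x', t)) - u₀ x'‖ₑ ^ 2)
    h2.aemeasurable, ← lintegral_vertEnergy hτ hΨ hgm,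
    ← lintegral_const_mul _ (measurable_vertEnergy hΨ hgm)]
  refine lintegral_mono_ae ?_
  filter_upwards [h0] with x' hx'
  calc _ ≤ ∫⁻ t in Ioo 0 b, ofReal b * vertEnergy τ Ψ g x' := by
        refine lintegral_mono_ae ?_
        filter_upwards [ae_restrict_of_ae_restrict_of_subset (Ioo_subset_Ioo_right hb) hx',
          ae_restrict_mem measurableSet_Ioo] with t ht htI
        refine ht.trans ?_
        gcongr
        exact htI.2.le
    _ = _ := by
        rw [setLIntegral_const, Real.volume_Ioo, sub_zero]
        ring

lemma IsTrace.tendsto_slab (h : IsTrace τ M Ψ u g u₀) :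
    Tendsto (fun ε : ℝ => ∫⁻ x, ‖u x - u₀ (horiz x)‖ₑ ^ 2 ∂slab τ Ψ ε) (𝓝[>] 0) (𝓝 0) := by
  have ⟨hτ, hΨ, hu, hum, hgm, hu₀, hE, h0⟩ := h
  have h1 : Tendsto (fun ε : ℝ => ofReal (4 * ε) * ∫⁻ x in layer τ Ψ 0 2, ‖g x‖ₑ ^ 2)
      (𝓝[>] 0) (𝓝 0) := by
    have h2 : Tendsto (fun ε : ℝ => ofReal (4 * ε)) (𝓝[>] 0) (𝓝 0) := by
      have : Continuous fun ε : ℝ => ofReal (4 * ε) := continuous_ofReal.comp (by fun_prop)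
      simpa using (this.tendsto 0).mono_left nhdsWithin_le_nhds
    simpa using ENNReal.Tendsto.mul_const h2 (Or.inr hE.ne)
  refine tendsto_nhds_bot_mono h1 ?_
  filter_upwards [self_mem_nhdsWithin, nhdsWithin_le_nhds (Iio_mem_nhds zero_lt_one)]
    with ε (hε : 0 < ε) (hε1 : ε < 1)
  rw [lintegral_slab]
  calc _ ≤ ofReal ε⁻¹ * ∫⁻ x in layer τ Ψ 0 (2 * ε), ‖u x - u₀ (horiz x)‖ₑ ^ 2 := by
        gcongr
        exact layer_mono hε.le
    _ ≤ ofReal ε⁻¹ * (ofReal (2 * ε) ^ 2 *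
          ∫⁻ x in layer τ Ψ 0 2, ‖g x‖ₑ ^ 2) := by
        gcongr
        exact h.lintegral_layer_le (by linarith)
    _ = _ := by
        rw [← mul_assoc, ← ofReal_pow (by positivity), ← ofReal_mul (by positivity)]
        congr 2
        field_simp
        ring

lemma isCompact_graphBox (hΨ : LipschitzWith M Ψ) (R a b : ℝ) :
    IsCompact (graphPt τ Ψ '' (closedBall 0 R ×ˢ Icc a b)) :=
  ((isCompact_closedBall 0 R).prod isCompact_Icc).image (continuous_graphPt hΨ)

lemma graphBox_subset (hτ : IsSgn τ) {R a b : ℝ} (ha : 0 < a) :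
    graphPt τ Ψ '' (closedBall 0 R ×ˢ Icc a b) ⊆ graphDom τ Ψ := by
  rintro _ ⟨p, hp, rfl⟩
  change 0 < depth τ Ψ _
  rw [depth_graphPt hτ]
  exact ha.trans_le hp.2.1

lemma IsTrace.lintegral_sub_lt_top (h : IsTrace τ M Ψ u g u₀) :
    ∫⁻ x in layer τ Ψ 0 2, ‖u x - u₀ (horiz x)‖ₑ ^ 2 < ∞ :=
  (h.lintegral_layer_le le_rfl).trans_lt
    (mul_lt_top (ENNReal.pow_lt_top ofReal_lt_top) h.energy)

/-- Between the depths 1 and 2, over a bounded part of the base, u is square integrable by the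
interior hypothesis and u − u₀ is by the energy bound. Integration over this layer of thickness 1
recovers the integral of u₀². -/
lemma IsTrace.lintegral_ball_lt_top (h : IsTrace τ M Ψ u g u₀) (R : ℝ) :
    ∫⁻ z in ball 0 R, ‖u₀ z‖ₑ ^ 2 < ∞ := by
  have ⟨hτ, hΨ, hu, hum, hgm, hu₀, hE, h0⟩ := h
  have hhm := measurable_horiz (n := n)
  set K := graphPt τ Ψ '' (closedBall 0 R ×ˢ Icc (1 : ℝ) 2)
  have hKc : IsCompact K := isCompact_graphBox hΨ R 1 2
  have hKD : K ⊆ graphDom τ Ψ := graphBox_subset hτ one_pos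
  have h1 : ∫⁻ x in K, ‖u x‖ₑ ^ 2 < ∞ := by
    rw [← eLpNorm_two_sq]
    exact ENNReal.pow_lt_top (hu.memLp K hKD hKc).2
  have h3 : ∫⁻ z in ball 0 R, ‖u₀ z‖ₑ ^ 2
      = ∫⁻ x in layer τ Ψ 1 2, (ball 0 R).indicator (fun z => ‖u₀ z‖ₑ ^ 2) (horiz x) := by
    rw [layer, lintegral_depth_preimage_horiz hτ hΨ measurableSet_Ioo
      (Measurable.indicator (by fun_prop) measurableSet_ball), Real.volume_Ioo,
      lintegral_indicator measurableSet_ball]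
    norm_num
  rw [h3]
  calc _ ≤ ∫⁻ x in layer τ Ψ 1 2, (2 * K.indicator (fun x => ‖u x‖ₑ ^ 2) x
        + 2 * ‖u x - u₀ (horiz x)‖ₑ ^ 2) := by
        refine setLIntegral_mono' (measurableSet_layer hΨ _ _) fun x hx => ?_
        by_cases hxR : horiz x ∈ ball (0 : Euc n) R
        · have hxK : x ∈ K := ⟨(horiz x, depth τ Ψ x),
            ⟨ball_subset_closedBall hxR, Ioo_subset_Icc_self hx⟩, graphPt_horiz_depth hτ x⟩
          rw [indicator_of_mem hxR, indicator_of_mem hxK]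
          have := enorm_sub_sq_le (u x) (u x - u₀ (horiz x))
          rwa [sub_sub_cancel] at this
        · rw [indicator_of_notMem hxR]; exact zero_le
    _ = 2 * (∫⁻ x in layer τ Ψ 1 2, K.indicator (fun x => ‖u x‖ₑ ^ 2) x)
        + 2 * ∫⁻ x in layer τ Ψ 1 2, ‖u x - u₀ (horiz x)‖ₑ ^ 2 := by
        have h4 : Measurable (K.indicator fun x => ‖u x‖ₑ ^ 2) :=
          Measurable.indicator (by fun_prop) hKc.measurableSet
        rw [lintegral_add_left (h4.const_mul 2), lintegral_const_mul _ h4,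
          lintegral_const_mul _ (by fun_prop)]
    _ ≤ 2 * (∫⁻ x in K, ‖u x‖ₑ ^ 2)
        + 2 * ∫⁻ x in layer τ Ψ 0 2, ‖u x - u₀ (horiz x)‖ₑ ^ 2 := by
        rw [← lintegral_indicator hKc.measurableSet]
        exact add_le_add (mul_le_mul_right (setLIntegral_le_lintegral _ _) _)
          (mul_le_mul_right (lintegral_mono_set (layer_mono zero_le_one)) _)
    _ < ∞ := ENNReal.add_lt_top.2 
      ⟨mul_lt_top (by simp) h1, mul_lt_top (by simp) h.lintegral_sub_lt_top⟩

/-- Local square integrability up to the boundary. -/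
lemma lintegral_inter_ball_lt_top (hΨ : LipschitzWith M Ψ) {E : Type*} [NormedAddCommGroup E]
    {f : Pt n → E} (hf : L2On (graphDom τ Ψ) f) {R : ℝ}
    (hE : ∫⁻ x in layer τ Ψ 0 2 ∩ ball 0 R, ‖f x‖ₑ ^ 2 < ∞) :
    ∫⁻ x in graphDom τ Ψ ∩ ball 0 R, ‖f x‖ₑ ^ 2 < ∞ := by
  set K := depth τ Ψ ⁻¹' Ici 1 ∩ closedBall 0 R
  have hKc : IsCompact K := (isCompact_closedBall 0 R).inter_left
    (isClosed_Ici.preimage (continuous_depth hΨ))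
  have hKD : K ⊆ graphDom τ Ψ := fun x hx => by
    have : (1 : ℝ) ≤ depth τ Ψ x := hx.1
    exact zero_lt_one.trans_le this
  have h1 : ∫⁻ x in K, ‖f x‖ₑ ^ 2 < ∞ := by
    rw [← eLpNorm_two_sq]
    exact ENNReal.pow_lt_top (hf K hKD hKc).2
  have hsub : graphDom τ Ψ ∩ ball 0 R ⊆ (layer τ Ψ 0 2 ∩ ball 0 R) ∪ K := by
    rintro x ⟨hx, hxR⟩
    rcases lt_or_ge (depth τ Ψ x) 1 with h | h
    · exact Or.inl ⟨⟨hx, h.trans (by norm_num)⟩, hxR⟩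
    · exact Or.inr ⟨h, ball_subset_closedBall hxR⟩
  calc _ ≤ ∫⁻ x in (layer τ Ψ 0 2 ∩ ball 0 R) ∪ K, ‖f x‖ₑ ^ 2 := lintegral_mono_set hsub
    _ ≤ _ := lintegral_union_le _ _ _
    _ < ∞ := ENNReal.add_lt_top.2 ⟨hE, h1⟩

lemma IsTrace.lintegral_inter_ball_lt_top (h : IsTrace τ M Ψ u g u₀) (R : ℝ) :
    ∫⁻ x in graphDom τ Ψ ∩ ball 0 R, ‖u x‖ₑ ^ 2 < ∞ := by
  have ⟨hτ, hΨ, hu, hum, hgm, hu₀, hE, h0⟩ := h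
  refine _root_.lintegral_inter_ball_lt_top hΨ hu.memLp ?_
  have hhm := measurable_horiz (n := n)
  have h1 := h.lintegral_ball_lt_top R
  have hIm : Measurable ((ball (0 : Euc n) R).indicator fun z => ‖u₀ z‖ₑ ^ 2) :=
    Measurable.indicator (by fun_prop) measurableSet_ball
  calc _ ≤ ∫⁻ x in layer τ Ψ 0 2 ∩ ball 0 R, (2 * ‖u x - u₀ (horiz x)‖ₑ ^ 2
        + 2 * (ball 0 R).indicator (fun z => ‖u₀ z‖ₑ ^ 2) (horiz x)) := by
        refine setLIntegral_mono' ((measurableSet_layer hΨ _ _).inter measurableSet_ball)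
          fun x hx => ?_
        have hxR : horiz x ∈ ball (0 : Euc n) R := by
          have := hx.2
          rw [mem_ball_zero_iff] at this ⊢
          exact (norm_horiz_le x).trans_lt this
        rw [indicator_of_mem hxR]
        simpa using enorm_add_sq_le (u x - u₀ (horiz x)) (u₀ (horiz x))
    _ ≤ ∫⁻ x in layer τ Ψ 0 2, (2 * ‖u x - u₀ (horiz x)‖ₑ ^ 2
        + 2 * (ball 0 R).indicator (fun z => ‖u₀ z‖ₑ ^ 2) (horiz x)) :=
        lintegral_mono_set inter_subset_left
    _ = 2 * (∫⁻ x in layer τ Ψ 0 2, ‖u x - u₀ (horiz x)‖ₑ ^ 2)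
        + 2 * (volume (Ioo (0 : ℝ) 2) * ∫⁻ z in ball 0 R, ‖u₀ z‖ₑ ^ 2) := by
        have h3 : Measurable fun x : Pt n =>
            (ball (0 : Euc n) R).indicator (fun z => ‖u₀ z‖ₑ ^ 2) (horiz x) := hIm.comp hhm
        rw [lintegral_add_left (by fun_prop), lintegral_const_mul _ (by fun_prop),
          lintegral_const_mul _ h3, layer,
          lintegral_depth_preimage_horiz hτ hΨ measurableSet_Ioo hIm,
          lintegral_indicator measurableSet_ball]
    _ < ∞ := by
        refine ENNReal.add_lt_top.2 ⟨mul_lt_top (by simp) h.lintegral_sub_lt_top,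
          mul_lt_top (by simp) (mul_lt_top (by simp) h1)⟩

/-- Mean square convergence near almost every boundary point. -/
lemma IsTrace.ae_tendsto_mean_sq (h : IsTrace τ M Ψ u g u₀) {C : ℝ} (hC : 1 ≤ C) :
    ∀ᵐ z : Euc n, Tendsto (fun k : ℕ => ofReal ((((1 / 2) ^ k / C) ^ (n + 1))⁻¹) *
      ∫⁻ y in {y | ‖z - horiz y‖ < (1 / 2) ^ k / C} ∩ layer τ Ψ 0 ((1 / 2) ^ k),
        ‖u y - u₀ (horiz y)‖ₑ ^ 2) atTop (𝓝 0) := by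
  have ⟨hτ, hΨ, hu, hum, hgm, hu₀, hE, h0⟩ := h
  have hhm := measurable_horiz (n := n)
  set r : ℕ → ℝ := fun k => (1 / 2) ^ k / C with hr
  have hr0 : ∀ k, 0 < r k := fun k => by positivity
  set A : ℕ → Euc n → ℝ≥0∞ := fun k z => ofReal ((r k ^ (n + 1))⁻¹) *
      ∫⁻ y in layer τ Ψ 0 ((1 / 2) ^ k), {y | ‖z - horiz y‖ < r k}.indicator
        (fun y => ‖u y - u₀ (horiz y)‖ₑ ^ 2) y
  have hIm : ∀ k, Measurable fun p : Euc n × Pt n => {p : Euc n × Pt n |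
      ‖p.1 - horiz p.2‖ < r k}.indicator (fun p => ‖u p.2 - u₀ (horiz p.2)‖ₑ ^ 2) p := fun k => by
    have : MeasurableSet {p : Euc n × Pt n | ‖p.1 - horiz p.2‖ < r k} :=
      measurableSet_lt (by fun_prop) (by fun_prop)
    exact Measurable.indicator (by fun_prop) this
  have hAm : ∀ k, Measurable (A k) := fun k => ((hIm k).lintegral_prod_right').const_mul _
  set E := ∫⁻ x in layer τ Ψ 0 2, ‖g x‖ₑ ^ 2
  -- The layer estimate gives two powers of 2⁻ᵏ and integrating in z gives rⁿ, against the
  -- normalization r^{-(n+1)}; one power of 2⁻ᵏ is left. The sum over dyadic scales is then finite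
  -- for almost every z, so its terms tend to zero, with no maximal function for u.
  have hAint : ∀ k, ∫⁻ z, A k z ≤ ofReal (C * unitVol n) * E * (2 : ℝ≥0∞)⁻¹ ^ k := by
    intro k
    have hk1 : ((1 : ℝ) / 2) ^ k ≤ 2 := (pow_le_one₀ (by norm_num) (by norm_num)).trans one_le_two
    calc ∫⁻ z, A k z = ofReal ((r k ^ (n + 1))⁻¹) * ∫⁻ z,
          ∫⁻ y in layer τ Ψ 0 ((1 / 2) ^ k), {y | ‖z - horiz y‖ < r k}.indicator
          (fun y => ‖u y - u₀ (horiz y)‖ₑ ^ 2) y :=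
          lintegral_const_mul _ (hIm k).lintegral_prod_right'
      _ = ofReal ((r k ^ (n + 1))⁻¹) * ∫⁻ y in layer τ Ψ 0 ((1 / 2) ^ k), ∫⁻ z,
          {y | ‖z - horiz y‖ < r k}.indicator (fun y => ‖u y - u₀ (horiz y)‖ₑ ^ 2) y := by
          rw [lintegral_lintegral_swap (f := fun z y => {y | ‖z - horiz y‖ < r k}.indicator
            (fun y => ‖u y - u₀ (horiz y)‖ₑ ^ 2) y)]
          exact (hIm k).aemeasurable
      _ = ofReal ((r k ^ (n + 1))⁻¹) * ∫⁻ y in layer τ Ψ 0 ((1 / 2) ^ k),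
          ofReal (r k ^ n * unitVol n) * ‖u y - u₀ (horiz y)‖ₑ ^ 2 := by
          congr 1
          refine lintegral_congr fun y => ?_
          rw [← volume_horiz_ball_le (horiz y) (hr0 k), mul_comm, ← lintegral_indicator_const
            (measurableSet_lt (by fun_prop) (by fun_prop))]
          rfl
      _ ≤ ofReal ((r k ^ (n + 1))⁻¹) * (ofReal (r k ^ n * unitVol n) *
          (ofReal ((1 / 2) ^ k) ^ 2 * E)) := by
          rw [lintegral_const_mul _ (by fun_prop)]
          gcongr
          exact h.lintegral_layer_le hk1
      _ = _ := by
          have e1 : (2 : ℝ≥0∞)⁻¹ ^ k = ofReal ((1 / 2) ^ k) := by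
            rw [ofReal_pow (by norm_num), one_div, ofReal_inv_of_pos (by norm_num)]
            norm_num
          rw [e1, ← ofReal_pow (by positivity), ← mul_assoc, ← mul_assoc,
            ← ofReal_mul (by positivity),
            ← ofReal_mul (mul_nonneg (by positivity)
              (mul_nonneg (by positivity) (unitVol_pos n).le)),
            mul_right_comm _ E, ← ofReal_mul (mul_nonneg (by positivity) (unitVol_pos n).le)]
          congr 2
          have h0 := (hr0 k).ne'
          have e2 : (1 / 2 : ℝ) ^ k = C * r k := by rw [hr]; field_simp
          rw [e2]
          generalize r k = s at h0
          rw [pow_succ]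
          field_simp
  have hsum : ∫⁻ z, ∑' k, A k z ≠ ∞ := by
    rw [lintegral_tsum fun k => (hAm k).aemeasurable]
    refine ((ENNReal.tsum_le_tsum hAint).trans_lt ?_).ne
    rw [ENNReal.tsum_mul_left]
    refine mul_lt_top (mul_lt_top ofReal_lt_top hE) ?_
    rw [ENNReal.tsum_geometric]
    simp
  filter_upwards [ae_lt_top (Measurable.tsum hAm) hsum] with z hz
  have e : ∀ k, MeasurableSet {y : Pt n | ‖z - horiz y‖ < (1 / 2) ^ k / C} := fun k =>
    measurableSet_lt (by fun_prop) (by fun_prop)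
  simp only [← setLIntegral_indicator (e _)]
  exact ENNReal.tendsto_atTop_zero_of_tsum_ne_top hz.ne

lemma locallyIntegrable_of_sq {d : ℕ} {f : Euc d → ℝ} (hf : Measurable f)
    (h : ∀ R, ∫⁻ z in ball 0 R, ‖f z‖ₑ ^ 2 < ∞) : LocallyIntegrable f := by
  intro x
  refine ⟨ball 0 (‖x‖ + 1), isOpen_ball.mem_nhds (by simp), ?_⟩
  have : IsFiniteMeasure ((volume : Measure (Euc d)).restrict (ball 0 (‖x‖ + 1))) :=
    ⟨by rw [Measure.restrict_apply_univ]; exact measure_ball_lt_top⟩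
  refine MemLp.integrable (q := 2) (by norm_num) ⟨hf.aestronglyMeasurable, ?_⟩
  have h1 := h (‖x‖ + 1)
  rw [← eLpNorm_two_sq] at h1
  by_contra hcon
  rw [not_lt_top_iff.1 hcon] at h1
  simp at h1

/-- The nontangential limit of a Sobolev function agrees with its trace. -/
lemma IsTrace.ae_eq_ntLimit (h : IsTrace τ M Ψ u g u₀) (hκ : 1 < κ) {f : Euc n → ℝ}
    (hlim : ∀ᵐ z, GLimit τ Ψ κ u (bdryPt Ψ z) (f z)) :
    ∀ᵐ z, f z = u₀ z := by
  have ⟨hτ, hΨ, hu, hum, hgm, hu₀, hE, h0⟩ := h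
  have hM : (1 : ℝ) ≤ 1 + M := by have := M.2; linarith
  have hhm := measurable_horiz (n := n)
  have hloc := locallyIntegrable_of_sq hu₀ h.lintegral_ball_lt_top
  have hleb := (Besicovitch.vitaliFamily (volume : Measure (Euc n))).ae_tendsto_lintegral_enorm_sub_div
    hloc
  obtain ⟨c, hc, hcone⟩ := exists_cone_volume n M κ hκ
  filter_upwards [hlim, h.ae_tendsto_mean_sq hM, hleb,
    hΨ.ae_differentiableAt] with z hz hA hL hd
  obtain ⟨r₀, hr₀, hr₀'⟩ := hcone τ hτ Ψ hΨ z hd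
  -- The depth is (1 + M)-Lipschitz, so in the ball of radius r the depth is below 2⁻ᵏ.
  set r : ℕ → ℝ := fun k => (1 / 2) ^ k / (1 + M) with hr
  have hr0 : ∀ k, 0 < r k := fun k => by positivity
  have hrlim0 : Tendsto r atTop (𝓝 0) := by
    have := (tendsto_pow_atTop_nhds_zero_of_lt_one (r := (1 / 2 : ℝ)) (by norm_num)
      (by norm_num)).div_const (1 + M : ℝ)
    rwa [zero_div] at this
  have hrlim : Tendsto r atTop (𝓝[>] 0) :=
    tendsto_nhdsWithin_iff.2 ⟨hrlim0, Eventually.of_forall hr0⟩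
  set A : ℕ → ℝ≥0∞ := fun k => ofReal ((r k ^ (n + 1))⁻¹) *
    ∫⁻ y in {y | ‖z - horiz y‖ < r k} ∩ layer τ Ψ 0 ((1 / 2) ^ k),
      ‖u y - u₀ (horiz y)‖ₑ ^ 2 with hAdef
  set B : ℕ → ℝ≥0∞ := fun k => laverage (volume.restrict
    (gCone τ Ψ κ (bdryPt Ψ z) ∩ ball (bdryPt Ψ z) (r k))) (fun x => ‖u x - f z‖ₑ) with hB
  set L : ℕ → ℝ≥0∞ := fun k => (∫⁻ y in closedBall z (r k), ‖u₀ y - u₀ z‖ₑ) /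
    volume (closedBall z (r k)) with hLdef
  have hBlim : Tendsto B atTop (𝓝 0) := Tendsto.comp hz hrlim
  have hLlim : Tendsto L atTop (𝓝 0) := hL.comp ((Besicovitch.tendsto_filterAt volume z).comp hrlim)
  set c₁ : ℝ≥0∞ := ofReal c⁻¹
  set c₂ : ℝ≥0∞ := ofReal ((1 + M) * unitVol n * c⁻¹) with hc₂
  have hlim0 : Tendsto (fun k => B k + (c₁ * A k) ^ (1 / 2 : ℝ) + c₂ * L k) atTop (𝓝 0) := by
    have h1 : Tendsto (fun k => c₁ * A k) atTop (𝓝 0) := by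
      simpa using ENNReal.Tendsto.const_mul (a := c₁) hA (Or.inr ofReal_ne_top)
    have h2 : Tendsto (fun k => (c₁ * A k) ^ (1 / 2 : ℝ)) atTop (𝓝 0) := by
      have := (ENNReal.continuous_rpow_const (y := (1 / 2 : ℝ))).tendsto 0 |>.comp h1
      simpa [Function.comp_def] using this
    have h3 : Tendsto (fun k => c₂ * L k) atTop (𝓝 0) := by
      simpa using ENNReal.Tendsto.const_mul (a := c₂) hLlim (Or.inr ofReal_ne_top)
    simpa using (hBlim.add h2).add h3
  -- The constant f(z) − u₀(z) is averaged over the cut approach region and split into u − f(z), u −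
  -- u₀(y') and u₀(y') − u₀(z). These are handled by the nontangential limit, the mean square
  -- convergence, and Lebesgue differentiation.
  have hev : ∀ᶠ k in atTop, ‖f z - u₀ z‖ₑ ≤ B k + (c₁ * A k) ^ (1 / 2 : ℝ) + c₂ * L k := by
    filter_upwards [hrlim0.eventually_lt_const hr₀] with k hk
    set S := gCone τ Ψ κ (bdryPt Ψ z) ∩ ball (bdryPt Ψ z) (r k)
    have hSm : MeasurableSet S := ((isOpen_ntCone hΨ _).inter isOpen_ball).measurableSet
    have hrk := hr0 k
    have hvol : ofReal (c * r k ^ (n + 1)) ≤ volume S := hr₀' _ hrk hk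
    have hinv : (volume S)⁻¹ ≤ c₁ * ofReal ((r k ^ (n + 1))⁻¹) := by
      rw [← ofReal_mul (by positivity), ← mul_inv, ofReal_inv_of_pos (by positivity)]
      exact ENNReal.inv_le_inv.2 hvol
    have hpos : volume S ≠ 0 :=
      ((ofReal_pos.2 (by positivity : 0 < c * r k ^ (n + 1))).trans_le hvol).ne'
    have hfin := isFiniteMeasure_restrict_inter_ball (gCone τ Ψ κ (bdryPt Ψ z)) (bdryPt Ψ z) (r k)
    have htop : volume S ≠ ∞ := by
      have := hfin.1
      rw [Measure.restrict_apply_univ] at this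
      exact this.ne
    have hSsub : S ⊆ {y | ‖z - horiz y‖ < r k} ∩ layer τ Ψ 0 ((1 / 2) ^ k) := fun y hy => by
      have hd1 : dist y (bdryPt Ψ z) < r k := hy.2
      refine ⟨?_, hy.1.1, ?_⟩
      · have h4 := norm_horiz_le (y - bdryPt Ψ z)
        rw [horiz_sub, horiz_bdryPt, norm_sub_rev, ← dist_eq_norm y] at h4
        exact h4.trans_lt hd1
      · have h4 := (lipschitz_depth hτ hΨ).dist_le_mul y (bdryPt Ψ z)
        rw [Real.dist_eq, depth_bdryPt, sub_zero] at h4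
        push_cast at h4
        have h5 : (1 + M : ℝ) * dist y (bdryPt Ψ z) < (1 + M) * r k := by gcongr
        have h6 : (1 + M : ℝ) * r k = (1 / 2) ^ k := by rw [hr]; field_simp
        linarith [le_abs_self (depth τ Ψ y)]
    have hI1 : (volume S)⁻¹ * ∫⁻ y in S, ‖u y - f z‖ₑ = B k := by
      simp only [hB]
      rw [laverage_eq, Measure.restrict_apply_univ, ENNReal.div_eq_inv_mul]
    have hI2 : (volume S)⁻¹ * ∫⁻ y in S, ‖u y - u₀ (horiz y)‖ₑ ≤ (c₁ * A k) ^ (1 / 2 : ℝ) := by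
      have e : ∀ a : ℝ≥0∞, a = (a ^ 2) ^ (1 / 2 : ℝ) := fun a => by
        rw [← ENNReal.rpow_natCast, ← ENNReal.rpow_mul]; norm_num
      rw [e ((volume S)⁻¹ * ∫⁻ y in S, ‖u y - u₀ (horiz y)‖ₑ)]
      refine ENNReal.rpow_le_rpow ?_ (by norm_num)
      calc _ = (volume S)⁻¹ * (volume S)⁻¹ * (∫⁻ y in S, ‖u y - u₀ (horiz y)‖ₑ) ^ 2 := by ring
        _ ≤ (volume S)⁻¹ * (volume S)⁻¹ *
            (volume S * ∫⁻ y in S, ‖u y - u₀ (horiz y)‖ₑ ^ 2) := by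
            gcongr
            exact setLIntegral_sq_le (by fun_prop)
        _ = (volume S)⁻¹ * ((volume S)⁻¹ * volume S) * ∫⁻ y in S, ‖u y - u₀ (horiz y)‖ₑ ^ 2 := by
            ring
        _ ≤ c₁ * ofReal ((r k ^ (n + 1))⁻¹) * 1 * _ := by
            rw [ENNReal.inv_mul_cancel hpos htop]
            exact mul_le_mul' (mul_le_mul' hinv le_rfl) (lintegral_mono_set hSsub)
        _ = c₁ * A k := by rw [mul_one, mul_assoc]
    have hI3 : (volume S)⁻¹ * ∫⁻ y in S, ‖u₀ (horiz y) - u₀ z‖ₑ ≤ c₂ * L k := by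
      have hIm : Measurable ((ball z (r k)).indicator fun y => ‖u₀ y - u₀ z‖ₑ) :=
        Measurable.indicator (by fun_prop) measurableSet_ball
      have h6 : (1 / 2 : ℝ) ^ k = (1 + M : ℝ) * r k := by rw [hr]; field_simp
      calc _ ≤ (c₁ * ofReal ((r k ^ (n + 1))⁻¹)) * ∫⁻ y in layer τ Ψ 0 ((1 / 2) ^ k),
            (ball z (r k)).indicator (fun y => ‖u₀ y - u₀ z‖ₑ) (horiz y) := by
            refine mul_le_mul' hinv ?_
            refine (lintegral_mono_set hSsub).trans_eq ?_
            rw [← setLIntegral_indicator (measurableSet_lt (by fun_prop) (by fun_prop))]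
            congr with y
            simp only [indicator, mem_ofPred_eq, mem_ball_iff_norm']
        _ = (c₁ * ofReal ((r k ^ (n + 1))⁻¹)) * (ofReal ((1 + M) * r k) *
            ∫⁻ y in ball z (r k), ‖u₀ y - u₀ z‖ₑ) := by
            rw [layer, lintegral_depth_preimage_horiz hτ hΨ measurableSet_Ioo hIm, Real.volume_Ioo,
              sub_zero, lintegral_indicator measurableSet_ball, h6]
        _ ≤ (c₁ * ofReal ((r k ^ (n + 1))⁻¹)) * (ofReal ((1 + M) * r k) *
            (ofReal (r k ^ n * unitVol n) * L k)) := by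
            gcongr
            have e1 : volume (closedBall z (r k)) = ofReal (r k ^ n * unitVol n) := by
              rw [← volume_ball_eq z hrk, Measure.addHaar_closedBall _ _ hrk.le,
                ← Measure.addHaar_ball_of_pos _ z hrk]
            have e2 : ofReal (r k ^ n * unitVol n) ≠ 0 := by
              rw [Ne, ofReal_eq_zero, not_le]
              exact mul_pos (by positivity) (unitVol_pos n)
            simp only [hLdef]
            rw [e1, ENNReal.mul_div_cancel e2 ofReal_ne_top]
            exact lintegral_mono_set ball_subset_closedBall
        _ = _ := by
            rw [← mul_assoc, ← mul_assoc, ← ofReal_mul (by positivity),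
              ← ofReal_mul (by positivity), ← ofReal_mul (by positivity), hc₂]
            congr 2
            have := hrk.ne'
            field_simp
            ring
    calc ‖f z - u₀ z‖ₑ = (volume S)⁻¹ * (‖f z - u₀ z‖ₑ * volume S) := by
          rw [mul_comm (‖f z - u₀ z‖ₑ), ← mul_assoc, ENNReal.inv_mul_cancel hpos htop, one_mul]
      _ = (volume S)⁻¹ * ∫⁻ y in S, ‖f z - u₀ z‖ₑ := by rw [setLIntegral_const]
      _ ≤ (volume S)⁻¹ * ∫⁻ y in S, (‖u y - f z‖ₑ + ‖u y - u₀ (horiz y)‖ₑ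
          + ‖u₀ (horiz y) - u₀ z‖ₑ) := by
          gcongr with y
          have e : f z - u₀ z = -(u y - f z) + (u y - u₀ (horiz y)) + (u₀ (horiz y) - u₀ z) := by ring
          rw [e]
          refine (enorm_add_le _ _).trans ?_
          gcongr
          refine (enorm_add_le _ _).trans ?_
          rw [enorm_neg]
      _ = (volume S)⁻¹ * (∫⁻ y in S, ‖u y - f z‖ₑ) + (volume S)⁻¹ * (∫⁻ y in S, ‖u y - u₀ (horiz y)‖ₑ)
          + (volume S)⁻¹ * ∫⁻ y in S, ‖u₀ (horiz y) - u₀ z‖ₑ := by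
          rw [lintegral_add_left (by fun_prop), lintegral_add_left (by fun_prop), mul_add, mul_add]
      _ ≤ _ := by rw [hI1]; gcongr
  have h9 := ge_of_tendsto hlim0 hev
  have h10 : ‖f z - u₀ z‖ₑ = 0 := le_antisymm h9 zero_le
  exact sub_eq_zero.1 (enorm_eq_zero.1 h10)

end TraceBounds

/-! ### The divergence theorem up to the graph -/

section Divergence

variable {n : ℕ} {τ : ℝ} {M : ℝ≥0} {Ψ : Euc n → ℝ}

/-- The gradient of the depth. -/
def depthGrad (τ : ℝ) (Ψ : Euc n → ℝ) (z : Euc n) : Pt n := τ • pairPt (-gradient Ψ z) 1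

lemma measurable_depthGrad (τ : ℝ) (Ψ : Euc n → ℝ) : Measurable (depthGrad τ Ψ) := by
  have h1 := measurable_gradient Ψ
  have h2 := (continuous_pairPt (n := n)).measurable
  exact (h2.comp (h1.neg.prodMk measurable_const)).const_smul τ

lemma norm_depthGrad_le (hτ : IsSgn τ) (hΨ : LipschitzWith M Ψ) (z : Euc n) :
    ‖depthGrad τ Ψ z‖ ≤ 1 + M := by
  rw [depthGrad, norm_smul, norm_eq_abs, abs_unit hτ, one_mul]
  refine (norm_le_horiz_add_height _).trans ?_
  have := norm_gradient_le hΨ z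
  simp only [horiz_pairPt, height_pairPt, norm_neg, abs_one]
  linarith

/-- This normalization replaces the unit normal throughout: the factor between it and the unit
normal is the density of the surface measure, so boundary terms over the base carry no Jacobian. -/
lemma inner_depthGrad_vert (hτ : IsSgn τ) (z : Euc n) :
    inner ℝ (vert n τ) (depthGrad τ Ψ z) = 1 := by
  rw [inner_eq_horiz_height, horiz_vert, height_vert, inner_zero_left, zero_add, depthGrad,
    height_smul, height_pairPt, mul_one, unit_mul_self hτ]

lemma hasFDerivAt_depth {x : Pt n} (h : DifferentiableAt ℝ Ψ (horiz x)) :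
    HasFDerivAt (depth τ Ψ) (innerSL ℝ (depthGrad τ Ψ (horiz x))) x := by
  have h1 : HasFDerivAt (fun y : Pt n => Ψ (horizL n y))
      ((fderiv ℝ Ψ (horiz x)).comp (horizL n)) x := h.hasFDerivAt.comp x (horizL n).hasFDerivAt
  have h2 := (((heightL n).hasFDerivAt (x := x)).sub h1).const_mul τ
  have e : innerSL ℝ (depthGrad τ Ψ (horiz x))
      = τ • (heightL n - (fderiv ℝ Ψ (horiz x)).comp (horizL n)) := by
    refine ContinuousLinearMap.ext fun v => ?_
    change _ = τ * (height v - fderiv ℝ Ψ (horiz x) (horiz v))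
    simp only [innerSL_apply_apply, depthGrad, inner_smul_left, inner_eq_horiz_height, horiz_pairPt,
      height_pairPt, inner_neg_left, inner_gradient_left, RCLike.conj_to_real]
    ring
  rw [e]
  exact h2

/-- A null set of the base spans a null cylinder. In particular Ψ is differentiable at the base
point of almost every x. -/
lemma ae_horiz (hτ : IsSgn τ) (hΨ : LipschitzWith M Ψ) {p : Euc n → Prop}
    (h : ∀ᵐ z, p z) : ∀ᵐ x : Pt n, p (horiz x) := by
  rw [ae_iff] at h ⊢
  set T := toMeasurable volume {z | ¬p z} with hT
  have hTm : MeasurableSet T := measurableSet_toMeasurable _ _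
  have hT0 : volume T = 0 := by rw [hT, measure_toMeasurable, h]
  refine measure_mono_null (t := horiz ⁻¹' T) (fun x hx => subset_toMeasurable _ _ hx) ?_
  have h1 := lintegral_depth_preimage_horiz hτ hΨ MeasurableSet.univ
    (h := T.indicator 1) (measurable_one.indicator hTm)
  rw [preimage_univ, Measure.restrict_univ, lintegral_indicator_one hTm, hT0, mul_zero] at h1
  rw [← h1, ← lintegral_indicator_one (measurable_horiz hTm)]
  rfl

/-- Level sets of the depth are graphs, hence null. This disposes of the two levels where the depth
cut-off has its corners. -/
lemma ae_depth_ne (hτ : IsSgn τ) (hΨ : LipschitzWith M Ψ) (t : ℝ) :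
    ∀ᵐ x : Pt n, depth τ Ψ x ≠ t := by
  have h1 := lintegral_depth_preimage hτ hΨ (measurableSet_singleton t) (F := fun _ => 1)
    measurable_const
  rw [Measure.restrict_singleton] at h1
  simp only [Real.volume_singleton, zero_smul, lintegral_zero_measure, lintegral_one,
    Measure.restrict_apply_univ] at h1
  rw [ae_iff]
  refine measure_mono_null (fun x hx => ?_) h1
  simpa using hx

/-- The cutoff that vanishes below depth `ε` and equals `1` above depth `2ε`. -/
def depthCut (τ : ℝ) (Ψ : Euc n → ℝ) (ε : ℝ) (x : Pt n) : ℝ := max 0 (min 1 ((depth τ Ψ x - ε) / ε))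

lemma depthCut_mem (ε : ℝ) (x : Pt n) : 0 ≤ depthCut τ Ψ ε x ∧ depthCut τ Ψ ε x ≤ 1 :=
  ⟨le_max_left _ _, max_le zero_le_one (min_le_left _ _)⟩

lemma norm_depthCut_le (ε : ℝ) (x : Pt n) : ‖depthCut τ Ψ ε x‖ ≤ 1 := by
  rw [norm_of_nonneg (depthCut_mem ε x).1]; exact (depthCut_mem ε x).2

lemma depthCut_of_le {ε : ℝ} (hε : 0 < ε) {x : Pt n} (h : depth τ Ψ x ≤ ε) :
    depthCut τ Ψ ε x = 0 := by
  refine max_eq_left ((min_le_right _ _).trans ?_)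
  exact div_nonpos_of_nonpos_of_nonneg (by linarith) hε.le

lemma depthCut_of_ge {ε : ℝ} (hε : 0 < ε) {x : Pt n} (h : 2 * ε ≤ depth τ Ψ x) :
    depthCut τ Ψ ε x = 1 := by
  have : 1 ≤ (depth τ Ψ x - ε) / ε := by rw [le_div_iff₀ hε]; linarith
  rw [depthCut, min_eq_left this, max_eq_right zero_le_one]

lemma depthCut_of_mem {ε : ℝ} (hε : 0 < ε) {x : Pt n} (h : x ∈ layer τ Ψ ε (2 * ε)) :
    depthCut τ Ψ ε x = ε⁻¹ * (depth τ Ψ x - ε) := by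
  have h1 : ε < depth τ Ψ x := h.1
  have h2 : depth τ Ψ x < 2 * ε := h.2
  have h3 : (depth τ Ψ x - ε) / ε ≤ 1 := by rw [div_le_iff₀ hε]; linarith
  have h4 : 0 ≤ (depth τ Ψ x - ε) / ε := div_nonneg (by linarith) hε.le
  rw [depthCut, min_eq_right h3, max_eq_right h4, div_eq_inv_mul]

lemma lipschitz_depthCut (hτ : IsSgn τ) (hΨ : LipschitzWith M Ψ) {ε : ℝ} (hε : 0 < ε) :
    ∃ C, LipschitzWith C (depthCut τ Ψ ε) := by
  refine ⟨⟨ε⁻¹ * (1 + M), by positivity⟩, LipschitzWith.of_dist_le_mul fun x y => ?_⟩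
  have h1 := (lipschitz_depth hτ hΨ).dist_le_mul x y
  rw [Real.dist_eq] at h1 ⊢
  have h2 : |(depth τ Ψ x - ε) / ε - (depth τ Ψ y - ε) / ε| ≤ ε⁻¹ * (1 + M) * dist x y := by
    rw [← sub_div, sub_sub_sub_cancel_right, abs_div, abs_of_pos hε, div_eq_inv_mul, mul_assoc]
    push_cast at h1
    gcongr
  refine le_trans ?_ h2
  unfold depthCut
  refine (abs_max_sub_max_le_max _ _ _ _).trans ?_
  rw [sub_self, abs_zero]
  refine max_le (abs_nonneg _) ((abs_min_sub_min_le_max _ _ _ _).trans ?_)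
  rw [sub_self, abs_zero]
  exact max_le (abs_nonneg _) le_rfl

lemma fderiv_depthCut_of_mem (hΨ : LipschitzWith M Ψ) {ε : ℝ} (hε : 0 < ε)
    {x : Pt n} (hx : x ∈ layer τ Ψ ε (2 * ε)) (hd : DifferentiableAt ℝ Ψ (horiz x))
    (v : Pt n) :
    fderiv ℝ (depthCut τ Ψ ε) x v = ε⁻¹ * inner ℝ v (depthGrad τ Ψ (horiz x)) := by
  have h1 : depthCut τ Ψ ε =ᶠ[𝓝 x] fun y => ε⁻¹ * (depth τ Ψ y - ε) := by
    filter_upwards [(isOpen_layer hΨ _ _).mem_nhds hx] with y hy using depthCut_of_mem hε hy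
  rw [h1.fderiv_eq, (((hasFDerivAt_depth hd).sub_const ε).const_mul ε⁻¹).fderiv]
  simp [real_inner_comm]

lemma fderiv_depthCut_of_notMem (hΨ : LipschitzWith M Ψ) {ε : ℝ} (hε : 0 < ε)
    {x : Pt n} (hx : x ∉ layer τ Ψ ε (2 * ε)) (h1 : depth τ Ψ x ≠ ε)
    (h2 : depth τ Ψ x ≠ 2 * ε) : fderiv ℝ (depthCut τ Ψ ε) x = 0 := by
  have hc := (continuous_depth (τ := τ) hΨ)
  rcases lt_or_gt_of_ne h1 with h | h
  · have : depthCut τ Ψ ε =ᶠ[𝓝 x] fun _ => 0 := by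
      filter_upwards [(isOpen_Iio.preimage hc).mem_nhds h] with y hy
      exact depthCut_of_le hε (le_of_lt hy)
    rw [this.fderiv_eq]; simp
  · have h3 : 2 * ε < depth τ Ψ x := lt_of_le_of_ne (not_lt.1 fun h4 => hx ⟨h, h4⟩) (Ne.symm h2)
    have : depthCut τ Ψ ε =ᶠ[𝓝 x] fun _ => 1 := by
      filter_upwards [(isOpen_Ioi.preimage hc).mem_nhds h3] with y hy
      exact depthCut_of_ge hε (le_of_lt hy)
    rw [this.fderiv_eq]; simp

lemma integral_slab {ε : ℝ} (hε : 0 < ε) (k : Pt n → ℝ) : ∫ x, k x ∂slab τ Ψ ε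
    = ε⁻¹ * ∫ x in layer τ Ψ ε (2 * ε), k x := by
  rw [slab, integral_smul_measure, toReal_ofReal (by positivity), smul_eq_mul]

lemma norm_inner_depthGrad_mul_le (hτ : IsSgn τ) (hΨ : LipschitzWith M Ψ) (v : Pt n) (z : Euc n)
    {s c : ℝ} (hs : |s| ≤ c) : ‖inner ℝ v (depthGrad τ Ψ z) * s‖ ≤ (1 + M) * c * ‖v‖ := by
  rw [norm_mul]
  calc _ ≤ (‖v‖ * (1 + M)) * c := by
        gcongr
        · exact (norm_inner_le_norm (𝕜 := ℝ) v _).trans (by gcongr; exact norm_depthGrad_le hτ hΨ _)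
        · exact hs
    _ = _ := by ring

lemma integrableOn_of_norm_le_of_off {d : ℕ} {s : Set (Euc d)} (hs : MeasurableSet s) {E : Type*}
    [NormedAddCommGroup E] {φ : Euc d → E} {k : Euc d → ℝ} {R : ℝ} (c : ℝ)
    (hφ : IntegrableOn φ (s ∩ ball 0 R))
    (hk : AEStronglyMeasurable k (volume.restrict (s ∩ ball 0 R)))
    (hle : ∀ x, ‖k x‖ ≤ c * ‖φ x‖) (hoff : ∀ x ∉ ball 0 R, k x = 0) : IntegrableOn k s :=
  IntegrableOn.of_forall_sdiff_eq_zero (Integrable.mono' (hφ.norm.const_mul c) hk (.of_forall hle))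
    hs fun x hx => hoff x fun h => hx.2 ⟨hx.1, h⟩

/-- Convergence of weighted averages over the boundary layers. -/
lemma tendsto_integral_slab (hτ : IsSgn τ) (hΨ : LipschitzWith M Ψ)
    {F : Pt n → Pt n} {F₀ : Euc n → Pt n} (hFm : Measurable F)
    (hF₀m : Measurable F₀)
    (hF : ∀ R, IntegrableOn F (graphDom τ Ψ ∩ ball 0 R))
    (hF₀ : ∀ R, IntegrableOn F₀ (ball 0 R))
    (hslab : ∀ R, Tendsto (fun ε => ∫⁻ x in ball 0 R, ‖F x - F₀ (horiz x)‖ₑ ∂slab τ Ψ ε)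
      (𝓝[>] 0) (𝓝 0))
    {η : Pt n → ℝ} {C : ℝ≥0} (hη : LipschitzWith C η) (hηc : HasCompactSupport η) :
    Tendsto (fun ε => ∫ x, inner ℝ (F x) (depthGrad τ Ψ (horiz x)) * η x ∂slab τ Ψ ε) (𝓝[>] 0)
      (𝓝 (∫ z, inner ℝ (F₀ z) (depthGrad τ Ψ z) * η (bdryPt Ψ z))) := by
  have hhm := measurable_horiz (n := n)
  have hNm := measurable_depthGrad τ Ψ
  have hηm := hη.continuous.measurable
  have hbm := (continuous_bdryPt hΨ).measurable
  obtain ⟨B, hB⟩ := exists_bound_of_lipschitz hη hηc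
  obtain ⟨R, hR⟩ := hηc.isCompact.isBounded.subset_ball (0 : Pt n)
  have hoff : ∀ x ∉ ball (0 : Pt n) R, η x = 0 := fun x hx =>
    image_eq_zero_of_notMem_tsupport fun h => hx (hR h)
  have hoff' : ∀ x : Pt n, horiz x ∉ ball (0 : Euc n) R → η x = 0 := fun x hx => by
    refine hoff x fun h => hx ?_
    rw [mem_ball_zero_iff] at h ⊢
    exact (norm_horiz_le x).trans_lt h
  set k₁ : Pt n → ℝ := fun x => inner ℝ (F x) (depthGrad τ Ψ (horiz x)) * η x with hk₁
  set k₀ : Euc n → ℝ := fun z => inner ℝ (F₀ z) (depthGrad τ Ψ z) * η (bdryPt Ψ z) with hk₀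
  have hk₁m : Measurable k₁ := by fun_prop
  have hk₀m : Measurable k₀ := by fun_prop
  have hle := norm_inner_depthGrad_mul_le hτ hΨ
  have hk₁i : ∀ ε, 0 < ε → Integrable k₁ (slab τ Ψ ε) := fun ε hε => by
    have h1 : IntegrableOn k₁ (graphDom τ Ψ) :=
      integrableOn_of_norm_le_of_off (measurableSet_graphDom hΨ) _ (hF R) hk₁m.aestronglyMeasurable
        (fun x => hle _ _ (hB x)) fun x hx => by simp [hk₁, hoff x hx]
    exact (h1.mono_set (layer_subset hε.le)).smul_measure ofReal_ne_top
  have hk₀i : Integrable k₀ := integrableOn_univ.1 <|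
    integrableOn_of_norm_le_of_off MeasurableSet.univ _ (by simpa using hF₀ R)
      hk₀m.aestronglyMeasurable (fun z => hle _ _ (hB _)) fun z hz => by
        simp [hk₀, hoff' (bdryPt Ψ z) (by simpa using hz)]
  rw [tendsto_iff_edist_tendsto_0]
  set D₀ := ∫⁻ z in ball 0 R, ‖F₀ z‖ₑ
  have hD₀f : D₀ < ∞ := (hF₀ R).2
  have hlim : Tendsto (fun ε => ofReal ((1 + M) * B) *
      (∫⁻ x in ball 0 R, ‖F x - F₀ (horiz x)‖ₑ ∂slab τ Ψ ε)
      + ofReal ((1 + M) * C * (2 * ε)) * D₀) (𝓝[>] 0) (𝓝 0) := by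
    have h1 := ENNReal.Tendsto.const_mul (a := ofReal ((1 + M) * B)) (hslab R)
      (Or.inr ofReal_ne_top)
    have h2 : Tendsto (fun ε : ℝ => ofReal ((1 + M) * C * (2 * ε))) (𝓝[>] 0) (𝓝 0) := by
      have : Continuous fun ε : ℝ => ofReal ((1 + M) * C * (2 * ε)) :=
        continuous_ofReal.comp (by fun_prop)
      simpa using (this.tendsto 0).mono_left nhdsWithin_le_nhds
    have h3 := ENNReal.Tendsto.mul_const (b := D₀) h2 (Or.inr hD₀f.ne)
    simpa using h1.add h3
  refine tendsto_nhds_bot_mono hlim ?_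
  filter_upwards [self_mem_nhdsWithin] with ε (hε : 0 < ε)
  have hmp := measurePreserving_horiz_slab hτ hΨ hε
  have e1 : ∫ z, k₀ z = ∫ x, k₀ (horiz x) ∂slab τ Ψ ε := by
    rw [← hmp.map_eq, integral_map hmp.measurable.aemeasurable hk₀m.aestronglyMeasurable]
  have hk₀i' : Integrable (fun x => k₀ (horiz x)) (slab τ Ψ ε) :=
    hmp.integrable_comp_of_integrable hk₀i
  rw [e1, edist_eq_enorm_sub, ← integral_sub (hk₁i ε hε) hk₀i']
  refine (enorm_integral_le_lintegral_enorm _).trans ?_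
  have hIm : Measurable ((ball (0 : Euc n) R).indicator fun z => ‖F₀ z‖ₑ) :=
    Measurable.indicator (by fun_prop) measurableSet_ball
  have hJm : Measurable ((ball (0 : Pt n) R).indicator fun x => ‖F x - F₀ (horiz x)‖ₑ) :=
    Measurable.indicator (by fun_prop) measurableSet_ball
  have hpt : ∀ x ∈ layer τ Ψ ε (2 * ε), ‖k₁ x - k₀ (horiz x)‖ₑ ≤ ofReal ((1 + M) * B) *
      (ball 0 R).indicator (fun x => ‖F x - F₀ (horiz x)‖ₑ) x
      + ofReal ((1 + M) * C * (2 * ε)) *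
        (ball (0 : Euc n) R).indicator (fun z => ‖F₀ z‖ₑ) (horiz x) := by
    intro x hx
    have ht0 : 0 < depth τ Ψ x := hε.trans hx.1
    have ht : depth τ Ψ x < 2 * ε := hx.2
    -- The first term is the convergence of F on the layer; the second is the oscillation of η along
    -- a vertical segment of length at most 2ε.
    have e2 : k₁ x - k₀ (horiz x) = inner ℝ (F x - F₀ (horiz x)) (depthGrad τ Ψ (horiz x)) * η x
        + inner ℝ (F₀ (horiz x)) (depthGrad τ Ψ (horiz x)) * (η x - η (bdryPt Ψ (horiz x))) := by
      simp only [hk₁, hk₀, inner_sub_left]; ring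
    have hmul : ∀ (v : Pt n) (s c : ℝ), |s| ≤ c →
        ‖inner ℝ v (depthGrad τ Ψ (horiz x)) * s‖ₑ ≤ ofReal ((1 + M) * c) * ‖v‖ₑ := by
      intro v s c hs
      rw [← ofReal_norm, ← ofReal_norm, ← ofReal_mul
        (mul_nonneg (by positivity) ((abs_nonneg s).trans hs))]
      exact ofReal_le_ofReal (hle v _ hs)
    rw [e2]
    refine (enorm_add_le _ _).trans (add_le_add ?_ ?_)
    · by_cases hxR : x ∈ ball (0 : Pt n) R
      · rw [indicator_of_mem hxR]
        exact hmul _ _ _ (hB x)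
      · rw [hoff x hxR, mul_zero, enorm_zero]; exact zero_le
    · by_cases hxR : horiz x ∈ ball (0 : Euc n) R
      · rw [indicator_of_mem hxR, mul_assoc (1 + M : ℝ)]
        refine hmul _ _ _ ?_
        have h1 := hη.dist_le_mul x (bdryPt Ψ (horiz x))
        rw [Real.dist_eq] at h1
        refine h1.trans ?_
        gcongr
        rw [dist_eq_norm]
        refine (norm_le_horiz_add_height _).trans ?_
        rw [horiz_sub, horiz_bdryPt, sub_self, norm_zero, zero_add, height_sub, height_bdryPt]
        have h2 : |depth τ Ψ x| = |height x - Ψ (horiz x)| := by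
          rw [depth, abs_mul, abs_unit hτ, one_mul]
        rw [← h2, abs_of_pos ht0]
        exact ht.le
      · rw [hoff' x hxR, hoff' _ (by simpa using hxR), sub_zero, mul_zero, enorm_zero]
        exact zero_le
  calc ∫⁻ x, ‖k₁ x - k₀ (horiz x)‖ₑ ∂slab τ Ψ ε
      ≤ ∫⁻ x, (ofReal ((1 + M) * B) * (ball 0 R).indicator (fun x => ‖F x - F₀ (horiz x)‖ₑ) x
        + ofReal ((1 + M) * C * (2 * ε)) *
        (ball (0 : Euc n) R).indicator (fun z => ‖F₀ z‖ₑ) (horiz x)) ∂slab τ Ψ ε := by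
        rw [lintegral_slab, lintegral_slab]
        exact mul_le_mul_right (setLIntegral_mono' (measurableSet_layer hΨ _ _) hpt) _
    _ = ofReal ((1 + M) * B) *
        (∫⁻ x, (ball 0 R).indicator (fun x => ‖F x - F₀ (horiz x)‖ₑ) x ∂slab τ Ψ ε)
        + ofReal ((1 + M) * C * (2 * ε)) *
        ∫⁻ x, (ball (0 : Euc n) R).indicator (fun z => ‖F₀ z‖ₑ) (horiz x) ∂slab τ Ψ ε := by
        have h5 : Measurable fun x : Pt n =>
          (ball (0 : Euc n) R).indicator (fun z => ‖F₀ z‖ₑ) (horiz x) := hIm.comp hhm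
        rw [lintegral_add_left (hJm.const_mul _), lintegral_const_mul _ hJm,
          lintegral_const_mul _ h5]
    _ = _ := by
        rw [lintegral_indicator measurableSet_ball, hmp.lintegral_comp hIm,
          lintegral_indicator measurableSet_ball]

/-- The divergence theorem up to the boundary. -/
lemma integral_eq_boundary (hτ : IsSgn τ) (hΨ : LipschitzWith M Ψ)
    {F : Pt n → Pt n} {H : Pt n → ℝ} {F₀ : Euc n → Pt n}
    (hFm : Measurable F) (hF₀m : Measurable F₀)
    (hF : ∀ R, IntegrableOn F (graphDom τ Ψ ∩ ball 0 R))
    (hH : ∀ R, IntegrableOn H (graphDom τ Ψ ∩ ball 0 R))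
    (hF₀ : ∀ R, IntegrableOn F₀ (ball 0 R))
    (hid : ∀ (θ : Pt n → ℝ) (C : ℝ≥0), LipschitzWith C θ → HasCompactSupport θ →
      tsupport θ ⊆ graphDom τ Ψ → ∫ x in graphDom τ Ψ, (fderiv ℝ θ x (F x) + H x * θ x) = 0)
    (hslab : ∀ R, Tendsto (fun ε => ∫⁻ x in ball 0 R, ‖F x - F₀ (horiz x)‖ₑ ∂slab τ Ψ ε)
      (𝓝[>] 0) (𝓝 0))
    {η : Pt n → ℝ} {C : ℝ≥0} (hη : LipschitzWith C η) (hηc : HasCompactSupport η) :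
    IntegrableOn (fun x => fderiv ℝ η x (F x) + H x * η x) (graphDom τ Ψ) ∧
    ∫ x in graphDom τ Ψ, (fderiv ℝ η x (F x) + H x * η x)
      = -∫ z, inner ℝ (F₀ z) (depthGrad τ Ψ z) * η (bdryPt Ψ z) := by
  have hDm := measurableSet_graphDom (τ := τ) hΨ
  obtain ⟨B, hB⟩ := exists_bound_of_lipschitz hη hηc
  obtain ⟨R, hR⟩ := hηc.isCompact.isBounded.subset_ball (0 : Pt n)
  have hoff : ∀ x ∉ ball (0 : Pt n) R, η x = 0 := fun x hx =>
    image_eq_zero_of_notMem_tsupport fun h => hx (hR h)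
  have hoff' : ∀ x ∉ ball (0 : Pt n) R, fderiv ℝ η x = 0 := fun x hx =>
    fderiv_of_notMem_tsupport ℝ fun h => hx (hR h)
  set k : Pt n → ℝ := fun x => fderiv ℝ η x (F x) + H x * η x with hk
  have hki : IntegrableOn k (graphDom τ Ψ) := by
    refine Integrable.add (integrableOn_of_norm_le_of_off hDm C (hF R) ?_ (fun x =>
      ContinuousLinearMap.le_of_opNorm_le _ (norm_fderiv_le_of_lipschitz ℝ hη) _)
      fun x hx => by simp [hoff' x hx]) (integrableOn_of_norm_le_of_off hDm B (hH R)
      ((hH R).1.mul hη.continuous.aestronglyMeasurable) (fun x => ?_)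
      fun x hx => by simp [hoff x hx])
    · simp only [← inner_gradient_left]
      exact ((measurable_gradient η).inner hFm).aestronglyMeasurable
    · rw [norm_mul, mul_comm]; gcongr; exact hB x
  have hlim₁ : Tendsto (fun ε => ∫ x in graphDom τ Ψ, depthCut τ Ψ ε x * k x) (𝓝[>] 0)
      (𝓝 (∫ x in graphDom τ Ψ, k x)) := by
    refine tendsto_integral_filter_of_dominated_convergence (fun x => ‖k x‖) ?_ ?_ hki.norm ?_
    · filter_upwards [self_mem_nhdsWithin] with ε (hε : 0 < ε)
      obtain ⟨C', hC'⟩ := lipschitz_depthCut hτ hΨ hε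
      exact hC'.continuous.aestronglyMeasurable.mul hki.aestronglyMeasurable
    · refine Eventually.of_forall fun ε => Eventually.of_forall fun x => ?_
      rw [norm_mul]
      exact mul_le_of_le_one_left (norm_nonneg _) (norm_depthCut_le ε x)
    · filter_upwards [ae_restrict_mem hDm] with x hx
      have hx0 : 0 < depth τ Ψ x := hx
      refine tendsto_const_nhds.congr' ?_
      filter_upwards [self_mem_nhdsWithin, nhdsWithin_le_nhds
        (Iio_mem_nhds (by positivity : 0 < depth τ Ψ x / 2))] with ε (hε : 0 < ε)
        (hε' : ε < depth τ Ψ x / 2)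
      rw [depthCut_of_ge hε (by linarith), one_mul]
  have hlim₂ := tendsto_integral_slab hτ hΨ hFm hF₀m hF hF₀ hslab hη hηc
  -- The interior identity is tested with η times the depth cut-off. Differentiating the cut-off
  -- gives ε⁻¹N on the layer and zero elsewhere, which is exactly an integral against the layer
  -- measure. The minus sign appears because N points into the domain.
  have hid' : ∀ ε > 0, ∫ x, inner ℝ (F x) (depthGrad τ Ψ (horiz x)) * η x ∂slab τ Ψ ε
      = -∫ x in graphDom τ Ψ, depthCut τ Ψ ε x * k x := by
    intro ε hε
    obtain ⟨C', hC'⟩ := lipschitz_depthCut (τ := τ) hτ hΨ hε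
    have hθ := hη.mul_of_bounded hC' hB (B₂ := 1) fun x => by
      rw [abs_of_nonneg (depthCut_mem ε x).1]; exact_mod_cast (depthCut_mem ε x).2
    have hθc : HasCompactSupport fun x => η x * depthCut τ Ψ ε x := hηc.mul_right
    have hθD : tsupport (fun x => η x * depthCut τ Ψ ε x) ⊆ graphDom τ Ψ := by
      refine (closure_minimal (t := depth τ Ψ ⁻¹' Ici ε) (fun x hx => ?_)
        (isClosed_Ici.preimage (continuous_depth hΨ))).trans
        fun x hx => hε.trans_le (show ε ≤ depth τ Ψ x from hx)
      by_contra hcon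
      have h1 : depth τ Ψ x < ε := not_le.1 hcon
      exact hx (by simp [depthCut_of_le hε h1.le])
    have h0 := hid _ _ hθ hθc hθD
    have hd1 := hη.ae_differentiableAt (μ := volume)
    have hd2 := hC'.ae_differentiableAt (μ := volume)
    have hd3 := ae_horiz hτ hΨ hΨ.ae_differentiableAt
    have e1 : (fun x => fderiv ℝ (fun x => η x * depthCut τ Ψ ε x) x (F x)
        + H x * (η x * depthCut τ Ψ ε x)) =ᵐ[volume.restrict (graphDom τ Ψ)]
        fun x => depthCut τ Ψ ε x * k x + (layer τ Ψ ε (2 * ε)).indicator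
          (fun x => ε⁻¹ * (inner ℝ (F x) (depthGrad τ Ψ (horiz x)) * η x)) x := by
      refine ae_restrict_of_ae ?_
      filter_upwards [hd1, hd2, hd3, ae_depth_ne hτ hΨ ε, ae_depth_ne hτ hΨ (2 * ε)]
        with x h1 h2 h3 h4 h5
      rw [fderiv_fun_mul h1 h2]
      by_cases hx : x ∈ layer τ Ψ ε (2 * ε)
      · rw [indicator_of_mem hx]
        simp only [add_apply, smul_apply, smul_eq_mul, hk, fderiv_depthCut_of_mem hΨ hε hx h3]
        ring
      · rw [indicator_of_notMem hx]
        simp only [add_apply, smul_apply, smul_eq_mul, hk,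
          fderiv_depthCut_of_notMem hΨ hε hx h4 h5, zero_apply]
        ring
    have hi1 : IntegrableOn (fun x => depthCut τ Ψ ε x * k x) (graphDom τ Ψ) :=
      hki.bdd_mul hC'.continuous.aestronglyMeasurable (.of_forall (norm_depthCut_le ε))
    have hi2 : IntegrableOn ((layer τ Ψ ε (2 * ε)).indicator
        (fun x => ε⁻¹ * (inner ℝ (F x) (depthGrad τ Ψ (horiz x)) * η x))) (graphDom τ Ψ) := by
      refine Integrable.indicator (Integrable.const_mul ?_ _) (measurableSet_layer hΨ _ _)
      have hm : Measurable fun x : Pt n => depthGrad τ Ψ (horiz x) :=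
        (measurable_depthGrad τ Ψ).comp measurable_horiz
      exact integrableOn_of_norm_le_of_off hDm _ (hF R)
        ((hFm.inner hm).mul hη.continuous.measurable).aestronglyMeasurable
        (fun x => norm_inner_depthGrad_mul_le hτ hΨ _ _ (hB x)) fun x hx => by simp [hoff x hx]
    rw [integral_congr_ae e1, integral_add hi1 hi2, setIntegral_indicator
      (measurableSet_layer hΨ _ _), inter_eq_self_of_subset_right (layer_subset hε.le),
      integral_const_mul, ← integral_slab hε] at h0
    linarith
  have hlim₃ : Tendsto (fun ε => ∫ x, inner ℝ (F x) (depthGrad τ Ψ (horiz x)) * η x ∂slab τ Ψ ε)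
      (𝓝[>] 0) (𝓝 (-∫ x in graphDom τ Ψ, k x)) := by
    refine hlim₁.neg.congr' ?_
    filter_upwards [self_mem_nhdsWithin] with ε hε using (hid' ε hε).symm
  exact ⟨hki, by rw [tendsto_nhds_unique hlim₂ hlim₃, neg_neg]⟩

end Divergence

lemma memLp_two_of_lintegral_lt_top {X E : Type*} [MeasurableSpace X] [NormedAddCommGroup E]
    {m : Measure X} {P : X → E} (hP : AEStronglyMeasurable P m) (h : ∫⁻ x, ‖P x‖ₑ ^ 2 ∂m < ∞) :
    MemLp P 2 m := by
  rw [← eLpNorm_two_sq] at h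
  exact ⟨hP, by simpa using h⟩

lemma integrable_of_norm_le_mul {X E₁ E₂ E₃ : Type*} [MeasurableSpace X] [NormedAddCommGroup E₁]
    [NormedAddCommGroup E₂] [NormedAddCommGroup E₃] {m : Measure X} {P : X → E₁} {Q : X → E₂}
    {F : X → E₃} {c : ℝ} (hF : AEStronglyMeasurable F m) (hPm : AEStronglyMeasurable P m)
    (hQm : AEStronglyMeasurable Q m) (hP : ∫⁻ x, ‖P x‖ₑ ^ 2 ∂m < ∞) (hQ : ∫⁻ x, ‖Q x‖ₑ ^ 2 ∂m < ∞)
    (h : ∀ᵐ x ∂m, ‖F x‖ ≤ c * (‖P x‖ * ‖Q x‖)) : Integrable F m := by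
  have h1 := (memLp_two_of_lintegral_lt_top hPm hP).norm.integrable_mul
    (memLp_two_of_lintegral_lt_top hQm hQ).norm
  exact Integrable.mono' (h1.const_mul c) hF h

/-! ### Boundary values of bilinear fields -/

section SlabProducts

variable {n : ℕ} {τ : ℝ} {M : ℝ≥0} {Ψ : Euc n → ℝ}
  {E₁ E₂ : Type*} [NormedAddCommGroup E₁] [MeasurableSpace E₁] [BorelSpace E₁]
  [SecondCountableTopology E₁] [NormedAddCommGroup E₂] [MeasurableSpace E₂] [BorelSpace E₂]
  [SecondCountableTopology E₂]

lemma lintegral_mul_le_sqrt {X : Type*} [MeasurableSpace X] {m : Measure X} {f g : X → ℝ≥0∞}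
    (hf : AEMeasurable f m) (hg : AEMeasurable g m) :
    ∫⁻ x, f x * g x ∂m ≤ ((∫⁻ x, f x ^ 2 ∂m) * ∫⁻ x, g x ^ 2 ∂m) ^ (1 / 2 : ℝ) := by
  have e : ∀ a : ℝ≥0∞, a = (a ^ 2) ^ (1 / 2 : ℝ) := fun a => by
    rw [← ENNReal.rpow_natCast, ← ENNReal.rpow_mul]; norm_num
  rw [e (∫⁻ x, f x * g x ∂m)]
  exact ENNReal.rpow_le_rpow (lintegral_mul_sq_le hf hg) (by norm_num)

/-- `P₀` are the boundary values of `P`, in mean square. -/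
structure HasBdryVal (τ : ℝ) (Ψ : Euc n → ℝ) (P : Pt n → E₁) (P₀ : Euc n → E₁) : Prop where
  meas : Measurable P
  meas_bdry : Measurable P₀
  sq R : ∫⁻ x in graphDom τ Ψ ∩ ball 0 R, ‖P x‖ₑ ^ 2 < ∞
  sq_bdry R : ∫⁻ z in ball 0 R, ‖P₀ z‖ₑ ^ 2 < ∞
  slab : Tendsto (fun ε : ℝ => ∫⁻ x, ‖P x - P₀ (horiz x)‖ₑ ^ 2 ∂slab τ Ψ ε) (𝓝[>] 0) (𝓝 0)

variable {P : Pt n → E₁} {P₀ : Euc n → E₁} {Q : Pt n → E₂} {Q₀ : Euc n → E₂}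

/-- Products of functions that converge in mean square on the boundary layers converge in mean. -/
lemma tendsto_slab_mul (hτ : IsSgn τ) (hΨ : LipschitzWith M Ψ) (hP : HasBdryVal τ Ψ P P₀)
    (hQ : HasBdryVal τ Ψ Q Q₀) (R : ℝ) {X : Pt n → ℝ≥0∞} {c : ℝ}
    (hX : ∀ x, X x ≤ ofReal c * (‖P x - P₀ (horiz x)‖ₑ * ‖Q x - Q₀ (horiz x)‖ₑ
      + ‖P x - P₀ (horiz x)‖ₑ * ‖Q₀ (horiz x)‖ₑ + ‖P₀ (horiz x)‖ₑ * ‖Q x - Q₀ (horiz x)‖ₑ)) :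
    Tendsto (fun ε : ℝ => ∫⁻ x in ball 0 R, X x ∂slab τ Ψ ε) (𝓝[>] 0) (𝓝 0) := by
  obtain ⟨hPm, hP₀m, -, hP₀, hP⟩ := hP
  obtain ⟨hQm, hQ₀m, -, hQ₀, hQ⟩ := hQ
  replace hP₀ := hP₀ R
  replace hQ₀ := hQ₀ R
  have hhm := measurable_horiz (n := n)
  set p := ∫⁻ z in ball 0 R, ‖P₀ z‖ₑ ^ 2
  set q := ∫⁻ z in ball 0 R, ‖Q₀ z‖ₑ ^ 2
  set A : ℝ → ℝ≥0∞ := fun ε => ∫⁻ x, ‖P x - P₀ (horiz x)‖ₑ ^ 2 ∂slab τ Ψ ε with hA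
  set B : ℝ → ℝ≥0∞ := fun ε => ∫⁻ x, ‖Q x - Q₀ (horiz x)‖ₑ ^ 2 ∂slab τ Ψ ε
  have hroot : ∀ {Y : ℝ → ℝ≥0∞}, Tendsto Y (𝓝[>] 0) (𝓝 0) →
      Tendsto (fun ε => Y ε ^ (1 / 2 : ℝ)) (𝓝[>] 0) (𝓝 0) := fun {Y} hY => by
    have := (ENNReal.continuous_rpow_const (y := (1 / 2 : ℝ))).tendsto 0 |>.comp hY
    simpa [Function.comp_def] using this
  have h1 := hroot (Y := fun ε => A ε * B ε) (by
    simpa using ENNReal.Tendsto.mul hP (Or.inr (by simp)) hQ (Or.inr (by simp)))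
  have h2 := hroot (Y := fun ε => A ε * q) (by
    simpa using ENNReal.Tendsto.mul_const hP (Or.inr hQ₀.ne))
  have h3 := hroot (Y := fun ε => p * B ε) (by
    simpa using ENNReal.Tendsto.const_mul hQ (Or.inr hP₀.ne))
  have h4 : Tendsto (fun ε => ofReal c * ((A ε * B ε) ^ (1 / 2 : ℝ)
      + (A ε * q) ^ (1 / 2 : ℝ) + (p * B ε) ^ (1 / 2 : ℝ))) (𝓝[>] 0) (𝓝 0) := by
    simpa using ENNReal.Tendsto.const_mul ((h1.add h2).add h3) (Or.inr ofReal_ne_top)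
  refine tendsto_nhds_bot_mono h4 ?_
  filter_upwards [self_mem_nhdsWithin] with ε (hε : 0 < ε)
  have hmp := measurePreserving_horiz_slab hτ hΨ hε
  have hball : ∀ h : Euc n → ℝ≥0∞, Measurable h →
      ∫⁻ x in ball 0 R, h (horiz x) ∂slab τ Ψ ε ≤ ∫⁻ z in ball 0 R, h z := fun h hh =>
    (lintegral_mono_set (t := horiz ⁻¹' ball 0 R) fun x hx => mem_ball_zero_iff.2
      ((norm_horiz_le x).trans_lt (by simpa using hx))).trans_eq
      (hmp.setLIntegral_comp_preimage measurableSet_ball hh)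
  set m := (slab τ Ψ ε).restrict (ball 0 R)
  have hPd : Measurable fun x => ‖P x - P₀ (horiz x)‖ₑ := (hPm.sub (hP₀m.comp hhm)).enorm
  have hQd : Measurable fun x => ‖Q x - Q₀ (horiz x)‖ₑ := (hQm.sub (hQ₀m.comp hhm)).enorm
  have hPh : Measurable fun x : Pt n => ‖P₀ (horiz x)‖ₑ := (hP₀m.comp hhm).enorm
  have hQh : Measurable fun x : Pt n => ‖Q₀ (horiz x)‖ₑ := (hQ₀m.comp hhm).enorm
  have hAle : ∫⁻ x, ‖P x - P₀ (horiz x)‖ₑ ^ 2 ∂m ≤ A ε := setLIntegral_le_lintegral _ _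
  have hBle : ∫⁻ x, ‖Q x - Q₀ (horiz x)‖ₑ ^ 2 ∂m ≤ B ε := setLIntegral_le_lintegral _ _
  have hpl : ∫⁻ x, ‖P₀ (horiz x)‖ₑ ^ 2 ∂m ≤ p := hball (fun z => ‖P₀ z‖ₑ ^ 2) (by fun_prop)
  have hql : ∫⁻ x, ‖Q₀ (horiz x)‖ₑ ^ 2 ∂m ≤ q := hball (fun z => ‖Q₀ z‖ₑ ^ 2) (by fun_prop)
  calc ∫⁻ x, X x ∂m ≤ ∫⁻ x, ofReal c * (‖P x - P₀ (horiz x)‖ₑ * ‖Q x - Q₀ (horiz x)‖ₑ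
      + ‖P x - P₀ (horiz x)‖ₑ * ‖Q₀ (horiz x)‖ₑ + ‖P₀ (horiz x)‖ₑ * ‖Q x - Q₀ (horiz x)‖ₑ) ∂m :=
        lintegral_mono hX
    _ = ofReal c * ((∫⁻ x, ‖P x - P₀ (horiz x)‖ₑ * ‖Q x - Q₀ (horiz x)‖ₑ ∂m)
        + (∫⁻ x, ‖P x - P₀ (horiz x)‖ₑ * ‖Q₀ (horiz x)‖ₑ ∂m)
        + ∫⁻ x, ‖P₀ (horiz x)‖ₑ * ‖Q x - Q₀ (horiz x)‖ₑ ∂m) := by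
        have m1 : Measurable fun x => ‖P x - P₀ (horiz x)‖ₑ * ‖Q₀ (horiz x)‖ₑ := hPd.mul hQh
        have m2 : Measurable fun x => ‖P₀ (horiz x)‖ₑ * ‖Q x - Q₀ (horiz x)‖ₑ := hPh.mul hQd
        rw [lintegral_const_mul' _ _ ofReal_ne_top, lintegral_add_right _ m2,
          lintegral_add_right _ m1]
    _ ≤ _ := by
        gcongr
        · refine (lintegral_mul_le_sqrt hPd.aemeasurable hQd.aemeasurable).trans ?_
          gcongr
        · refine (lintegral_mul_le_sqrt hPd.aemeasurable hQh.aemeasurable).trans ?_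
          gcongr
        · refine (lintegral_mul_le_sqrt hPh.aemeasurable hQd.aemeasurable).trans ?_
          gcongr

/-- The divergence theorem for a field that is bilinear in functions with boundary values. -/
lemma integral_eq_boundary_bilin (hτ : IsSgn τ) (hΨ : LipschitzWith M Ψ)
    (hP : HasBdryVal τ Ψ P P₀) (hQ : HasBdryVal τ Ψ Q Q₀) {T : Pt n → E₁ → E₂ → Pt n} {c : ℝ}
    (hT : ∀ x v w, ‖T x v w‖ ≤ c * (‖v‖ * ‖w‖)) (hTi : ∀ x, T (bdryPt Ψ (horiz x)) = T x)
    (hTs : ∀ x v v' w w', T x v w - T x v' w'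
      = T x (v - v') (w - w') + T x (v - v') w' + T x v' (w - w'))
    (mF : Measurable fun x => T x (P x) (Q x))
    (mF₀ : Measurable fun z => T (bdryPt Ψ z) (P₀ z) (Q₀ z)) {H : Pt n → ℝ}
    (hH : ∀ R, IntegrableOn H (graphDom τ Ψ ∩ ball 0 R))
    (hid : ∀ (θ : Pt n → ℝ) (C : ℝ≥0), LipschitzWith C θ → HasCompactSupport θ →
      tsupport θ ⊆ graphDom τ Ψ →
      ∫ x in graphDom τ Ψ, (fderiv ℝ θ x (T x (P x) (Q x)) + H x * θ x) = 0)
    {η : Pt n → ℝ} {C : ℝ≥0} (hη : LipschitzWith C η) (hηc : HasCompactSupport η) :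
    IntegrableOn (fun x => fderiv ℝ η x (T x (P x) (Q x)) + H x * η x) (graphDom τ Ψ) ∧
    ∫ x in graphDom τ Ψ, (fderiv ℝ η x (T x (P x) (Q x)) + H x * η x)
      = -∫ z, inner ℝ (T (bdryPt Ψ z) (P₀ z) (Q₀ z)) (depthGrad τ Ψ z) * η (bdryPt Ψ z) := by
  have hTe : ∀ x v w, ‖T x v w‖ₑ ≤ ofReal c * (‖v‖ₑ * ‖w‖ₑ) := fun x v w => by
    rw [← ofReal_norm, ← ofReal_norm, ← ofReal_norm, ← ofReal_mul (norm_nonneg _),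
      ← ofReal_mul' (by positivity)]
    exact ofReal_le_ofReal (hT x v w)
  refine integral_eq_boundary hτ hΨ mF mF₀ (fun R => ?_) hH (fun R => ?_) hid (fun R => ?_) hη hηc
  · exact integrable_of_norm_le_mul mF.aestronglyMeasurable hP.meas.aestronglyMeasurable
      hQ.meas.aestronglyMeasurable (hP.sq R) (hQ.sq R) (.of_forall fun x => hT _ _ _)
  · exact integrable_of_norm_le_mul mF₀.aestronglyMeasurable hP.meas_bdry.aestronglyMeasurable
      hQ.meas_bdry.aestronglyMeasurable (hP.sq_bdry R) (hQ.sq_bdry R) (.of_forall fun x => hT _ _ _)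
  -- The field has the same coefficients at x and at the boundary point below it, so T(P, Q) − T(P₀,
  -- Q₀) expands into three products, each with at least one factor tending to zero in L² of the
  -- layer.
  · refine tendsto_slab_mul (c := c) hτ hΨ hP hQ R fun x => ?_
    rw [hTi, hTs, mul_add, mul_add]
    exact (enorm_add_le _ _).trans (add_le_add ((enorm_add_le _ _).trans
      (add_le_add (hTe _ _ _) (hTe _ _ _))) (hTe _ _ _))

end SlabProducts

/-! ### Energy, trace and Rellich identities with boundary terms -/

section BoundaryIdentities

variable {n : ℕ} {τ : ℝ} {M : ℝ≥0} {Ψ : Euc n → ℝ} {μ Λ K : ℝ}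
  {a : Pt n → Pt n →L[ℝ] Pt n} {V : Pt n → ℝ}
  {u : Pt n → ℝ} {g : Pt n → Pt n} {f : Euc n → ℝ} {G : Euc n → Pt n}

/-- `f` and `G` are the boundary values of `u` and `g`, in mean square. -/
structure BdryData (τ : ℝ) (Ψ : Euc n → ℝ) (u : Pt n → ℝ) (g : Pt n → Pt n)
    (f : Euc n → ℝ) (G : Euc n → Pt n) : Prop where
  meas_u : Measurable u
  meas_g : Measurable g
  meas_f : Measurable f
  meas_G : Measurable G
  sq_u : ∀ R, ∫⁻ x in graphDom τ Ψ ∩ ball 0 R, ‖u x‖ₑ ^ 2 < ∞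
  sq_g : ∀ R, ∫⁻ x in graphDom τ Ψ ∩ ball 0 R, ‖g x‖ₑ ^ 2 < ∞
  sq_f : ∀ R, ∫⁻ z in ball 0 R, ‖f z‖ₑ ^ 2 < ∞
  sq_G : ∫⁻ z, ‖G z‖ₑ ^ 2 < ∞
  slab_u : Tendsto (fun ε : ℝ => ∫⁻ x, ‖u x - f (horiz x)‖ₑ ^ 2 ∂slab τ Ψ ε) (𝓝[>] 0) (𝓝 0)
  slab_g : Tendsto (fun ε : ℝ => ∫⁻ x, ‖g x - G (horiz x)‖ₑ ^ 2 ∂slab τ Ψ ε) (𝓝[>] 0) (𝓝 0)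

lemma BdryData.val_u (h : BdryData τ Ψ u g f G) : HasBdryVal τ Ψ u f :=
  ⟨h.meas_u, h.meas_f, h.sq_u, h.sq_f, h.slab_u⟩

lemma BdryData.val_g (h : BdryData τ Ψ u g f G) : HasBdryVal τ Ψ g G :=
  ⟨h.meas_g, h.meas_G, h.sq_g, fun _ => (setLIntegral_le_lintegral _ _).trans_lt h.sq_G, h.slab_g⟩

lemma GoodCoeff.meas_bdry (ha : GoodCoeff μ Λ a) (hΨ : LipschitzWith M Ψ) (hG : Measurable G) :
    Measurable fun z => a (bdryPt Ψ z) (G z) := by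
  have h1 := ha.meas (fun x => G (horiz x)) (hG.comp measurable_horiz)
  have h2 := h1.comp (continuous_bdryPt hΨ).measurable
  simpa [Function.comp_def] using h2

/-- The conormal derivative, with respect to the gradient of the depth. -/
def bdryFlux (τ : ℝ) (Ψ : Euc n → ℝ) (a : Pt n → Pt n →L[ℝ] Pt n)
    (G : Euc n → Pt n) (z : Euc n) : ℝ :=
  inner ℝ (a (bdryPt Ψ z) (G z)) (depthGrad τ Ψ z)

/-- The energy density on the boundary. -/
def bdryEnergy (Ψ : Euc n → ℝ) (a : Pt n → Pt n →L[ℝ] Pt n) (G : Euc n → Pt n) (z : Euc n) : ℝ :=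
  inner ℝ (a (bdryPt Ψ z) (G z)) (G z)

lemma IsBInfty.exists_bound_ball (hV : IsBInfty K V) (R : ℝ) :
    ∃ B : ℝ, 0 ≤ B ∧ ∀ᵐ x ∂volume.restrict (ball (0 : Pt n) R), |V x| ≤ B := by
  refine ⟨ballSup V 0 R, ballSup_nonneg _ _, ?_⟩
  have h := hV.locBounded 0 R
  filter_upwards [ae_le_eLpNormEssSup (f := V) (μ := volume.restrict (ball 0 R))] with x hx
  rw [← eLpNorm_exponent_top] at hx
  have := toReal_mono h.2.ne hx
  simpa [ballSup] using this

/-- The energy identity up to the boundary. -/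
lemma BdryData.energy (h : BdryData τ Ψ u g f G) (hτ : IsSgn τ) (hΨ : LipschitzWith M Ψ)
    (ha : GoodCoeff μ Λ a) (hV : IsBInfty K V) (hVm : Measurable V)
    (hu : HasWeakGrad (graphDom τ Ψ) u g)
    (hW : WeakId (graphDom τ Ψ) (fun x => a x (g x)) (fun x => V x * u x))
    {η : Pt n → ℝ} {C : ℝ≥0} (hη : LipschitzWith C η) (hηc : HasCompactSupport η) :
    IntegrableOn (fun x => fderiv ℝ η x (u x • a x (g x))
      + (inner ℝ (a x (g x)) (g x) + V x * u x ^ 2) * η x) (graphDom τ Ψ) ∧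
    ∫ x in graphDom τ Ψ, (fderiv ℝ η x (u x • a x (g x))
      + (inner ℝ (a x (g x)) (g x) + V x * u x ^ 2) * η x)
      = -∫ z, f z * bdryFlux τ Ψ a G z * η (bdryPt Ψ z) := by
  have hum := h.meas_u
  have hgm := h.meas_g
  have hfm := h.meas_f
  have hGm := h.meas_G
  have hagm := ha.meas g hgm
  have haGm := ha.meas_bdry hΨ hGm
  have key := integral_eq_boundary_bilin (T := fun x (s : ℝ) v => s • a x v) (c := Λ)
    (H := fun x => inner ℝ (a x (g x)) (g x) + V x * u x ^ 2) hτ hΨ h.val_u h.val_g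
    (fun x s v => ?_) (fun x => ?_) (fun x s s' v v' => ?_) (hum.smul hagm) (hfm.smul haGm)
    (fun R => ?_) (fun θ C' h1 h2 h3 => energy_identity (isOpen_graphDom hΨ) hu hW h1 h2 h3) hη hηc
  · simp only [real_inner_smul_left] at key
    exact key
  · rw [norm_smul, mul_left_comm]; gcongr; exact ha.bound x v
  · rw [ha.indep _ x (by simp)]
  · simp only [map_sub]; module
  · refine Integrable.add ?_ ?_
    · exact integrable_of_norm_le_mul (hagm.inner hgm).aestronglyMeasurable
        hgm.aestronglyMeasurable hgm.aestronglyMeasurable (h.sq_g R) (h.sq_g R)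
        (.of_forall fun x => ha.abs_inner_le _ _ _)
    · obtain ⟨B, hB, hVB⟩ := hV.exists_bound_ball R
      refine integrable_of_norm_le_mul (c := B) (by fun_prop) hum.aestronglyMeasurable
        hum.aestronglyMeasurable (h.sq_u R) (h.sq_u R) ?_
      filter_upwards [ae_restrict_of_ae_restrict_of_subset inter_subset_right hVB] with x hx
      rw [norm_mul, norm_pow, sq, norm_eq_abs (V x)]
      gcongr

/-- The trace identity up to the boundary. -/
lemma BdryData.trace (h : BdryData τ Ψ u g f G) (hτ : IsSgn τ) (hΨ : LipschitzWith M Ψ)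
    (hu : HasWeakGrad (graphDom τ Ψ) u g)
    {η : Pt n → ℝ} {C : ℝ≥0} (hη : LipschitzWith C η) (hηc : HasCompactSupport η) :
    IntegrableOn (fun x => fderiv ℝ η x (u x ^ 2 • vert n τ)
      + 2 * u x * inner ℝ (g x) (vert n τ) * η x) (graphDom τ Ψ) ∧
    ∫ x in graphDom τ Ψ, (fderiv ℝ η x (u x ^ 2 • vert n τ)
      + 2 * u x * inner ℝ (g x) (vert n τ) * η x) = -∫ z, f z ^ 2 * η (bdryPt Ψ z) := by
  have hum := h.meas_u
  have hgm := h.meas_g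
  have hfm := h.meas_f
  have key := integral_eq_boundary_bilin (T := fun _ (s t : ℝ) => (s * t) • vert n τ) (c := 1)
    (H := fun x => 2 * u x * inner ℝ (g x) (vert n τ)) hτ hΨ h.val_u h.val_u
    (fun x s t => ?_) (fun x => rfl) (fun x s s' t t' => ?_) (by fun_prop) (by fun_prop)
    (fun R => ?_) (fun θ C' h1 h2 h3 => ?_) hη hηc
  · simp only [real_inner_smul_left, inner_depthGrad_vert hτ, mul_one, ← sq] at key
    exact key
  · rw [norm_smul, norm_vert hτ, norm_mul, mul_one, one_mul]
  · simp only [← sub_smul, ← add_smul]; congr 1; ring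
  · refine integrable_of_norm_le_mul (c := 2) (by fun_prop) hum.aestronglyMeasurable
      hgm.aestronglyMeasurable (h.sq_u R) (h.sq_g R) (.of_forall fun x => ?_)
    rw [norm_mul, norm_mul, Real.norm_ofNat, mul_assoc]
    gcongr
    exact abs_inner_vert_le hτ _
  · simp only [← sq]
    exact trace_identity (isOpen_graphDom hΨ) hu _ h1 h2 h3

lemma GoodCoeff.norm_rellichField_le (ha : GoodCoeff μ Λ a) (hτ : IsSgn τ) (x v w : Pt n) :
    ‖rellichField (a x) (vert n τ) v w‖ ≤ 3 * Λ * (‖v‖ * ‖w‖) := by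
  refine (norm_sub_le _ _).trans ?_
  rw [norm_smul, norm_smul, norm_vert hτ, mul_one, norm_mul, Real.norm_ofNat]
  have h1 : 2 * ‖inner ℝ v (vert n τ)‖ * ‖a x w‖ ≤ 2 * ‖v‖ * (Λ * ‖w‖) := by
    gcongr
    exacts [abs_inner_vert_le hτ v, ha.bound x w]
  have h2 := ha.abs_inner_le x v w
  rw [← norm_eq_abs] at h2
  linarith

lemma measurable_rellichField {X : Type*} [MeasurableSpace X] {A : X → Pt n →L[ℝ] Pt n}
    {w : X → Pt n} (hw : Measurable w) (hA : Measurable fun x => A x (w x)) (e : Pt n) :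
    Measurable fun x => rellichField (A x) e (w x) (w x) := by
  have h1 : Measurable fun x => inner ℝ (w x) e := hw.inner measurable_const
  have h2 : Measurable fun x => inner ℝ (A x (w x)) (w x) := hA.inner hw
  exact ((h1.const_mul 2).smul hA).sub (h2.smul measurable_const)

/-- The Rellich identity up to the boundary. -/
lemma BdryData.rellich (h : BdryData τ Ψ u g f G) (hτ : IsSgn τ) (hΨ : LipschitzWith M Ψ)
    (ha : GoodCoeff μ Λ a) (hV : IsBInfty K V) (hVm : Measurable V)
    (hu : HasWeakGrad (graphDom τ Ψ) u g)
    (hW : WeakId (graphDom τ Ψ) (fun x => a x (g x)) (fun x => V x * u x))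
    {η : Pt n → ℝ} {C : ℝ≥0} (hη : LipschitzWith C η) (hηc : HasCompactSupport η) :
    IntegrableOn (fun x => fderiv ℝ η x (rellichField (a x) (vert n τ) (g x) (g x))
      + 2 * V x * u x * inner ℝ (g x) (vert n τ) * η x) (graphDom τ Ψ) ∧
    ∫ x in graphDom τ Ψ, (fderiv ℝ η x (rellichField (a x) (vert n τ) (g x) (g x))
      + 2 * V x * u x * inner ℝ (g x) (vert n τ) * η x)
      = -∫ z, (2 * inner ℝ (G z) (vert n τ) * bdryFlux τ Ψ a G z - bdryEnergy Ψ a G z)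
        * η (bdryPt Ψ z) := by
  have hum := h.meas_u
  have hgm := h.meas_g
  have hfm := h.meas_f
  have hGm := h.meas_G
  have hagm := ha.meas g hgm
  have haGm := ha.meas_bdry hΨ hGm
  have key := integral_eq_boundary_bilin (T := fun x => rellichField (a x) (vert n τ))
    (H := fun x => 2 * V x * u x * inner ℝ (g x) (vert n τ)) hτ hΨ h.val_g h.val_g
    (ha.norm_rellichField_le hτ) (fun x => ?_) (fun x v v' w w' => ?_)
    (measurable_rellichField hgm hagm _) (measurable_rellichField hGm haGm _) (fun R => ?_)
    (fun θ C' h1 h2 h3 => rellich_identity (isOpen_graphDom hΨ) ha hgm hu hW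
      (fun x hx s hs => ?_) (horiz_vert ..) h1 h2 h3) hη hηc
  · simp only [rellichField.eq_1 (a (bdryPt _ _)), inner_sub_left, real_inner_smul_left,
      inner_depthGrad_vert hτ, mul_one] at key
    exact key
  · rw [ha.indep _ x (by simp)]
  · simp only [rellichField, map_sub, inner_sub_left, inner_sub_right]; module
  · obtain ⟨B, hB, hVB⟩ := hV.exists_bound_ball R
    refine integrable_of_norm_le_mul (c := 2 * B) (by fun_prop) hum.aestronglyMeasurable
      hgm.aestronglyMeasurable (h.sq_u R) (h.sq_g R) ?_
    filter_upwards [ae_restrict_of_ae_restrict_of_subset inter_subset_right hVB] with x hx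
    have h1 := abs_inner_vert_le hτ (g x)
    rw [← norm_eq_abs] at h1
    rw [norm_mul, norm_mul, norm_mul, Real.norm_ofNat, norm_eq_abs (V x), mul_assoc (2 * |V x|)]
    gcongr
  · change 0 < depth τ Ψ _
    rw [depth_add_smul_vert hτ]
    have : 0 < depth τ Ψ x := hx
    linarith

end BoundaryIdentities

/-- Passes from an inequality with a signed integrable function h to nonnegative integrals, without
assuming that the right-hand side is finite: if N is not integrable there is nothing to prove. -/
lemma lintegral_le_of_integral_le {X : Type*} [MeasurableSpace X] {m : Measure X} {h L N : X → ℝ}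
    {P : ℝ} (hh : Integrable h m) (hP : ∫ x, h x ∂m ≤ P) (hN : AEMeasurable N m)
    (hL : ∀ᵐ x ∂m, 0 ≤ L x) (hN0 : ∀ᵐ x ∂m, 0 ≤ N x) (hle : ∀ᵐ x ∂m, L x ≤ h x + N x) :
    ∫⁻ x, ofReal (L x) ∂m ≤ ofReal P + ∫⁻ x, ofReal (N x) ∂m := by
  by_cases hfin : ∫⁻ x, ofReal (N x) ∂m = ∞
  · simp [hfin]
  have hNi : Integrable N m := by
    refine ⟨hN.aestronglyMeasurable, ?_⟩
    rw [hasFiniteIntegral_iff_ofReal hN0]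
    exact lt_top_iff_ne_top.2 hfin
  calc ∫⁻ x, ofReal (L x) ∂m ≤ ∫⁻ x, ofReal (h x + N x) ∂m :=
        lintegral_mono_ae (hle.mono fun x hx => ofReal_le_ofReal hx)
    _ = ofReal (∫ x, h x + N x ∂m) := by
        refine (ofReal_integral_eq_lintegral_ofReal (hh.add hNi) ?_).symm
        filter_upwards [hL, hle] with x h1 h2 using h1.trans h2
    _ ≤ ofReal (P + ∫ x, N x ∂m) := by
        rw [integral_add hh hNi]; exact ofReal_le_ofReal (by linarith)
    _ ≤ _ := by
        refine ofReal_add_le.trans ?_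
        rw [ofReal_integral_eq_lintegral_ofReal hNi hN0]

/-- Fatou's lemma with an error tending to zero; it removes the cut-offs and the regularization of
the weight. -/
lemma lintegral_le_of_tendsto {X : Type*} [MeasurableSpace X] {m : Measure X} {F : ℕ → X → ℝ≥0∞}
    {F₀ : X → ℝ≥0∞} {a : ℝ≥0∞} {b : ℕ → ℝ≥0∞} (hF : ∀ k, AEMeasurable (F k) m)
    (hlim : ∀ᵐ x ∂m, Tendsto (fun k => F k x) atTop (𝓝 (F₀ x)))
    (hle : ∀ᶠ k in atTop, ∫⁻ x, F k x ∂m ≤ a + b k) (hb : Tendsto b atTop (𝓝 0)) :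
    ∫⁻ x, F₀ x ∂m ≤ a := by
  calc ∫⁻ x, F₀ x ∂m = ∫⁻ x, liminf (fun k => F k x) atTop ∂m :=
        lintegral_congr_ae (hlim.mono fun x hx => hx.liminf_eq.symm)
    _ ≤ liminf (fun k => ∫⁻ x, F k x ∂m) atTop := lintegral_liminf_le' hF
    _ ≤ liminf (fun k => a + b k) atTop := liminf_le_liminf hle
    _ = a := by
        have : Tendsto (fun k => a + b k) atTop (𝓝 (a + 0)) := tendsto_const_nhds.add hb
        simpa using this.liminf_eq

/-! ### The weight (ρ + ε)^{-1/2} -/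

section RootWeight

variable {d : ℕ} {ρ : Euc d → ℝ} {ε : ℝ}

/-- The weight `(ρ + ε)^{-1/2}`. -/
def rootWt (ρ : Euc d → ℝ) (ε : ℝ) (x : Euc d) : ℝ := (√(ρ x + ε))⁻¹

lemma rootWt_pos (hρ : ∀ x, 0 < ρ x) (hε : 0 < ε) (x : Euc d) : 0 < rootWt ρ ε x :=
  inv_pos.2 (Real.sqrt_pos.2 (add_pos (hρ x) hε))

lemma rootWt_sq (hρ : ∀ x, 0 < ρ x) (hε : 0 < ε) (x : Euc d) : rootWt ρ ε x ^ 2 = (ρ x + ε)⁻¹ := by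
  rw [rootWt, inv_pow, Real.sq_sqrt (add_pos (hρ x) hε).le]

lemma rootWt_sq_le (hρ : ∀ x, 0 < ρ x) (hε : 0 < ε) (x : Euc d) : rootWt ρ ε x ^ 2 ≤ ε⁻¹ := by
  rw [rootWt_sq hρ hε]
  exact inv_anti₀ hε (by linarith [hρ x])

lemma abs_rootWt_le (hρ : ∀ x, 0 < ρ x) (hε : 0 < ε) (x : Euc d) :
    |rootWt ρ ε x| ≤ Real.sqrt ε⁻¹ :=
  Real.abs_le_sqrt (rootWt_sq_le hρ hε x)

lemma exists_lipschitz_rootWt (h1 : LipschitzWith 1 ρ) (hρ : ∀ x, 0 < ρ x) (hε : 0 < ε) :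
    ∃ C : ℝ≥0, LipschitzWith C (rootWt ρ ε) := by
  set c := Real.sqrt ε
  have hc0 : 0 < c := Real.sqrt_pos.2 hε
  refine ⟨Real.toNNReal (c ^ 3)⁻¹, LipschitzWith.of_dist_le_mul fun x y => ?_⟩
  have hd := h1.dist_le_mul x y
  rw [Real.dist_eq] at hd ⊢
  rw [coe_toNNReal _ (by positivity)]
  set p := √(ρ x + ε) with hp
  set q := √(ρ y + ε)
  have hcp : c ≤ p := Real.sqrt_le_sqrt (by linarith [hρ x])
  have hcq : c ≤ q := Real.sqrt_le_sqrt (by linarith [hρ y])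
  have hp0 : 0 < p := hc0.trans_le hcp
  have hq0 : 0 < q := hc0.trans_le hcq
  have e : ρ x - ρ y = (p - q) * (p + q) := by
    have h2 : p ^ 2 = ρ x + ε := Real.sq_sqrt (add_pos (hρ x) hε).le
    have h3 : q ^ 2 = ρ y + ε := Real.sq_sqrt (add_pos (hρ y) hε).le
    nlinarith
  rw [e, abs_mul, abs_of_pos (add_pos hp0 hq0)] at hd
  have e2 : rootWt ρ ε x - rootWt ρ ε y = (q - p) / (p * q) := by
    change p⁻¹ - q⁻¹ = _
    field_simp
  rw [e2, abs_div, abs_of_pos (mul_pos hp0 hq0), div_le_iff₀ (mul_pos hp0 hq0), abs_sub_comm]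
  have h4 : c * |p - q| ≤ dist x y := by
    have : c * |p - q| ≤ |p - q| * (p + q) := by nlinarith [abs_nonneg (p - q)]
    simp only [NNReal.coe_one, one_mul] at hd
    linarith
  have h5 : c ^ 2 ≤ p * q := by nlinarith
  have h6 : |p - q| ≤ c⁻¹ * dist x y := by rw [inv_mul_eq_div, le_div_iff₀ hc0]; linarith
  calc |p - q| ≤ c⁻¹ * dist x y := h6
    _ = (c ^ 3)⁻¹ * dist x y * c ^ 2 := by field_simp
    _ ≤ _ := mul_le_mul_of_nonneg_left h5 (by positivity)

/-- Formally ∇(ρ + ε)^{-1/2} = −½(ρ + ε)^{-3/2}∇ρ with |∇ρ| ≤ 1. The chain rule is applied to ρ as a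
function of the weight, so only differentiability of the weight is needed, and where that fails the
derivative is zero by convention. -/
lemma norm_fderiv_rootWt_le (h1 : LipschitzWith 1 ρ) (hρ : ∀ x, 0 < ρ x) (hε : 0 < ε) (x : Euc d) :
    ‖fderiv ℝ (rootWt ρ ε) x‖ ≤ rootWt ρ ε x ^ 3 := by
  have hS := rootWt_pos hρ hε x
  by_cases hd : DifferentiableAt ℝ (rootWt ρ ε) x
  swap
  · rw [fderiv_zero_of_not_differentiableAt hd, norm_zero]; positivity
  have e : ρ = fun y => (rootWt ρ ε y ^ 2)⁻¹ - ε := by funext y; rw [rootWt_sq hρ hε, inv_inv]; ring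
  have hS2 : rootWt ρ ε x ^ 2 ≠ 0 := by positivity
  have hq : HasDerivAt (fun s : ℝ => (s ^ 2)⁻¹ - ε)
      (-(2 * rootWt ρ ε x) / (rootWt ρ ε x ^ 2) ^ 2) (rootWt ρ ε x) := by
    simpa using ((hasDerivAt_pow 2 (rootWt ρ ε x)).fun_inv hS2).sub_const ε
  have hT := hq.comp_hasFDerivAt x hd.hasFDerivAt
  rw [show (fun s : ℝ => (s ^ 2)⁻¹ - ε) ∘ rootWt ρ ε = ρ from e.symm] at hT
  have hb := norm_fderiv_le_of_lipschitz ℝ h1 (x₀ := x)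
  rw [hT.fderiv] at hb
  simp only [norm_smul, NNReal.coe_one, norm_div, norm_neg, norm_mul, norm_pow,
    norm_of_nonneg hS.le, RCLike.norm_ofNat] at hb
  set s := rootWt ρ ε x
  set N := ‖fderiv ℝ (rootWt ρ ε) x‖
  have hN : 0 ≤ N := norm_nonneg _
  have e3 : 2 * s / (s ^ 2) ^ 2 * N = 2 * N / s ^ 3 := by field_simp
  rw [e3, div_le_one (by positivity)] at hb
  linarith

end RootWeight

/-! ### Radial cut-off functions -/

section RadialCut

variable {d : ℕ} {R : ℝ}

/-- The radial cut-off function: `1` on `B(0, R)` and `0` outside `B(0, 2R)`. -/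
def radCut (R : ℝ) (x : Euc d) : ℝ := max 0 (min 1 (2 - ‖x‖ / R))

lemma radCut_nonneg (x : Euc d) : 0 ≤ radCut R x := le_max_left _ _

lemma radCut_le_one (x : Euc d) : radCut R x ≤ 1 := max_le zero_le_one (min_le_left _ _)

lemma radCut_eq_one (hR : 0 < R) {x : Euc d} (hx : ‖x‖ ≤ R) : radCut R x = 1 := by
  have : ‖x‖ / R ≤ 1 := (div_le_one hR).2 hx
  rw [radCut, min_eq_left (by linarith), max_eq_right zero_le_one]

lemma radCut_eq_zero (hR : 0 < R) {x : Euc d} (hx : 2 * R ≤ ‖x‖) : radCut R x = 0 := by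
  have : 2 ≤ ‖x‖ / R := (le_div_iff₀ hR).2 hx
  rw [radCut, max_eq_left]
  exact (min_le_right _ _).trans (by linarith)

lemma lipschitz_radCut (hR : 0 < R) : LipschitzWith (Real.toNNReal R⁻¹) (radCut R : Euc d → ℝ) := by
  have h : LipschitzWith (Real.toNNReal R⁻¹) (fun x : Euc d => 2 - ‖x‖ / R) := by
    refine LipschitzWith.of_dist_le_mul fun x y => ?_
    rw [Real.dist_eq, coe_toNNReal _ (by positivity), dist_eq_norm]
    have : 2 - ‖x‖ / R - (2 - ‖y‖ / R) = R⁻¹ * (‖y‖ - ‖x‖) := by field_simp; ring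
    rw [this, abs_mul, abs_of_pos (inv_pos.2 hR), abs_sub_comm]
    exact mul_le_mul_of_nonneg_left (abs_norm_sub_norm_le x y) (by positivity)
  exact (h.const_min 1).const_max 0

lemma hasCompactSupport_radCut (hR : 0 < R) : HasCompactSupport (radCut R : Euc d → ℝ) :=
  HasCompactSupport.intro (isCompact_closedBall 0 (2 * R)) fun x hx =>
    radCut_eq_zero hR (by simpa using (not_le.1 (by simpa using hx)).le)

lemma norm_fderiv_radCut_le (hR : 0 < R) (x : Euc d) : ‖fderiv ℝ (radCut R) x‖ ≤
    (closedBall (0 : Euc d) (2 * R) \ ball 0 R).indicator (fun _ => R⁻¹) x := by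
  by_cases hx : x ∈ closedBall (0 : Euc d) (2 * R) \ ball 0 R
  · rw [indicator_of_mem hx]
    simpa [hR.le] using norm_fderiv_le_of_lipschitz ℝ (lipschitz_radCut (d := d) hR) (x₀ := x)
  · rw [indicator_of_notMem hx]
    refine le_of_eq (norm_eq_zero.2 ?_)
    simp only [Set.mem_sdiff, Metric.mem_closedBall, dist_zero_right, mem_ball, not_and,
      not_not] at hx
    rcases lt_or_ge (2 * R) ‖x‖ with h | h
    · have : (radCut R : Euc d → ℝ) =ᶠ[𝓝 x] fun _ => 0 := by
        filter_upwards [continuous_norm.continuousAt.eventually (lt_mem_nhds h)] with y hy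
        exact radCut_eq_zero hR hy.le
      rw [this.fderiv_eq]; simp
    · have : (radCut R : Euc d → ℝ) =ᶠ[𝓝 x] fun _ => 1 := by
        filter_upwards [continuous_norm.continuousAt.eventually (gt_mem_nhds (hx h))] with y hy
        exact radCut_eq_one hR hy.le
      rw [this.fderiv_eq]; simp

end RadialCut

/-! ### Weighted energy, trace and Fefferman–Phong estimates -/

section WeightedEstimate

variable {n : ℕ} {τ μ Λ K δ : ℝ} {M : ℝ≥0} {Ψ : Euc n → ℝ}
  {a : Pt n → Pt n →L[ℝ] Pt n} {V : Pt n → ℝ}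
  {u : Pt n → ℝ} {g : Pt n → Pt n} {f : Euc n → ℝ} {G : Euc n → Pt n}
  {S η : Pt n → ℝ}

/-- A solution with square integrable boundary values, over a Lipschitz graph. -/
structure BdrySol (τ : ℝ) (M : ℝ≥0) (K μ Λ : ℝ) (Ψ : Euc n → ℝ)
    (a : Pt n → Pt n →L[ℝ] Pt n) (V : Pt n → ℝ)
    (u : Pt n → ℝ) (g : Pt n → Pt n) (f : Euc n → ℝ)
    (G : Euc n → Pt n) : Prop where
  side : τ = 1 ∨ τ = -1
  lip : LipschitzWith M Ψ
  coeff : GoodCoeff μ Λ a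
  pot : IsBInfty K V
  meas_pot : Measurable V
  grad : HasWeakGrad (graphDom τ Ψ) u g
  weak : WeakId (graphDom τ Ψ) (fun x => a x (g x)) (fun x => V x * u x)
  bdry : BdryData τ Ψ u g f G

/-- A slowly varying weight `S`, small compared with the critical radius, and a cut-off `η`. -/
structure WeightPair (V : Pt n → ℝ) (δ : ℝ) (S η : Pt n → ℝ) : Prop where
  lip_wt : ∃ C : ℝ≥0, LipschitzWith C S
  bdd_wt : ∃ B : ℝ≥0, ∀ x, |S x| ≤ B
  pos : ∀ x, 0 < S x
  slow : ∀ x, ‖fderiv ℝ S x‖ ≤ S x ^ 3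
  small : ∀ x, S x ^ 2 * critRad V 1 x ≤ δ
  lip_cut : ∃ C : ℝ≥0, LipschitzWith C η
  cpt : HasCompactSupport η
  nonneg : ∀ x, 0 ≤ η x
  le_one : ∀ x, η x ≤ 1

lemma norm_fderiv_mul_self_le {w : Pt n → ℝ} {x : Pt n} (hd : DifferentiableAt ℝ w x)
    {Y : ℝ} (hY : ‖fderiv ℝ w x‖ ≤ Y) (hw : 0 ≤ w x) (v : Pt n) :
    |fderiv ℝ (fun y => w y * w y) x v| ≤ 2 * w x * Y * ‖v‖ := by
  rw [fderiv_fun_mul hd hd]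
  simp only [add_apply, smul_apply, smul_eq_mul]
  have h1 : |fderiv ℝ w x v| ≤ Y * ‖v‖ := ((fderiv ℝ w x).le_opNorm v).trans (by gcongr)
  rw [← two_mul, abs_mul, abs_mul, abs_of_nonneg hw, abs_two]
  nlinarith

/-- The product rule with |∇S| ≤ S³: each derivative that falls on the weight costs a factor S². The
three bounds serve the test function S²η²u, the function Sηu, and the trace weight (S²η)². -/
lemma WeightPair.pointwise (hw : WeightPair V δ S η) : ∀ᵐ x,
    (∀ v, |fderiv ℝ (fun y => S y * η y * (S y * η y)) x v|
      ≤ 2 * (S x * η x) * (S x * ‖fderiv ℝ η x‖ + S x ^ 3 * η x) * ‖v‖) ∧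
    (‖fderiv ℝ (fun y => S y * η y) x‖ ≤ S x * ‖fderiv ℝ η x‖ + S x ^ 3 * η x) ∧
    (∀ v, |fderiv ℝ (fun y => S y * (S y * η y) * (S y * (S y * η y))) x v|
      ≤ 2 * (S x * (S x * η x)) * (S x ^ 2 * ‖fderiv ℝ η x‖ + 2 * S x ^ 4 * η x) * ‖v‖) := by
  obtain ⟨_, h1⟩ := hw.lip_wt
  obtain ⟨_, h2⟩ := hw.lip_cut
  filter_upwards [h1.ae_differentiableAt, h2.ae_differentiableAt] with x d1 d2
  have s0 := (hw.pos x).le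
  have e0 := hw.nonneg x
  have b1 : ‖fderiv ℝ (fun y => S y * η y) x‖ ≤ S x * ‖fderiv ℝ η x‖ + S x ^ 3 * η x := by
    rw [fderiv_fun_mul d1 d2]
    refine (norm_add_le _ _).trans ?_
    rw [norm_smul, norm_smul, norm_of_nonneg s0, norm_of_nonneg e0]
    have := mul_le_mul_of_nonneg_right (hw.slow x) e0
    linarith
  have d3 : DifferentiableAt ℝ (fun y => S y * η y) x := d1.fun_mul d2
  have b2 : ‖fderiv ℝ (fun y => S y * (S y * η y)) x‖
      ≤ S x ^ 2 * ‖fderiv ℝ η x‖ + 2 * S x ^ 4 * η x := by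
    rw [fderiv_fun_mul d1 d3]
    refine (norm_add_le _ _).trans ?_
    rw [norm_smul, norm_smul, norm_of_nonneg s0, norm_of_nonneg (mul_nonneg s0 e0)]
    have h3 := mul_le_mul_of_nonneg_right (hw.slow x) (mul_nonneg s0 e0)
    have h4 := mul_le_mul_of_nonneg_left b1 s0
    nlinarith
  exact ⟨fun v => norm_fderiv_mul_self_le d3 b1 (mul_nonneg s0 e0) v, b1,
    fun v => norm_fderiv_mul_self_le (d1.fun_mul d3) b2 (mul_nonneg s0 (mul_nonneg s0 e0)) v⟩

lemma WeightPair.exists_lipschitz (hw : WeightPair V δ S η) :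
    (∃ C B : ℝ≥0, LipschitzWith C (fun y => S y * η y) ∧ ∀ x, |S x * η x| ≤ B) ∧
    (∃ C : ℝ≥0, LipschitzWith C (fun y => S y * η y * (S y * η y))) ∧
    (∃ C : ℝ≥0, LipschitzWith C (fun y => S y * (S y * η y) * (S y * (S y * η y)))) := by
  obtain ⟨_, h1⟩ := hw.lip_wt
  obtain ⟨B, hB⟩ := hw.bdd_wt
  obtain ⟨_, h2⟩ := hw.lip_cut
  have hb : ∀ {B' : ℝ≥0} {θ : Pt n → ℝ}, (∀ x, |θ x| ≤ B') →
      ∀ x, |S x * θ x| ≤ (B * B' : ℝ≥0) := fun h x => by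
    rw [abs_mul]; push_cast
    exact mul_le_mul (hB x) (h x) (abs_nonneg _) B.2
  have he : ∀ x, |η x| ≤ (1 : ℝ≥0) := fun x => by
    rw [abs_of_nonneg (hw.nonneg x)]; exact hw.le_one x
  have m1 := h1.mul_of_bounded h2 hB he
  have m2 := h1.mul_of_bounded m1 hB (hb he)
  exact ⟨⟨_, _, m1, hb he⟩, ⟨_, m1.mul_of_bounded m1 (hb he) (hb he)⟩,
    ⟨_, m2.mul_of_bounded m2 (hb (hb he)) (hb (hb he))⟩⟩

/-- The relative error S⁴ caused by differentiating the weight is δ² times the Fefferman–Phong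
weight. This is where the smallness needed for absorption enters. -/
lemma WeightPair.pow_four_le (hw : WeightPair V δ S η) (hV : IsBInfty K V) (x : Pt n) :
    S x ^ 4 ≤ δ ^ 2 * (critRad V 1 x ^ 2)⁻¹ := by
  have hr := hV.critRad_pos one_pos x
  rw [← div_eq_mul_inv, le_div_iff₀ (by positivity)]
  have h1 := hw.small x
  have h0 : 0 ≤ S x ^ 2 * critRad V 1 x := by positivity
  calc S x ^ 4 * critRad V 1 x ^ 2 = (S x ^ 2 * critRad V 1 x) ^ 2 := by ring
    _ ≤ δ ^ 2 := pow_le_pow_left₀ h0 h1 2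

/-- `∫ S² η² |∇u|²`. -/
def wtDirichlet (τ : ℝ) (Ψ : Euc n → ℝ) (S η : Pt n → ℝ) (g : Pt n → Pt n) :
    ℝ≥0∞ := ∫⁻ x in graphDom τ Ψ, ofReal ((S x * η x) ^ 2 * ‖g x‖ ^ 2)

/-- `∫ S² η² H u²`. -/
def wtMass (τ : ℝ) (Ψ : Euc n → ℝ) (S η H u : Pt n → ℝ) : ℝ≥0∞ :=
  ∫⁻ x in graphDom τ Ψ, ofReal ((S x * η x) ^ 2 * (H x * u x ^ 2))

/-- `∫ S² |∇η|² u²`. -/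
def wtErr (τ : ℝ) (Ψ : Euc n → ℝ) (S η u : Pt n → ℝ) : ℝ≥0∞ :=
  ∫⁻ x in graphDom τ Ψ, ofReal (S x ^ 2 * ‖fderiv ℝ η x‖ ^ 2 * u x ^ 2)

/-- `∫_{∂Ω} |f| |p| S² η²`, over the base of the graph. -/
def wtFlux (Ψ : Euc n → ℝ) (S η : Pt n → ℝ) (f p : Euc n → ℝ) : ℝ≥0∞ :=
  ∫⁻ z, ofReal ((S (bdryPt Ψ z) * η (bdryPt Ψ z)) ^ 2 * |f z * p z|)

/-- `∫_{∂Ω} f² S⁴ η²`, over the base of the graph. -/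
def wtTrace (Ψ : Euc n → ℝ) (S η : Pt n → ℝ) (f : Euc n → ℝ) : ℝ≥0∞ :=
  ∫⁻ z, ofReal ((S (bdryPt Ψ z) * (S (bdryPt Ψ z) * η (bdryPt Ψ z))) ^ 2 * f z ^ 2)

lemma ofReal_neg_integral_le {X : Type*} [MeasurableSpace X] {m : Measure X} (F : X → ℝ) :
    ofReal (-∫ x, F x ∂m) ≤ ∫⁻ x, ofReal |F x| ∂m := by
  refine (ofReal_le_ofReal (neg_le_abs _)).trans ?_
  have := enorm_integral_le_lintegral_enorm (μ := m) F
  simpa only [enorm_eq_ofReal_abs] using this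

lemma measurable_critRad (hV : IsBInfty K V) : Measurable fun x => (critRad V 1 x ^ 2)⁻¹ :=
  ((hV.lipschitz_critRad one_pos).continuous.measurable.pow_const 2).inv

lemma lintegral_ofReal_add_mul {X : Type*} [MeasurableSpace X] {m : Measure X} {F H : X → ℝ}
    (hF : Measurable F) (hH : Measurable H) (hF0 : ∀ᵐ x ∂m, 0 ≤ F x) (hH0 : ∀ᵐ x ∂m, 0 ≤ H x)
    {a b : ℝ} (ha : 0 ≤ a) (hb : 0 ≤ b) :
    ∫⁻ x, ofReal (a * F x + b * H x) ∂m = ofReal a * ∫⁻ x, ofReal (F x) ∂m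
      + ofReal b * ∫⁻ x, ofReal (H x) ∂m := by
  rw [← lintegral_const_mul _ hF.ennreal_ofReal, ← lintegral_const_mul _ hH.ennreal_ofReal,
    ← lintegral_add_left (by fun_prop)]
  refine lintegral_congr_ae ?_
  filter_upwards [hF0, hH0] with x h1 h2
  rw [ofReal_add (mul_nonneg ha h1) (mul_nonneg hb h2), ofReal_mul ha, ofReal_mul hb]

lemma WeightPair.measurable (hw : WeightPair V δ S η) : Measurable S ∧ Measurable η ∧
    Measurable fun x => ‖fderiv ℝ η x‖ :=
  ⟨hw.lip_wt.choose_spec.continuous.measurable, hw.lip_cut.choose_spec.continuous.measurable,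
    (measurable_fderiv ℝ η).norm⟩

/-- The equation is tested with w²u, w = Sη. The cross term is at most 2w|∇w||u|Λ|∇u|; Young's
inequality gives half of the ellipticity back, and |∇w|² ≤ 2S²|∇η|² + 2δ²w²ρ^{-2}. -/
lemma BdrySol.energy_le (h : BdrySol τ M K μ Λ Ψ a V u g f G) (hw : WeightPair V δ S η)
    (hμ : 0 < μ) (hΛ : 0 < Λ) :
    ofReal (μ / 2) * wtDirichlet τ Ψ S η g + wtMass τ Ψ S η V u
      ≤ wtFlux Ψ S η f (bdryFlux τ Ψ a G) + ofReal (4 * Λ ^ 2 / μ) * (wtErr τ Ψ S η u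
        + ofReal (δ ^ 2) * wtMass τ Ψ S η (fun x => (critRad V 1 x ^ 2)⁻¹) u) := by
  obtain ⟨C, hC⟩ := hw.exists_lipschitz.2.1
  have hc : HasCompactSupport fun y => S y * η y * (S y * η y) := (hw.cpt.mul_left).mul_left
  obtain ⟨hi, he⟩ := h.bdry.energy h.side h.lip h.coeff h.pot h.meas_pot h.grad h.weak hC hc
  obtain ⟨hS, hη, hN⟩ := hw.measurable
  have hum := h.bdry.meas_u
  have hgm := h.bdry.meas_g
  have hVm := h.meas_pot
  have hrm := measurable_critRad h.pot
  have hp4 := hw.pow_four_le h.pot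
  have hr0 : ∀ x, 0 ≤ (critRad V 1 x ^ 2)⁻¹ := fun x => by positivity
  have hF : Measurable fun x => S x ^ 2 * ‖fderiv ℝ η x‖ ^ 2 * u x ^ 2 := by fun_prop
  have hH : Measurable fun x => (S x * η x) ^ 2 * ((critRad V 1 x ^ 2)⁻¹ * u x ^ 2) := by fun_prop
  have hA : Measurable fun x => (S x * η x) ^ 2 * ‖g x‖ ^ 2 := by fun_prop
  have hB : Measurable fun x => (S x * η x) ^ 2 * (V x * u x ^ 2) := by fun_prop
  have hF0 : ∀ x, 0 ≤ S x ^ 2 * ‖fderiv ℝ η x‖ ^ 2 * u x ^ 2 := fun x => by positivity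
  have hH0 : ∀ x, 0 ≤ (S x * η x) ^ 2 * ((critRad V 1 x ^ 2)⁻¹ * u x ^ 2) := fun x => by
    have := hr0 x; positivity
  have hA0 : ∀ x, 0 ≤ (S x * η x) ^ 2 * ‖g x‖ ^ 2 := fun x => by positivity
  have hB0 : ∀ᵐ x, 0 ≤ (S x * η x) ^ 2 * (V x * u x ^ 2) := by
    filter_upwards [h.pot.nonneg_ae] with x hx
    positivity
  have key := lintegral_le_of_integral_le
    (L := fun x => μ / 2 * ((S x * η x) ^ 2 * ‖g x‖ ^ 2) + 1 * ((S x * η x) ^ 2 * (V x * u x ^ 2)))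
    (N := fun x => 4 * Λ ^ 2 / μ * (S x ^ 2 * ‖fderiv ℝ η x‖ ^ 2 * u x ^ 2)
      + 4 * Λ ^ 2 / μ * δ ^ 2 * ((S x * η x) ^ 2 * ((critRad V 1 x ^ 2)⁻¹ * u x ^ 2)))
    hi he.le (by fun_prop) ?_ ?_ ?_
  · rw [lintegral_ofReal_add_mul hA hB (ae_of_all _ hA0) (ae_restrict_of_ae hB0) (by positivity)
      zero_le_one, lintegral_ofReal_add_mul hF hH (ae_of_all _ hF0) (ae_of_all _ hH0)
      (by positivity) (by positivity), ofReal_one, one_mul,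
      ofReal_mul (by positivity : (0 : ℝ) ≤ 4 * Λ ^ 2 / μ)] at key
    refine key.trans ?_
    rw [mul_add, mul_assoc]
    refine add_le_add_left ((ofReal_neg_integral_le _).trans (le_of_eq ?_)) _
    refine lintegral_congr fun z => ?_
    rw [abs_mul, abs_of_nonneg (mul_self_nonneg (S (bdryPt Ψ z) * η (bdryPt Ψ z))), sq, mul_comm]
  · filter_upwards [ae_restrict_of_ae hB0] with x hx
    have := hA0 x
    positivity
  · filter_upwards with x
    have h1 := hF0 x
    have h2 := hH0 x
    positivity
  · filter_upwards [ae_restrict_of_ae hw.pointwise, ae_restrict_of_ae hB0] with x ⟨hx, _, _⟩ hBx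
    have s0 := hw.pos x
    have e0 := hw.nonneg x
    have hfd := hx (u x • a x (g x))
    rw [norm_smul, norm_eq_abs] at hfd
    have hag := h.coeff.bound x (g x)
    have hel := h.coeff.elliptic x (g x)
    generalize hN' : ‖fderiv ℝ η x‖ = N at *
    have hN0 : 0 ≤ N := hN' ▸ norm_nonneg _
    generalize hD : fderiv ℝ (fun y => S y * η y * (S y * η y)) x (u x • a x (g x)) = D at *
    set w := S x * η x with hw'
    have w0 : 0 ≤ w := by positivity
    set Y := S x * N + w * S x ^ 2 with hY
    have hY0 : 0 ≤ Y := by positivity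
    have h1 : |D| ≤ 2 * w * Y * (|u x| * (Λ * ‖g x‖)) := by
      refine hfd.trans ?_
      rw [show S x * N + S x ^ 3 * η x = Y by rw [hY, hw']; ring]
      gcongr
    have h2 : 2 * w * Y * (|u x| * (Λ * ‖g x‖)) ≤ μ / 2 * (w ^ 2 * ‖g x‖ ^ 2)
        + 2 * Λ ^ 2 / μ * (u x ^ 2 * Y ^ 2) := by
      have e : μ / 2 * (w ^ 2 * ‖g x‖ ^ 2) + 2 * Λ ^ 2 / μ * (u x ^ 2 * Y ^ 2)
          - 2 * w * Y * (|u x| * (Λ * ‖g x‖))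
          = (μ * (w * ‖g x‖) - 2 * Λ * (|u x| * Y)) ^ 2 / (2 * μ) := by
        rw [← sq_abs (u x)]; field_simp; ring
      have : 0 ≤ (μ * (w * ‖g x‖) - 2 * Λ * (|u x| * Y)) ^ 2 / (2 * μ) := by positivity
      linarith
    have h3 : Y ^ 2 ≤ 2 * (S x ^ 2 * N ^ 2) + 2 * (w ^ 2 * (δ ^ 2 * (critRad V 1 x ^ 2)⁻¹)) := by
      have h4 := mul_le_mul_of_nonneg_left (hp4 x) (sq_nonneg w)
      have h5 := sq_nonneg (S x * N - w * S x ^ 2)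
      nlinarith
    have h6 := mul_le_mul_of_nonneg_left h3 (by positivity : 0 ≤ 2 * Λ ^ 2 / μ * u x ^ 2)
    have h7 := mul_le_mul_of_nonneg_right hel (sq_nonneg w)
    have h8 := neg_abs_le D
    rw [show 4 * Λ ^ 2 / μ = 2 * (2 * Λ ^ 2 / μ) by ring]
    nlinarith

/-- The divergence theorem for (S²η)²u²e turns the trace into a solid integral. Finiteness is
recorded because the trace is later absorbed into itself. -/
lemma BdrySol.trace_le (h : BdrySol τ M K μ Λ Ψ a V u g f G) (hw : WeightPair V δ S η)
    (hδ : δ ≤ 1) (hδ0 : 0 ≤ δ) :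
    wtTrace Ψ S η f ≤ wtErr τ Ψ S η u + wtDirichlet τ Ψ S η g
        + 6 * wtMass τ Ψ S η (fun x => (critRad V 1 x ^ 2)⁻¹) u ∧ wtTrace Ψ S η f < ∞ := by
  obtain ⟨C, hC⟩ := hw.exists_lipschitz.2.2
  have hc : HasCompactSupport fun y => S y * (S y * η y) * (S y * (S y * η y)) :=
    (hw.cpt.mul_left.mul_left).mul_left
  obtain ⟨hi, he⟩ := h.bdry.trace h.side h.lip h.grad hC hc
  obtain ⟨hS, hη, hN⟩ := hw.measurable
  have hum := h.bdry.meas_u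
  have hgm := h.bdry.meas_g
  have hfm := h.bdry.meas_f
  have hrm := measurable_critRad h.pot
  have hp4 := hw.pow_four_le h.pot
  have hr0 : ∀ x, 0 ≤ (critRad V 1 x ^ 2)⁻¹ := fun x => by positivity
  have hv := norm_vert (n := n) h.side
  have hbm := (continuous_bdryPt h.lip).measurable
  -- The constant 6 is 4 + 1 + 1 copies of S⁴w²u² with w = Sη: four from the derivative of S, one
  -- from the Young splitting of the ∇η term, one from that of 2u ∂_e u.
  have hb : ∀ᵐ x, |fderiv ℝ (fun y => S y * (S y * η y) * (S y * (S y * η y))) x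
      (u x ^ 2 • vert n τ) + 2 * u x * inner ℝ (g x) (vert n τ)
        * (S x * (S x * η x) * (S x * (S x * η x)))| ≤
      S x ^ 2 * ‖fderiv ℝ η x‖ ^ 2 * u x ^ 2 + (S x * η x) ^ 2 * ‖g x‖ ^ 2
        + 6 * ((S x * η x) ^ 2 * ((critRad V 1 x ^ 2)⁻¹ * u x ^ 2)) := by
    filter_upwards [hw.pointwise] with x ⟨_, _, hx⟩
    have s0 := hw.pos x
    have e0 := hw.nonneg x
    have e1 := hw.le_one x
    have hfd := hx (u x ^ 2 • vert n τ)
    rw [norm_smul, hv, mul_one, norm_of_nonneg (sq_nonneg _)] at hfd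
    have hin := abs_inner_vert_le h.side (g x)
    generalize ‖fderiv ℝ η x‖ = N at *
    set w := S x * η x with hw'
    have w0 : 0 ≤ w := by positivity
    have h1 : |2 * u x * inner ℝ (g x) (vert n τ) * (S x * w * (S x * w))|
        ≤ 2 * (|u x| * ‖g x‖) * (S x ^ 2 * w ^ 2) := by
      rw [abs_mul, abs_mul, abs_mul, abs_two, abs_of_nonneg (mul_self_nonneg (S x * w))]
      have : |u x| * |inner ℝ (g x) (vert n τ)| ≤ |u x| * ‖g x‖ := by gcongr
      have h' := mul_le_mul_of_nonneg_right this (mul_self_nonneg (S x * w))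
      nlinarith
    refine (abs_add_le _ _).trans ((add_le_add hfd h1).trans ?_)
    have h2 : S x ^ 4 * (w ^ 2 * u x ^ 2) ≤ (critRad V 1 x ^ 2)⁻¹ * (w ^ 2 * u x ^ 2) := by
      refine mul_le_mul_of_nonneg_right ((hp4 x).trans ?_) (by positivity)
      exact mul_le_of_le_one_left (hr0 x) (pow_le_one₀ hδ0 hδ)
    have h3 := sq_nonneg (S x * N * u x - S x ^ 2 * w * u x)
    have h4 := sq_nonneg (w * ‖g x‖ - S x ^ 2 * w * |u x|)
    have h5 : (w * ‖g x‖ - S x ^ 2 * w * |u x|) ^ 2 = w ^ 2 * ‖g x‖ ^ 2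
        - 2 * (|u x| * ‖g x‖) * (S x ^ 2 * w ^ 2) + S x ^ 4 * (w ^ 2 * u x ^ 2) := by
      rw [← sq_abs (u x)]; ring
    have e6 : 2 * (S x * w) * (S x ^ 2 * N + 2 * S x ^ 4 * η x) * u x ^ 2
        = 2 * (S x * N * u x) * (S x ^ 2 * w * u x) + 4 * (S x ^ 4 * (w ^ 2 * u x ^ 2)) := by
      rw [hw']; ring
    rw [e6]
    nlinarith
  have e1 : wtTrace Ψ S η f = ofReal (∫ z, f z ^ 2 *
      (S (bdryPt Ψ z) * (S (bdryPt Ψ z) * η (bdryPt Ψ z))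
        * (S (bdryPt Ψ z) * (S (bdryPt Ψ z) * η (bdryPt Ψ z))))) := by
    rw [ofReal_integral_eq_lintegral_ofReal]
    · exact lintegral_congr fun z => by congr 1; ring
    · obtain ⟨B, hB⟩ := exists_bound_of_lipschitz hC hc
      obtain ⟨R, hR⟩ := hc.isCompact.isBounded.subset_ball 0
      have hi2 : IntegrableOn (fun z => f z ^ 2) (ball 0 R) :=
        (memLp_two_of_lintegral_lt_top hfm.aestronglyMeasurable (h.bdry.sq_f R)).integrable_sq
      refine (((integrable_indicator_iff isOpen_ball.measurableSet).2 hi2).mul_const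
        (B : ℝ)).mono' (by fun_prop) (ae_of_all _ fun z => ?_)
      by_cases hz : z ∈ ball (0 : Euc n) R
      · rw [indicator_of_mem hz, norm_mul, norm_of_nonneg (sq_nonneg _)]
        exact mul_le_mul_of_nonneg_left (hB _) (sq_nonneg _)
      · have : bdryPt Ψ z ∉ tsupport fun y => S y * (S y * η y) * (S y * (S y * η y)) := by
          intro hcon
          have h1 := hR hcon
          rw [mem_ball_zero_iff] at h1 hz
          have h2 := norm_horiz_le (bdryPt Ψ z)
          rw [horiz_bdryPt] at h2
          exact hz (h2.trans_lt h1)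
        have h0 := image_eq_zero_of_notMem_tsupport this
        rw [h0]; simp [hz]
    · exact ae_of_all _ fun z => mul_nonneg (sq_nonneg _) (mul_self_nonneg _)
  refine ⟨?_, e1 ▸ ofReal_lt_top⟩
  rw [e1, ← neg_neg (∫ z, _), ← he]
  refine (ofReal_neg_integral_le _).trans ?_
  refine (lintegral_mono_ae ((ae_restrict_of_ae hb).mono fun x hx =>
    ofReal_le_ofReal hx)).trans (le_of_eq ?_)
  rw [wtErr, wtDirichlet, wtMass, ← lintegral_const_mul _ (by fun_prop),
    ← lintegral_add_left (by fun_prop), ← lintegral_add_left (by fun_prop)]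
  refine lintegral_congr fun x => ?_
  have := hr0 x
  rw [ofReal_add (by positivity) (by positivity), ofReal_add (by positivity)
    (by positivity), ofReal_mul (by norm_num : (0 : ℝ) ≤ 6)]
  norm_num

/-- Fefferman–Phong applied to Sηu. The gradient of the factor Sη produces the δ² term, which is
again the quantity being estimated. -/
lemma BdrySol.mass_le (h : BdrySol τ M K μ Λ Ψ a V u g f G) (hw : WeightPair V δ S η) {c : ℝ}
    (hc : ∀ v q, Measurable v → Measurable q → HasWeakGrad (graphDom τ Ψ) v q →
      ∫⁻ x in graphDom τ Ψ, ofReal ((critRad V 1 x ^ 2)⁻¹) * ‖v x‖ₑ ^ 2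
        ≤ ofReal c * ((∫⁻ x in graphDom τ Ψ, ‖q x‖ₑ ^ 2)
          + ∫⁻ x in graphDom τ Ψ, ofReal (V x) * ‖v x‖ₑ ^ 2)) :
    wtMass τ Ψ S η (fun x => (critRad V 1 x ^ 2)⁻¹) u
      ≤ ofReal c * ((2 * wtDirichlet τ Ψ S η g + 4 * (wtErr τ Ψ S η u
        + ofReal (δ ^ 2) * wtMass τ Ψ S η (fun x => (critRad V 1 x ^ 2)⁻¹) u))
        + wtMass τ Ψ S η V u) := by
  obtain ⟨C, B, hC, hB⟩ := hw.exists_lipschitz.1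
  obtain ⟨hS, hη, hN⟩ := hw.measurable
  have hum := h.bdry.meas_u
  have hgm := h.bdry.meas_g
  have hrm := measurable_critRad h.pot
  have hp4 := hw.pow_four_le h.pot
  have hr0 : ∀ x, 0 ≤ (critRad V 1 x ^ 2)⁻¹ := fun x => by positivity
  have hgr := measurable_gradient fun y => S y * η y
  have hsq : ∀ (c : ℝ) (x : Pt n), ofReal c * ‖u x * (S x * η x)‖ₑ ^ 2
      = ofReal ((S x * η x) ^ 2 * (c * u x ^ 2)) := fun c x => by
    rw [enorm_eq_ofReal_abs, ← ofReal_pow (abs_nonneg _), sq_abs, mul_comm,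
      ← ofReal_mul (by positivity)]
    congr 1; ring
  have key := hc _ _ (hum.mul (hS.mul hη)) (((hS.mul hη).smul hgm).add (hum.smul hgr))
    (h.grad.mul_lipschitz (isOpen_graphDom h.lip) hC hB)
  simp only [Pi.mul_apply, hsq] at key
  refine key.trans (mul_le_mul_right (add_le_add_left ?_ _) _)
  rw [wtErr, wtDirichlet, wtMass, ← lintegral_const_mul _ (by fun_prop),
    ← lintegral_const_mul _ (by fun_prop), ← lintegral_add_left (by fun_prop),
    ← lintegral_const_mul _ (by fun_prop), ← lintegral_add_left (by fun_prop)]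
  refine lintegral_mono_ae (ae_restrict_of_ae ?_)
  filter_upwards [hw.pointwise] with x ⟨_, hx, _⟩
  have s0 := hw.pos x
  have e0 := hw.nonneg x
  have hr := hr0 x
  have h2 := norm_add_le ((S x * η x) • g x) (u x • gradient (fun y => S y * η y) x)
  rw [norm_smul, norm_smul, norm_gradient, norm_of_nonneg (mul_nonneg s0.le e0), norm_eq_abs] at h2
  have e2 : ∀ y : ℝ, 2 * ofReal y = ofReal (2 * y) := fun y => by rw [ofReal_mul zero_le_two]; simp
  have e4 : ∀ y : ℝ, 4 * ofReal y = ofReal (4 * y) := fun y => by rw [ofReal_mul zero_le_four]; simp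
  rw [← ofReal_norm, ← ofReal_pow (norm_nonneg _), e2,
    ← ofReal_mul (sq_nonneg δ), ← ofReal_add (by positivity) (by positivity), e4,
    ← ofReal_add (by positivity) (by positivity)]
  refine ofReal_le_ofReal ?_
  simp only [Pi.add_apply, Pi.smul_apply', Pi.mul_apply]
  generalize ‖fderiv ℝ η x‖ = N at *
  generalize ‖fderiv ℝ (fun y => S y * η y) x‖ = Z at *
  set w := S x * η x with hw'
  have w0 : 0 ≤ w := by positivity
  set Y := S x * N + w * S x ^ 2 with hY
  rw [show S x * N + S x ^ 3 * η x = Y by rw [hY, hw']; ring] at hx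
  have h3 : Y ^ 2 ≤ 2 * (S x ^ 2 * N ^ 2) + 2 * (w ^ 2 * (δ ^ 2 * (critRad V 1 x ^ 2)⁻¹)) := by
    have h4 := mul_le_mul_of_nonneg_left (hp4 x) (sq_nonneg w)
    have h5 := sq_nonneg (S x * N - w * S x ^ 2)
    nlinarith
  have h4 : ‖w • g x + u x • gradient (fun y => S y * η y) x‖ ≤ w * ‖g x‖ + |u x| * Y :=
    h2.trans (by gcongr)
  calc _ ≤ (w * ‖g x‖ + |u x| * Y) ^ 2 := pow_le_pow_left₀ (norm_nonneg _) h4 2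
    _ ≤ 2 * (w ^ 2 * ‖g x‖ ^ 2) + 2 * (u x ^ 2 * Y ^ 2) := by
        have h5 := sq_nonneg (w * ‖g x‖ - |u x| * Y)
        rw [← sq_abs (u x)]; nlinarith
    _ ≤ 2 * (w ^ 2 * ‖g x‖ ^ 2) + 2 * (u x ^ 2 * (2 * (S x ^ 2 * N ^ 2)
        + 2 * (w ^ 2 * (δ ^ 2 * (critRad V 1 x ^ 2)⁻¹)))) := by gcongr
    _ = _ := by ring

/-- The cut-off confines the integral to a bounded set, where ρ is bounded below and u is square
integrable up to the boundary. Finiteness permits the absorption. -/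
lemma BdrySol.mass_lt_top (h : BdrySol τ M K μ Λ Ψ a V u g f G) (hw : WeightPair V δ S η) :
    wtMass τ Ψ S η (fun x => (critRad V 1 x ^ 2)⁻¹) u < ∞ := by
  obtain ⟨C, B, hC, hB⟩ := hw.exists_lipschitz.1
  obtain ⟨R, hR⟩ := hw.cpt.isCompact.isBounded.subset_ball 0
  have hcont : Continuous fun x => (critRad V 1 x ^ 2)⁻¹ :=
    ((h.pot.lipschitz_critRad one_pos).continuous.pow 2).inv₀ fun x =>
      (pow_pos (h.pot.critRad_pos one_pos x) 2).ne'
  obtain ⟨c, hc⟩ := (isCompact_closedBall (0 : Pt n) R).exists_bound_of_continuousOn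
    hcont.continuousOn
  have hfin := h.bdry.sq_u R
  calc wtMass τ Ψ S η (fun x => (critRad V 1 x ^ 2)⁻¹) u
      ≤ ∫⁻ x in graphDom τ Ψ, (ball 0 R).indicator
        (fun x => ofReal (B ^ 2 * c) * ‖u x‖ₑ ^ 2) x := by
        refine lintegral_mono fun x => ?_
        by_cases hx : x ∈ ball (0 : Pt n) R
        · rw [indicator_of_mem hx, enorm_eq_ofReal_abs, ← ofReal_pow (abs_nonneg _),
            sq_abs, ← ofReal_mul' (sq_nonneg _)]
          refine ofReal_le_ofReal ?_
          have h1 := sq_le_sq' (abs_le.1 (hB x)).1 (abs_le.1 (hB x)).2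
          have h2 := (le_abs_self _).trans (hc x (ball_subset_closedBall hx))
          have h3 : 0 ≤ (critRad V 1 x ^ 2)⁻¹ := by positivity
          rw [← mul_assoc]
          gcongr
        · rw [image_eq_zero_of_notMem_tsupport fun hcon => hx (hR hcon)]
          simp [hx]
    _ < ∞ := by
        rw [lintegral_indicator isOpen_ball.measurableSet,
          Measure.restrict_restrict isOpen_ball.measurableSet, inter_comm,
          lintegral_const_mul _ (h.bdry.meas_u.enorm.pow_const 2)]
        exact mul_lt_top ofReal_lt_top hfin

end WeightedEstimate

/-! ### Absorption of the error terms -/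

section Absorb

variable {n : ℕ} {τ μ Λ K δ : ℝ} {M : ℝ≥0} {Ψ : Euc n → ℝ}
  {a : Pt n → Pt n →L[ℝ] Pt n} {V : Pt n → ℝ}
  {u : Pt n → ℝ} {g : Pt n → Pt n} {f : Euc n → ℝ} {G : Euc n → Pt n}
  {S η : Pt n → ℝ}

/-- Young's inequality for S²η|f| times |p|. As η ≤ 1, one factor η of the flux may be dropped,
matching the weight (S²η)² of the trace. -/
lemma WeightPair.flux_le (hw : WeightPair V δ S η) (hΨ : LipschitzWith M Ψ) {f p : Euc n → ℝ}
    (hf : Measurable f) (hp : Measurable p) {ε : ℝ} (hε : 0 < ε) :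
    wtFlux Ψ S η f p ≤ ofReal ε * wtTrace Ψ S η f + ofReal (ε⁻¹ / 4) * ∫⁻ z, ‖p z‖ₑ ^ 2 := by
  obtain ⟨hS, hη, -⟩ := hw.measurable
  have hbm := (continuous_bdryPt hΨ).measurable
  have e : ∫⁻ z, ‖p z‖ₑ ^ 2 = ∫⁻ z, ofReal (p z ^ 2) := lintegral_congr fun z => by
    rw [enorm_eq_ofReal_abs, ← ofReal_pow (abs_nonneg _), sq_abs]
  rw [e, wtTrace, ← lintegral_ofReal_add_mul (by fun_prop) (by fun_prop)
    (ae_of_all _ fun z => by positivity) (ae_of_all _ fun z => by positivity) hε.le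
    (by positivity)]
  refine lintegral_mono fun z => ofReal_le_ofReal ?_
  set b := bdryPt Ψ z
  have e0 := hw.nonneg b
  have h1 : (S b * η b) ^ 2 * |f z * p z| ≤ S b * (S b * η b) * |f z| * |p z| := by
    rw [abs_mul, ← mul_assoc]
    refine mul_le_mul_of_nonneg_right (mul_le_mul_of_nonneg_right ?_ (abs_nonneg _)) (abs_nonneg _)
    nlinarith [mul_le_mul_of_nonneg_left (hw.le_one b) (by positivity : 0 ≤ S b ^ 2 * η b)]
  refine h1.trans ?_
  set y := S b * (S b * η b) * |f z| with hy
  have h2 : ε * ((S b * (S b * η b)) ^ 2 * f z ^ 2) + ε⁻¹ / 4 * p z ^ 2 - y * |p z|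
      = (2 * ε * y - |p z|) ^ 2 / (4 * ε) := by
    rw [hy, ← sq_abs (f z), ← sq_abs (p z)]; field_simp; ring
  have h3 : 0 ≤ (2 * ε * y - |p z|) ^ 2 / (4 * ε) := by positivity
  linarith

/-- The energy bound for A and B is inserted in the Fefferman–Phong bound for k; the smallness of δ
leaves at most k/2 on the right, and k is finite. The resulting bound for k then controls A. -/
lemma absorb_energy {μ c cF δ : ℝ} (hμ : 0 < μ) (hc : 0 < c) (hcF : 0 < cF) (hδ : 0 ≤ δ)
    (hδ1 : δ ≤ 1) (hsm : cF * ((4 / μ + 1) * c + 4) * δ ≤ 1 / 2) : ∃ C : ℝ≥0, 1 ≤ C ∧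
    ∀ A B k e P : ℝ≥0∞, k < ∞ → ofReal (μ / 2) * A + B ≤ P + ofReal c * (e + ofReal δ * k) →
      k ≤ ofReal cF * ((2 * A + 4 * (e + ofReal δ * k)) + B) →
      A + k ≤ C * (P + e) := by
  -- Chosen so that mμ/2 ≥ 2 and m ≥ 1: m times the energy inequality dominates 2A + B.
  set m := 4 / μ + 1 with hm
  have hm0 : 0 < m := by positivity
  set C₂ := 2 * cF * (m + m * c + 4) with hC₂
  have hC₂0 : 0 < C₂ := by positivity
  set C₃ := 2 / μ * (1 + c + c * C₂) with hC₃
  have hC₃0 : 0 < C₃ := by positivity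
  refine ⟨Real.toNNReal (C₂ + C₃ + 1), by simp; linarith, fun A B k e P hk hE hM => ?_⟩
  by_cases hP : P = ∞
  · rw [hP, top_add, ENNReal.mul_top]
    · exact le_top
    · exact (ofReal_pos.2 (by linarith)).ne'
  by_cases he : e = ∞
  · rw [he, add_top, ENNReal.mul_top]
    · exact le_top
    · exact (ofReal_pos.2 (by linarith)).ne'
  have hfin : ofReal (μ / 2) * A + B < ∞ := hE.trans_lt (by finiteness)
  have hA : A ≠ ∞ := by
    rintro rfl
    rw [ENNReal.mul_top (ofReal_pos.2 (by linarith)).ne'] at hfin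
    simp at hfin
  have hB : B ≠ ∞ := (le_add_self.trans_lt hfin).ne
  lift A to ℝ≥0 using hA
  lift B to ℝ≥0 using hB
  lift k to ℝ≥0 using hk.ne
  lift e to ℝ≥0 using he
  lift P to ℝ≥0 using hP
  simp only [ofReal] at hE hM
  norm_cast at hE hM ⊢
  rw [← NNReal.coe_le_coe] at hE hM ⊢
  push_cast at hE hM ⊢
  simp only [coe_toNNReal _ hcF.le, coe_toNNReal _ hδ, coe_toNNReal _ hc.le,
    coe_toNNReal _ (by positivity : 0 ≤ μ / 2), coe_toNNReal _
    (by positivity : 0 ≤ C₂ + C₃ + 1)] at hE hM ⊢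
  have A0 : (0 : ℝ) ≤ A := A.2
  generalize (A : ℝ) = A' at *
  have B0 : (0 : ℝ) ≤ B := B.2
  generalize (B : ℝ) = B' at *
  have k0 : (0 : ℝ) ≤ k := k.2
  generalize (k : ℝ) = k' at *
  have e0 : (0 : ℝ) ≤ e := e.2
  generalize (e : ℝ) = e' at *
  have P0 : (0 : ℝ) ≤ P := P.2
  generalize (P : ℝ) = P' at *
  have h1 : 2 * A' + B' ≤ m * (P' + c * (e' + δ * k')) := by
    have h := mul_le_mul_of_nonneg_left hE hm0.le
    refine le_trans ?_ h
    have h3 : m * (μ / 2) = 2 + μ / 2 := by rw [hm]; field_simp; ring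
    have h4 : m * (μ / 2 * A' + B') = (2 + μ / 2) * A' + m * B' := by rw [← h3]; ring
    rw [h4]
    have h5 : B' ≤ m * B' := le_mul_of_one_le_left B0 (by rw [hm]; linarith [div_pos four_pos hμ])
    have h6 : 2 * A' ≤ (2 + μ / 2) * A' := mul_le_mul_of_nonneg_right (by linarith) A0
    linarith
  have h2 : k' ≤ C₂ * (P' + e') := by
    have h3 := mul_le_mul_of_nonneg_left h1 hcF.le
    have h4 := mul_le_mul_of_nonneg_right hsm k0
    have h5 : 0 ≤ cF * (m * e') + cF * (m * c + 4) * P' := by positivity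
    rw [hC₂]
    nlinarith
  have h7 : A' ≤ C₃ * (P' + e') := by
    have h3 : δ * k' ≤ k' := mul_le_of_le_one_left k0 hδ1
    have h4 : A' ≤ 2 / μ * (P' + c * (e' + k')) := by
      rw [div_mul_eq_mul_div, le_div_iff₀ hμ]
      have := mul_le_mul_of_nonneg_left h3 hc.le
      nlinarith
    refine h4.trans ?_
    rw [hC₃, mul_assoc]
    refine mul_le_mul_of_nonneg_left ?_ (by positivity)
    have := mul_le_mul_of_nonneg_left h2 hc.le
    nlinarith [mul_nonneg hc.le P0]
  nlinarith

/-- Weighted energy and trace estimates, with the constants depending only on the data. -/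
lemma exists_weighted_bounds (n : ℕ) (M : ℝ≥0) (K : ℝ) (hK : 1 ≤ K) (μ Λ : ℝ) (hμ : 0 < μ)
    (hΛ : 0 < Λ) : ∃ δ : ℝ, 0 < δ ∧ δ ≤ 1 ∧ ∃ C : ℝ≥0,
    ∀ (τ : ℝ) (Ψ : Euc n → ℝ) (a : Pt n → Pt n →L[ℝ] Pt n)
      (V u : Pt n → ℝ) (g : Pt n → Pt n) (f : Euc n → ℝ)
      (G : Euc n → Pt n) (S η : Pt n → ℝ), BdrySol τ M K μ Λ Ψ a V u g f G →
      Measurable (bdryFlux τ Ψ a G) → WeightPair V δ S η →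
      wtDirichlet τ Ψ S η g + wtMass τ Ψ S η (fun x => (critRad V 1 x ^ 2)⁻¹) u
        ≤ C * (wtFlux Ψ S η f (bdryFlux τ Ψ a G) + wtErr τ Ψ S η u) ∧
      wtTrace Ψ S η f ≤ C * ((∫⁻ z, ‖bdryFlux τ Ψ a G z‖ₑ ^ 2) + wtErr τ Ψ S η u) := by
  obtain ⟨cF, hcF, hFP⟩ := exists_feffermanPhong n M K hK
  set c := 4 * Λ ^ 2 / μ with hc
  have hc0 : 0 < c := by positivity
  set q := cF * ((4 / μ + 1) * c + 4)
  have hq0 : 0 < q := by positivity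
  -- This fixes δ in terms of the data alone; it is the smallness condition of `absorb_energy`, in
  -- which δ² plays the role of its parameter.
  have hδ : ∃ δ : ℝ, 0 < δ ∧ δ ≤ 1 ∧ q * δ ^ 2 ≤ 1 / 2 := by
    refine ⟨min 1 (1 / (2 * q)), by positivity, min_le_left _ _, ?_⟩
    have h0 : 0 ≤ min 1 (1 / (2 * q)) := by positivity
    have h1 : min 1 (1 / (2 * q)) ^ 2 ≤ 1 / (2 * q) := by
      nlinarith [min_le_left 1 (1 / (2 * q)), min_le_right 1 (1 / (2 * q))]
    calc q * _ ≤ q * (1 / (2 * q)) := by gcongr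
      _ = 1 / 2 := by field_simp
  obtain ⟨δ, hδ0, hδ1, hsm⟩ := hδ
  obtain ⟨C, hC1, hC⟩ := absorb_energy hμ hc0 hcF (sq_nonneg δ) (pow_le_one₀ hδ0.le hδ1) hsm
  have hC0 : (0 : ℝ) < C := by exact_mod_cast one_pos.trans_le hC1
  refine ⟨δ, hδ0, hδ1, C + 14 * C + 2 * (7 * C) * (14 * C), fun τ Ψ a V u g f G S η h hpm hw => ?_⟩
  have hE := hC _ _ _ _ _ (h.mass_lt_top hw) (h.energy_le hw hμ hΛ)
    (h.mass_le hw (hFP τ h.side Ψ h.lip V h.pot h.meas_pot))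
  obtain ⟨hX, hXfin⟩ := h.trace_le hw hδ1 hδ0.le
  -- The trace will be bounded by 7C times the flux plus the error, so this ε returns exactly half
  -- of the trace.
  have hY := hw.flux_le h.lip h.bdry.meas_f hpm (ε := (14 * C)⁻¹) (by positivity)
  refine ⟨hE.trans (mul_le_mul_left ?_ _), ?_⟩
  · norm_cast
    exact (le_self_add.trans le_self_add)
  generalize wtFlux Ψ S η f (bdryFlux τ Ψ a G) = P at *
  generalize wtErr τ Ψ S η u = e at *
  generalize wtTrace Ψ S η f = X at *
  generalize (∫⁻ z, ‖bdryFlux τ Ψ a G z‖ₑ ^ 2) = Q at *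
  generalize wtDirichlet τ Ψ S η g = A at *
  generalize wtMass τ Ψ S η (fun x => (critRad V 1 x ^ 2)⁻¹) u = k at *
  have h1 : X ≤ 7 * C * (P + e) := by
    calc X ≤ e + A + 6 * k := hX
      _ ≤ e + 6 * (A + k) := by
        rw [mul_add, add_assoc]
        gcongr
        exact le_mul_of_one_le_left' (by norm_num)
      _ ≤ C * (P + e) + 6 * (C * (P + e)) := by
        refine add_le_add ?_ (mul_le_mul_right hE _)
        calc e ≤ 1 * (P + e) := by rw [one_mul]; exact le_add_self
          _ ≤ C * (P + e) := by gcongr; exact_mod_cast hC1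
      _ = 7 * C * (P + e) := by ring
  have hne : ((C + 14 * C + 2 * (7 * C) * (14 * C) : ℝ≥0) : ℝ≥0∞) ≠ 0 := by
    have : 0 < C := by exact_mod_cast hC0
    positivity
  by_cases hQ : Q = ∞
  · rw [hQ, top_add, ENNReal.mul_top hne]; exact le_top
  by_cases he : e = ∞
  · rw [he, add_top, ENNReal.mul_top hne]; exact le_top
  have hPfin : P ≠ ∞ := (hY.trans_lt (by finiteness)).ne
  lift X to ℝ≥0 using hXfin.ne
  lift Q to ℝ≥0 using hQ
  lift e to ℝ≥0 using he
  lift P to ℝ≥0 using hPfin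
  simp only [ofReal] at hY
  norm_cast at h1 hY ⊢
  rw [← NNReal.coe_le_coe] at h1 hY ⊢
  push_cast at h1 hY ⊢
  rw [coe_toNNReal _ (by positivity), coe_toNNReal _ (by positivity), inv_inv] at hY
  have hX0 := X.2
  have hQ0 := Q.2
  have he0 := e.2
  have h3 := mul_le_mul_of_nonneg_left hY (by positivity : (0 : ℝ) ≤ 7 * C)
  have h4 : 7 * (C : ℝ) * ((14 * (C : ℝ))⁻¹ * X + 14 * (C : ℝ) / 4 * Q)
      = X / 2 + 7 * (C : ℝ) * (14 * C / 4) * Q := by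
    field_simp; ring
  have h5 : (0 : ℝ) ≤ C * C * Q := by positivity
  have h6 : (0 : ℝ) ≤ C * C * e := by positivity
  have h7 : (0 : ℝ) ≤ C * Q := by positivity
  have h8 : (0 : ℝ) ≤ C * e := by positivity
  nlinarith

end Absorb

/-! ### Removing the cut-offs by decay at infinity -/

section Limits

variable {n : ℕ} {τ μ Λ K δ : ℝ} {M : ℝ≥0} {Ψ : Euc n → ℝ}
  {a : Pt n → Pt n →L[ℝ] Pt n} {V : Pt n → ℝ}
  {u : Pt n → ℝ} {g : Pt n → Pt n} {f : Euc n → ℝ} {G : Euc n → Pt n}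

/-- `u = O(|x|^{2-d})` and `∇u = O(|x|^{1-d})` at infinity. -/
def DecaysOn (D : Set (Pt n)) (u : Pt n → ℝ) (g : Pt n → Pt n) : Prop :=
  ∃ C R₀ : ℝ, 0 ≤ C ∧ ∀ᵐ x ∂volume.restrict D, R₀ ≤ ‖x‖ →
    |u x| * ‖x‖ ^ (n - 1) ≤ C ∧ ‖g x‖ * ‖x‖ ^ n ≤ C

/-- The hypothesis δ⁻¹ρ_1 ≤ ρ_l gives S²ρ_1 ≤ ρ_1/ρ_l ≤ δ, uniformly in the regularization ε. -/
lemma weightPair_rootWt (hV : IsBInfty K V) {l : ℝ} (hl : 0 < l) (hδ : 0 < δ)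
    (hs : ∀ x, δ⁻¹ * critRad V 1 x ≤ critRad V l x) {ε R : ℝ} (hε : 0 < ε) (hR : 0 < R) :
    WeightPair V δ (rootWt (critRad V l) ε) (radCut R) where
  lip_wt := exists_lipschitz_rootWt (hV.lipschitz_critRad hl) (hV.critRad_pos hl) hε
  bdd_wt := ⟨Real.toNNReal (Real.sqrt ε⁻¹), fun x => by
    rw [coe_toNNReal _ (Real.sqrt_nonneg _)]
    exact abs_rootWt_le (hV.critRad_pos hl) hε x⟩
  pos := rootWt_pos (hV.critRad_pos hl) hε
  slow := norm_fderiv_rootWt_le (hV.lipschitz_critRad hl) (hV.critRad_pos hl) hε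
  small x := by
    have h1 := hV.critRad_pos hl x
    rw [rootWt_sq (hV.critRad_pos hl) hε, inv_mul_le_iff₀ (by positivity)]
    have h2 := hs x
    rw [inv_mul_le_iff₀ hδ] at h2
    nlinarith
  lip_cut := ⟨_, lipschitz_radCut hR⟩
  cpt := hasCompactSupport_radCut hR
  nonneg := radCut_nonneg
  le_one := radCut_le_one

/-- The gradient of the cut-off is at most R⁻¹ and lives on the annulus between R and 2R, where
decay gives |v| ≤ C/R^m; the radius 3R only encloses the closed annulus in an open ball. -/
lemma lintegral_fderiv_radCut_le {D : Set (Pt n)} {v s : Pt n → ℝ} {C B R R₀ : ℝ} {j m : ℕ}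
    (hj : j ≠ 0) (hR : 0 < R) (hR₀ : R₀ ≤ R) (hB : 0 ≤ B) (hs : ∀ x, s x ≤ B)
    (hv : ∀ᵐ x ∂volume.restrict D, R₀ ≤ ‖x‖ → |v x| * ‖x‖ ^ m ≤ C) :
    ∫⁻ x in D, ofReal (s x * ‖fderiv ℝ (radCut R) x‖ ^ j * v x ^ 2) ≤
      ofReal (B * R⁻¹ ^ j * (C / R ^ m) ^ 2 * ((3 * R) ^ (n + 1) * unitVol (n + 1))) := by
  rw [ofReal_mul (by positivity), ← volume_ball_eq 0 (by positivity), ← setLIntegral_const,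
    ← lintegral_indicator isOpen_ball.measurableSet]
  refine (lintegral_mono_ae (hv.mono fun x hx => ?_)).trans (setLIntegral_le_lintegral _ _)
  have hb := norm_fderiv_radCut_le hR x
  by_cases hx' : x ∈ closedBall (0 : Pt n) (2 * R) \ ball 0 R
  · rw [indicator_of_mem hx'] at hb
    have hxR : R ≤ ‖x‖ := by simpa using hx'.2
    have h2 := mem_closedBall_zero_iff.1 hx'.1
    rw [indicator_of_mem (mem_ball_zero_iff.2 (by linarith)), ← sq_abs (v x)]
    have hvx : |v x| ≤ C / R ^ m := by
      rw [le_div_iff₀ (by positivity)]; exact le_trans (by gcongr) (hx (by linarith))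
    have := hs x
    gcongr
  · rw [indicator_of_notMem hx'] at hb
    simp [norm_le_zero_iff.1 hb, hj]

/-- The radii of the cut-offs used for the passage to the limit. -/
def cutRad (k : ℕ) : ℝ := ((k : ℝ) + 1) ^ 2

lemma cutRad_pos (k : ℕ) : 0 < cutRad k := by unfold cutRad; positivity

lemma le_cutRad (k : ℕ) : (k : ℝ) + 1 ≤ cutRad k := by
  unfold cutRad; nlinarith [(Nat.cast_nonneg k : (0 : ℝ) ≤ k)]

lemma tendsto_radCut (x : Pt n) : ∀ᶠ k in atTop, radCut (cutRad k) x = 1 := by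
  obtain ⟨k₀, hk₀⟩ := exists_nat_gt ‖x‖
  filter_upwards [eventually_ge_atTop k₀] with k hk
  have h1 : (k₀ : ℝ) ≤ k := by exact_mod_cast hk
  exact radCut_eq_one (cutRad_pos k) (by linarith [le_cutRad k])

lemma tendsto_ofReal_div (c : ℝ) :
    Tendsto (fun k : ℕ => ofReal (c / ((k : ℝ) + 1))) atTop (𝓝 0) := by
  have h := (tendsto_one_div_add_atTop_nhds_zero_nat (𝕜 := ℝ)).const_mul c
  have h2 := (continuous_ofReal.tendsto _).comp h
  simpa [Function.comp_def, div_eq_mul_inv] using h2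

/-- With R = (k + 1)², the powers combine to (k + 1)·R⁻²·R^{-2(n−1)}·R^{n+1} = (k + 1)R^{1−n} ≤ 1/(k
+ 1). This uses n ≥ 2, and is why the radius grows quadratically while S² is allowed to grow
linearly. -/
lemma DecaysOn.exists_err_le (hn : 2 ≤ n) (h : DecaysOn (graphDom τ Ψ) u g) :
    ∃ c : ℝ, ∀ᶠ k : ℕ in atTop, ∀ S : Pt n → ℝ, (∀ x, S x ^ 2 ≤ (k : ℝ) + 1) →
      wtErr τ Ψ S (radCut (cutRad k)) u ≤ ofReal (c / ((k : ℝ) + 1)) := by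
  obtain ⟨C, R₀, hC, h⟩ := h
  refine ⟨C ^ 2 * (3 ^ (n + 1) * unitVol (n + 1)), ?_⟩
  obtain ⟨k₀, hk₀⟩ := exists_nat_gt R₀
  filter_upwards [eventually_ge_atTop k₀] with k hk S hS
  have h1 : (k₀ : ℝ) ≤ k := by exact_mod_cast hk
  have hR := cutRad_pos k
  have hkR := le_cutRad k
  have hkR2 : cutRad k = ((k : ℝ) + 1) ^ 2 := rfl
  set R := cutRad k
  have hk0 : (0 : ℝ) ≤ k := Nat.cast_nonneg k
  have hR1 : 1 ≤ R := by linarith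
  have hu := (unitVol_pos (n + 1)).le
  refine (lintegral_fderiv_radCut_le two_ne_zero hR (by linarith) (by positivity) hS
    (h.mono fun x hx hx' => (hx hx').1)).trans (ofReal_le_ofReal ?_)
  obtain ⟨m, rfl⟩ : ∃ m, n = m + 2 := ⟨n - 2, by omega⟩
  have e : ((k : ℝ) + 1) * R⁻¹ ^ 2 * (C / R ^ (m + 2 - 1)) ^ 2
      * ((3 * R) ^ (m + 2 + 1) * unitVol (m + 2 + 1))
      = C ^ 2 * (3 ^ (m + 2 + 1) * unitVol (m + 2 + 1)) / ((k : ℝ) + 1) * (1 / R ^ m) := by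
    rw [show m + 2 - 1 = m + 1 from rfl, hkR2, mul_pow 3]
    have ht : (k : ℝ) + 1 ≠ 0 := by positivity
    generalize (k : ℝ) + 1 = t at ht ⊢
    field_simp
    ring
  rw [e]
  refine mul_le_of_le_one_right (by positivity) ?_
  rw [div_le_one (by positivity)]
  exact one_le_pow₀ hR1

/-- Here the powers are R⁻¹·R^{-2n}·R^{n+1} = R⁻ⁿ. -/
lemma DecaysOn.exists_grad_le (hn : 2 ≤ n) (h : DecaysOn (graphDom τ Ψ) u g) :
    ∃ c : ℝ, ∀ᶠ k : ℕ in atTop, ∫⁻ x in graphDom τ Ψ,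
      ofReal (‖fderiv ℝ (radCut (cutRad k)) x‖ * ‖g x‖ ^ 2) ≤ ofReal (c / ((k : ℝ) + 1)) := by
  obtain ⟨C, R₀, hC, h⟩ := h
  refine ⟨C ^ 2 * (3 ^ (n + 1) * unitVol (n + 1)), ?_⟩
  obtain ⟨k₀, hk₀⟩ := exists_nat_gt R₀
  filter_upwards [eventually_ge_atTop k₀] with k hk
  have h1 : (k₀ : ℝ) ≤ k := by exact_mod_cast hk
  have hR := cutRad_pos k
  have hkR := le_cutRad k
  have hkR2 : cutRad k = ((k : ℝ) + 1) ^ 2 := rfl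
  set R := cutRad k
  have hk0 : (0 : ℝ) ≤ k := Nat.cast_nonneg k
  have hR1 : 1 ≤ R := by linarith
  have hu := (unitVol_pos (n + 1)).le
  have h2 := lintegral_fderiv_radCut_le (R₀ := R₀) one_ne_zero hR (by linarith)
    zero_le_one (fun _ => le_refl _) (v := fun x => ‖g x‖)
    (h.mono fun x hx hx' => by simpa using (hx hx').2)
  simp only [pow_one, one_mul] at h2
  refine h2.trans (ofReal_le_ofReal ?_)
  have e : R⁻¹ * (C / R ^ n) ^ 2 * ((3 * R) ^ (n + 1) * unitVol (n + 1))
      = C ^ 2 * (3 ^ (n + 1) * unitVol (n + 1)) * (1 / R ^ n) := by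
    rw [mul_pow]; field_simp; ring
  rw [e, div_eq_mul_one_div _ ((k : ℝ) + 1)]
  refine mul_le_mul_of_nonneg_left ?_ (by positivity)
  refine one_div_le_one_div_of_le (by positivity) (hkR.trans ?_)
  exact le_self_pow₀ hR1 (by omega)

lemma tendsto_rootWt {ρ : Pt n → ℝ} (hρ : ∀ x, 0 < ρ x) (x : Pt n) :
    Tendsto (fun k : ℕ => rootWt ρ (1 / ((k : ℝ) + 1)) x) atTop (𝓝 (√(ρ x))⁻¹) := by
  have h1 : Tendsto (fun k : ℕ => ρ x + 1 / ((k : ℝ) + 1)) atTop (𝓝 (ρ x)) := by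
    simpa using (tendsto_one_div_add_atTop_nhds_zero_nat (𝕜 := ℝ)).const_add (ρ x)
  exact ((Real.continuous_sqrt.tendsto _).comp h1).inv₀ (Real.sqrt_pos.2 (hρ x)).ne'

lemma BdrySol.measurable_flux (h : BdrySol τ M K μ Λ Ψ a V u g f G) :
    Measurable (bdryFlux τ Ψ a G) :=
  (h.coeff.meas_bdry h.lip h.bdry.meas_G).inner (measurable_depthGrad τ Ψ)

lemma wtFlux_le {S η ρ : Pt n → ℝ} (hw : WeightPair V δ S η)
    (hS : ∀ x, S x ^ 2 ≤ ρ x) (f p : Euc n → ℝ) :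
    wtFlux Ψ S η f p ≤ ∫⁻ z, ofReal (ρ (bdryPt Ψ z) * |f z * p z|) := by
  refine lintegral_mono fun z => ofReal_le_ofReal ?_
  refine mul_le_mul_of_nonneg_right (le_trans ?_ (hS _)) (abs_nonneg _)
  rw [mul_pow]
  exact mul_le_of_le_one_right (sq_nonneg _) (pow_le_one₀ (hw.nonneg _) (hw.le_one _))

/-- The boundary trace and the weighted Dirichlet integral of a decaying solution are controlled
by its conormal derivative. -/
lemma exists_trace_bounds (n : ℕ) (hn : 2 ≤ n) (M : ℝ≥0) (K : ℝ) (hK : 1 ≤ K) (μ Λ : ℝ)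
    (hμ : 0 < μ) (hΛ : 0 < Λ) : ∃ C : ℝ≥0,
    ∀ (τ : ℝ) (Ψ : Euc n → ℝ) (a : Pt n → Pt n →L[ℝ] Pt n)
      (V u : Pt n → ℝ) (g : Pt n → Pt n) (f : Euc n → ℝ)
      (G : Euc n → Pt n), BdrySol τ M K μ Λ Ψ a V u g f G →
      DecaysOn (graphDom τ Ψ) u g →
      ∫⁻ z, ofReal ((critRad V 1 (bdryPt Ψ z) ^ 2)⁻¹ * f z ^ 2)
        ≤ C * ∫⁻ z, ‖bdryFlux τ Ψ a G z‖ₑ ^ 2 ∧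
      ∫⁻ x in graphDom τ Ψ, ofReal ((critRad V 1 x)⁻¹ * ‖g x‖ ^ 2
        + (critRad V 1 x)⁻¹ * ((critRad V 1 x ^ 2)⁻¹ * u x ^ 2))
        ≤ C * ∫⁻ z, ofReal ((critRad V 1 (bdryPt Ψ z))⁻¹ * |f z * bdryFlux τ Ψ a G z|) := by
  obtain ⟨δ, hδ, hδ1, C, hC⟩ := exists_weighted_bounds n M K hK μ Λ hμ hΛ
  -- The weight is built from the critical radius at level l², which is at least δ⁻¹ times the one
  -- at level 1 and at most l times it. The first bound gives smallness, the second lets the final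
  -- estimate be stated with the level 1 radius.
  obtain ⟨l, hl, hcr⟩ := exists_critRad_ge (n + 1) (by omega) K hK δ⁻¹ ((one_le_inv₀ hδ).2 hδ1)
  have hl0 : 0 < l := by linarith
  refine ⟨Real.toNNReal (l ^ 2) * C, fun τ Ψ a V u g f G h hdec => ?_⟩
  have hpm := h.measurable_flux
  have hV := h.pot
  have hum := h.bdry.meas_u
  have hgm := h.bdry.meas_g
  have hfm := h.bdry.meas_f
  have hbm := (continuous_bdryPt h.lip).measurable
  have hr := hV.critRad_pos one_pos
  set ρ := critRad V (l ^ 2)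
  have hρ0 : ∀ x, 0 < ρ x := hV.critRad_pos (by positivity)
  have hρm : Measurable ρ := (hV.lipschitz_critRad (by positivity)).continuous.measurable
  have hrm : Measurable (critRad V 1) := (hV.lipschitz_critRad one_pos).continuous.measurable
  have hρr : ∀ x, (critRad V 1 x)⁻¹ ≤ l * (ρ x)⁻¹ := fun x => by
    have h1 : ρ x ≤ l * critRad V 1 x := by
      have := hV.critRad_le_mul one_pos hl x
      rwa [mul_one] at this
    rw [← div_eq_mul_inv, le_div_iff₀ (hρ0 x), inv_mul_le_iff₀ (hr x)]
    linarith
  have hrρ : ∀ x, (ρ x)⁻¹ ≤ (critRad V 1 x)⁻¹ := fun x =>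
    inv_anti₀ (hr x) (hV.critRad_mono one_pos (one_le_pow₀ hl) x)
  -- The regularization 1/(k + 1) gives S² ≤ k + 1, the growth that the cut-off radii are designed
  -- to beat.
  set S : ℕ → Pt n → ℝ := fun k => rootWt ρ (1 / ((k : ℝ) + 1)) with hS
  set η : ℕ → Pt n → ℝ := fun k => radCut (cutRad k)
  have hw : ∀ k, WeightPair V δ (S k) (η k) := fun k =>
    weightPair_rootWt hV (by positivity) hδ (hcr V hV) (by positivity) (cutRad_pos k)
  have hSlim : ∀ x, Tendsto (fun k => S k x) atTop (𝓝 (√(ρ x))⁻¹) := tendsto_rootWt hρ0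
  have hηlim : ∀ x, Tendsto (fun k => η k x) atTop (𝓝 1) := fun x =>
    tendsto_const_nhds.congr' ((tendsto_radCut x).mono fun k hk => hk.symm)
  have hsq : ∀ x, (√(ρ x))⁻¹ ^ 2 = (ρ x)⁻¹ := fun x => by rw [inv_pow, Real.sq_sqrt (hρ0 x).le]
  have hSk : ∀ k x, S k x ^ 2 ≤ (k : ℝ) + 1 := fun k x => by
    exact (rootWt_sq_le hρ0 (by positivity) x).trans_eq (by rw [one_div, inv_inv])
  have hSρ : ∀ k x, S k x ^ 2 ≤ (ρ x)⁻¹ := fun k x => by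
    rw [hS]
    simp only
    rw [rootWt_sq hρ0 (by positivity)]
    exact inv_anti₀ (hρ0 x) (by linarith [(by positivity : (0 : ℝ) < 1 / ((k : ℝ) + 1))])
  obtain ⟨c, hc⟩ := hdec.exists_err_le hn
  have hwS : ∀ x, Tendsto (fun k => (S k x * η k x) ^ 2) atTop (𝓝 (ρ x)⁻¹) := fun x => by
    have := ((hSlim x).mul (hηlim x)).pow 2
    rwa [mul_one, hsq] at this
  have hb : Tendsto (fun k : ℕ => (C : ℝ≥0∞) * ofReal (c / ((k : ℝ) + 1))) atTop (𝓝 0) := by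
    simpa using ENNReal.Tendsto.const_mul (tendsto_ofReal_div c) (Or.inr ENNReal.coe_ne_top)
  have scale : ∀ {X : Type} [MeasurableSpace X] {m : Measure X} {F H : X → ℝ} (b : ℝ≥0∞),
      (∀ x, F x ≤ l ^ 2 * H x) → Measurable H → ∫⁻ x, ofReal (H x) ∂m ≤ C * b →
      ∫⁻ x, ofReal (F x) ∂m ≤ (Real.toNNReal (l ^ 2) * C : ℝ≥0) * b := by
    intro X _ m F H b hFH hH hle
    calc ∫⁻ x, ofReal (F x) ∂m ≤ ∫⁻ x, ofReal (l ^ 2) * ofReal (H x) ∂m :=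
          lintegral_mono fun x => by
            rw [← ofReal_mul (by positivity)]
            exact ofReal_le_ofReal (hFH x)
      _ = ofReal (l ^ 2) * ∫⁻ x, ofReal (H x) ∂m :=
          lintegral_const_mul _ hH.ennreal_ofReal
      _ ≤ ofReal (l ^ 2) * (C * b) := mul_le_mul_right hle _
      _ = _ := by rw [ENNReal.coe_mul, mul_assoc]; rfl
  constructor
  · refine scale (H := fun z => (ρ (bdryPt Ψ z))⁻¹ ^ 2 * f z ^ 2) _ (fun z => ?_) (by fun_prop) ?_
    · rw [← mul_assoc, ← inv_pow,
        show l ^ 2 * (ρ (bdryPt Ψ z))⁻¹ ^ 2 = (l * (ρ (bdryPt Ψ z))⁻¹) ^ 2 by ring]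
      have h0 := inv_nonneg.2 (hr (bdryPt Ψ z)).le
      have := hρr (bdryPt Ψ z)
      gcongr
    -- As k grows the trace weight (S²η)² tends to ρ^{-2} at the level l², and the cut-off error
    -- tends to zero.
    · refine lintegral_le_of_tendsto (F := fun k z => ofReal ((S k (bdryPt Ψ z)
        * (S k (bdryPt Ψ z) * η k (bdryPt Ψ z))) ^ 2 * f z ^ 2)) (fun k => ?_)
        (ae_of_all _ fun z => ?_) (hc.mono fun k hk => ?_) hb
      · obtain ⟨h1, h2, -⟩ := (hw k).measurable
        exact Measurable.aemeasurable (by fun_prop)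
      · refine (continuous_ofReal.tendsto _).comp (Tendsto.mul_const _ ?_)
        have := ((hSlim (bdryPt Ψ z)).pow 2).mul (hwS (bdryPt Ψ z))
        rw [hsq, ← sq] at this
        exact this.congr fun k => by ring
      · refine ((hC τ Ψ a V u g f G _ _ h hpm (hw k)).2).trans ?_
        rw [mul_add]
        exact add_le_add_right (mul_le_mul_right (hk _ (hSk k)) _) _
  · refine scale (H := fun x => (ρ x)⁻¹ * ‖g x‖ ^ 2
      + (ρ x)⁻¹ * ((critRad V 1 x ^ 2)⁻¹ * u x ^ 2)) _ (fun x => ?_) (by fun_prop) ?_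
    · rw [← mul_add, ← mul_add, ← mul_assoc]
      have h0 := hr x
      refine mul_le_mul_of_nonneg_right ((hρr x).trans ?_) (by positivity)
      refine mul_le_mul_of_nonneg_right ?_ (inv_nonneg.2 (hρ0 x).le)
      nlinarith
    · refine (lintegral_le_of_tendsto (F := fun k x => ofReal ((S k x * η k x) ^ 2
        * ‖g x‖ ^ 2 + (S k x * η k x) ^ 2 * ((critRad V 1 x ^ 2)⁻¹ * u x ^ 2))) (fun k => ?_)
        (ae_of_all _ fun x => ?_) (hc.mono fun k hk => ?_) hb).trans
        (b := C * ∫⁻ z, ofReal ((ρ (bdryPt Ψ z))⁻¹ * |f z * bdryFlux τ Ψ a G z|))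
        (mul_le_mul_right (lintegral_mono fun z => ofReal_le_ofReal
          (mul_le_mul_of_nonneg_right (hrρ _) (abs_nonneg _))) _)
      · obtain ⟨h1, h2, -⟩ := (hw k).measurable
        exact Measurable.aemeasurable (by fun_prop)
      · exact (continuous_ofReal.tendsto _).comp (((hwS x).mul_const _).add ((hwS x).mul_const _))
      · obtain ⟨h1, h2, -⟩ := (hw k).measurable
        have e := (hC τ Ψ a V u g f G _ _ h hpm (hw k)).1
        rw [wtDirichlet, wtMass, ← lintegral_add_left (by fun_prop)] at e
        simp only [← ofReal_add (mul_nonneg (sq_nonneg _) (sq_nonneg _))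
          (mul_nonneg (sq_nonneg _) (mul_nonneg (inv_nonneg.2 (sq_nonneg _)) (sq_nonneg _)))] at e
        refine e.trans ?_
        rw [mul_add]
        exact add_le_add (mul_le_mul_right (wtFlux_le (hw k) (hSρ k) _ _) _)
          (mul_le_mul_right (hk _ (hSk k)) _)

end Limits

/-! ### Comparison of the boundary quantities -/

section Comparison

variable {n : ℕ} {τ μ Λ K δ : ℝ} {M : ℝ≥0} {Ψ : Euc n → ℝ}
  {a : Pt n → Pt n →L[ℝ] Pt n} {V : Pt n → ℝ}
  {u : Pt n → ℝ} {g : Pt n → Pt n} {f : Euc n → ℝ} {G : Euc n → Pt n}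

/-- The density of the boundary term in the Rellich identity. -/
def bdryRellich (τ : ℝ) (Ψ : Euc n → ℝ) (a : Pt n → Pt n →L[ℝ] Pt n)
    (G : Euc n → Pt n) (z : Euc n) : ℝ :=
  2 * inner ℝ (G z) (vert n τ) * bdryFlux τ Ψ a G z - bdryEnergy Ψ a G z

/-- The component of `G` orthogonal to the normal of the graph. -/
def bdryTang (τ : ℝ) (Ψ : Euc n → ℝ) (G : Euc n → Pt n) (z : Euc n) : Pt n :=
  G z - (inner ℝ (depthGrad τ Ψ z) (G z) / ‖depthGrad τ Ψ z‖ ^ 2) • depthGrad τ Ψ z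

lemma BdrySol.measurable_rellich (h : BdrySol τ M K μ Λ Ψ a V u g f G) :
    Measurable (bdryRellich τ Ψ a G) := by
  have hG := h.bdry.meas_G
  have h1 : Measurable fun z => inner ℝ (G z) (vert n τ) := hG.inner measurable_const
  have h2 : Measurable (bdryEnergy Ψ a G) := (h.coeff.meas_bdry h.lip hG).inner hG
  exact ((h1.const_mul 2).mul h.measurable_flux).sub h2

lemma BdrySol.abs_flux_le (h : BdrySol τ M K μ Λ Ψ a V u g f G) (z : Euc n) :
    |bdryFlux τ Ψ a G z| ≤ Λ * (1 + M) * ‖G z‖ := by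
  rw [mul_assoc, mul_comm (1 + _)]
  refine (abs_real_inner_le_norm _ _).trans ?_
  rw [← mul_assoc]
  have h1 := h.coeff.bound (bdryPt Ψ z) (G z)
  gcongr
  exacts [(norm_nonneg _).trans h1, norm_depthGrad_le h.side h.lip z]

lemma BdrySol.integrable_rellich (h : BdrySol τ M K μ Λ Ψ a V u g f G) :
    Integrable (bdryRellich τ Ψ a G) := by
  refine integrable_of_norm_le_mul (c := 2 * (Λ * (1 + M)) + Λ)
    h.measurable_rellich.aestronglyMeasurable h.bdry.meas_G.aestronglyMeasurable
    h.bdry.meas_G.aestronglyMeasurable h.bdry.sq_G h.bdry.sq_G (ae_of_all _ fun z => ?_)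
  have h1 := abs_inner_vert_le h.side (G z)
  have h2 := h.abs_flux_le z
  have h3 : |bdryEnergy Ψ a G z| ≤ _ := h.coeff.abs_inner_le _ _ _
  rw [norm_eq_abs, bdryRellich]
  refine (abs_sub _ _).trans ?_
  rw [abs_mul, abs_mul, abs_two]
  have h4 : |inner ℝ (G z) (vert n τ)| * |bdryFlux τ Ψ a G z| ≤ ‖G z‖ * (Λ * (1 + M) * ‖G z‖) := by
    gcongr
  linarith

/-- The Rellich boundary term of a decaying solution is controlled by the weighted energy. -/
lemma BdrySol.rellich_le (h : BdrySol τ M K μ Λ Ψ a V u g f G) (hn : 2 ≤ n)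
    (hΛ : 0 < Λ) (hdec : DecaysOn (graphDom τ Ψ) u g) :
    ‖∫ z, bdryRellich τ Ψ a G z‖ₑ ≤ ∫⁻ x in graphDom τ Ψ, ofReal
      ((critRad V 1 x)⁻¹ * ‖g x‖ ^ 2 + (critRad V 1 x)⁻¹ * ((critRad V 1 x ^ 2)⁻¹ * u x ^ 2)) := by
  obtain ⟨c, hc⟩ := hdec.exists_grad_le hn
  have hgm := h.bdry.meas_g
  have hβ := h.integrable_rellich
  have hbm := (continuous_bdryPt h.lip).measurable
  set I := ∫⁻ x in graphDom τ Ψ, ofReal ((critRad V 1 x)⁻¹ * ‖g x‖ ^ 2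
    + (critRad V 1 x)⁻¹ * ((critRad V 1 x ^ 2)⁻¹ * u x ^ 2)) with hI
  have hlim : Tendsto (fun k : ℕ => ∫ z, bdryRellich τ Ψ a G z * radCut (cutRad k) (bdryPt Ψ z))
      atTop (𝓝 (∫ z, bdryRellich τ Ψ a G z)) := by
    refine tendsto_integral_of_dominated_convergence (fun z => |bdryRellich τ Ψ a G z|)
      (fun k => ?_) hβ.abs (fun k => ae_of_all _ fun z => ?_) (ae_of_all _ fun z => ?_)
    · exact (h.measurable_rellich.mul ((lipschitz_radCut
        (cutRad_pos k)).continuous.measurable.comp hbm)).aestronglyMeasurable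
    · rw [norm_mul, norm_of_nonneg (radCut_nonneg _)]
      exact mul_le_of_le_one_right (abs_nonneg _) (radCut_le_one _)
    · exact tendsto_const_nhds.congr' ((tendsto_radCut (bdryPt Ψ z)).mono fun k hk => by
        simp only [hk, mul_one])
  have hrhs : Tendsto (fun k : ℕ => ofReal (3 * Λ) * ofReal (c / ((k : ℝ) + 1)) + I)
      atTop (𝓝 I) := by
    simpa using (ENNReal.Tendsto.const_mul (tendsto_ofReal_div c)
      (Or.inr (ofReal_ne_top (r := 3 * Λ)))).add_const I
  refine le_of_tendsto_of_tendsto hlim.enorm hrhs (hc.mono fun k hk => ?_)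
  have hR := cutRad_pos k
  obtain ⟨hi, he⟩ := h.bdry.rellich h.side h.lip h.coeff h.pot h.meas_pot h.grad h.weak
    (lipschitz_radCut hR) (hasCompactSupport_radCut hR)
  have e1 : ∫ z, bdryRellich τ Ψ a G z * radCut (cutRad k) (bdryPt Ψ z) = -_ :=
    (neg_eq_iff_eq_neg.1 he.symm)
  have hm : Measurable fun x => ‖fderiv ℝ (radCut (cutRad k)) x‖ * ‖g x‖ ^ 2 :=
    (measurable_fderiv ℝ _).norm.mul (hgm.norm.pow_const 2)
  dsimp only
  rw [e1, enorm_neg]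
  refine (enorm_integral_le_lintegral_enorm _).trans ?_
  refine le_trans ?_ (add_le_add_left (mul_le_mul_right hk _) _)
  rw [← lintegral_const_mul _ hm.ennreal_ofReal, hI,
    ← lintegral_add_left (hm.ennreal_ofReal.const_mul _)]
  refine lintegral_mono_ae (ae_restrict_of_ae ?_)
  filter_upwards [h.pot.ae_le_critRad, h.pot.nonneg_ae] with x hVx hV0
  have hr := h.pot.critRad_pos one_pos x
  have η0 := radCut_nonneg (R := cutRad k) x
  have η1 := radCut_le_one (R := cutRad k) x
  rw [← ofReal_mul (by positivity), ← ofReal_add (by positivity) (by positivity),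
    enorm_eq_ofReal_abs]
  refine ofReal_le_ofReal ((abs_add_le _ _).trans (add_le_add ?_ ?_))
  · refine ((fderiv ℝ (radCut (cutRad k)) x).le_opNorm _).trans ?_
    rw [mul_left_comm, sq]
    gcongr
    exact h.coeff.norm_rellichField_le h.side x _ _
  · have hin := abs_inner_vert_le h.side (g x)
    -- With q = ρ⁻¹ this gives 2V|u||∇u| ≤ 2q²|u||∇u| ≤ q|∇u|² + q³u², precisely the weighted energy
    -- density.
    have hV2 : V x ≤ (critRad V 1 x ^ 2)⁻¹ := by rwa [← one_div, le_div_iff₀ (by positivity)]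
    rw [abs_mul, abs_mul, abs_mul, abs_mul, abs_two, abs_of_nonneg hV0, abs_of_nonneg η0]
    set q := (critRad V 1 x)⁻¹ with hq
    have q0 : 0 < q := inv_pos.2 hr
    rw [← inv_pow, ← hq] at hV2 ⊢
    calc 2 * V x * |u x| * |inner ℝ (g x) (vert n τ)| * radCut (cutRad k) x
        ≤ 2 * q ^ 2 * |u x| * ‖g x‖ * 1 := by gcongr
      _ ≤ q * ‖g x‖ ^ 2 + q * (q ^ 2 * u x ^ 2) := by
        rw [← sq_abs (u x)]
        nlinarith [mul_nonneg q0.le (sq_nonneg (‖g x‖ - q * |u x|))]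

/-- Write G = αN + T with T orthogonal to N. Since N·e = 1, the cross terms αAT·N cancel in β =
α²AN·N + 2(T·e)p − AT·T, while p = αAN·N + AT·N. Thus p² is controlled by α²AN·N and |T|², and the
term (T·e)p is absorbed by Young's inequality. -/
lemma BdrySol.flux_sq_le (h : BdrySol τ M K μ Λ Ψ a V u g f G) (hμ : 0 < μ) (hΛ : 0 < Λ)
    (z : Euc n) : bdryFlux τ Ψ a G z ^ 2 ≤ 4 * (Λ * (1 + M) ^ 2) * bdryRellich τ Ψ a G z
      + (16 * (Λ * (1 + M) ^ 2) ^ 2 + 8 * Λ * (Λ * (1 + M) ^ 2)) * ‖bdryTang τ Ψ G z‖ ^ 2 := by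
  set N := depthGrad τ Ψ z with hN
  set T := bdryTang τ Ψ G z with hT
  set α := inner ℝ N (G z) / ‖N‖ ^ 2 with hα
  set L := a (bdryPt Ψ z) with hL
  have hG : G z = α • N + T := by rw [hT, bdryTang]; abel
  have hNe : inner ℝ N (vert n τ) = 1 := by
    rw [real_inner_comm]; exact inner_depthGrad_vert h.side z
  have hsym : inner ℝ (L N) T = inner ℝ (L T) N := by
    rw [real_inner_comm T]; rw [h.coeff.symm, real_inner_comm]
  have hNn := norm_depthGrad_le h.side h.lip z
  have hA0 : 0 ≤ inner ℝ (L N) N := le_trans (by positivity) (h.coeff.elliptic (bdryPt Ψ z) N)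
  have hle := fun v w => (le_abs_self _).trans (h.coeff.abs_inner_le (bdryPt Ψ z) v w)
  have hA1 : inner ℝ (L N) N ≤ Λ * (1 + M) ^ 2 := (hle N N).trans (by rw [sq]; gcongr)
  have hb : |inner ℝ (L T) N| ≤ Λ * (1 + M) * ‖T‖ := (h.coeff.abs_inner_le _ T N).trans
    (by rw [mul_assoc, mul_comm ‖T‖]; gcongr)
  have hTT : inner ℝ (L T) T ≤ Λ * ‖T‖ ^ 2 := (hle T T).trans_eq (by rw [sq])
  have hTe := abs_inner_vert_le h.side T
  have hp : bdryFlux τ Ψ a G z = α * inner ℝ (L N) N + inner ℝ (L T) N := by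
    rw [bdryFlux, ← hN, ← hL, hG, map_add, map_smul, inner_add_left, real_inner_smul_left]
  have hβ : bdryRellich τ Ψ a G z = α ^ 2 * inner ℝ (L N) N
      + 2 * inner ℝ T (vert n τ) * bdryFlux τ Ψ a G z - inner ℝ (L T) T := by
    rw [bdryRellich, bdryEnergy, hp, ← hL, hG]
    simp only [map_add, map_smul, inner_add_left, inner_add_right, real_inner_smul_left,
      real_inner_smul_right, hNe, hsym]
    ring
  generalize bdryFlux τ Ψ a G z = p at *
  generalize bdryRellich τ Ψ a G z = β at *
  generalize inner ℝ (L N) N = A₀ at *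
  generalize inner ℝ (L T) N = b at *
  generalize inner ℝ (L T) T = t at *
  generalize inner ℝ T (vert n τ) = s at *
  clear_value α
  set m : ℝ := 1 + M with hm
  have hm0 : 0 < m := by positivity
  have hm1 : 1 ≤ m := by rw [hm]; linarith [M.2]
  have h1 : p ^ 2 ≤ 2 * (Λ * m ^ 2) * (α ^ 2 * A₀) + 2 * b ^ 2 := by
    have h2 : α ^ 2 * A₀ * A₀ ≤ α ^ 2 * A₀ * (Λ * m ^ 2) := by gcongr
    rw [hp]
    nlinarith [sq_nonneg (α * A₀ - b)]
  have h3 : b ^ 2 ≤ Λ * (Λ * m ^ 2) * ‖T‖ ^ 2 := by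
    calc b ^ 2 = |b| ^ 2 := (sq_abs b).symm
      _ ≤ (Λ * m * ‖T‖) ^ 2 := by gcongr
      _ = _ := by ring
  have h4 : -(2 * s * p) ≤ 2 * ‖T‖ * |p| := by
    have : |s * p| ≤ ‖T‖ * |p| := by rw [abs_mul]; gcongr
    linarith [neg_abs_le (s * p)]
  set Q := Λ * m ^ 2
  have hQ0 : 0 < Q := by positivity
  have h5 : p ^ 2 ≤ 2 * Q * (β + 2 * ‖T‖ * |p| + Λ * ‖T‖ ^ 2) + 2 * (Λ * Q * ‖T‖ ^ 2) := by
    have : α ^ 2 * A₀ ≤ β + 2 * ‖T‖ * |p| + Λ * ‖T‖ ^ 2 := by linarith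
    have := mul_le_mul_of_nonneg_left this (by positivity : 0 ≤ 2 * Q)
    linarith
  have h6 := sq_nonneg (|p| - 4 * Q * ‖T‖)
  have h7 : (|p| - 4 * Q * ‖T‖) ^ 2 = p ^ 2 - 8 * Q * (‖T‖ * |p|) + 16 * Q ^ 2 * ‖T‖ ^ 2 := by
    rw [← sq_abs p]; ring
  nlinarith

/-- Ellipticity bounds μ|G|² by the energy density, which equals 2(G·e)p − β; Young's inequality
absorbs the product. -/
lemma BdrySol.norm_sq_le (h : BdrySol τ M K μ Λ Ψ a V u g f G) (hμ : 0 < μ) (z : Euc n) :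
    ‖G z‖ ^ 2 ≤ -(2 / μ) * bdryRellich τ Ψ a G z + 4 / μ ^ 2 * bdryFlux τ Ψ a G z ^ 2 := by
  have h1 : μ * ‖G z‖ ^ 2 ≤ bdryEnergy Ψ a G z := h.coeff.elliptic _ _
  have h2 : inner ℝ (G z) (vert n τ) * bdryFlux τ Ψ a G z ≤ ‖G z‖ * |bdryFlux τ Ψ a G z| := by
    refine (le_abs_self _).trans ?_
    rw [abs_mul]
    gcongr
    exact abs_inner_vert_le h.side _
  have h3 : bdryEnergy Ψ a G z = 2 * inner ℝ (G z) (vert n τ) * bdryFlux τ Ψ a G z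
      - bdryRellich τ Ψ a G z := by rw [bdryRellich]; ring
  generalize bdryFlux τ Ψ a G z = p at *
  generalize bdryRellich τ Ψ a G z = β at *
  have h4 : μ * ‖G z‖ ^ 2 ≤ 2 * (‖G z‖ * |p|) - β := by linarith
  have h5 : 2 * (‖G z‖ * |p|) ≤ μ / 2 * ‖G z‖ ^ 2 + 2 / μ * p ^ 2 := by
    have e : μ / 2 * ‖G z‖ ^ 2 + 2 / μ * p ^ 2 - 2 * (‖G z‖ * |p|)
        = (μ * ‖G z‖ - 2 * |p|) ^ 2 / (2 * μ) := by
      rw [← sq_abs p]; field_simp; ring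
    have : 0 ≤ (μ * ‖G z‖ - 2 * |p|) ^ 2 / (2 * μ) := by positivity
    linarith
  have h6 : μ / 2 * ‖G z‖ ^ 2 ≤ -β + 2 / μ * p ^ 2 := by linarith
  have h7 := mul_le_mul_of_nonneg_left h6 (by positivity : 0 ≤ 2 / μ)
  have e : 2 / μ * (μ / 2 * ‖G z‖ ^ 2) = ‖G z‖ ^ 2 := by field_simp
  have e2 : 2 / μ * (-β + 2 / μ * p ^ 2) = -(2 / μ) * β + 4 / μ ^ 2 * p ^ 2 := by field_simp; ring
  linarith

/-- Pythagoras for the orthogonal decomposition along N, which is nonzero because e·N = 1. -/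
lemma norm_bdryTang_le (hτ : IsSgn τ) (z : Euc n) : ‖bdryTang τ Ψ G z‖ ≤ ‖G z‖ := by
  have hN0 : depthGrad τ Ψ z ≠ 0 := fun h0 => by
    have := inner_depthGrad_vert (Ψ := Ψ) hτ z
    rw [h0, inner_zero_right] at this
    exact zero_ne_one this
  have hN := norm_pos_iff.2 hN0
  have e : ‖G z‖ ^ 2 = ‖bdryTang τ Ψ G z‖ ^ 2 + (inner ℝ (depthGrad τ Ψ z) (G z)) ^ 2
      / ‖depthGrad τ Ψ z‖ ^ 2 := by
    rw [bdryTang, norm_sub_sq_real, real_inner_smul_right, norm_smul, mul_pow,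
      real_inner_comm (depthGrad τ Ψ z) (G z), norm_eq_abs, sq_abs]
    field_simp
    ring
  refine le_of_sq_le_sq ?_ (norm_nonneg _)
  have : 0 ≤ (inner ℝ (depthGrad τ Ψ z) (G z)) ^ 2 / ‖depthGrad τ Ψ z‖ ^ 2 := by positivity
  linarith

lemma lintegral_ofReal_sq {X E : Type*} [MeasurableSpace X] [NormedAddCommGroup E] {m : Measure X}
    (p : X → E) : ∫⁻ z, ofReal (‖p z‖ ^ 2) ∂m = ∫⁻ z, ‖p z‖ₑ ^ 2 ∂m :=
  lintegral_congr fun z => by rw [ofReal_pow (norm_nonneg _), ofReal_norm]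

/-- The comparison of the conormal derivative with the tangential gradient and the trace, in the
coordinates of the graph. -/
lemma exists_comparison (n : ℕ) (hn : 2 ≤ n) (M : ℝ≥0) (K : ℝ) (hK : 1 ≤ K) (μ Λ : ℝ)
    (hμ : 0 < μ) (hΛ : 0 < Λ) : ∃ C : ℝ≥0,
    ∀ (τ : ℝ) (Ψ : Euc n → ℝ) (a : Pt n → Pt n →L[ℝ] Pt n)
      (V u : Pt n → ℝ) (g : Pt n → Pt n) (f : Euc n → ℝ)
      (G : Euc n → Pt n), BdrySol τ M K μ Λ Ψ a V u g f G →
      DecaysOn (graphDom τ Ψ) u g →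
      (∫⁻ z, ‖bdryTang τ Ψ G z‖ₑ ^ 2) + ∫⁻ z, ofReal ((critRad V 1 (bdryPt Ψ z) ^ 2)⁻¹ * f z ^ 2)
        ≤ C * ∫⁻ z, ‖bdryFlux τ Ψ a G z‖ₑ ^ 2 ∧
      ∫⁻ z, ‖bdryFlux τ Ψ a G z‖ₑ ^ 2 ≤ C * ((∫⁻ z, ‖bdryTang τ Ψ G z‖ₑ ^ 2)
        + ∫⁻ z, ofReal ((critRad V 1 (bdryPt Ψ z) ^ 2)⁻¹ * f z ^ 2)) := by
  obtain ⟨C, hC⟩ := exists_trace_bounds n hn M K hK μ Λ hμ hΛ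
  set c₁ : ℝ := 4 * (Λ * (1 + M) ^ 2) with hc₁
  set c₂ : ℝ := 16 * (Λ * (1 + M) ^ 2) ^ 2 + 8 * Λ * (Λ * (1 + M) ^ 2)
  have h1 : 0 < c₁ := by have := M.2; positivity
  have h2 : 0 ≤ c₂ := by have := M.2; positivity
  have hC0 : (0 : ℝ) ≤ C := C.2
  refine ⟨Real.toNNReal (C + 2 / μ * C * (1 + C) + 4 / μ ^ 2 + (4 * (c₁ * C) ^ 2 + 2 * (c₁ * C))
    + 2 * c₂),
    fun τ Ψ a V u g f G h hdec => ?_⟩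
  obtain ⟨hW, hI⟩ := hC τ Ψ a V u g f G h hdec
  have hB := (h.rellich_le hn hΛ hdec).trans hI
  have hpm := h.measurable_flux
  have hfm := h.bdry.meas_f
  have hbm := (continuous_bdryPt h.lip).measurable
  have hrm : Measurable fun z => critRad V 1 (bdryPt Ψ z) :=
    (h.pot.lipschitz_critRad one_pos).continuous.measurable.comp hbm
  have hβ := h.integrable_rellich
  have hTm : Measurable (bdryTang τ Ψ G) := by
    have hN := measurable_depthGrad τ Ψ
    have hG := h.bdry.meas_G
    exact hG.sub (((hN.inner hG).div (hN.norm.pow_const 2)).smul hN)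
  set F := ∫⁻ z, ofReal ((critRad V 1 (bdryPt Ψ z))⁻¹ * |f z * bdryFlux τ Ψ a G z|) with hF
  set W := ∫⁻ z, ofReal ((critRad V 1 (bdryPt Ψ z) ^ 2)⁻¹ * f z ^ 2) with hWdef
  set Q := ∫⁻ z, ‖bdryFlux τ Ψ a G z‖ₑ ^ 2 with hQ
  set T := ∫⁻ z, ‖bdryTang τ Ψ G z‖ₑ ^ 2 with hT
  set J := ∫ z, bdryRellich τ Ψ a G z
  have hQ' : ∫⁻ z, ofReal (bdryFlux τ Ψ a G z ^ 2) = Q := by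
    rw [hQ, ← lintegral_ofReal_sq]
    exact lintegral_congr fun z => by rw [norm_eq_abs, sq_abs]
  -- Young's inequality for |p| and ρ⁻¹|f|, kept with a free ε: ε = 1 serves the lower bound, a
  -- small ε the upper one.
  have hFle : ∀ ε : ℝ, 0 < ε → F ≤ ofReal ε * Q + ofReal ε⁻¹ * W := fun ε hε => by
    rw [← hQ', hWdef, ← lintegral_ofReal_add_mul (by fun_prop) (by fun_prop)
      (ae_of_all _ fun z => sq_nonneg _) (ae_of_all _ fun z => by positivity) hε.le
      (by positivity)]
    refine lintegral_mono fun z => ofReal_le_ofReal ?_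
    have hr := h.pot.critRad_pos one_pos (bdryPt Ψ z)
    rw [← inv_pow]
    have hq := inv_pos.2 hr
    generalize (critRad V 1 (bdryPt Ψ z))⁻¹ = q at hq ⊢
    generalize bdryFlux τ Ψ a G z = p
    have e : ε * p ^ 2 + ε⁻¹ * (q ^ 2 * f z ^ 2) - q * |f z * p|
        = ((ε * |p| - q * |f z|) ^ 2 + q * |f z| * ε * |p|) / ε := by
      rw [abs_mul, ← sq_abs p, ← sq_abs (f z)]; field_simp; ring
    have : 0 ≤ ((ε * |p| - q * |f z|) ^ 2 + q * |f z| * ε * |p|) / ε := by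
      have q0 := hq.le
      positivity
    linarith
  -- The conormal derivative is square integrable because G is; this a priori finiteness justifies
  -- absorbing Q below.
  have hQfin : Q < ∞ := by
    have : Q ≤ ∫⁻ z, ofReal ((Λ * (1 + M)) ^ 2) * ‖G z‖ₑ ^ 2 := by
      rw [← hQ']
      refine lintegral_mono fun z => ?_
      rw [← ofReal_norm, ← ofReal_pow (norm_nonneg _), ← ofReal_mul (sq_nonneg _),
        ← mul_pow, ← sq_abs]
      exact ofReal_le_ofReal (pow_le_pow_left₀ (abs_nonneg _) (h.abs_flux_le z) 2)
    refine this.trans_lt ?_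
    rw [lintegral_const_mul _ (h.bdry.meas_G.enorm.pow_const 2)]
    exact mul_lt_top ofReal_lt_top h.bdry.sq_G
  have hWfin : W < ∞ := hW.trans_lt (mul_lt_top ENNReal.coe_lt_top hQfin)
  have hFfin : F < ∞ := (hFle 1 one_pos).trans_lt (by finiteness)
  have hlow : T ≤ ofReal (2 / μ * |J|) + ofReal (4 / μ ^ 2) * Q := by
    calc T ≤ ∫⁻ z, ofReal (‖G z‖ ^ 2) := by
          rw [hT, ← lintegral_ofReal_sq]
          refine lintegral_mono fun z => ofReal_le_ofReal ?_
          exact pow_le_pow_left₀ (norm_nonneg _) (norm_bdryTang_le h.side z) 2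
      _ ≤ _ := lintegral_le_of_integral_le (hβ.const_mul (-(2 / μ))) (P := 2 / μ * |J|)
          (N := fun z => 4 / μ ^ 2 * bdryFlux τ Ψ a G z ^ 2) (by
            rw [integral_const_mul]
            have := mul_le_mul_of_nonneg_left (neg_abs_le J) (by positivity : 0 ≤ 2 / μ)
            linarith) (by fun_prop) (ae_of_all _ fun z => sq_nonneg _)
          (ae_of_all _ fun z => by positivity) (ae_of_all _ fun z => h.norm_sq_le hμ z)
      _ = _ := by
          simp only [ofReal_mul (by positivity : 0 ≤ 4 / μ ^ 2)]
          rw [lintegral_const_mul _ (by fun_prop), hQ']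
  have hup : Q ≤ ofReal (c₁ * |J|) + ofReal c₂ * T := by
    rw [← hQ']
    refine (lintegral_le_of_integral_le (hβ.const_mul c₁) (P := c₁ * |J|)
      (N := fun z => c₂ * ‖bdryTang τ Ψ G z‖ ^ 2) ?_ (by fun_prop) (ae_of_all _ fun z => sq_nonneg _)
      (ae_of_all _ fun z => by positivity) (ae_of_all _ fun z => h.flux_sq_le hμ hΛ z)).trans_eq ?_
    · rw [integral_const_mul]
      exact mul_le_mul_of_nonneg_left (le_abs_self J) h1.le
    · simp only [ofReal_mul h2]
      rw [lintegral_const_mul _ (by fun_prop), lintegral_ofReal_sq]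
  have hTfin : T < ∞ := hlow.trans_lt (by finiteness)
  have hY1 := hFle 1 one_pos
  -- With b = c₁C, the flux term returns b/(2b + 1) ≤ 1/2 of Q, which is absorbed on the left.
  have hY2 := hFle (2 * (c₁ * C) + 1)⁻¹ (by positivity)
  rw [enorm_eq_ofReal_abs] at hB
  clear_value F W Q T J
  lift Q to ℝ≥0 using hQfin.ne
  lift W to ℝ≥0 using hWfin.ne
  lift F to ℝ≥0 using hFfin.ne
  lift T to ℝ≥0 using hTfin.ne
  simp only [ofReal] at hlow hup hY1 hY2 hB
  norm_cast at hlow hup hY1 hY2 hB hW ⊢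
  rw [← NNReal.coe_le_coe] at hlow hup hY1 hY2 hB hW
  rw [← NNReal.coe_le_coe, ← NNReal.coe_le_coe]
  push_cast at hlow hup hY1 hY2 hB hW ⊢
  have hJ0 := abs_nonneg J
  rw [coe_toNNReal _ (by positivity), coe_toNNReal _ (by positivity)] at hlow hup hY2
  rw [coe_toNNReal _ (by positivity)] at hY1 hB ⊢
  rw [inv_inv] at hY2
  rw [inv_one, coe_toNNReal _ zero_le_one] at hY1
  have hQ0 : (0 : ℝ) ≤ Q := Q.2
  have hW0 : (0 : ℝ) ≤ W := W.2
  have hT0 : (0 : ℝ) ≤ T := T.2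
  generalize (Q : ℝ) = q at *
  generalize (W : ℝ) = w at *
  generalize (T : ℝ) = t at *
  generalize (F : ℝ) = e at *
  generalize (C : ℝ) = c at *
  set b := c₁ * c
  have hb0 : 0 ≤ b := by positivity
  constructor
  · have h5 : |J| ≤ c * ((1 + c) * q) := hB.trans (mul_le_mul_of_nonneg_left (by linarith) hC0)
    have h6 := mul_le_mul_of_nonneg_left h5 (by positivity : 0 ≤ 2 / μ)
    have h7 : 0 ≤ ((4 * b ^ 2 + 2 * b) + 2 * c₂) * q := by positivity
    linarith
  · have h5 : c₁ * |J| ≤ b * ((2 * b + 1)⁻¹ * q + (2 * b + 1) * w) := by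
      have := mul_le_mul_of_nonneg_left (hB.trans (mul_le_mul_of_nonneg_left hY2 hC0)) h1.le
      rwa [← mul_assoc] at this
    have h6 : b * (2 * b + 1)⁻¹ ≤ 1 / 2 := by
      rw [← div_eq_mul_inv, div_le_iff₀ (by positivity)]; linarith
    have h7 := mul_le_mul_of_nonneg_right h6 hQ0
    have h8 : 0 ≤ (c + 2 / μ * c * (1 + c) + 4 / μ ^ 2) * (t + w) := by positivity
    have h9 : 0 ≤ (4 * b ^ 2 + 2 * b) * t := by positivity
    have h10 : 0 ≤ 2 * c₂ * w := by positivity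
    linarith

end Comparison

/-! ### The surface measure and the unit normal in base coordinates -/

section Surface

variable {n : ℕ} {τ : ℝ} {M : ℝ≥0} {Ψ : Euc n → ℝ}

/-- The density of the surface measure over the base of the graph. -/
def surfDensity (Ψ : Euc n → ℝ) (z : Euc n) : ℝ := √(1 + ‖gradient Ψ z‖ ^ 2)

lemma surfDensity_le (hΨ : LipschitzWith M Ψ) (z : Euc n) : surfDensity Ψ z ≤ 1 + M := by
  have h1 := norm_gradient_le hΨ z
  have h2 := M.2
  refine Real.sqrt_le_iff.2 ⟨by positivity, ?_⟩
  have := norm_nonneg (gradient Ψ z)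
  change (0 : ℝ) ≤ M at h2
  nlinarith

lemma measurable_surfDensity (Ψ : Euc n → ℝ) : Measurable fun z => ofReal (surfDensity Ψ z) := by
  have := measurable_gradient Ψ
  unfold surfDensity
  fun_prop

/-- Projection to the base is a continuous left inverse. An embedding is required because the
boundary functions integrated against the surface measure are not assumed measurable. -/
lemma measurableEmbedding_bdryPt (hΨ : LipschitzWith M Ψ) : MeasurableEmbedding (bdryPt Ψ) :=
  (Function.LeftInverse.isClosedEmbedding (f := horiz) (fun z => horiz_bdryPt z)
    continuous_horiz (continuous_bdryPt hΨ)).measurableEmbedding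

lemma lintegral_surfMeasure (hΨ : LipschitzWith M Ψ) (F : Pt n → ℝ≥0∞) :
    ∫⁻ z, F z ∂surfMeasure Ψ = ∫⁻ z, ofReal (surfDensity Ψ z) * F (bdryPt Ψ z) := by
  have h1 : surfMeasure Ψ = (volume.withDensity
      fun z => ofReal (surfDensity Ψ z)).map (bdryPt Ψ) := rfl
  rw [h1, (measurableEmbedding_bdryPt hΨ).lintegral_map,
    lintegral_withDensity_eq_lintegral_mul_non_measurable _ (measurable_surfDensity Ψ)
      (ae_of_all _ fun z => ofReal_lt_top)]
  rfl

lemma lintegral_le_surfMeasure (hΨ : LipschitzWith M Ψ) (F : Pt n → ℝ≥0∞) :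
    ∫⁻ z, F (bdryPt Ψ z) ≤ ∫⁻ z, F z ∂surfMeasure Ψ := by
  rw [lintegral_surfMeasure hΨ]
  exact lintegral_mono fun z => le_mul_of_one_le_left' (one_le_ofReal.2 (sqrt_one_add_ge_one _))

lemma lintegral_surfMeasure_le (hΨ : LipschitzWith M Ψ) (F : Pt n → ℝ≥0∞) :
    ∫⁻ z, F z ∂surfMeasure Ψ ≤ ofReal (1 + M) * ∫⁻ z, F (bdryPt Ψ z) := by
  rw [lintegral_surfMeasure hΨ, ← lintegral_const_mul' _ _ ofReal_ne_top]
  exact lintegral_mono fun z => mul_le_mul_left (ofReal_le_ofReal (surfDensity_le hΨ z)) _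

lemma ae_bdryPt_of_ae_surfMeasure (hΨ : LipschitzWith M Ψ) {p : Pt n → Prop}
    (h : ∀ᵐ z ∂surfMeasure Ψ, p z) : ∀ᵐ z, p (bdryPt Ψ z) := by
  have h1 := ae_of_ae_map (continuous_bdryPt hΨ).measurable.aemeasurable h
  filter_upwards [(ae_withDensity_iff (measurable_surfDensity Ψ)).1 h1] with z hz
  exact hz (ofReal_pos.2 (one_pos.trans_le (sqrt_one_add_ge_one _))).ne'

lemma norm_depthGrad (hτ : IsSgn τ) (z : Euc n) : ‖depthGrad τ Ψ z‖ = surfDensity Ψ z := by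
  rw [depthGrad, norm_smul, norm_eq_abs, abs_unit hτ, one_mul, surfDensity,
    eq_comm, Real.sqrt_eq_iff_eq_sq (by positivity) (norm_nonneg _), norm_sq_eq_horiz_height]
  simp
  ring

/-- The normal always points out of the upper domain, whereas N points into the domain considered;
hence the factor −τ. The sign disappears in the squared conormal derivative and in the tangential
projection. -/
lemma outerNormal_bdryPt (hτ : IsSgn τ) (z : Euc n) :
    outerNormal Ψ (bdryPt Ψ z) = (-(τ * (surfDensity Ψ z)⁻¹)) • depthGrad τ Ψ z := by
  have h : τ * τ = 1 := unit_mul_self hτ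
  rw [outerNormal, horiz_bdryPt, depthGrad, smul_smul, ← surfDensity,
    show -(τ * (surfDensity Ψ z)⁻¹) * τ = -(surfDensity Ψ z)⁻¹ by
      linear_combination (-(surfDensity Ψ z)⁻¹) * h]
  refine pairPt_ext ?_ ?_ <;> simp

lemma tangGrad_bdryPt (hτ : IsSgn τ) (G : Pt n → Pt n) (z : Euc n) :
    tangGrad Ψ G (bdryPt Ψ z) = bdryTang τ Ψ (fun z => G (bdryPt Ψ z)) z := by
  have h : τ * τ = 1 := unit_mul_self hτ
  rw [tangGrad, bdryTang, outerNormal_bdryPt hτ, norm_depthGrad hτ, real_inner_smul_left, smul_smul]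
  congr 2
  rw [div_eq_mul_inv, ← inv_pow]
  linear_combination (inner ℝ (depthGrad τ Ψ z) (G (bdryPt Ψ z)) * (surfDensity Ψ z)⁻¹ ^ 2) * h

end Surface

/-! ### Regular representatives of the coefficient matrix -/

section Coefficients

variable {n : ℕ} {μ : ℝ} {A : Pt n → Matrix (Fin (n + 1)) (Fin (n + 1)) ℝ}

lemma inner_toEuclideanCLM {d : ℕ} (B : Matrix (Fin d) (Fin d) ℝ) (v w : Euc d) :
    inner ℝ (Matrix.toEuclideanCLM (𝕜 := ℝ) B v) w = ∑ i, ∑ j, B i j * v j * w i := by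
  rw [PiLp.inner_apply]
  refine Finset.sum_congr rfl fun i _ => ?_
  rw [Matrix.ofLp_toEuclideanCLM]
  simp [Matrix.mulVec, dotProduct, Finset.mul_sum, mul_comm]

lemma norm_toEuclideanCLM_le {d : ℕ} {B : Matrix (Fin d) (Fin d) ℝ} {c : ℝ}
    (hB : ∀ i j, |B i j| ≤ c) (v : Euc d) :
    ‖Matrix.toEuclideanCLM (𝕜 := ℝ) B v‖ ≤ d * (d * c) * ‖v‖ := by
  set w := Matrix.toEuclideanCLM (𝕜 := ℝ) B v with hw
  rcases eq_or_ne ‖w‖ 0 with h | h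
  · rw [h]
    rcases Nat.eq_zero_or_pos d with rfl | hd
    · simp
    · have i : Fin d := ⟨0, hd⟩
      have := (abs_nonneg _).trans (hB i i)
      positivity
  · have h1 : ‖w‖ * ‖w‖ ≤ d * (d * c) * ‖v‖ * ‖w‖ := by
      rw [← real_inner_self_eq_norm_mul_norm, hw, inner_toEuclideanCLM, ← hw]
      calc ∑ i, ∑ j, B i j * v j * w i ≤ ∑ i : Fin d, ∑ j : Fin d, c * ‖v‖ * ‖w‖ := by
            refine Finset.sum_le_sum fun i _ => Finset.sum_le_sum fun j _ => ?_
            refine (le_abs_self _).trans ?_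
            rw [abs_mul, abs_mul]
            have h2 : |v j| ≤ ‖v‖ := PiLp.norm_apply_le v j
            have h3 : |w i| ≤ ‖w‖ := PiLp.norm_apply_le w i
            have h4 := (abs_nonneg _).trans (hB i j)
            gcongr
            exact hB i j
        _ = _ := by simp; ring
    exact le_of_mul_le_mul_right h1 (lt_of_le_of_ne (norm_nonneg _) h.symm)

/-- The coefficients can be changed on a null set of vertical lines so that they are measurable,
elliptic, bounded and symmetric everywhere. -/
lemma IsCoeff.exists_goodCoeff (hA : IsCoeff μ A) (hμ : 0 < μ) : ∃ a : Pt n → Pt n →L[ℝ] Pt n,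
      GoodCoeff μ ((n + 1 : ℕ) * ((n + 1 : ℕ) * μ⁻¹) + μ) a ∧
      ∀ᵐ z : Euc n, ∀ t, a (pairPt z t) = Matrix.toEuclideanCLM (𝕜 := ℝ) (A (pairPt z t)) := by
  have h1 : ∀ᵐ x, (∀ i j, (hA.aemeasurable i j).mk _ x = A x i j) ∧
      (∀ ξ : Pt n, μ * ‖ξ‖ ^ 2 ≤ ∑ i, ∑ j, A x i j * ξ i * ξ j) ∧
      (∀ i j, |A x i j| ≤ μ⁻¹) ∧ (A x).IsSymm := by
    have : ∀ᵐ x, ∀ i j, (hA.aemeasurable i j).mk _ x = A x i j :=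
      ae_all_iff.2 fun i => ae_all_iff.2 fun j => (hA.aemeasurable i j).ae_eq_mk.symm
    filter_upwards [this, hA.elliptic, hA.bounded, hA.symmetric] with x h1 h2 h3 h4
    exact ⟨h1, h2, h3, h4⟩
  -- By Fubini some height t₀ is good for almost every base point. Independence of the vertical
  -- variable then transfers the conditions to every height, in particular to the graph, which is
  -- itself a null set.
  have h2 := Measure.ae_ae_of_ae_prod ((Measure.measurePreserving_swap (μ := (volume :
    Measure ℝ)) (ν := (volume : Measure (Euc n)))).quasiMeasurePreserving.ae
      (measurePreserving_pairPt.quasiMeasurePreserving.ae h1))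
  obtain ⟨t₀, ht₀⟩ := h2.exists
  simp only [Prod.swap] at ht₀
  set B : Euc n → Matrix (Fin (n + 1)) (Fin (n + 1)) ℝ :=
    fun z i j => (hA.aemeasurable i j).mk _ (pairPt z t₀)
  have hBm : ∀ i j, Measurable fun z => B z i j := fun i j =>
    (hA.aemeasurable i j).measurable_mk.comp (continuous_pairPt.comp
      (by fun_prop : Continuous fun z : Euc n => (z, t₀))).measurable
  set N := toMeasurable volume {z : Euc n | ¬ ((∀ i j, B z i j = A (pairPt z t₀) i j) ∧
      (∀ ξ : Pt n, μ * ‖ξ‖ ^ 2 ≤ ∑ i, ∑ j, A (pairPt z t₀) i j * ξ i * ξ j) ∧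
      (∀ i j, |A (pairPt z t₀) i j| ≤ μ⁻¹) ∧ (A (pairPt z t₀)).IsSymm)} with hN
  have hN0 : volume N = 0 := by rw [hN, measure_toMeasurable]; exact ht₀
  have hgood : ∀ z ∉ N, (∀ t, B z = A (pairPt z t)) ∧
      (∀ ξ : Pt n, μ * ‖ξ‖ ^ 2 ≤ ∑ i, ∑ j, B z i j * ξ i * ξ j) ∧
      (∀ i j, |B z i j| ≤ μ⁻¹) ∧ (B z).IsSymm := fun z hz => by
    have h := not_not.1 fun hc => hz (subset_toMeasurable _ _ hc)
    have e : B z = A (pairPt z t₀) := Matrix.ext h.1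
    rw [e]
    exact ⟨fun t => hA.independent z t₀ t, h.2⟩
  classical
  -- Over the null set of bad base points the matrix is replaced by μ times the identity, which
  -- accounts for the summand μ in the upper bound.
  refine ⟨fun x => if horiz x ∈ N then μ • ContinuousLinearMap.id ℝ _ else
    Matrix.toEuclideanCLM (𝕜 := ℝ) (B (horiz x)), ⟨fun g hg => ?_, fun x v => ?_, fun x v => ?_,
    fun x v w => ?_, fun x y hxy => by rw [hxy]⟩, ?_⟩
  · have e : (fun x => (if horiz x ∈ N then μ • ContinuousLinearMap.id ℝ (Pt n) else
        Matrix.toEuclideanCLM (𝕜 := ℝ) (B (horiz x))) (g x)) = fun x => if horiz x ∈ N then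
        μ • g x else Matrix.toEuclideanCLM (𝕜 := ℝ) (B (horiz x)) (g x) := by
      funext x; split_ifs <;> rfl
    rw [e]
    refine Measurable.ite (measurable_horiz (measurableSet_toMeasurable _ _)) (hg.const_smul μ) ?_
    have h5 : Measurable fun x => (fun i => ∑ j, B (horiz x) i j * g x j) := by
      refine measurable_pi_lambda _ fun i => Finset.measurable_fun_sum _ fun j _ => ?_
      exact ((hBm i j).comp measurable_horiz).mul (by fun_prop)
    exact (WithLp.measurable_toLp 2 _).comp h5
  · split_ifs with hx
    · simp [inner_smul_left]
    · rw [inner_toEuclideanCLM]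
      refine ((hgood _ hx).2.1 v).trans_eq (Finset.sum_congr rfl fun i _ =>
        Finset.sum_congr rfl fun j _ => by ring)
  · have h0 : 0 ≤ ((n + 1 : ℕ) : ℝ) * ((n + 1 : ℕ) * μ⁻¹) * ‖v‖ := by positivity
    have h3 : 0 ≤ μ * ‖v‖ := by positivity
    rw [add_mul]
    split_ifs with hx
    · simp only [smul_apply, ContinuousLinearMap.id_apply, norm_smul, norm_of_nonneg hμ.le]
      linarith
    · linarith [norm_toEuclideanCLM_le (hgood _ hx).2.2.1 v]
  · split_ifs with hx
    · simp [inner_smul_left, real_inner_comm]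
    · rw [inner_toEuclideanCLM, inner_toEuclideanCLM, Finset.sum_comm]
      refine Finset.sum_congr rfl fun i _ => Finset.sum_congr rfl fun j _ => ?_
      rw [(hgood _ hx).2.2.2.apply]
      ring
  · filter_upwards [compl_mem_ae_iff.2 hN0] with z hz t
    have hz' : z ∉ N := hz
    simp only [horiz_pairPt, hz', if_false]
    rw [(hgood z hz').1 t]

end Coefficients

/-! ### Independence of almost everywhere representatives -/

section Representatives

variable {d : ℕ} {D S : Set (Euc d)} {κ : ℝ} {E : Type*} [NormedAddCommGroup E] {f f' : Euc d → E}

lemma ntMax_congr (h : f =ᵐ[volume.restrict D] f') (z : Euc d) :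
    ntMax D S κ f z = ntMax D S κ f' z :=
  essSup_congr_ae ((ae_restrict_of_ae_restrict_of_subset (fun _ hx => hx.1) h).mono
    fun x hx => by simp only [hx])

lemma HasNTLimit.congr {z : Euc d} {L : E} (hL : HasNTLimit D S κ f z L)
    (h : f =ᵐ[volume.restrict D] f') : HasNTLimit D S κ f' z L :=
  Tendsto.congr (fun _ => laverage_congr ((ae_restrict_of_ae_restrict_of_subset
    (fun _ hx => hx.1.1) h).mono fun x hx => by simp only [hx])) hL

lemma HasWeakGrad.congr {u u' : Euc d → ℝ} {g g' : Euc d → Euc d} (hw : HasWeakGrad D u g)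
    (hu : u =ᵐ[volume.restrict D] u') (hg : g =ᵐ[volume.restrict D] g') :
    HasWeakGrad D u' g' where
  memLp K hK hc := (hw.memLp K hK hc).ae_eq (ae_mono (Measure.restrict_mono_set _ hK) hu)
  memLp_grad K hK hc := (hw.memLp_grad K hK hc).ae_eq (ae_mono (Measure.restrict_mono_set _ hK) hg)
  integral_eq φ hφ i := by
    have h1 : ∫ x in D, u x * partialD i φ x = ∫ x in D, u' x * partialD i φ x :=
      integral_congr_ae (hu.mono fun x hx => by simp only [hx])
    have h2 : ∫ x in D, g x i * φ x = ∫ x in D, g' x i * φ x :=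
      integral_congr_ae (hg.mono fun x hx => by simp only [hx])
    rw [← h1, ← h2, hw.integral_eq φ hφ i]

lemma IsBInfty.congr {K : ℝ} {V V' : Euc d → ℝ} (hV : IsBInfty K V) (h : V =ᵐ[volume] V') :
    IsBInfty K V' where
  locBounded x r := (memLp_congr_ae (ae_restrict_of_ae h)).1 (hV.locBounded x r)
  pos := by filter_upwards [h, hV.pos] with x hx h1 using hx ▸ h1
  reverseHolder x r hr := by
    rw [← eLpNorm_congr_ae (ae_restrict_of_ae h), ← average_congr (ae_restrict_of_ae h)]
    exact hV.reverseHolder x r hr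

lemma mFun_congr {n : ℕ} {V V' : Pt n → ℝ} (h : V =ᵐ[volume] V') : mFun V = mFun V' := by
  have e : psiFun V = psiFun V' := by
    funext x r
    rw [psiFun, psiFun, integral_congr_ae (ae_restrict_of_ae h)]
  funext x
  rw [mFun, mFun, e]

lemma IsBInfty.aemeasurable {K : ℝ} {V : Euc d → ℝ} (hV : IsBInfty K V) : AEMeasurable V := by
  have h : AEMeasurable V (volume.restrict (⋃ k : ℕ, ball (0 : Euc d) k)) :=
    aemeasurable_iUnion_iff.2 fun k => (hV.locBounded 0 k).1.aemeasurable
  rwa [Metric.iUnion_ball_nat, Measure.restrict_univ] at h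

/-- An open set is a countable union of compact sets, obtained by cutting closed pieces with balls;
on each of them measurability is part of square integrability. -/
lemma L2On.aestronglyMeasurable (hD : IsOpen D) (hf : L2On D f) :
    AEStronglyMeasurable f (volume.restrict D) := by
  obtain ⟨F, hF, hFD, hU, -⟩ := hD.exists_iUnion_isClosed
  have e : D = ⋃ p : ℕ × ℕ, F p.1 ∩ closedBall 0 p.2 := by
    ext x
    simp only [mem_iUnion, mem_inter_iff, Prod.exists, exists_and_left, ← hU]
    refine ⟨fun ⟨i, hi⟩ => ⟨i, hi, (exists_nat_ge (dist x 0)).imp fun k hk => hk⟩,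
      fun ⟨i, hi, _⟩ => ⟨i, hi⟩⟩
  rw [e]
  exact aestronglyMeasurable_iUnion_iff.2 fun p => (hf _ (inter_subset_left.trans (hFD _))
    ((isCompact_closedBall _ _).inter_left (hF _))).1

end Representatives

/-! ### From the hypotheses of the theorem to the analytic setting -/

section Cleaning

variable {n : ℕ} {τ μ Λ K κ : ℝ} {M : ℝ≥0} {Ψ : Euc n → ℝ}
  {A : Pt n → Matrix (Fin (n + 1)) (Fin (n + 1)) ℝ}
  {a : Pt n → Pt n →L[ℝ] Pt n} {V : Pt n → ℝ}
  {u : Pt n → ℝ} {g : Pt n → Pt n}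

lemma fderiv_eq_inner_gradient {d : ℕ} (φ : Euc d → ℝ) (x v : Euc d) :
    fderiv ℝ φ x v = inner ℝ v (gradient φ x) := by
  rw [real_inner_comm, gradient, InnerProductSpace.toDual_symm_apply]

lemma partialD_eq_gradient {d : ℕ} (φ : Euc d → ℝ) (x : Euc d) (i : Fin d) :
    partialD i φ x = gradient φ x i := by
  rw [partialD, fderiv_eq_inner_gradient, EuclideanSpace.inner_single_left]
  simp

lemma IsWeakSol.weakId (h : IsWeakSol (graphDom τ Ψ) A V u g)
    (ha : GoodCoeff μ Λ a) (hV : IsBInfty K V)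
    (haA : ∀ᵐ x, a x = Matrix.toEuclideanCLM (𝕜 := ℝ) (A x)) {u' : Pt n → ℝ}
    {g' : Pt n → Pt n} {V' : Pt n → ℝ} (hg' : Measurable g')
    (hV' : Measurable V') (hu : u =ᵐ[volume.restrict (graphDom τ Ψ)] u')
    (hg : g =ᵐ[volume.restrict (graphDom τ Ψ)] g') (hVV : V =ᵐ[volume] V') :
    WeakId (graphDom τ Ψ) (fun x => a x (g' x)) (fun x => V' x * u' x) where
  memF K' hK hc := ((h.weakGrad.congr hu hg).memLp_grad K' hK hc).of_le_mul
    (ha.meas g' hg').aestronglyMeasurable (ae_of_all _ fun x => ha.bound x _)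
  memH K' hK hc := by
    obtain ⟨R, hR⟩ := hc.isBounded.subset_ball 0
    obtain ⟨B, -, hB⟩ := (hV.congr hVV).exists_bound_ball R
    have hu' := (h.weakGrad.congr hu hg).memLp K' hK hc
    refine hu'.of_le_mul (c := B) (hV'.aestronglyMeasurable.mul hu'.1) ?_
    filter_upwards [ae_mono (Measure.restrict_mono hR le_rfl) hB] with x hx
    rw [norm_mul]
    exact mul_le_mul_of_nonneg_right hx (norm_nonneg _)
  eq φ hφ := by
    rw [← h.weak_eq φ hφ]
    refine integral_congr_ae ?_
    filter_upwards [hu, hg, ae_restrict_of_ae hVV, ae_restrict_of_ae haA] with x h1 h2 h3 h4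
    rw [fderiv_eq_inner_gradient, h4, inner_toEuclideanCLM, ← h1, ← h2, ← h3]
    simp only [partialD_eq_gradient]

lemma decaysOn_of_isBigO (hn : 2 ≤ n) {D : Set (Pt n)} (h : (fun x => |u x| + ‖x‖ * ‖g x‖)
      =O[Bornology.cobounded (Pt n) ⊓ ae (volume.restrict D)]
        (fun x => ‖x‖ ^ (2 - ((n + 1 : ℕ) : ℤ)))) : DecaysOn D u g := by
  obtain ⟨C, hC0, hC⟩ := h.exists_nonneg
  obtain ⟨s, hs, t, ht, hst⟩ := mem_inf_iff.1 hC.bound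
  obtain ⟨R, -, hR⟩ := (hasBasis_cobounded_norm (E := Pt n)).mem_iff.1 hs
  refine ⟨C, max R 1, hC0, ?_⟩
  filter_upwards [ht] with x hx hxR
  have hx1 : 1 ≤ ‖x‖ := (le_max_right _ _).trans hxR
  have h1 : x ∈ s ∩ t := ⟨hR ((le_max_left _ _).trans hxR), hx⟩
  rw [← hst] at h1
  have hx0 : 0 < ‖x‖ := by linarith
  have h2 : |u x| + ‖x‖ * ‖g x‖ ≤ C * ‖x‖ ^ (2 - ((n + 1 : ℕ) : ℤ)) := by
    have h3 : ‖|u x| + ‖x‖ * ‖g x‖‖ ≤ C * ‖‖x‖ ^ (2 - ((n + 1 : ℕ) : ℤ))‖ := h1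
    rwa [norm_of_nonneg (by positivity), norm_of_nonneg (by positivity)] at h3
  have e : ‖x‖ ^ (2 - ((n + 1 : ℕ) : ℤ)) * ‖x‖ ^ (n - 1) = 1 := by
    rw [← zpow_natCast, ← zpow_add₀ hx0.ne',
      show 2 - ((n + 1 : ℕ) : ℤ) + ((n - 1 : ℕ) : ℤ) = 0 by omega, zpow_zero]
  have h4 := mul_le_mul_of_nonneg_right h2 (by positivity : 0 ≤ ‖x‖ ^ (n - 1))
  rw [mul_assoc, e, mul_one, add_mul] at h4
  have h5 : 0 ≤ |u x| * ‖x‖ ^ (n - 1) := by positivity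
  have h6 : 0 ≤ ‖x‖ * ‖g x‖ * ‖x‖ ^ (n - 1) := by positivity
  have h7 : ‖g x‖ * ‖x‖ ^ n = ‖x‖ * ‖g x‖ * ‖x‖ ^ (n - 1) := by
    obtain ⟨m, rfl⟩ : ∃ m, n = m + 1 := ⟨n - 1, by omega⟩
    rw [Nat.add_sub_cancel, pow_succ]; ring
  exact ⟨by linarith, by rw [h7]; linarith⟩

/-- Weak solutions with nontangential limits give solutions with square integrable boundary
values, after passing to measurable representatives. -/
lemma IsWeakSol.exists_bdrySol (h : IsWeakSol (graphDom τ Ψ) A V u g) (hτ : IsSgn τ)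
    (hΨ : LipschitzWith M Ψ) (ha : GoodCoeff μ Λ a) (hV : IsBInfty K V)
    (haA : ∀ᵐ x, a x = Matrix.toEuclideanCLM (𝕜 := ℝ) (A x)) (hκ : 1 < κ)
    (hN : ∫⁻ z, gMax τ Ψ κ g z ^ 2 ∂surfMeasure Ψ < ∞)
    (hdec : DecaysOn (graphDom τ Ψ) u g) {f : Euc n → ℝ} {G : Euc n → Pt n}
    (hf : ∀ᵐ z, GLimit τ Ψ κ u (bdryPt Ψ z) (f z))
    (hG : ∀ᵐ z, GLimit τ Ψ κ g (bdryPt Ψ z) (G z)) :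
    ∃ (V' u' : Pt n → ℝ) (g' : Pt n → Pt n) (f' : Euc n → ℝ)
      (G' : Euc n → Pt n), BdrySol τ M K μ Λ Ψ a V' u' g' f' G' ∧
      DecaysOn (graphDom τ Ψ) u' g' ∧ f =ᵐ[volume] f' ∧ G =ᵐ[volume] G' ∧ V =ᵐ[volume] V' := by
  have hD := isOpen_graphDom (τ := τ) hΨ
  have hum := (L2On.aestronglyMeasurable hD h.weakGrad.memLp).aemeasurable
  have hgm := (L2On.aestronglyMeasurable hD h.weakGrad.memLp_grad).aemeasurable
  have hVm := hV.aemeasurable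
  have hu := hum.ae_eq_mk
  have hg := hgm.ae_eq_mk
  have hVV := hVm.ae_eq_mk
  have hum' := hum.measurable_mk
  have hgm' := hgm.measurable_mk
  have hVm' := hVm.measurable_mk
  set u' := hum.mk u
  set g' := hgm.mk g
  set V' := hVm.mk V
  have hN' : ∫⁻ z, gMax τ Ψ κ g' (bdryPt Ψ z) ^ 2 < ∞ := by
    simp only [ntMax_congr hg] at hN
    exact (lintegral_le_surfMeasure hΨ _).trans_lt hN
  have hNm := measurable_ntMax (τ := τ) (κ := κ) hΨ hgm'
  have hf' := hf.mono fun z hz => hz.congr hu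
  have hG' := hG.mono fun z hz => hz.congr hg
  have hGm : AEMeasurable G := by
    refine aemeasurable_ntLimit hτ hΨ hκ hgm' ?_ hG'
    filter_upwards [ae_lt_top (hNm.pow_const 2) hN'.ne] with z hz
    exact lt_top_iff_ne_top.2 fun hc => by simp [hc] at hz
  have hGG := hGm.ae_eq_mk
  have hG'' : ∀ᵐ z, GLimit τ Ψ κ g' (bdryPt Ψ z) (hGm.mk G z) := by
    filter_upwards [hG', hGG] with z h1 h2 using h2 ▸ h1
  have hGle := ae_enorm_ntLimit_le hτ hΨ hκ hG''
  have hGsq : ∫⁻ z, ‖hGm.mk G z‖ₑ ^ 2 < ∞ := (lintegral_mono_ae (hGle.mono fun z hz =>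
    pow_le_pow_left₀ (zero_le) hz 2)).trans_lt hN'
  have hwg := h.weakGrad.congr hu hg
  have hE : ∫⁻ x in layer τ Ψ 0 2, ‖g' x‖ₑ ^ 2 < ∞ := lintegral_layer_sq_lt_top hτ hΨ hκ hgm' hN' 2
  -- No maximal function of u is assumed, so its boundary values are taken from the trace, using the
  -- gradient's square integrability near the graph. The given nontangential limit is identified
  -- with the trace afterwards.
  obtain ⟨u₀, hu₀, htr⟩ := exists_trace hτ hΨ hwg hum' hgm' hE
  have htr : IsTrace τ M Ψ u' g' u₀ := ⟨hτ, hΨ, hwg, hum', hgm', hu₀, hE, htr⟩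
  refine ⟨V', u', g', u₀, hGm.mk G, ⟨hτ, hΨ, ha, hV.congr hVV, hVm', hwg,
    h.weakId ha hV haA hgm' hVm' hu hg hVV, ⟨hum', hgm', hu₀, hGm.measurable_mk,
    htr.lintegral_inter_ball_lt_top,
    fun R => lintegral_inter_ball_lt_top hΨ hwg.memLp_grad
      ((lintegral_mono_set inter_subset_left).trans_lt hE),
    htr.lintegral_ball_lt_top, hGsq,
    htr.tendsto_slab,
    tendsto_slab_of_hasNTLimit hτ hΨ hκ hgm' hGm.measurable_mk
      (memLp_two_of_lintegral_lt_top hGm.measurable_mk.aestronglyMeasurable hGsq) hNm hN'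
      (ae_of_all _ fun z => ae_ntMax _ _ _ _ _) hGle hG''⟩⟩, ?_,
    htr.ae_eq_ntLimit hκ hf', hGG, hVV⟩
  obtain ⟨C, R₀, hC, hd⟩ := hdec
  refine ⟨C, R₀, hC, ?_⟩
  filter_upwards [hd, hu, hg] with x h1 h2 h3
  rwa [← h2, ← h3]

lemma conormalDeriv_bdryPt (hτ : IsSgn τ) (G : Pt n → Pt n) {z : Euc n}
    (h : a (bdryPt Ψ z) = Matrix.toEuclideanCLM (𝕜 := ℝ) (A (bdryPt Ψ z))) :
    conormalDeriv Ψ A G (bdryPt Ψ z)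
      = -(τ * (surfDensity Ψ z)⁻¹) * bdryFlux τ Ψ a (fun z => G (bdryPt Ψ z)) z := by
  rw [bdryFlux, ← real_inner_smul_right, ← outerNormal_bdryPt hτ, h, inner_toEuclideanCLM]
  exact Finset.sum_congr rfl fun i _ => Finset.sum_congr rfl fun j _ => by ring

/-- The two-sided estimate on one side of the graph. -/
lemma exists_comparison_surfMeasure (n : ℕ) (hn : 2 ≤ n) (M : ℝ≥0) (μ : ℝ) (hμ : 0 < μ) (K : ℝ) :
    ∃ C : ℝ≥0, 0 < C ∧ ∀ (τ : ℝ), (τ = 1 ∨ τ = -1) → ∀ (Ψ : Euc n → ℝ), LipschitzWith M Ψ →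
      ∀ (A : Pt n → Matrix (Fin (n + 1)) (Fin (n + 1)) ℝ), IsCoeff μ A →
      ∀ (V : Pt n → ℝ), IsBInfty K V → ∀ (κ : ℝ), 1 < κ →
      ∀ (u : Pt n → ℝ) (g : Pt n → Pt n),
      IsWeakSol (graphDom τ Ψ) A V u g →
      ∫⁻ z, gMax τ Ψ κ g z ^ 2 ∂surfMeasure Ψ < ∞ →
      DecaysOn (graphDom τ Ψ) u g →
      ∀ (f : Pt n → ℝ) (G : Pt n → Pt n),
      (∀ᵐ z ∂surfMeasure Ψ, GLimit τ Ψ κ u z (f z)) →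
      (∀ᵐ z ∂surfMeasure Ψ, GLimit τ Ψ κ g z (G z)) →
      ∫⁻ z, ‖tangGrad Ψ G z‖ₑ ^ 2 ∂surfMeasure Ψ
        + ∫⁻ z, ‖f z‖ₑ ^ 2 * ofReal (mFun V z ^ 2) ∂surfMeasure Ψ
        ≤ C * ∫⁻ z, ‖conormalDeriv Ψ A G z‖ₑ ^ 2 ∂surfMeasure Ψ ∧
      ∫⁻ z, ‖conormalDeriv Ψ A G z‖ₑ ^ 2 ∂surfMeasure Ψ
        ≤ C * (∫⁻ z, ‖tangGrad Ψ G z‖ₑ ^ 2 ∂surfMeasure Ψ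
          + ∫⁻ z, ‖f z‖ₑ ^ 2 * ofReal (mFun V z ^ 2) ∂surfMeasure Ψ) := by
  -- The hypothesis allows any real K, while the quantitative lemmas need K ≥ 1; the constant is
  -- raised by `IsBInfty.mono`.
  obtain ⟨C, hC⟩ := exists_comparison n hn M (max K 1) (le_max_right _ _) μ
    ((n + 1 : ℕ) * ((n + 1 : ℕ) * μ⁻¹) + μ) hμ (by positivity)
  obtain ⟨m, hm1, hm⟩ := exists_mFun_bounds (n := n) (by omega) (max K 1) (le_max_right _ _)
  have hm0 : 0 < m := by linarith
  set J : ℝ := 1 + M with hJ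
  have hJ0 : 0 < J := by positivity
  have hJ1 : 1 ≤ J := by rw [hJ]; linarith [M.2, show (0 : ℝ) ≤ M from M.2]
  refine ⟨Real.toNNReal (J * m ^ 2 * J ^ 2) * C + Real.toNNReal (J * m ^ 2) * C + 1,
    by positivity, fun τ hτ Ψ hΨ A hA V hV κ hκ u g h hN hdec f G hf hG => ?_⟩
  obtain ⟨a, ha, haA⟩ := hA.exists_goodCoeff hμ
  have haA' : ∀ᵐ x, a x = Matrix.toEuclideanCLM (𝕜 := ℝ) (A x) := by
    filter_upwards [ae_horiz hτ hΨ haA] with x hx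
    have := hx (height x)
    rwa [show pairPt (horiz x) (height x) = x from pairPt_ext (by simp) (by simp)] at this
  obtain ⟨V', u', g', f', G', hsol, hdec', hff, hGG, hVV⟩ := h.exists_bdrySol hτ hΨ ha
    (hV.mono (le_max_left K 1)) haA' hκ hN hdec (ae_bdryPt_of_ae_surfMeasure hΨ hf)
    (ae_bdryPt_of_ae_surfMeasure hΨ hG)
  obtain ⟨h1, h2⟩ := hC τ Ψ a V' u' g' f' G' hsol hdec'
  rw [mFun_congr hVV]
  have hr := hsol.pot.critRad_pos one_pos
  have hmb := hm V' hsol.pot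
  set T := ∫⁻ z, ‖bdryTang τ Ψ G' z‖ₑ ^ 2 with hT
  set W := ∫⁻ z, ofReal ((critRad V' 1 (bdryPt Ψ z) ^ 2)⁻¹ * f' z ^ 2) with hW
  set Q := ∫⁻ z, ‖bdryFlux τ Ψ a G' z‖ₑ ^ 2 with hQ
  have eT : ∫⁻ z, ‖tangGrad Ψ G (bdryPt Ψ z)‖ₑ ^ 2 = T := by
    refine lintegral_congr_ae (hGG.mono fun z hz => ?_)
    simp only [tangGrad_bdryPt hτ, bdryTang, hz]
  have eW : ∀ c : ℝ, ∀ z, f (bdryPt Ψ z) = f' z → ‖f (bdryPt Ψ z)‖ₑ ^ 2 * ofReal (c ^ 2)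
      = ofReal (c ^ 2 * f' z ^ 2) := fun c z hz => by
    rw [hz, enorm_eq_ofReal_abs, ← ofReal_pow (abs_nonneg _), sq_abs, mul_comm,
      ofReal_mul (sq_nonneg _)]
  have hm2 : 0 ≤ m ^ 2 := sq_nonneg m
  have hW1 : W ≤ ofReal (m ^ 2) *
      ∫⁻ z, ‖f (bdryPt Ψ z)‖ₑ ^ 2 * ofReal (mFun V' (bdryPt Ψ z) ^ 2) := by
    rw [← lintegral_const_mul' _ _ ofReal_ne_top]
    refine lintegral_mono_ae (hff.mono fun z hz => ?_)
    rw [eW _ z hz, ← ofReal_mul hm2, ← inv_pow, ← mul_assoc, ← mul_pow m]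
    have h0 := inv_nonneg.2 (hr (bdryPt Ψ z)).le
    have := (hmb (bdryPt Ψ z)).1
    gcongr
  have hW2 : ∫⁻ z, ‖f (bdryPt Ψ z)‖ₑ ^ 2 * ofReal (mFun V' (bdryPt Ψ z) ^ 2)
      ≤ ofReal (m ^ 2) * W := by
    rw [← lintegral_const_mul' _ _ ofReal_ne_top]
    refine lintegral_mono_ae (hff.mono fun z hz => ?_)
    rw [eW _ z hz, ← ofReal_mul hm2, ← inv_pow, ← mul_assoc, ← mul_pow m]
    have h0 : 0 ≤ mFun V' (bdryPt Ψ z) := by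
      have := (inv_nonneg.2 (hr (bdryPt Ψ z)).le).trans (hmb (bdryPt Ψ z)).1
      exact nonneg_of_mul_nonneg_right this hm0
    have := (hmb (bdryPt Ψ z)).2
    gcongr
  -- Squaring removes the side-dependent sign. The remaining factor is the inverse surface density,
  -- between 1/(1 + M) and 1.
  have hcon : ∀ᵐ z, ‖conormalDeriv Ψ A G (bdryPt Ψ z)‖ₑ ^ 2
      = ofReal (((surfDensity Ψ z)⁻¹ * bdryFlux τ Ψ a G' z) ^ 2) := by
    filter_upwards [hGG, haA] with z hz hz2
    rw [conormalDeriv_bdryPt hτ G (hz2 _), enorm_eq_ofReal_abs, ← ofReal_pow (abs_nonneg _), sq_abs]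
    simp only [bdryFlux, hz]
    congr 1
    linear_combination ((surfDensity Ψ z)⁻¹ * inner ℝ (a (bdryPt Ψ z) (G' z))
      (depthGrad τ Ψ z)) ^ 2 * unit_mul_self hτ
  have eQ : Q = ∫⁻ z, ofReal (bdryFlux τ Ψ a G' z ^ 2) := by
    rw [hQ, ← lintegral_ofReal_sq]
    exact lintegral_congr fun z => by rw [norm_eq_abs, sq_abs]
  have hs1 : ∀ z, 1 ≤ surfDensity Ψ z := fun z => sqrt_one_add_ge_one _
  have hQ1 : Q ≤ ofReal (J ^ 2) * ∫⁻ z, ‖conormalDeriv Ψ A G z‖ₑ ^ 2 ∂surfMeasure Ψ := by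
    refine le_trans ?_ (mul_le_mul_right (lintegral_le_surfMeasure hΨ _) _)
    rw [eQ, ← lintegral_const_mul' _ _ ofReal_ne_top]
    refine lintegral_mono_ae (hcon.mono fun z hz => ?_)
    rw [hz, ← ofReal_mul (sq_nonneg _), ← mul_pow, ← mul_assoc, mul_pow]
    refine ofReal_le_ofReal (le_mul_of_one_le_left (sq_nonneg _) (one_le_pow₀ ?_))
    rw [← div_eq_mul_inv, one_le_div (one_pos.trans_le (hs1 z))]
    exact surfDensity_le hΨ z
  have hQ2 : ∫⁻ z, ‖conormalDeriv Ψ A G z‖ₑ ^ 2 ∂surfMeasure Ψ ≤ ofReal J * Q := by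
    refine (lintegral_surfMeasure_le hΨ _).trans (mul_le_mul_right ?_ _)
    rw [eQ]
    refine lintegral_mono_ae (hcon.mono fun z hz => ?_)
    rw [hz, mul_pow]
    exact ofReal_le_ofReal (mul_le_of_le_one_left (sq_nonneg _)
      (pow_le_one₀ (inv_nonneg.2 (zero_le_one.trans (hs1 z))) (inv_le_one_of_one_le₀ (hs1 z))))
  have hTs := lintegral_surfMeasure_le hΨ fun z => ‖tangGrad Ψ G z‖ₑ ^ 2
  have hTl := lintegral_le_surfMeasure hΨ fun z => ‖tangGrad Ψ G z‖ₑ ^ 2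
  have hWs := lintegral_surfMeasure_le hΨ fun z => ‖f z‖ₑ ^ 2 * ofReal (mFun V' z ^ 2)
  have hWl := lintegral_le_surfMeasure hΨ fun z => ‖f z‖ₑ ^ 2 * ofReal (mFun V' z ^ 2)
  rw [eT] at hTs hTl
  have hm3 : (1 : ℝ≥0∞) ≤ ofReal (m ^ 2) := one_le_ofReal.2 (one_le_pow₀ hm1)
  constructor
  · calc _ ≤ ofReal J * T + ofReal J * (ofReal (m ^ 2) * W) :=
          add_le_add hTs (hWs.trans (mul_le_mul_right hW2 _))
      _ ≤ ofReal J * (ofReal (m ^ 2) * T)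
          + ofReal J * (ofReal (m ^ 2) * W) := by
          gcongr; exact le_mul_of_one_le_left' hm3
      _ = ofReal J * ofReal (m ^ 2) * (T + W) := by ring
      _ ≤ ofReal J * ofReal (m ^ 2) * (C * (ofReal (J ^ 2) *
          ∫⁻ z, ‖conormalDeriv Ψ A G z‖ₑ ^ 2 ∂surfMeasure Ψ)) :=
          mul_le_mul_right (h1.trans (mul_le_mul_right hQ1 _)) _
      _ = (Real.toNNReal (J * m ^ 2 * J ^ 2) * C : ℝ≥0) *
          ∫⁻ z, ‖conormalDeriv Ψ A G z‖ₑ ^ 2 ∂surfMeasure Ψ := by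
          rw [ENNReal.coe_mul, toNNReal_mul (by positivity), toNNReal_mul hJ0.le]
          simp only [ENNReal.coe_mul, ofReal]
          ring
      _ ≤ _ := by
          refine mul_le_mul_left ?_ _
          norm_cast
          rw [add_assoc]; exact le_self_add
  · calc _ ≤ ofReal J * (C * (T + W)) := hQ2.trans (mul_le_mul_right h2 _)
      _ ≤ ofReal J * (C * (ofReal (m ^ 2) *
          ∫⁻ z, ‖tangGrad Ψ G z‖ₑ ^ 2 ∂surfMeasure Ψ + ofReal (m ^ 2) *
          ∫⁻ z, ‖f z‖ₑ ^ 2 * ofReal (mFun V' z ^ 2) ∂surfMeasure Ψ)) := by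
          gcongr
          · exact hTl.trans (le_mul_of_one_le_left' hm3)
          · exact hW1.trans (mul_le_mul_right hWl _)
      _ = (Real.toNNReal (J * m ^ 2) * C : ℝ≥0) * (∫⁻ z, ‖tangGrad Ψ G z‖ₑ ^ 2 ∂surfMeasure Ψ
          + ∫⁻ z, ‖f z‖ₑ ^ 2 * ofReal (mFun V' z ^ 2) ∂surfMeasure Ψ) := by
          rw [ENNReal.coe_mul, toNNReal_mul hJ0.le]
          simp only [ENNReal.coe_mul, ofReal]
          ring
      _ ≤ _ := by
          refine mul_le_mul_left ?_ _
          norm_cast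
          exact le_add_self.trans le_self_add

end Cleaning

end

/-! ### The theorem on both sides of the graph -/

theorem theorem4p1 (n : ℕ) (hn : 2 ≤ n) (M : ℝ≥0) (μ : ℝ) (hμ : 0 < μ) (K : ℝ) :
    ∃ c C : ℝ≥0, 0 < c ∧ 0 < C ∧
      ∀ (Ψ : Euc n → ℝ), LipschitzWith M Ψ →
      ∀ (A : Euc (n + 1) → Matrix (Fin (n + 1)) (Fin (n + 1)) ℝ), IsCoeff μ A →
      ∀ (V : Euc (n + 1) → ℝ), IsBInfty K V →
      ∀ (κ : ℝ), 1 < κ →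
      -- the interior and the exterior case
      ∀ (D : Set (Euc (n + 1))), (D = aboveGraph Ψ ∨ D = belowGraph Ψ) →
      ∀ (u : Euc (n + 1) → ℝ) (g : Euc (n + 1) → Euc (n + 1)), IsWeakSol D A V u g →
      -- `(∇u)^* ∈ L²(∂Ω)`
      ∫⁻ z, (ntMax D (graphBdry Ψ) κ g z) ^ 2 ∂(surfMeasure Ψ) < ∞ →
      -- `|u(x)| + |x||∇u(x)| = O(|x|^{2-d})` as `|x| → ∞` in `D`
      (fun x => |u x| + ‖x‖ * ‖g x‖)
        =O[Bornology.cobounded (Euc (n + 1)) ⊓ ae (volume.restrict D)]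
          (fun x => ‖x‖ ^ (2 - ((n + 1 : ℕ) : ℤ))) →
      -- `f` and `G` are the boundary values of `u` and `∇u`, taken from `D`
      ∀ (f : Euc (n + 1) → ℝ) (G : Euc (n + 1) → Euc (n + 1)),
        (∀ᵐ z ∂(surfMeasure Ψ), HasNTLimit D (graphBdry Ψ) κ u z (f z)) →
        (∀ᵐ z ∂(surfMeasure Ψ), HasNTLimit D (graphBdry Ψ) κ g z (G z)) →
        c * (∫⁻ z, ‖tangGrad Ψ G z‖ₑ ^ 2 ∂(surfMeasure Ψ) +
              ∫⁻ z, ‖f z‖ₑ ^ 2 * ENNReal.ofReal (mFun V z ^ 2) ∂(surfMeasure Ψ))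
            ≤ ∫⁻ z, ‖conormalDeriv Ψ A G z‖ₑ ^ 2 ∂(surfMeasure Ψ) ∧
        ∫⁻ z, ‖conormalDeriv Ψ A G z‖ₑ ^ 2 ∂(surfMeasure Ψ)
            ≤ C * (∫⁻ z, ‖tangGrad Ψ G z‖ₑ ^ 2 ∂(surfMeasure Ψ) +
              ∫⁻ z, ‖f z‖ₑ ^ 2 * ENNReal.ofReal (mFun V z ^ 2) ∂(surfMeasure Ψ)) := by
  obtain ⟨C, hC, h⟩ := exists_comparison_surfMeasure n hn M μ hμ K
  -- One constant serves both inequalities, since the tangential and trace terms were bounded by C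
  -- times the conormal term and conversely.
  refine ⟨C⁻¹, C, inv_pos.2 hC, hC, fun Ψ hΨ A hA V hV κ hκ D hD u g hu hN hdec f G hf hG => ?_⟩
  obtain ⟨τ, hτ, rfl⟩ : ∃ τ : ℝ, (τ = 1 ∨ τ = -1) ∧ D = graphDom τ Ψ := by
    rcases hD with rfl | rfl
    · exact ⟨1, Or.inl rfl, aboveGraph_eq Ψ⟩
    · exact ⟨-1, Or.inr rfl, belowGraph_eq Ψ⟩
  obtain ⟨h1, h2⟩ := h τ hτ Ψ hΨ A hA V hV κ hκ u g hu hN (decaysOn_of_isBigO hn hdec) f G hf hG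
  refine ⟨?_, h2⟩
  rw [ENNReal.coe_inv hC.ne', mul_comm, ← div_eq_mul_inv]
  exact ENNReal.div_le_of_le_mul' h1
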